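/- **Setting.** Let $T\ge 1$ and let $\mu_j,s_j,d_j$ ($1\le j\le r$) be positive integers. Put $\chi(e^{-i\lambda})=\prod_j(1-e^{-i\lambda\mu_js_j})^{d_j}$, $\beta(i\lambda)=\prod_j\prod_{k=-[s_j/2]}^{[s_j/2]}(i\lambda-2\pi ik/s_j)^{d_j}$, $w(\lambda)=|\chi(e^{-i\lambda})|^2/|\beta(i\lambda)|^2$. A spectral density is an integrable function $f$ on $[-\pi,\pi)$ with values in the nonnegative definite Hermitian $T\times T$ matrices. A sequence $\vec\xi(m)\in\mathbb C^T$, $m\in\mathbb Z$, has stationary increments $\chi\vec\xi(m)=\prod_j(1-B^{\mu_js_j})^{d_j}\vec\xi(m)$ ($B$ the backward shift) with spectral density $f$ if, for all vectors $\mu,\mu'$ of positive steps, the increments have mean $0$ and finite second moments and $\mathsf E\,\chi_{\mu}\xi_p(n+m)\overline{\chi_{\mu'}\xi_q(n)}=\frac1{2\pi}\int_{-\pi}^{\pi}e^{im\lambda}\frac{\chi_\mu(e^{-i\lambda})\overline{\chi_{\mu'}(e^{-i\lambda})}}{|\beta(i\lambda)|^2}f_{pq}(\lambda)\,d\lambda$.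 Let $\vec a(k)\in\mathbb C^T$, $k\ge0$, let $\sum_k d_\mu(k)x^k=\prod_j(\sum_l x^{\mu_js_jl})^{d_j}$ and $\vec b(k)=(D^\mu\mathbf a)_k=\sum_{m\ge k}d_\mu(m-k)\vec a(m)$ (convergent), and assume $\sum\|\vec a(k)\|<\infty$, $\sum(k+1)\|\vec a(k)\|^2<\infty$ and the same for $\vec b$. The functional $A\vec\xi=\sum_{k\ge0}\vec a(k)^\top\vec\xi(k)$ equals $\sum_{k\ge0}\vec b(k)^\top\chi\vec\xi(k)$ up to a finite linear combination of observed values, so estimating it from $\vec\xi(m)$, $m\le-1$, means estimating the latter sum from the increments $\chi\vec\xi(m)$, $m\le-1$. Let $\vec B(e^{i\lambda})=\sum_{k\ge0}\vec b(k)e^{i\lambda k}$, let $L_2(f)$ have the squared norm $\frac1{2\pi}\int g^\top f\bar g\,d\lambda$, and let $L_2^{0-}(f)$ be the closed span in it of $e^{i\lambda k}\chi(e^{-i\lambda})\beta(i\lambda)^{-1}\delta_l$, $k\le-1$, $1\le l\le T$ ($\delta_l$ the unit vectors). Let $\Delta(h;f)$ be the squared norm of $\vec B\chi(e^{-i\lambda})/\beta(i\lambda)-h$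 in $L_2(f)$, and $\Delta(f)=\min_{h\in L_2^{0-}(f)}\Delta(h;f)$. For a class $D$ of spectral densities, $f_0\in D$ is least favourable if $\Delta(f_0)=\max_{f\in D}\Delta(f)$; and $h^0\in H_D=\bigcap_{f\in D}L_2^{0-}(f)$ is minimax-robust if $\sup_{f\in D}\Delta(h^0;f)=\min_{h\in H_D}\sup_{f\in D}\Delta(h;f)$. A spectral density $f$ satisfies the minimality condition if it is a.e. invertible and $\int\operatorname{Tr}[w^{-1}f^{-1}]\,d\lambda<\infty$. For such $f$ let $\mathbf F$ be the block Toeplitz operator with matrix entries $\mathbf F(j,k)=\frac1{2\pi}\int e^{i\lambda(k-j)}G(\lambda)\,d\lambda$, $j,k\ge0$, of symbol $G=w^{-1}(f^{-1})^\top$: it acts on the coefficient sequences $\mathbf c$ of integrable functions $C(\lambda)\sim\sum_{k\ge0}\vec c(k)e^{i\lambda k}$ with $\int C^*GC\,d\lambda<\infty$, and $(\mathbf F\mathbf c)_j$ is the $j$-th Fourier coefficient of $GC$, $j\ge0$. Put $\langle\mathbf b,\mathbf c\rangle=\sum_k\vec b(k)^\top\overline{\vec c(k)}$. **Classes.** Let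 $V,U$ be spectral densities, $Q,B_2$ positive definite Hermitian matrices, $q,q_k$ real numbers, and $\langle A,B\rangle=\operatorname{Tr}(AB^*)$. Let $D^1,\dots,D^4$ be the sets of spectral densities $f$ with, respectively (inequalities a.e., Loewner order for $D^1$) 1. $V\le f\le U$, $\frac1{2\pi}\int wf\,d\lambda=Q$; 2. $\operatorname{Tr}V\le\operatorname{Tr}f\le\operatorname{Tr}U$, $\frac1{2\pi}\int w\operatorname{Tr}f\,d\lambda=q$; 3. $v_{kk}\le f_{kk}\le u_{kk}$, $\frac1{2\pi}\int wf_{kk}\,d\lambda=q_k$, $1\le k\le T$; 4. $\langle B_2,V\rangle\le\langle B_2,f\rangle\le\langle B_2,U\rangle$, $\frac1{2\pi}\int w\langle B_2,f\rangle\,d\lambda=q$. **Theorem.** (0) For every spectral density $f$, $\Delta(f)$ is the mean square error of the optimal linear estimate of $A\vec\xi$ for each sequence $\vec\xi$ whose increments have spectral density $f$. If $f$ satisfies the minimality condition, then $\mathbf F\mathbf c=D^\mu\mathbf a$ has exactly one solution $\mathbf c=\mathbf F^{-1}D^\mu\mathbf a$. Let $f_0$ be a spectral density that satisfies the minimality condition,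 $\mathbf F^0$ its operator, and $C_0(\lambda)=\sum_{k\ge0}((\mathbf F^0)^{-1}D^\mu\mathbf a)_ke^{i\lambda k}$ (the function with this Fourier series). Then for $D=D^k$, $k=1,2,3,4$: (i) $f_0$ is least favourable in $D$ if and only if $f_0\in D$ and $\langle D^\mu\mathbf a,\mathbf F^{-1}D^\mu\mathbf a\rangle\le\langle D^\mu\mathbf a,(\mathbf F^0)^{-1}D^\mu\mathbf a\rangle$ for all $f\in D$ that satisfy the minimality condition. (ii) Let $f_0$ be least favourable in $D$, and let the lower bound not be active at almost every frequency: on a set of positive measure, $f_0-V$ is positive definite ($k=1$), $\operatorname{Tr}f_0>\operatorname{Tr}V$ ($k=2$), $\langle B_2,f_0\rangle>\langle B_2,V\rangle$ ($k=4$); for $k=3$, for every index $j$, $f^0_{jj}>v_{jj}$ on a set of positive measure. Then a.e. $$C_0(\lambda)C_0(\lambda)^*=\big(w(\lambda)f_0(\lambda)^\top\big)\,L(\lambda)\,\big(w(\lambda)f_0(\lambda)^\top\big)\qquad(*)$$ where, with measurable functions and a.e. in $\lambda$, * $k=1$: $L=\vec\beta\vec\beta^*+\Gamma_1+\Gamma_2$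 with a vector $\vec\beta\in\mathbb C^T$, $\Gamma_1\le0$, $\Gamma_1=0$ where $f_0>V$, $\Gamma_2\ge0$, $\Gamma_2=0$ where $f_0<U$ ($>$, $<$ meaning that the difference is definite); * $k=2$: $L=(\beta^2+\gamma_1+\gamma_2)I$ with $\beta\in\mathbb R$, $\gamma_1\le0$, $\gamma_1=0$ where $\operatorname{Tr}f_0>\operatorname{Tr}V$, $\gamma_2\ge0$, $\gamma_2=0$ where $\operatorname{Tr}f_0<\operatorname{Tr}U$; * $k=3$: $L=\operatorname{diag}(\beta_j^2+\gamma_{1j}+\gamma_{2j})$ with $\beta_j\in\mathbb R$, $\gamma_{1j}\le0$, $\gamma_{1j}=0$ where $f^0_{jj}>v_{jj}$, $\gamma_{2j}\ge0$, $\gamma_{2j}=0$ where $f^0_{jj}<u_{jj}$; * $k=4$: $L=(\beta^2+\gamma_1'+\gamma_2')B_2^\top$ with $\beta\in\mathbb R$, $\gamma_1'\le0$, $\gamma_1'=0$ where $\langle B_2,f_0\rangle>\langle B_2,V\rangle$, $\gamma_2'\ge0$, $\gamma_2'=0$ where $\langle B_2,f_0\rangle<\langle B_2,U\rangle$. (iii)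 Conversely, if $f_0\in D$ and $(*)$ holds with such an $L$, then $f_0$ is least favourable in $D$; for $k=1$ the slackness conditions are here taken in the full form $\Gamma_1^\top(f_0-V)=0$, $\Gamma_2^\top(U-f_0)=0$. (iv) Let $wf_0=\Phi_\mu(e^{-i\lambda})\Phi_\mu(e^{-i\lambda})^*$ be a canonical factorization, $\Phi_\mu(e^{-i\lambda})=\sum_{k\ge0}\varphi_\mu(k)e^{-i\lambda k}$ with $T\times q$ coefficients, $\sum\|\varphi_\mu(k)\|^2<\infty$, where canonical means that the functions $e^{-i\lambda k}\Phi_\mu(e^{-i\lambda})^\top\delta_p$, $k\ge0$, $1\le p\le T$, have in $L_2([-\pi,\pi);\mathbb C^q)$ the same closed span as the functions $e^{-i\lambda k}v$, $k\ge0$, $v\in\mathbb C^q$. Then (ii) and (iii) hold with $(*)$ replaced by $$R(\lambda)R(\lambda)^*=\Phi_\mu(e^{-i\lambda})^\top L(\lambda)\,\overline{\Phi_\mu(e^{-i\lambda})},$$ where $R(\lambda)=\sum_{k\ge0}(D^\mu\mathbf A\varphi_\mu)_ke^{i\lambda k}$ and $(D^\mu\mathbf A\varphi_\mu)_k=\sum_{m\ge0}\sum_{l\ge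 k}\varphi_\mu(m)^\top\vec a(m+l)d_\mu(l-k)$. (v) If $f_0$ is least favourable in $D$, then $h^0$ given by $$h^0(\lambda)^\top=\vec B(e^{i\lambda})^\top\frac{\chi(e^{-i\lambda})}{\beta(i\lambda)}-\frac{\overline{\beta(i\lambda)}}{\chi(e^{i\lambda})}\,C_0(\lambda)^\top f_0(\lambda)^{-1}$$ belongs to $H_D$ and is, up to equality a.e., the unique minimax-robust spectral characteristic for $D$; moreover $\Delta(h^0;f_0)=\Delta(f_0)$ and $\Delta(h^0;f)\le\Delta(h^0;f_0)$ for all $f\in D$. -/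

import Mathlib

open MeasureTheory Filter Matrix
open scoped ENNReal Topology ComplexConjugate ComplexOrder

noncomputable section

namespace GMForecast

/-- `T × T` complex matrices. -/
abbrev Mat (T : ℕ) := Matrix (Fin T) (Fin T) ℂ

/-- The normalized Lebesgue measure `dλ / (2π)` on `(-π, π]`. -/
def circ : Measure ℝ :=
  ENNReal.ofReal (1 / (2 * Real.pi)) • volume.restrict (Set.Ioc (-Real.pi) Real.pi)

section Increments

variable {r : ℕ} (μ s d : Fin r → ℕ)

/-- `χ_μ^{(d)}(e^{-iλ}) = ∏ⱼ (1 - e^{-iλ μⱼ sⱼ})^{dⱼ}`. -/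
def chi (t : ℝ) : ℂ :=
  ∏ j, (1 - Complex.exp (-(Complex.I * t * ((μ j * s j : ℕ) : ℂ)))) ^ d j

/-- `β^{(d)}(iλ) = ∏ⱼ ∏_{k = -[sⱼ/2]}^{[sⱼ/2]} (iλ - 2πik/sⱼ)^{dⱼ}`. -/
def beta (t : ℝ) : ℂ :=
  ∏ j, ∏ k ∈ Finset.Icc (-((s j / 2 : ℕ) : ℤ)) ((s j / 2 : ℕ) : ℤ),
    (Complex.I * t - 2 * Real.pi * Complex.I * (k : ℂ) / (s j : ℂ)) ^ d j

/-- `χ_μ^{(d)}(e^{-iλ}) / β^{(d)}(iλ)`. -/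
def kappa (t : ℝ) : ℂ := chi μ s d t / beta s d t

/-- `|χ_μ^{(d)}(e^{-iλ})|² / |β^{(d)}(iλ)|²`. -/
def weight (t : ℝ) : ℝ := ‖chi μ s d t‖ ^ 2 / ‖beta s d t‖ ^ 2

/-- The generating series `∏ⱼ (∑ₗ x^{μⱼ sⱼ l})^{dⱼ}` of the coefficients `d_μ(k)`. -/
def dSeries : PowerSeries ℂ :=
  ∏ j, (PowerSeries.mk fun n => if μ j * s j ∣ n then (1 : ℂ) else 0) ^ d j

/-- `b = D^μ a`, that is `b(k) = ∑_{m ≥ k} d_μ(m - k) a(m)` (an ordered, convergent series). -/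
def IsDTransform {T : ℕ} (a b : ℕ → Fin T → ℂ) : Prop :=
  ∀ k p, Tendsto
    (fun N => ∑ j ∈ Finset.range N, PowerSeries.coeff j (dSeries μ s d) * a (k + j) p)
    atTop (𝓝 (b k p))

/-- `∑ ‖x(k)‖ < ∞` and `∑ (k + 1) ‖x(k)‖² < ∞`. -/
def IsAdmissible {T : ℕ} (x : ℕ → Fin T → ℂ) : Prop :=
  Summable (fun k => ‖x k‖) ∧ Summable (fun k : ℕ => ((k : ℝ) + 1) * ‖x k‖ ^ 2)

/-- The polynomial `∏ⱼ (1 - x^{μⱼ sⱼ})^{dⱼ}` of the increment operator in the backward shift. -/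
def incPoly : Polynomial ℂ := ∏ j, (1 - Polynomial.X ^ (μ j * s j)) ^ d j

/-- The generalized multiple increment `χ_{μ,s}^{(d)}(ξ_p(n))`. -/
def increment {T : ℕ} {Ω : Type*} (ξ : ℤ → Fin T → Ω → ℂ) (n : ℤ) (p : Fin T) (ω : Ω) : ℂ :=
  (incPoly μ s d).sum fun k e => e * ξ (n - k) p ω

end Increments

/-- A spectral density: integrable, Hermitian nonnegative definite almost everywhere. -/
def IsSpectralDensity {T : ℕ} (f : ℝ → Mat T) : Prop :=
  (∀ i j, Integrable (fun t => f t i j) circ) ∧ ∀ᵐ t ∂circ, (f t).PosSemidef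

/-- `ξ` is a vector sequence with stationary GM increments, of mean zero, with spectral density
`f` (with respect to `dλ / 2π`): the structural function of the increments, for any two vectors of
positive steps, is given by the spectral representation. -/
structure HasSpectralDensity {r T : ℕ} (s d : Fin r → ℕ) (f : ℝ → Mat T)
    {Ω : Type*} [MeasurableSpace Ω] (P : Measure Ω) (ξ : ℤ → Fin T → Ω → ℂ) : Prop where
  memLp : ∀ μ : Fin r → ℕ, (∀ j, 0 < μ j) → ∀ n p, MemLp (increment μ s d ξ n p) 2 P
  mean_zero : ∀ μ : Fin r → ℕ, (∀ j, 0 < μ j) → ∀ n p, ∫ ω, increment μ s d ξ n p ω ∂P = 0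
  structural : ∀ μ₁ μ₂ : Fin r → ℕ, (∀ j, 0 < μ₁ j) → (∀ j, 0 < μ₂ j) → ∀ (n m : ℤ) (p q : Fin T),
    ∫ ω, increment μ₁ s d ξ (n + m) p ω * conj (increment μ₂ s d ξ n q ω) ∂P =
      ∫ t, Complex.exp (Complex.I * m * t) *
        (chi μ₁ s d t * conj (chi μ₂ s d t) / ((‖beta s d t‖ ^ 2 : ℝ) : ℂ)) * f t p q ∂circ

/-- The mean square error of the optimal linear forecast. With `b = D^μ a`, the functional
`Aξ = ∑_{k ≥ 0} a(k)ᵀ ξ(k)` is `∑_{k ≥ 0} b(k)ᵀ χ(ξ(k))` minus a finite linear combination of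
observed values, so the error is the squared distance of `∑ b(k)ᵀ χ(ξ(k))` to the linear
combinations of the observed increments `χ(ξ_p(k))`, `k ≤ -1`. -/
def forecastError {r T : ℕ} (μ s d : Fin r → ℕ) (b : ℕ → Fin T → ℂ)
    {Ω : Type*} [MeasurableSpace Ω] (P : Measure Ω) (ξ : ℤ → Fin T → Ω → ℂ) : ℝ≥0∞ :=
  ⨅ (N : ℕ) (x : ℕ → Fin T → ℂ),
    ∫⁻ ω, ‖(∑' k : ℕ, b k ⬝ᵥ fun p => increment μ s d ξ k p ω) -
      ∑ j ∈ Finset.range N, x j ⬝ᵥ fun p => increment μ s d ξ (-((j : ℤ) + 1)) p ω‖ₑ ^ 2 ∂P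

/-- `‖x‖²` in `L₂(f)`, i.e. the integral of `x(λ)ᵀ f(λ) conj(x(λ))` against `dλ / 2π`. -/
def sqNorm {T : ℕ} (f : ℝ → Mat T) (x : ℝ → Fin T → ℂ) : ℝ≥0∞ :=
  ∫⁻ t, ENNReal.ofReal (x t ⬝ᵥ (f t *ᵥ star (x t))).re ∂circ

/-- `∑_{k ≥ 0} b(k) e^{iλk}`. -/
def targetFun {T : ℕ} (b : ℕ → Fin T → ℂ) (t : ℝ) : Fin T → ℂ :=
  fun p => ∑' k : ℕ, b k p * Complex.exp (Complex.I * k * t)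

/-- A finite linear combination of `e^{iλk} χ_μ(e^{-iλ}) β(iλ)⁻¹ δ_l`, `k ≤ -1`. -/
def pastPoly {r T : ℕ} (μ s d : Fin r → ℕ) (N : ℕ) (x : ℕ → Fin T → ℂ) (t : ℝ) : Fin T → ℂ :=
  kappa μ s d t •
    ∑ j ∈ Finset.range N, Complex.exp (-(Complex.I * ((j : ℂ) + 1) * t)) • x j

/-- Membership in `L₂^{0-}(f)`, the closed span in `L₂(f)` of the functions
`e^{iλk} χ_μ(e^{-iλ}) β(iλ)⁻¹ δ_l`, `k ≤ -1`. -/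
def InPast {r T : ℕ} (μ s d : Fin r → ℕ) (f : ℝ → Mat T) (h : ℝ → Fin T → ℂ) : Prop :=
  (∀ p, AEMeasurable (fun t => h t p) circ) ∧
    ∀ ε : ℝ≥0∞, 0 < ε → ∃ (N : ℕ) (x : ℕ → Fin T → ℂ),
      sqNorm f (fun t => h t - pastPoly μ s d N x t) < ε

/-- `Δ(h; f)`: the mean square error, under the spectral density `f`, of the linear estimate with
spectral characteristic `h`. -/
def err {r T : ℕ} (μ s d : Fin r → ℕ) (b : ℕ → Fin T → ℂ) (h : ℝ → Fin T → ℂ)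
    (f : ℝ → Mat T) : ℝ≥0∞ :=
  sqNorm f (fun t => kappa μ s d t • targetFun b t - h t)

/-- `h = h_μ(f)`: the spectral characteristic of the optimal linear estimate, i.e. the projection
of `B_μ(e^{iλ}) χ_μ(e^{-iλ}) / β(iλ)` on `L₂^{0-}(f)`. -/
def IsOptimal {r T : ℕ} (μ s d : Fin r → ℕ) (b : ℕ → Fin T → ℂ) (f : ℝ → Mat T)
    (h : ℝ → Fin T → ℂ) : Prop :=
  InPast μ s d f h ∧ ∀ h', InPast μ s d f h' → err μ s d b h f ≤ err μ s d b h' f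

/-- `Δ(f) = Δ(h_μ(f); f)`: the mean square error of the optimal linear estimate. -/
def optErr {r T : ℕ} (μ s d : Fin r → ℕ) (b : ℕ → Fin T → ℂ) (f : ℝ → Mat T) : ℝ≥0∞ :=
  ⨅ (h : ℝ → Fin T → ℂ) (_ : InPast μ s d f h), err μ s d b h f

/-- `f₀` is least favourable in `D`: `f₀ ∈ D` and `Δ(f₀) = max_{f ∈ D} Δ(f)`. -/
def IsLeastFavourable {r T : ℕ} (μ s d : Fin r → ℕ) (b : ℕ → Fin T → ℂ)
    (D : Set (ℝ → Mat T)) (f₀ : ℝ → Mat T) : Prop :=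
  f₀ ∈ D ∧ ∀ f ∈ D, optErr μ s d b f ≤ optErr μ s d b f₀

/-- `H_D = ⋂_{f ∈ D} L₂^{0-}(f)`. -/
def commonPast {r T : ℕ} (μ s d : Fin r → ℕ) (D : Set (ℝ → Mat T)) : Set (ℝ → Fin T → ℂ) :=
  {h | ∀ f ∈ D, InPast μ s d f h}

/-- `h₀` is minimax-robust: `h₀ ∈ H_D` and `h₀` minimizes `sup_{f ∈ D} Δ(h; f)` over `H_D`. -/
def IsMinimaxRobust {r T : ℕ} (μ s d : Fin r → ℕ) (b : ℕ → Fin T → ℂ)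
    (D : Set (ℝ → Mat T)) (h₀ : ℝ → Fin T → ℂ) : Prop :=
  h₀ ∈ commonPast μ s d D ∧
    ∀ h ∈ commonPast μ s d D,
      (⨆ f ∈ D, err μ s d b h₀ f) ≤ ⨆ f ∈ D, err μ s d b h f

/-- The minimality condition: `∫ Tr[ |β|² |χ_μ|⁻² f⁻¹ ] dλ < ∞` (which presupposes that `f` is
invertible almost everywhere). -/
def Minimality {r T : ℕ} (μ s d : Fin r → ℕ) (f : ℝ → Mat T) : Prop :=
  (∀ᵐ t ∂circ, (f t).PosDef) ∧
    Integrable (fun t => (((weight μ s d t)⁻¹ : ℝ) : ℂ) * ((f t)⁻¹).trace) circ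

/-- `F(λ) = ∑_{k ≥ 0} c(k) e^{iλk}` in the sense of Fourier series: `F` is integrable, with Fourier
coefficients `c(k)` for `k ≥ 0` and `0` for `k < 0`. -/
def HasFourierSeries {n : ℕ} (F : ℝ → Fin n → ℂ) (c : ℕ → Fin n → ℂ) : Prop :=
  ∀ p, Integrable (fun t => F t p) circ ∧
    ∀ k : ℤ, ∫ t, Complex.exp (-(Complex.I * k * t)) * F t p ∂circ =
      if 0 ≤ k then c k.toNat p else 0

/-- `c = 𝐅_μ⁻¹ D^μ a` with `C(λ) = ∑_{k ≥ 0} c(k) e^{iλk}`. Here `𝐅_μ` is the block Toeplitz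
operator with matrix entries the Fourier coefficients `𝐅_μ(j, k) = (2π)⁻¹ ∫ e^{iλ(k-j)} G(λ) dλ` of
its symbol `G = |β|² |χ_μ|⁻² (f⁻¹)ᵀ`. It acts on the sequences `c` of finite energy
`∫ C(λ)* G(λ) C(λ) dλ`, and `(𝐅_μ c)(j)` is the `j`-th Fourier coefficient of `G C`. The system
`𝐅_μ c = b` reads `∫ [B(e^{iλ})ᵀ - |β|² |χ_μ|⁻² C(λ)ᵀ f(λ)⁻¹] e^{-ijλ} dλ = 0` for `j ≥ 0`. -/
structure IsSolution {r T : ℕ} (μ s d : Fin r → ℕ) (b : ℕ → Fin T → ℂ) (f : ℝ → Mat T)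
    (c : ℕ → Fin T → ℂ) (C : ℝ → Fin T → ℂ) : Prop where
  series : HasFourierSeries C c
  energy : Integrable
    (fun t => (((weight μ s d t)⁻¹ : ℝ) : ℂ) * (C t ⬝ᵥ ((f t)⁻¹ *ᵥ star (C t)))) circ
  system : ∀ (j : ℕ) (p : Fin T),
    ∫ t, Complex.exp (-(Complex.I * j * t)) *
      ((((weight μ s d t)⁻¹ : ℝ) : ℂ) * (((f t)⁻¹)ᵀ *ᵥ C t) p) ∂circ = b j p

/-- `⟨b, c⟩ = ∑_{k ≥ 0} b(k)ᵀ conj(c(k))`. -/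
def pairing {T : ℕ} (b c : ℕ → Fin T → ℂ) : ℂ := ∑' k, b k ⬝ᵥ star (c k)

/-- `f₀` solves the constrained optimization problem
`max_{f ∈ D} ⟨D^μ a, 𝐅_μ⁻¹ D^μ a⟩ = ⟨D^μ a, (𝐅_μ⁰)⁻¹ D^μ a⟩`, where `f` runs through the densities
of `D` for which `𝐅_μ` is defined, i.e. which satisfy the minimality condition. -/
def SolvesOptimization {r T : ℕ} (μ s d : Fin r → ℕ) (b : ℕ → Fin T → ℂ)
    (D : Set (ℝ → Mat T)) (f₀ : ℝ → Mat T) : Prop :=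
  ∀ f ∈ D, Minimality μ s d f → ∀ c C c₀ C₀,
    IsSolution μ s d b f c C → IsSolution μ s d b f₀ c₀ C₀ →
      (pairing b c).re ≤ (pairing b c₀).re

/-- The spectral characteristic given by
`hᵀ = Bᵀ χ_μ(e^{-iλ}) / β(iλ) - conj(β(iλ)) / χ_μ(e^{iλ}) C(λ)ᵀ f(λ)⁻¹`. -/
def spectralCharacteristic {r T : ℕ} (μ s d : Fin r → ℕ) (b : ℕ → Fin T → ℂ) (f : ℝ → Mat T)
    (C : ℝ → Fin T → ℂ) (t : ℝ) : Fin T → ℂ :=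
  kappa μ s d t • targetFun b t - (conj (beta s d t) / chi μ s d (-t)) • (C t ᵥ* (f t)⁻¹)

/-- A canonical factorization
`|χ_μ(e^{-iλ})|² |β(iλ)|⁻² f(λ) = Φ_μ(e^{-iλ}) Φ_μ(e^{-iλ})*`, `Φ_μ(e^{-iλ}) = ∑ₖ φ_μ(k) e^{-iλk}`.
It comes from a moving average `χ(ξ(m)) = ∑ₖ φ_μ(k) ε(m - k)` in which the past of the innovations
`ε` is the past of the increments; the last field states this in the spectral domain: every
constant vector is a mean square limit of combinations of `e^{-iλk} Φ_μ(e^{-iλ})ᵀ δ_p`, `k ≥ 0`. -/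
structure IsCanonicalFactorization {r T q : ℕ} (μ s d : Fin r → ℕ) (f : ℝ → Mat T)
    (φ : ℕ → Matrix (Fin T) (Fin q) ℂ) (Φ : ℝ → Matrix (Fin T) (Fin q) ℂ) : Prop where
  memLp : ∀ i j, MemLp (fun t => Φ t i j) 2 circ
  series : ∀ i j, ∀ k : ℤ, ∫ t, Complex.exp (Complex.I * k * t) * Φ t i j ∂circ =
    if 0 ≤ k then φ k.toNat i j else 0
  factorization : ∀ᵐ t ∂circ, (weight μ s d t : ℂ) • f t = Φ t * (Φ t)ᴴ
  canonical : ∀ (v : Fin q → ℂ) (ε : ℝ≥0∞), 0 < ε → ∃ (N : ℕ) (x : ℕ → Fin T → ℂ),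
    ∫⁻ t, ‖v - ∑ k ∈ Finset.range N,
      Complex.exp (-(Complex.I * k * t)) • ((Φ t)ᵀ *ᵥ x k)‖ₑ ^ 2 ∂circ < ε

/-- `(D^μ 𝐀 φ)_k = ∑_{m ≥ 0} φ(m)ᵀ ∑_{l ≥ k} d_μ(l - k) a(m + l)`; the inner sum is `b(m + k)`
for `b = D^μ a`. -/
def transformedCoeff {T q : ℕ} (b : ℕ → Fin T → ℂ) (φ : ℕ → Matrix (Fin T) (Fin q) ℂ)
    (k : ℕ) : Fin q → ℂ :=
  fun i => ∑' m : ℕ, ((φ m)ᵀ *ᵥ b (m + k)) i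

/-- The equation `C C* = (|χ_μ|² |β|⁻² f₀ᵀ) L (|χ_μ|² |β|⁻² f₀ᵀ)`. -/
def MainEquation {r T : ℕ} (μ s d : Fin r → ℕ) (f₀ : ℝ → Mat T) (C : ℝ → Fin T → ℂ)
    (L : ℝ → Mat T) : Prop :=
  ∀ᵐ t ∂circ, vecMulVec (C t) (star (C t)) =
    ((weight μ s d t : ℂ) • (f₀ t)ᵀ) * L t * ((weight μ s d t : ℂ) • (f₀ t)ᵀ)

/-- The equation `R R* = Φ_μᵀ L conj(Φ_μ)`. -/
def FactorizedEquation {T q : ℕ} (Φ : ℝ → Matrix (Fin T) (Fin q) ℂ) (R : ℝ → Fin q → ℂ)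
    (L : ℝ → Mat T) : Prop :=
  ∀ᵐ t ∂circ, vecMulVec (R t) (star (R t)) = (Φ t)ᵀ * L t * (Φ t).map conj

/-- `⟨A, B⟩ = Tr(A B*)`, a real number for Hermitian matrices. -/
def frob {T : ℕ} (A B : Mat T) : ℝ := (A * Bᴴ).trace.re

section Classes

variable {r T : ℕ} (μ s d : Fin r → ℕ) (V U : ℝ → Mat T)

/-- `V ≤ f ≤ U` (Loewner order) and `(2π)⁻¹ ∫ |χ_μ|² |β|⁻² f dλ = Q`. -/
def class1 (Q : Mat T) : Set (ℝ → Mat T) :=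
  {f | IsSpectralDensity f ∧
    (∀ᵐ t ∂circ, (f t - V t).PosSemidef ∧ (U t - f t).PosSemidef) ∧
    ∀ i j, ∫ t, (weight μ s d t : ℂ) * f t i j ∂circ = Q i j}

/-- `Tr V ≤ Tr f ≤ Tr U` and `(2π)⁻¹ ∫ |χ_μ|² |β|⁻² Tr f dλ = q`. -/
def class2 (q : ℝ) : Set (ℝ → Mat T) :=
  {f | IsSpectralDensity f ∧
    (∀ᵐ t ∂circ, (V t).trace.re ≤ (f t).trace.re ∧ (f t).trace.re ≤ (U t).trace.re) ∧
    ∫ t, weight μ s d t * (f t).trace.re ∂circ = q}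

/-- `v_kk ≤ f_kk ≤ u_kk` and `(2π)⁻¹ ∫ |χ_μ|² |β|⁻² f_kk dλ = q_k` for all `k`. -/
def class3 (q : Fin T → ℝ) : Set (ℝ → Mat T) :=
  {f | IsSpectralDensity f ∧
    (∀ᵐ t ∂circ, ∀ k, (V t k k).re ≤ (f t k k).re ∧ (f t k k).re ≤ (U t k k).re) ∧
    ∀ k, ∫ t, weight μ s d t * (f t k k).re ∂circ = q k}

/-- `⟨B₂, V⟩ ≤ ⟨B₂, f⟩ ≤ ⟨B₂, U⟩` and `(2π)⁻¹ ∫ |χ_μ|² |β|⁻² ⟨B₂, f⟩ dλ = q`. -/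
def class4 (B₂ : Mat T) (q : ℝ) : Set (ℝ → Mat T) :=
  {f | IsSpectralDensity f ∧
    (∀ᵐ t ∂circ, frob B₂ (V t) ≤ frob B₂ (f t) ∧ frob B₂ (f t) ≤ frob B₂ (U t)) ∧
    ∫ t, weight μ s d t * frob B₂ (f t) ∂circ = q}

variable (f₀ : ℝ → Mat T)

/-- `L = β β* + Γ₁ + Γ₂` with `Γ₁ ≤ 0`, `Γ₁ = 0` where `f₀ > V`, and `Γ₂ ≥ 0`, `Γ₂ = 0` where
`f₀ < U`. -/
def Multipliers1 (L : ℝ → Mat T) : Prop :=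
  ∃ (β : Fin T → ℂ) (Γ₁ Γ₂ : ℝ → Mat T),
    (∀ i j, AEMeasurable (fun t => Γ₁ t i j) circ) ∧
    (∀ i j, AEMeasurable (fun t => Γ₂ t i j) circ) ∧
    ∀ᵐ t ∂circ, L t = vecMulVec β (star β) + Γ₁ t + Γ₂ t ∧
      (-Γ₁ t).PosSemidef ∧ ((f₀ t - V t).PosDef → Γ₁ t = 0) ∧
      (Γ₂ t).PosSemidef ∧ ((U t - f₀ t).PosDef → Γ₂ t = 0)

/-- `L = β β* + Γ₁ + Γ₂` with `Γ₁ ≤ 0 ≤ Γ₂` and the full complementary slackness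
`Γ₁ᵀ (f₀ - V) = 0`, `Γ₂ᵀ (U - f₀) = 0`. This contains the slackness of `Multipliers1`, and says the
same for `T = 1`; for larger `T` it also covers the frequencies at which `f₀ - V` or `U - f₀` is
singular but not zero. -/
def StrictMultipliers1 (L : ℝ → Mat T) : Prop :=
  ∃ (β : Fin T → ℂ) (Γ₁ Γ₂ : ℝ → Mat T),
    (∀ i j, AEMeasurable (fun t => Γ₁ t i j) circ) ∧
    (∀ i j, AEMeasurable (fun t => Γ₂ t i j) circ) ∧
    ∀ᵐ t ∂circ, L t = vecMulVec β (star β) + Γ₁ t + Γ₂ t ∧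
      (-Γ₁ t).PosSemidef ∧ (Γ₁ t)ᵀ * (f₀ t - V t) = 0 ∧
      (Γ₂ t).PosSemidef ∧ (Γ₂ t)ᵀ * (U t - f₀ t) = 0

/-- `L = (β² + γ₁ + γ₂) I` with `γ₁ ≤ 0`, `γ₁ = 0` where `Tr f₀ > Tr V`, and `γ₂ ≥ 0`, `γ₂ = 0`
where `Tr f₀ < Tr U`. -/
def Multipliers2 (L : ℝ → Mat T) : Prop :=
  ∃ (β : ℝ) (γ₁ γ₂ : ℝ → ℝ), AEMeasurable γ₁ circ ∧ AEMeasurable γ₂ circ ∧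
    ∀ᵐ t ∂circ, L t = ((β ^ 2 + γ₁ t + γ₂ t : ℝ) : ℂ) • (1 : Mat T) ∧
      γ₁ t ≤ 0 ∧ ((V t).trace.re < (f₀ t).trace.re → γ₁ t = 0) ∧
      0 ≤ γ₂ t ∧ ((f₀ t).trace.re < (U t).trace.re → γ₂ t = 0)

/-- `L = diag(β_k² + γ_{1k} + γ_{2k})` with `γ_{1k} ≤ 0`, `γ_{1k} = 0` where `f⁰_kk > v_kk`, and
`γ_{2k} ≥ 0`, `γ_{2k} = 0` where `f⁰_kk < u_kk`. -/
def Multipliers3 (L : ℝ → Mat T) : Prop :=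
  ∃ (β : Fin T → ℝ) (γ₁ γ₂ : Fin T → ℝ → ℝ),
    (∀ k, AEMeasurable (γ₁ k) circ) ∧ (∀ k, AEMeasurable (γ₂ k) circ) ∧
    ∀ᵐ t ∂circ, L t = Matrix.diagonal (fun k => ((β k ^ 2 + γ₁ k t + γ₂ k t : ℝ) : ℂ)) ∧
      ∀ k, γ₁ k t ≤ 0 ∧ ((V t k k).re < (f₀ t k k).re → γ₁ k t = 0) ∧
        0 ≤ γ₂ k t ∧ ((f₀ t k k).re < (U t k k).re → γ₂ k t = 0)

/-- `L = (β² + γ₁' + γ₂') B₂ᵀ` with `γ₁' ≤ 0`, `γ₁' = 0` where `⟨B₂, f₀⟩ > ⟨B₂, V⟩`, and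
`γ₂' ≥ 0`, `γ₂' = 0` where `⟨B₂, f₀⟩ < ⟨B₂, U⟩`. -/
def Multipliers4 (B₂ : Mat T) (L : ℝ → Mat T) : Prop :=
  ∃ (β : ℝ) (γ₁ γ₂ : ℝ → ℝ), AEMeasurable γ₁ circ ∧ AEMeasurable γ₂ circ ∧
    ∀ᵐ t ∂circ, L t = ((β ^ 2 + γ₁ t + γ₂ t : ℝ) : ℂ) • B₂ᵀ ∧
      γ₁ t ≤ 0 ∧ (frob B₂ (V t) < frob B₂ (f₀ t) → γ₁ t = 0) ∧
      0 ≤ γ₂ t ∧ (frob B₂ (f₀ t) < frob B₂ (U t) → γ₂ t = 0)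

end Classes

/-- The least favourable densities of the class `D` are determined by the equations with
multipliers `M`, the constrained optimization problem and membership in `D`, and the
minimax-robust spectral characteristic is the explicit one. `C₀` is the function
`∑_{k ≥ 0} ((𝐅_μ⁰)⁻¹ D^μ a)_k e^{iλk}`; `Nd` is the nondegeneracy of the lower constraint at `f₀`,
under which the multipliers exist; `Ms` describes the multipliers with full complementary
slackness, for which the equation alone suffices. -/
def DeterminedBy {r T : ℕ} (μ s d : Fin r → ℕ) (b : ℕ → Fin T → ℂ) (D : Set (ℝ → Mat T))
    (f₀ : ℝ → Mat T) (C₀ : ℝ → Fin T → ℂ) (Nd : Prop) (M Ms : (ℝ → Mat T) → Prop) : Prop :=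
  -- the optimization problem and the restrictions
  (IsLeastFavourable μ s d b D f₀ ↔ f₀ ∈ D ∧ SolvesOptimization μ s d b D f₀) ∧
  -- the equation is necessary
  (IsLeastFavourable μ s d b D f₀ → Nd → ∃ L, M L ∧ MainEquation μ s d f₀ C₀ L) ∧
  -- the equation with full complementary slackness is sufficient
  (f₀ ∈ D → (∃ L, Ms L ∧ MainEquation μ s d f₀ C₀ L) → IsLeastFavourable μ s d b D f₀) ∧
  -- the same for the equation in terms of a canonical factorization
  (∀ (q : ℕ) (φ : ℕ → Matrix (Fin T) (Fin q) ℂ) (Φ : ℝ → Matrix (Fin T) (Fin q) ℂ),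
    IsCanonicalFactorization μ s d f₀ φ Φ →
      ∃ R : ℝ → Fin q → ℂ, HasFourierSeries R (transformedCoeff b φ) ∧
        (IsLeastFavourable μ s d b D f₀ → Nd → ∃ L, M L ∧ FactorizedEquation Φ R L) ∧
        (f₀ ∈ D → (∃ L, Ms L ∧ FactorizedEquation Φ R L) → IsLeastFavourable μ s d b D f₀)) ∧
  -- the minimax-robust spectral characteristic, and the saddle point
  (IsLeastFavourable μ s d b D f₀ →
    IsMinimaxRobust μ s d b D (spectralCharacteristic μ s d b f₀ C₀) ∧
    (∀ h, IsMinimaxRobust μ s d b D h →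
      ∀ᵐ t ∂circ, h t = spectralCharacteristic μ s d b f₀ C₀ t) ∧
    IsOptimal μ s d b f₀ (spectralCharacteristic μ s d b f₀ C₀) ∧
    ∀ f ∈ D, err μ s d b (spectralCharacteristic μ s d b f₀ C₀) f ≤
      err μ s d b (spectralCharacteristic μ s d b f₀ C₀) f₀)

end GMForecast

end

/-!
All questions are transferred to the weighted density `g = w f`, the spectral density of the
increments. Division by `χ/β` turns a spectral characteristic into a function `h`, the target into
`B = ∑ b(k) e^{ikλ}` and the past into the closed span in `L₂(g)` of the trigonometric polynomials
with negative frequencies (`inPast_iff`, `err_eq`). The minimal error is thus the squared distance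
of `B` to that span, and the spectral isometry identifies it with the error of the forecast of any
sequence with the given spectral density (`HasSpectralDensity.forecastError_eq`).

*The Toeplitz system.* Let `e = B - h` be the residual of the projection of `B`, and `C = gᵀ e`.
That `h` lies in the past means that the Fourier coefficients of `e` of nonnegative index are those
of `B`, and these are the equations `𝐅 c = b`; that `e` is orthogonal to the past means that `C` has
nonnegative spectrum. The first equivalence needs that, under the minimality condition, the past
contains every function of `L₂(g)` with negative spectrum (`inClosure_negSpan`). This follows from
`integral_dotProduct_star_eq_zero`: an integrable product of a function with negative spectrum and
the conjugate of one with nonnegative spectrum has mean zero. It is a form of Smirnov's maximum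
principle. Without Hardy space theory, it is proved by multiplying both factors by squares of damping
functions `q`, the residuals of the constant `1` in `L₂(W)` for a scalar weight `W ≥ 1` dominating the
two functions (`exists_damping`). Orthogonality makes `|q|² W` constant, so the damped functions are
bounded, and `q → 1` as the weight tends to `1`. Applied to the difference of two residuals
and its product with `gᵀ`, the same lemma gives uniqueness of the solution.

*Saddle points.* The minimal error is concave in `f`. If `f₀` is least favourable in a convex class,
near-minimizers for `(1 - τ) f₀ + τ f` converge to the optimal characteristic of `f₀` as `τ → 0`, and
their errors under `f` are at most `Δ(f₀) + τ`. Hence the error `∫ eᵀ (w f) ē` of the characteristic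
optimal for `f₀` has its maximum over the class at `f₀` (`IsLeastFavourable.sqNorm_residual_le`). The
converse is `isLeastFavourable_of_sqNorm_residual_le`. For the converse it matters that `(f₀ + f)/2`
satisfies the minimality condition although `f` need not. The saddle point gives the minimax property,
and Pythagoras under `f₀` its uniqueness (`IsLeastFavourable.minimax`).

*Multipliers.* What remains is to maximize the linear functional `f ↦ ∫ w eᵀ f ē` over the class.
Since `C₀ = w f₀ᵀ e` with `w f₀` invertible, the main equation says exactly `L = e e*`, and with
`R = Φᵀ e` the factorized equation says the same; here the canonical factorization ensures that `Φᵀ e`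
has nonnegative spectrum (`IsResidual.hasFourierSeries_factor`). So everything reduces to conditions on
`e e*` (`determinedBy_of_residual`). They are necessary by an exchange argument: if moving mass between
two sets of frequencies in a direction `G` never increases the functional, then a constant separates
the values of `eᵀ G ē` where the density may be lowered from those where it may be raised
(`exists_threshold`). The separating constants are the `β²`, and the positive and negative parts of the
deviations are the multipliers of the bounds. Classes 2, 3 and 4 are instances of a class given by
finitely many functionals `⟨Kᵢ, f⟩` (`determinedBy_traceClass`). For the Loewner order the constants in
all directions `v v*` together force `e` to be proportional to one fixed vector wherever a bound is
slack (`exists_vector_class1`). Sufficiency is a pointwise inequality whose integral uses that all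
densities of the class have the same weighted mean.
-/

namespace GMForecast

/-! ### Hermitian forms -/


variable {T : ℕ}

/-- The quadratic form `xᵀ A conj(x)` of a matrix, as a real number. -/
noncomputable def quadForm (A : Mat T) (x : Fin T → ℂ) : ℝ := (x ⬝ᵥ (A *ᵥ star x)).re

/-- The sesquilinear form `xᵀ A conj(y)` of a matrix. -/
noncomputable def sesqForm (A : Mat T) (x y : Fin T → ℂ) : ℂ := x ⬝ᵥ (A *ᵥ star y)

lemma sesqForm_add_left (A : Mat T) (x y z : Fin T → ℂ) :
    sesqForm A (x + y) z = sesqForm A x z + sesqForm A y z := by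
  simp [sesqForm, add_dotProduct]

lemma sesqForm_sub_left (A : Mat T) (x y z : Fin T → ℂ) :
    sesqForm A (x - y) z = sesqForm A x z - sesqForm A y z := by
  simp [sesqForm, sub_dotProduct]

lemma sesqForm_add_right (A : Mat T) (x y z : Fin T → ℂ) :
    sesqForm A x (y + z) = sesqForm A x y + sesqForm A x z := by
  simp [sesqForm, mulVec_add, dotProduct_add]

lemma sesqForm_sub_right (A : Mat T) (x y z : Fin T → ℂ) :
    sesqForm A x (y - z) = sesqForm A x y - sesqForm A x z := by
  simp [sesqForm, mulVec_sub, dotProduct_sub]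

lemma sesqForm_smul_left (A : Mat T) (c : ℂ) (x y : Fin T → ℂ) :
    sesqForm A (c • x) y = c * sesqForm A x y := by
  simp [sesqForm]

lemma sesqForm_smul_right (A : Mat T) (c : ℂ) (x y : Fin T → ℂ) :
    sesqForm A x (c • y) = conj c * sesqForm A x y := by
  simp [sesqForm, mulVec_smul]

lemma quadForm_eq_re (A : Mat T) (x : Fin T → ℂ) : quadForm A x = (sesqForm A x x).re := rfl

lemma sesqForm_eq_sum (A : Mat T) (x y : Fin T → ℂ) :
    sesqForm A x y = ∑ i, ∑ j, x i * (A i j * conj (y j)) := by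
  simp [sesqForm, dotProduct, mulVec, Finset.mul_sum]

lemma sesqForm_conj {A : Mat T} (hA : A.IsHermitian) (x y : Fin T → ℂ) :
    conj (sesqForm A x y) = sesqForm A y x := by
  rw [sesqForm_eq_sum, sesqForm_eq_sum, Finset.sum_comm]
  simp only [map_sum, map_mul, Complex.conj_conj]
  refine Finset.sum_congr rfl fun i _ => Finset.sum_congr rfl fun j _ => ?_
  have : conj (A j i) = A i j := hA.apply i j
  rw [this]; ring

lemma sesqForm_self {A : Mat T} (hA : A.IsHermitian) (x : Fin T → ℂ) :
    sesqForm A x x = (quadForm A x : ℂ) := by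
  rw [quadForm_eq_re]
  exact (Complex.conj_eq_iff_re.1 (sesqForm_conj hA x x)).symm

lemma quadForm_smul (A : Mat T) (c : ℂ) (x : Fin T → ℂ) :
    quadForm A (c • x) = ‖c‖ ^ 2 * quadForm A x := by
  rw [quadForm_eq_re, quadForm_eq_re, sesqForm_smul_left, sesqForm_smul_right, ← mul_assoc,
    Complex.mul_conj, Complex.re_ofReal_mul, Complex.normSq_eq_norm_sq]

lemma quadForm_smul_mat (A : Mat T) (w : ℝ) (x : Fin T → ℂ) :
    quadForm ((w : ℂ) • A) x = w * quadForm A x := by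
  simp [quadForm, smul_mulVec, dotProduct_smul]

lemma quadForm_neg (A : Mat T) (x : Fin T → ℂ) : quadForm A (-x) = quadForm A x := by
  simp [quadForm, mulVec_neg]

lemma quadForm_sub_comm (A : Mat T) (x y : Fin T → ℂ) :
    quadForm A (x - y) = quadForm A (y - x) := by
  rw [← quadForm_neg, neg_sub]

lemma quadForm_add_mat (A B : Mat T) (x : Fin T → ℂ) :
    quadForm (A + B) x = quadForm A x + quadForm B x := by
  simp [quadForm, add_mulVec, dotProduct_add]

lemma quadForm_sub_mat (A B : Mat T) (x : Fin T → ℂ) :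
    quadForm (A - B) x = quadForm A x - quadForm B x := by
  simp [quadForm, sub_mulVec, dotProduct_sub]

lemma quadForm_parallelogram (A : Mat T) (x y : Fin T → ℂ) :
    quadForm A (x + y) + quadForm A (x - y) = 2 * quadForm A x + 2 * quadForm A y := by
  simp only [quadForm_eq_re, sesqForm_add_left, sesqForm_add_right, sesqForm_sub_left,
    sesqForm_sub_right, Complex.add_re, Complex.sub_re]
  ring

lemma quadForm_nonneg {A : Mat T} (hA : A.PosSemidef) (x : Fin T → ℂ) : 0 ≤ quadForm A x := by
  have := hA.dotProduct_mulVec_nonneg (star x)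
  rw [star_star] at this
  exact (Complex.le_def.1 this).1

lemma quadForm_pos {A : Mat T} (hA : A.PosDef) {x : Fin T → ℂ} (hx : x ≠ 0) :
    0 < quadForm A x := by
  have := hA.dotProduct_mulVec_pos (x := star x) (by simpa using hx)
  rw [star_star] at this
  exact (Complex.lt_def.1 this).1

lemma posSemidef_of_quadForm {A : Mat T} (hA : A.IsHermitian) (h : ∀ x, 0 ≤ quadForm A x) :
    A.PosSemidef := by
  refine PosSemidef.of_dotProduct_mulVec_nonneg hA fun x => ?_
  have h1 := sesqForm_self hA (star x)
  rw [sesqForm, star_star] at h1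
  rw [h1]
  exact_mod_cast h (star x)

/-- The Cauchy–Schwarz inequality for the semi-inner product of a nonnegative definite matrix. -/
lemma norm_sesqForm_sq_le {A : Mat T} (hA : A.PosSemidef) (x y : Fin T → ℂ) :
    ‖sesqForm A x y‖ ^ 2 ≤ quadForm A x * quadForm A y := by
  -- nonnegativity of the form at `b x - s y`, with `b = yᵀAȳ` and `s = xᵀAȳ`
  have key : ∀ u v : ℂ, 0 ≤ ‖u‖ ^ 2 * quadForm A x + ‖v‖ ^ 2 * quadForm A y
      - 2 * (u * conj v * sesqForm A x y).re := by
    intro u v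
    have h := quadForm_nonneg hA (u • x - v • y)
    have e : quadForm A (u • x - v • y) = ‖u‖ ^ 2 * quadForm A x + ‖v‖ ^ 2 * quadForm A y
        - 2 * (u * conj v * sesqForm A x y).re := by
      have h2 : sesqForm A (v • y) (u • x) = conj (sesqForm A (u • x) (v • y)) :=
        (sesqForm_conj hA.1 _ _).symm
      rw [quadForm_eq_re, sesqForm_sub_left, sesqForm_sub_right, sesqForm_sub_right, h2,
        Complex.sub_re, Complex.sub_re, Complex.sub_re, Complex.conj_re, ← quadForm_eq_re,
        ← quadForm_eq_re, quadForm_smul, quadForm_smul, sesqForm_smul_left, sesqForm_smul_right,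
        ← mul_assoc]
      ring
    rwa [e] at h
  set s := sesqForm A x y with hs
  have hx := quadForm_nonneg hA x
  have hy := quadForm_nonneg hA y
  rcases hy.eq_or_lt with h0 | h0
  · -- a degenerate `y`: take a large multiple of `s y`
    by_contra hcon
    rw [← h0, mul_zero, not_le] at hcon
    have h1 := key 1 (((quadForm A x + 1) / ‖s‖ ^ 2 : ℝ) * s)
    rw [← h0] at h1
    have : (1 * conj ((((quadForm A x + 1) / ‖s‖ ^ 2 : ℝ) : ℂ) * s) * s).re
        = quadForm A x + 1 := by
      rw [one_mul, map_mul, mul_assoc, Complex.conj_mul', Complex.conj_ofReal]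
      norm_cast
      exact div_mul_cancel₀ _ hcon.ne'
    rw [this] at h1
    simp at h1
    linarith
  · have h1 := key (quadForm A y) s
    have : ((quadForm A y : ℂ) * conj s * s).re = quadForm A y * ‖s‖ ^ 2 := by
      rw [mul_assoc, Complex.conj_mul']; norm_cast
    rw [this, Complex.norm_real, Real.norm_of_nonneg hy] at h1
    nlinarith

lemma norm_sesqForm_le {A : Mat T} (hA : A.PosSemidef) (x y : Fin T → ℂ) :
    ‖sesqForm A x y‖ ≤ (quadForm A x + quadForm A y) / 2 := by
  have h := norm_sesqForm_sq_le hA x y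
  have hx := quadForm_nonneg hA x
  have hy := quadForm_nonneg hA y
  apply le_of_sq_le_sq _ (by positivity)
  nlinarith [sq_nonneg (quadForm A x - quadForm A y)]

/-- The triangle inequality for quadratic forms, in a form which is stable under integration. -/
lemma quadForm_add_le {A : Mat T} (hA : A.PosSemidef) (x y : Fin T → ℂ) {δ : ℝ} (hδ : 0 < δ) :
    quadForm A (x + y) ≤ (1 + δ) * quadForm A x + (1 + δ⁻¹) * quadForm A y := by
  have h2 : sesqForm A y x = conj (sesqForm A x y) := (sesqForm_conj hA.1 _ _).symm
  have e : quadForm A (x + y) = quadForm A x + quadForm A y + 2 * (sesqForm A x y).re := by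
    rw [quadForm_eq_re, sesqForm_add_left, sesqForm_add_right, sesqForm_add_right, h2]
    simp only [Complex.add_re, Complex.conj_re, ← quadForm_eq_re]; ring
  have h := norm_sesqForm_sq_le hA x y
  have hx := quadForm_nonneg hA x
  have hy := quadForm_nonneg hA y
  have h3 : (sesqForm A x y).re ≤ ‖sesqForm A x y‖ := Complex.re_le_norm _
  have h4 : 2 * ‖sesqForm A x y‖ ≤ δ * quadForm A x + δ⁻¹ * quadForm A y := by
    apply le_of_sq_le_sq _ (by positivity)
    have : δ * δ⁻¹ = 1 := mul_inv_cancel₀ hδ.ne'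
    nlinarith [sq_nonneg (δ * quadForm A x - δ⁻¹ * quadForm A y)]
  rw [e]; linarith

/-- The quadratic form dominates the squared coordinates, with the diagonal of the inverse as
constants. -/
lemma norm_sq_le_inv_mul_quadForm {A : Mat T} (hA : A.PosDef) (x : Fin T → ℂ) (p : Fin T) :
    ‖x p‖ ^ 2 ≤ (A⁻¹ p p).re * quadForm A x := by
  -- Cauchy–Schwarz against `y` with `A ȳ = δ_p`
  have hu : IsUnit A.det := (isUnit_iff_isUnit_det A).1 hA.isUnit
  set y : Fin T → ℂ := star (A⁻¹ *ᵥ Pi.single p 1) with hy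
  have hAy : A *ᵥ star y = Pi.single p 1 := by
    rw [hy, star_star, mulVec_mulVec, mul_nonsing_inv _ hu, one_mulVec]
  have h1 : sesqForm A x y = x p := by simp [sesqForm, hAy]
  have h2 : quadForm A y = (A⁻¹ p p).re := by
    rw [quadForm, hAy]; simp [hy]
  have := norm_sesqForm_sq_le hA.posSemidef x y
  rwa [h1, h2, mul_comm] at this

lemma PosDef.inv_diag_re_nonneg {A : Mat T} (hA : A.PosDef) (p : Fin T) : 0 ≤ (A⁻¹ p p).re :=
  (Complex.le_def.1 (hA.inv.posSemidef.diag_nonneg (i := p))).1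

lemma PosSemidef.trace_re_nonneg {A : Mat T} (hA : A.PosSemidef) : 0 ≤ A.trace.re :=
  (Complex.le_def.1 hA.trace_nonneg).1

lemma trace_re_eq_sum (A : Mat T) : A.trace.re = ∑ p, (A p p).re := by
  simp [Matrix.trace]

lemma inv_diag_le_trace {A : Mat T} (hA : A.PosDef) (p : Fin T) : (A⁻¹ p p).re ≤ (A⁻¹).trace.re := by
  rw [trace_re_eq_sum]
  exact Finset.single_le_sum (f := fun p => (A⁻¹ p p).re)
    (fun i _ => PosDef.inv_diag_re_nonneg hA i) (Finset.mem_univ p)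

lemma sum_norm_sq_le_inv_trace_mul {A : Mat T} (hA : A.PosDef) (x : Fin T → ℂ) :
    ∑ p, ‖x p‖ ^ 2 ≤ (A⁻¹).trace.re * quadForm A x := by
  rw [trace_re_eq_sum, Finset.sum_mul]
  exact Finset.sum_le_sum fun p _ => norm_sq_le_inv_mul_quadForm hA x p

lemma quadForm_le_sum_mul {H : Mat T} (x : Fin T → ℂ) :
    |quadForm H x| ≤ (∑ i, ∑ j, ‖H i j‖) * ∑ p, ‖x p‖ ^ 2 := by
  have h1 : |quadForm H x| ≤ ‖sesqForm H x x‖ := Complex.abs_re_le_norm _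
  refine h1.trans ?_
  rw [sesqForm_eq_sum, Finset.sum_mul]
  refine (norm_sum_le _ _).trans (Finset.sum_le_sum fun i _ => ?_)
  rw [Finset.sum_mul]
  refine (norm_sum_le _ _).trans (Finset.sum_le_sum fun j _ => ?_)
  have hle : ∀ i, ‖x i‖ ^ 2 ≤ ∑ p, ‖x p‖ ^ 2 := fun i =>
    Finset.single_le_sum (f := fun p => ‖x p‖ ^ 2) (fun i _ => by positivity) (Finset.mem_univ i)
  rw [norm_mul, norm_mul, RCLike.norm_conj]
  have : ‖x i‖ * ‖x j‖ ≤ ∑ p, ‖x p‖ ^ 2 := by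
    nlinarith [hle i, hle j, sq_nonneg (‖x i‖ - ‖x j‖)]
  calc ‖x i‖ * (‖H i j‖ * ‖x j‖) = ‖H i j‖ * (‖x i‖ * ‖x j‖) := by ring
    _ ≤ _ := by gcongr

/-- A number `ρ > 0` with `A ≥ ρ I` for positive definite `A`. It is `0` for singular `A`, since the
inverse of a singular matrix is `0` by convention. -/
noncomputable def room (A : Mat T) : ℝ := ((A⁻¹).trace.re)⁻¹

lemma room_nonneg {A : Mat T} (hA : A.PosSemidef) : 0 ≤ room A :=
  inv_nonneg.2 (PosSemidef.trace_re_nonneg hA.inv)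

lemma room_pos [NeZero T] {A : Mat T} (hA : A.PosDef) : 0 < room A :=
  inv_pos.2 (Complex.lt_def.1 hA.inv.trace_pos).1

lemma posDef_of_isUnit_det {A : Mat T} (hA : A.PosSemidef) (h : A.det ≠ 0) : A.PosDef := by
  refine PosDef.of_dotProduct_mulVec_pos hA.1 fun x hx => ?_
  refine lt_of_le_of_ne (hA.dotProduct_mulVec_nonneg x) fun h0 => hx ?_
  have h1 : A *ᵥ x = 0 := by
    have := norm_sesqForm_sq_le hA
    ext i
    have h2 := norm_sesqForm_sq_le hA (Pi.single i 1) (star x)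
    have h3 : quadForm A (star x) = 0 := by
      rw [quadForm, star_star, ← h0]; rfl
    rw [h3, mul_zero] at h2
    have h4 : sesqForm A (Pi.single i 1) (star x) = 0 := by
      have h5 : ‖sesqForm A (Pi.single i 1) (star x)‖ ^ 2 = 0 := le_antisymm h2 (by positivity)
      simpa using h5
    simpa [sesqForm] using h4
  have hu : IsUnit A.det := isUnit_iff_ne_zero.2 h
  have : A⁻¹ *ᵥ (A *ᵥ x) = x := by rw [mulVec_mulVec, nonsing_inv_mul _ hu, one_mulVec]
  rw [← this, h1, mulVec_zero]

lemma posDef_of_room_pos {A : Mat T} (hA : A.PosSemidef) (h : 0 < room A) : A.PosDef := by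
  refine posDef_of_isUnit_det hA fun h0 => ?_
  rw [room, nonsing_inv_apply_not_isUnit _ (by simp [h0])] at h
  simp at h

lemma room_mul_sum_le {A : Mat T} (hA : A.PosSemidef) (x : Fin T → ℂ) :
    room A * ∑ p, ‖x p‖ ^ 2 ≤ quadForm A x := by
  rcases (room_nonneg hA).eq_or_lt with h | h
  · rw [← h, zero_mul]; exact quadForm_nonneg hA x
  · have := sum_norm_sq_le_inv_trace_mul (posDef_of_room_pos hA h) x
    have h2 : room A * (A⁻¹).trace.re = 1 := by
      rw [room] at h ⊢; exact inv_mul_cancel₀ (inv_pos.1 h).ne'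
    calc room A * ∑ p, ‖x p‖ ^ 2 ≤ room A * ((A⁻¹).trace.re * quadForm A x) := by gcongr
      _ = quadForm A x := by rw [← mul_assoc, h2, one_mul]

/-- A small Hermitian perturbation of a positive definite matrix is nonnegative definite. -/
lemma posSemidef_add_smul {A H : Mat T} (hA : A.PosSemidef) (hH : H.IsHermitian) {θ : ℝ}
    (hθ : |θ| * ∑ i, ∑ j, ‖H i j‖ ≤ room A) : (A + (θ : ℂ) • H).PosSemidef := by
  refine posSemidef_of_quadForm (hA.1.add ?_) fun x => ?_
  · rw [IsHermitian, conjTranspose_smul, hH.eq]; simp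
  · rw [quadForm_add_mat, quadForm_smul_mat]
    have h1 := room_mul_sum_le hA x
    have h2 := quadForm_le_sum_mul (H := H) x
    have h3 : |θ * quadForm H x| ≤ quadForm A x := by
      rw [abs_mul]
      calc |θ| * |quadForm H x| ≤ |θ| * ((∑ i, ∑ j, ‖H i j‖) * ∑ p, ‖x p‖ ^ 2) := by gcongr
        _ = (|θ| * ∑ i, ∑ j, ‖H i j‖) * ∑ p, ‖x p‖ ^ 2 := by ring
        _ ≤ room A * ∑ p, ‖x p‖ ^ 2 := by gcongr
        _ ≤ _ := h1
    linarith [(abs_le.1 h3).1]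

lemma inv_diag_le_of_le {A B : Mat T} (hA : A.PosDef) (hB : B.PosDef) {s : ℝ} (hs : 0 < s)
    (h : ∀ x, s * quadForm A x ≤ quadForm B x) (p : Fin T) :
    (B⁻¹ p p).re ≤ s⁻¹ * (A⁻¹ p p).re := by
  have hu : IsUnit B.det := (isUnit_iff_isUnit_det B).1 hB.isUnit
  set y : Fin T → ℂ := star (B⁻¹ *ᵥ Pi.single p 1) with hy
  have hBy : B *ᵥ star y = Pi.single p 1 := by
    rw [hy, star_star, mulVec_mulVec, mul_nonsing_inv _ hu, one_mulVec]
  have h2 : quadForm B y = (B⁻¹ p p).re := by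
    rw [quadForm, hBy]; simp [hy]
  have h3 : y p = conj (B⁻¹ p p) := by simp [hy]
  have h4 : (B⁻¹ p p).re ≤ ‖y p‖ := by
    rw [h3, RCLike.norm_conj]; exact Complex.re_le_norm _
  have h5 := norm_sq_le_inv_mul_quadForm hA y p
  have h6 := h y
  rw [h2] at h6
  have hb := PosDef.inv_diag_re_nonneg hB p
  have ha := PosDef.inv_diag_re_nonneg hA p
  rcases hb.eq_or_lt with h7 | h7
  · rw [← h7]; positivity
  · have h8 : (B⁻¹ p p).re ^ 2 ≤ s⁻¹ * (A⁻¹ p p).re * (B⁻¹ p p).re := by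
      calc (B⁻¹ p p).re ^ 2 ≤ ‖y p‖ ^ 2 := by gcongr
        _ ≤ (A⁻¹ p p).re * quadForm A y := h5
        _ = s⁻¹ * (A⁻¹ p p).re * (s * quadForm A y) := by field_simp
        _ ≤ _ := by gcongr
    rw [sq] at h8
    exact le_of_mul_le_mul_right h8 h7

/-! ### Fourier coefficients and the weight -/


instance : IsProbabilityMeasure circ := by
  constructor
  rw [circ, Measure.smul_apply, Measure.restrict_apply MeasurableSet.univ, Set.univ_inter,
    Real.volume_Ioc, smul_eq_mul, ← ENNReal.ofReal_mul (by positivity)]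
  rw [show 1 / (2 * Real.pi) * (Real.pi - -Real.pi) = 1 by field_simp; ring, ENNReal.ofReal_one]

lemma circ_absolutelyContinuous : circ ≪ volume :=
  Measure.smul_absolutelyContinuous.trans Measure.restrict_le_self.absolutelyContinuous

/-- The character `e^{int}`. -/
noncomputable def expi (n : ℤ) (t : ℝ) : ℂ := Complex.exp (Complex.I * n * t)

lemma expi_add (m n : ℤ) (t : ℝ) : expi (m + n) t = expi m t * expi n t := by
  rw [expi, expi, expi, ← Complex.exp_add]; push_cast; ring_nf

@[simp] lemma expi_zero (t : ℝ) : expi 0 t = 1 := by simp [expi]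

lemma conj_expi (n : ℤ) (t : ℝ) : conj (expi n t) = expi (-n) t := by
  rw [expi, expi, ← Complex.exp_conj]; simp

@[simp] lemma norm_expi (n : ℤ) (t : ℝ) : ‖expi n t‖ = 1 := by
  rw [expi, Complex.norm_exp]; simp

lemma continuous_expi (n : ℤ) : Continuous (expi n) := by unfold expi; fun_prop

lemma expi_neg_eq (k : ℤ) (t : ℝ) : Complex.exp (-(Complex.I * k * t)) = expi (-k) t := by
  rw [expi]; push_cast; ring_nf

lemma expi_neg_nat_eq (k : ℕ) (t : ℝ) : Complex.exp (-(Complex.I * k * t)) = expi (-(k : ℤ)) t := by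
  rw [expi]; push_cast; ring_nf

lemma expi_nat_eq (k : ℕ) (t : ℝ) : Complex.exp (Complex.I * k * t) = expi (k : ℤ) t := by
  rw [expi]; push_cast; ring_nf

lemma integrable_expi_mul {F : ℝ → ℂ} (hF : Integrable F circ) (n : ℤ) :
    Integrable (fun t => expi n t * F t) circ :=
  hF.bdd_mul (c := 1) (continuous_expi n).aestronglyMeasurable (by simp)

lemma integrable_expi (n : ℤ) : Integrable (expi n) circ := by
  simpa using integrable_expi_mul (integrable_const (1 : ℂ)) n

lemma integral_expi (n : ℤ) : ∫ t, expi n t ∂circ = if n = 0 then 1 else 0 := by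
  split_ifs with h
  · subst h; simp
  · have h1 : ∫ t in -Real.pi..Real.pi, Complex.exp ((Complex.I * n) * t) = 0 := by
      rw [integral_exp_mul_complex (by simp [h])]
      have : Complex.exp (Complex.I * n * (Real.pi : ℝ)) =
          Complex.exp (Complex.I * n * ((-Real.pi : ℝ) : ℂ)) := by
        rw [Complex.exp_eq_exp_iff_exists_int]
        exact ⟨n, by push_cast; ring⟩
      rw [this, sub_self, zero_div]
    rw [intervalIntegral.integral_of_le (by linarith [Real.pi_pos])] at h1
    rw [circ, integral_smul_measure]
    simp only [expi]
    rw [h1, smul_zero]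

/-- An integrable function on the circle is determined by its Fourier coefficients. -/
theorem ae_eq_zero_of_fourier {F : ℝ → ℂ} (hF : Integrable F circ)
    (h : ∀ n : ℤ, ∫ t, expi n t * F t ∂circ = 0) : F =ᵐ[circ] 0 := by
  have hpi := Real.pi_pos
  have : Fact (0 < 2 * Real.pi) := ⟨by positivity⟩
  have hbdd : ∀ ψ : C(AddCircle (2 * Real.pi), ℂ),
      Integrable (fun t : ℝ => ψ (t : AddCircle (2 * Real.pi)) * F t) circ := fun ψ =>
    hF.bdd_mul (c := ‖ψ‖)
      (ψ.continuous.comp (AddCircle.continuous_mk' _)).aestronglyMeasurable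
      (ae_of_all _ fun t => ψ.norm_coe_le_norm _)
  -- continuous periodic functions are uniform limits of trigonometric polynomials
  have hspan : ∀ ψ ∈ Submodule.span ℂ (Set.range (@fourier (2 * Real.pi))),
      ∫ t : ℝ, ψ (t : AddCircle (2 * Real.pi)) * F t ∂circ = 0 := by
    intro ψ hψ
    induction hψ using Submodule.span_induction with
    | mem x hx =>
      obtain ⟨n, rfl⟩ := hx
      rw [← h n]
      refine integral_congr_ae (ae_of_all _ fun t => ?_)
      simp only [fourier_coe_apply, expi]
      congr 2
      push_cast
      field_simp
    | zero => simp
    | add x y _ _ hx hy =>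
      simp only [ContinuousMap.add_apply, add_mul]
      rw [integral_add (hbdd x) (hbdd y), hx, hy, add_zero]
    | smul a x _ hx =>
      simp only [ContinuousMap.smul_apply, smul_eq_mul, mul_assoc]
      rw [integral_const_mul, hx, mul_zero]
  have hall : ∀ ψ : C(AddCircle (2 * Real.pi), ℂ),
      ∫ t : ℝ, ψ (t : AddCircle (2 * Real.pi)) * F t ∂circ = 0 := by
    intro ψ
    have hψ : ψ ∈ (Submodule.span ℂ (Set.range (@fourier (2 * Real.pi)))).topologicalClosure := by
      rw [span_fourier_closure_eq_top]; trivial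
    rw [← SetLike.mem_coe, Submodule.topologicalClosure_coe, Metric.mem_closure_iff] at hψ
    rw [← norm_le_zero_iff]
    refine le_of_forall_pos_le_add fun ε hε => ?_
    set K := ∫ t, ‖F t‖ ∂circ with hK
    have hK0 : 0 ≤ K := integral_nonneg fun _ => norm_nonneg _
    obtain ⟨ψ', hψ', hd⟩ := hψ (ε / (K + 1)) (by positivity)
    have e : ∫ t : ℝ, ψ (t : AddCircle (2 * Real.pi)) * F t ∂circ =
        ∫ t : ℝ, (ψ - ψ') (t : AddCircle (2 * Real.pi)) * F t ∂circ := by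
      simp only [ContinuousMap.sub_apply, sub_mul]
      rw [integral_sub (hbdd ψ) (hbdd ψ'), hspan ψ' hψ', sub_zero]
    rw [e, zero_add]
    calc ‖∫ t : ℝ, (ψ - ψ') (t : AddCircle (2 * Real.pi)) * F t ∂circ‖
        ≤ ∫ t, (ε / (K + 1)) * ‖F t‖ ∂circ := by
          refine norm_integral_le_of_norm_le (hF.norm.const_mul _) (ae_of_all _ fun t => ?_)
          rw [norm_mul]
          gcongr
          refine ((ψ - ψ').norm_coe_le_norm _).trans ?_
          rw [← dist_eq_norm]; exact hd.le
      _ = ε / (K + 1) * K := integral_const_mul _ _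
      _ ≤ ε := by
          rw [div_mul_eq_mul_div, div_le_iff₀ (by positivity)]; nlinarith
  have hc0 : ENNReal.ofReal (1 / (2 * Real.pi)) ≠ 0 := by simp [hpi]
  have hFr : IntegrableOn F (Set.Ioc (-Real.pi) Real.pi) volume := by
    have := hF
    rw [circ, integrable_smul_measure hc0 ENNReal.ofReal_ne_top] at this
    exact this
  -- a test function supported in the open interval extends to a continuous periodic function
  have hloc : ∀ᵐ t, t ∈ Set.Ioo (-Real.pi) Real.pi → F t = 0 := by
    refine isOpen_Ioo.ae_eq_zero_of_integral_contDiff_smul_eq_zero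
      ((hFr.mono_set Set.Ioo_subset_Ioc_self).locallyIntegrableOn) fun g hg _ hgs => ?_
    have hg0 : ∀ t, t ∉ Set.Ioo (-Real.pi) Real.pi → g t = 0 := fun t ht =>
      image_eq_zero_of_notMem_tsupport fun hh => ht (hgs hh)
    have hend : (fun t : ℝ => ((g t : ℝ) : ℂ)) (-Real.pi) =
        (fun t : ℝ => ((g t : ℝ) : ℂ)) (-Real.pi + 2 * Real.pi) := by
      simp only
      rw [hg0 (-Real.pi) (by simp), hg0 (-Real.pi + 2 * Real.pi) (by simp; intro; linarith)]
    have hcont := AddCircle.liftIco_continuous (p := 2 * Real.pi) (a := -Real.pi)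
      (f := fun t : ℝ => ((g t : ℝ) : ℂ)) hend
      (Complex.continuous_ofReal.comp hg.continuous).continuousOn
    have h1 := hall ⟨_, hcont⟩
    rw [circ, integral_smul_measure] at h1
    have h2 : ∫ t in Set.Ioc (-Real.pi) Real.pi, (g t : ℂ) * F t = 0 := by
      have h3 := (smul_eq_zero.1 h1).resolve_left (by
        simp [ENNReal.toReal_ofReal, hpi.le, hpi.ne'])
      rw [← h3, integral_Ioc_eq_integral_Ioo, integral_Ioc_eq_integral_Ioo]
      refine setIntegral_congr_fun measurableSet_Ioo fun t ht => ?_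
      simp only [ContinuousMap.coe_mk]
      rw [AddCircle.liftIco_coe_apply ⟨ht.1.le, by linarith [ht.2]⟩]
    rw [← h2, ← setIntegral_eq_integral_of_forall_compl_eq_zero (s := Set.Ioc (-Real.pi) Real.pi)]
    · rfl
    · intro t ht
      rw [hg0 t fun hh => ht (Set.Ioo_subset_Ioc_self hh), zero_smul]
  have h5 : ∀ᵐ t ∂(volume.restrict (Set.Ioc (-Real.pi) Real.pi)), F t = 0 := by
    rw [← Measure.restrict_congr_set Ioo_ae_eq_Ioc, ae_restrict_iff' measurableSet_Ioo]
    exact hloc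
  exact Measure.ae_smul_measure h5 _

section Weight

variable {r : ℕ} (μ s d : Fin r → ℕ)

lemma continuous_chi : Continuous (chi μ s d) := by unfold chi; fun_prop

lemma continuous_beta : Continuous (beta s d) := by unfold beta; fun_prop

lemma measurable_kappa : Measurable (kappa μ s d) :=
  (continuous_chi μ s d).measurable.div (continuous_beta s d).measurable

lemma weight_eq (t : ℝ) : weight μ s d t = ‖kappa μ s d t‖ ^ 2 := by
  rw [weight, kappa, norm_div, div_pow]

lemma weight_nonneg (t : ℝ) : 0 ≤ weight μ s d t := by rw [weight_eq]; positivity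

lemma measurable_weight : Measurable (weight μ s d) := by
  rw [show weight μ s d = fun t => ‖kappa μ s d t‖ ^ 2 from funext (weight_eq μ s d)]
  exact (measurable_kappa μ s d).norm.pow_const 2

lemma chi_neg (t : ℝ) : chi μ s d (-t) = conj (chi μ s d t) := by
  simp only [chi, map_prod, map_pow, map_sub, map_one, ← Complex.exp_conj]
  simp

variable {μ s}

lemma chi_ne_zero_ae (hμ : ∀ j, 0 < μ j) (hs : ∀ j, 0 < s j) :
    ∀ᵐ t ∂circ, chi μ s d t ≠ 0 := by
  refine circ_absolutelyContinuous.ae_le ?_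
  have h : ∀ j, ∀ᵐ t : ℝ, 1 - Complex.exp (-(Complex.I * t * ((μ j * s j : ℕ) : ℂ))) ≠ 0 := by
    intro j
    have hm : ((μ j * s j : ℕ) : ℝ) ≠ 0 := by
      exact_mod_cast (Nat.mul_pos (hμ j) (hs j)).ne'
    rw [ae_iff]
    refine Set.Countable.measure_zero ?_ _
    refine (Set.countable_range fun n : ℤ => -(n * (2 * Real.pi)) / ((μ j * s j : ℕ) : ℝ)).mono ?_
    intro t ht
    simp only [ne_eq, not_not, Set.mem_ofPred_eq, sub_eq_zero] at ht
    obtain ⟨n, hn⟩ := Complex.exp_eq_one_iff.1 ht.symm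
    refine ⟨n, ?_⟩
    have : (-(t * ((μ j * s j : ℕ) : ℝ)) : ℂ) = n * (2 * Real.pi) := by
      apply mul_right_cancel₀ Complex.I_ne_zero
      push_cast at hn ⊢
      linear_combination hn
    have h2 : -(t * ((μ j * s j : ℕ) : ℝ)) = n * (2 * Real.pi) := by exact_mod_cast this
    simp only
    rw [← h2]; field_simp
  filter_upwards [ae_all_iff.2 h] with t ht
  exact Finset.prod_ne_zero_iff.2 fun j _ => pow_ne_zero _ (ht j)

lemma beta_ne_zero_ae (hs : ∀ j, 0 < s j) : ∀ᵐ t ∂circ, beta s d t ≠ 0 := by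
  refine circ_absolutelyContinuous.ae_le ?_
  have h : ∀ (j : Fin r) (k : ℤ), ∀ᵐ t : ℝ,
      Complex.I * t - 2 * Real.pi * Complex.I * (k : ℂ) / (s j : ℂ) ≠ 0 := by
    intro j k
    have hs' : (s j : ℂ) ≠ 0 := by exact_mod_cast (hs j).ne'
    filter_upwards [compl_mem_ae_iff.2 (measure_singleton (2 * Real.pi * k / s j : ℝ))] with t ht h0
    apply ht
    have : (t : ℂ) = ((2 * Real.pi * k / s j : ℝ) : ℂ) := by
      apply mul_left_cancel₀ Complex.I_ne_zero
      push_cast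
      linear_combination h0
    exact_mod_cast this
  filter_upwards [ae_all_iff.2 fun j => ae_all_iff.2 (h j)] with t ht
  exact Finset.prod_ne_zero_iff.2 fun j _ => Finset.prod_ne_zero_iff.2 fun k _ =>
    pow_ne_zero _ (ht j k)

lemma kappa_ne_zero_ae (hμ : ∀ j, 0 < μ j) (hs : ∀ j, 0 < s j) :
    ∀ᵐ t ∂circ, kappa μ s d t ≠ 0 := by
  filter_upwards [chi_ne_zero_ae d hμ hs, beta_ne_zero_ae d hs] with t h1 h2
  exact div_ne_zero h1 h2

lemma weight_pos_ae (hμ : ∀ j, 0 < μ j) (hs : ∀ j, 0 < s j) :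
    ∀ᵐ t ∂circ, 0 < weight μ s d t := by
  filter_upwards [kappa_ne_zero_ae d hμ hs] with t h
  rw [weight_eq]; positivity

lemma norm_one_sub_exp_mul_le (z : ℝ) (m : ℕ) :
    ‖1 - Complex.exp (-(Complex.I * z * (m : ℂ)))‖ ≤ m * ‖1 - Complex.exp (-(Complex.I * z))‖ := by
  have h : Complex.exp (-(Complex.I * z * (m : ℂ))) = Complex.exp (-(Complex.I * z)) ^ m := by
    rw [← Complex.exp_nat_mul]; ring_nf
  rw [h, ← mul_neg_geom_sum, norm_mul, mul_comm]
  gcongr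
  refine (norm_sum_le _ _).trans ?_
  calc ∑ i ∈ Finset.range m, ‖Complex.exp (-(Complex.I * z)) ^ i‖
      ≤ ∑ _i ∈ Finset.range m, (1 : ℝ) := by
        refine Finset.sum_le_sum fun i _ => ?_
        rw [norm_pow, Complex.norm_exp]; simp
    _ = m := by simp

/-- `|1 - e^{-ist}| ≤ s |t - 2πk/s|` for every integer `k`. -/
lemma norm_one_sub_exp_le (t : ℝ) (n : ℕ) (hn : 0 < n) (k : ℤ) :
    ‖1 - Complex.exp (-(Complex.I * ((t * n : ℝ) : ℂ)))‖ ≤ n * |t - 2 * Real.pi * k / n| := by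
  have hn' : (n : ℝ) ≠ 0 := by exact_mod_cast hn.ne'
  have h : Complex.exp (-(Complex.I * ((t * n : ℝ) : ℂ))) =
      Complex.exp (Complex.I * ((-(n * (t - 2 * Real.pi * k / n)) : ℝ) : ℂ)) := by
    rw [Complex.exp_eq_exp_iff_exists_int]
    refine ⟨-k, ?_⟩
    have : (n * (t - 2 * Real.pi * k / n) : ℝ) = n * t - 2 * Real.pi * k := by field_simp
    rw [this]; push_cast; ring
  rw [h, ← norm_neg, neg_sub]
  refine (Real.norm_exp_I_mul_ofReal_sub_one_le).trans ?_
  rw [Real.norm_eq_abs, abs_neg, abs_mul, Nat.abs_cast]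

/-- The zeros of the denominator of `χ/β` are compensated by the numerator: of the finitely many
factors `t - 2πk/s` at most one is small. -/
lemma exists_norm_kappa_le (hs : ∀ j, 0 < s j) :
    ∃ K : ℝ, 0 < K ∧ ∀ t, ‖kappa μ s d t‖ ≤ K := by
  have hfac : ∀ j, ∃ K : ℝ, 0 < K ∧ ∀ t : ℝ,
      ‖(1 - Complex.exp (-(Complex.I * t * ((μ j * s j : ℕ) : ℂ)))) /
        ∏ k ∈ Finset.Icc (-((s j / 2 : ℕ) : ℤ)) ((s j / 2 : ℕ) : ℤ),
          (Complex.I * t - 2 * Real.pi * Complex.I * (k : ℂ) / (s j : ℂ))‖ ≤ K := by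
    intro j
    set I := Finset.Icc (-((s j / 2 : ℕ) : ℤ)) ((s j / 2 : ℕ) : ℤ) with hI
    have hne : I.Nonempty := ⟨0, by simp only [hI, Finset.mem_Icc]; omega⟩
    have hsj : (0 : ℝ) < s j := by exact_mod_cast hs j
    have hpi := Real.pi_pos
    refine ⟨μ j * s j / (Real.pi / s j) ^ (I.card - 1) + 1, by positivity, fun t => ?_⟩
    -- `k₀` belongs to the zero nearest to `t`; the other zeros have distance at least `π / s` from `t`
    obtain ⟨k₀, hk₀, hmin⟩ := I.exists_min_image (fun k => |t - 2 * Real.pi * k / s j|) hne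
    have hnum : ‖1 - Complex.exp (-(Complex.I * t * ((μ j * s j : ℕ) : ℂ)))‖ ≤
        μ j * (s j * |t - 2 * Real.pi * k₀ / s j|) := by
      have h1 := norm_one_sub_exp_mul_le (t * s j) (μ j)
      have h2 := norm_one_sub_exp_le t (s j) (hs j) k₀
      refine le_trans (le_of_eq ?_) (h1.trans (by gcongr))
      congr 3; push_cast; ring
    have hfn : ∀ k : ℤ, ‖Complex.I * t - 2 * Real.pi * Complex.I * (k : ℂ) / (s j : ℂ)‖ =
        |t - 2 * Real.pi * k / s j| := by
      intro k
      rw [show Complex.I * t - 2 * Real.pi * Complex.I * (k : ℂ) / (s j : ℂ) =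
        Complex.I * ((t - 2 * Real.pi * k / s j : ℝ) : ℂ) by push_cast; ring]
      rw [norm_mul, Complex.norm_I, one_mul, Complex.norm_real, Real.norm_eq_abs]
    have hden : (Real.pi / s j) ^ (I.card - 1) ≤
        ∏ k ∈ I.erase k₀, |t - 2 * Real.pi * k / s j| := by
      rw [← Finset.card_erase_of_mem hk₀, ← Finset.prod_const]
      refine Finset.prod_le_prod (fun _ _ => by positivity) fun k hk => ?_
      have hkk := Finset.ne_of_mem_erase hk
      have h1 := hmin k (Finset.mem_of_mem_erase hk)
      have h2 : 2 * Real.pi / s j ≤ |2 * Real.pi * k / s j - 2 * Real.pi * k₀ / s j| := by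
        rw [← sub_div, ← mul_sub, abs_div, abs_mul, abs_of_pos hsj,
          abs_of_pos (by positivity : 0 < 2 * Real.pi)]
        have : (1 : ℝ) ≤ |(k : ℝ) - k₀| := by
          exact_mod_cast Int.one_le_abs (sub_ne_zero.2 hkk)
        exact div_le_div_of_nonneg_right (le_mul_of_one_le_right (by positivity) this) hsj.le
      have h3 : |2 * Real.pi * k / s j - 2 * Real.pi * k₀ / s j| ≤
          |t - 2 * Real.pi * k₀ / s j| + |t - 2 * Real.pi * k / s j| := by
        rw [show 2 * Real.pi * k / s j - 2 * Real.pi * k₀ / s j =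
          (t - 2 * Real.pi * k₀ / s j) - (t - 2 * Real.pi * k / s j) by ring]
        exact abs_sub _ _
      have h4 : 2 * Real.pi / s j = 2 * (Real.pi / s j) := by ring
      linarith
    rw [norm_div, norm_prod, Finset.prod_congr rfl fun k _ => hfn k, ← Finset.mul_prod_erase I _ hk₀]
    -- at a zero of the denominator the quotient is `0` by convention
    rcases (abs_nonneg (t - 2 * Real.pi * k₀ / s j)).eq_or_lt with h0 | h0
    · rw [← h0, zero_mul, div_zero]; positivity
    · have hP : 0 < ∏ k ∈ I.erase k₀, |t - 2 * Real.pi * k / s j| :=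
        lt_of_lt_of_le (by positivity) hden
      rw [div_le_iff₀ (by positivity)]
      refine hnum.trans ?_
      have h5 : (μ j * s j : ℝ) ≤ (μ j * s j / (Real.pi / s j) ^ (I.card - 1) + 1) *
          ∏ k ∈ I.erase k₀, |t - 2 * Real.pi * k / s j| := by
        calc (μ j * s j : ℝ) = μ j * s j / (Real.pi / s j) ^ (I.card - 1) *
              (Real.pi / s j) ^ (I.card - 1) := by field_simp
          _ ≤ _ := by
              gcongr
              linarith
      calc (μ j : ℝ) * (s j * |t - 2 * Real.pi * k₀ / s j|)
          = (μ j * s j) * |t - 2 * Real.pi * k₀ / s j| := by ring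
        _ ≤ _ := mul_le_mul_of_nonneg_right h5 h0.le
        _ = _ := by ring
  choose K hK0 hK using hfac
  refine ⟨∏ j, K j ^ d j, Finset.prod_pos fun j _ => pow_pos (hK0 j) _, fun t => ?_⟩
  rw [kappa, chi, beta, ← Finset.prod_div_distrib, norm_prod]
  refine Finset.prod_le_prod (fun _ _ => norm_nonneg _) fun j _ => ?_
  rw [Finset.prod_pow, ← div_pow, norm_pow]
  exact pow_le_pow_left₀ (norm_nonneg _) (hK j t) _

lemma exists_weight_le (hs : ∀ j, 0 < s j) : ∃ K : ℝ, 0 < K ∧ ∀ t, weight μ s d t ≤ K := by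
  obtain ⟨K, hK, h⟩ := exists_norm_kappa_le (μ := μ) d hs
  refine ⟨K ^ 2, by positivity, fun t => ?_⟩
  rw [weight_eq]
  exact pow_le_pow_left₀ (norm_nonneg _) (h t) 2

lemma integrable_weight (hs : ∀ j, 0 < s j) : Integrable (weight μ s d) circ := by
  obtain ⟨K, _, h⟩ := exists_weight_le (μ := μ) d hs
  refine Integrable.of_bound (measurable_weight μ s d).aestronglyMeasurable K
    (ae_of_all _ fun t => ?_)
  rw [Real.norm_of_nonneg (weight_nonneg μ s d t)]; exact h t

end Weight

/-! ### The spaces `L₂(g)` and their projections -/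


variable {T : ℕ} {g : ℝ → Mat T}

lemma IsSpectralDensity.aemeasurable (hg : IsSpectralDensity g) (i j : Fin T) :
    AEMeasurable (fun t => g t i j) circ := (hg.1 i j).aemeasurable

lemma aemeasurable_sesqForm (hg : ∀ i j, AEMeasurable (fun t => g t i j) circ)
    {x y : ℝ → Fin T → ℂ} (hx : AEMeasurable x circ) (hy : AEMeasurable y circ) :
    AEMeasurable (fun t => sesqForm (g t) (x t) (y t)) circ := by
  simp only [sesqForm_eq_sum]
  refine Finset.aemeasurable_fun_sum _ fun i _ => Finset.aemeasurable_fun_sum _ fun j _ => ?_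
  have h1 := aemeasurable_pi_iff.1 hx i
  have h2 := aemeasurable_pi_iff.1 hy j
  exact h1.mul ((hg i j).mul (Complex.continuous_conj.measurable.comp_aemeasurable h2))

lemma aemeasurable_quadForm (hg : ∀ i j, AEMeasurable (fun t => g t i j) circ)
    {x : ℝ → Fin T → ℂ} (hx : AEMeasurable x circ) :
    AEMeasurable (fun t => quadForm (g t) (x t)) circ :=
  Complex.measurable_re.comp_aemeasurable (aemeasurable_sesqForm hg hx hx)

/-- Measurable vector functions of finite norm in `L₂(g)`. -/
def InL2 (g : ℝ → Mat T) (x : ℝ → Fin T → ℂ) : Prop := AEMeasurable x circ ∧ sqNorm g x < ∞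

lemma sqNorm_eq (g : ℝ → Mat T) (x : ℝ → Fin T → ℂ) :
    sqNorm g x = ∫⁻ t, ENNReal.ofReal (quadForm (g t) (x t)) ∂circ := rfl

lemma sqNorm_congr {f g : ℝ → Mat T} {x y : ℝ → Fin T → ℂ}
    (h : ∀ᵐ t ∂circ, quadForm (f t) (x t) = quadForm (g t) (y t)) : sqNorm f x = sqNorm g y :=
  lintegral_congr_ae (h.mono fun t ht => by
    change ENNReal.ofReal (quadForm (f t) (x t)) = ENNReal.ofReal (quadForm (g t) (y t))
    rw [ht])

lemma sqNorm_congr_ae {x y : ℝ → Fin T → ℂ} (h : x =ᵐ[circ] y) : sqNorm g x = sqNorm g y :=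
  sqNorm_congr (h.mono fun t ht => by rw [ht])

lemma sqNorm_sub_comm (x y : ℝ → Fin T → ℂ) : sqNorm g (x - y) = sqNorm g (y - x) :=
  sqNorm_congr (ae_of_all _ fun _ => quadForm_sub_comm _ _ _)

lemma sqNorm_smul (c : ℂ) (x : ℝ → Fin T → ℂ) :
    sqNorm g (c • x) = ENNReal.ofReal (‖c‖ ^ 2) * sqNorm g x := by
  rw [sqNorm_eq, sqNorm_eq, ← lintegral_const_mul' _ _ ENNReal.ofReal_ne_top]
  refine lintegral_congr fun t => ?_
  rw [Pi.smul_apply, quadForm_smul, ENNReal.ofReal_mul (by positivity)]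

lemma sqNorm_add_le (hg : IsSpectralDensity g) {x y : ℝ → Fin T → ℂ} (hx : AEMeasurable x circ)
    {δ : ℝ} (hδ : 0 < δ) :
    sqNorm g (x + y) ≤
      ENNReal.ofReal (1 + δ) * sqNorm g x + ENNReal.ofReal (1 + δ⁻¹) * sqNorm g y := by
  rw [sqNorm_eq, sqNorm_eq, sqNorm_eq, ← lintegral_const_mul' _ _ ENNReal.ofReal_ne_top,
    ← lintegral_const_mul' _ _ ENNReal.ofReal_ne_top, ← lintegral_add_left']
  · refine lintegral_mono_ae (hg.2.mono fun t ht => ?_)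
    rw [← ENNReal.ofReal_mul (by positivity), ← ENNReal.ofReal_mul (by positivity),
      ← ENNReal.ofReal_add (mul_nonneg (by positivity) (quadForm_nonneg ht _))
        (mul_nonneg (by positivity) (quadForm_nonneg ht _))]
    exact ENNReal.ofReal_le_ofReal (quadForm_add_le ht _ _ hδ)
  · exact ((aemeasurable_quadForm hg.aemeasurable hx).ennreal_ofReal).const_mul _

lemma InL2.add (hg : IsSpectralDensity g) {x y : ℝ → Fin T → ℂ} (hx : InL2 g x) (hy : InL2 g y) :
    InL2 g (x + y) := by
  refine ⟨hx.1.add hy.1, (sqNorm_add_le hg hx.1 one_pos).trans_lt ?_⟩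
  exact ENNReal.add_lt_top.2 ⟨ENNReal.mul_lt_top ENNReal.ofReal_lt_top hx.2,
    ENNReal.mul_lt_top ENNReal.ofReal_lt_top hy.2⟩

lemma InL2.smul {x : ℝ → Fin T → ℂ} (hx : InL2 g x) (c : ℂ) : InL2 g (c • x) :=
  ⟨hx.1.const_smul c, by
    rw [sqNorm_smul]; exact ENNReal.mul_lt_top ENNReal.ofReal_lt_top hx.2⟩

lemma InL2.sub (hg : IsSpectralDensity g) {x y : ℝ → Fin T → ℂ} (hx : InL2 g x) (hy : InL2 g y) :
    InL2 g (x - y) := by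
  have := hx.add hg (hy.smul (-1))
  rwa [neg_one_smul, ← sub_eq_add_neg] at this

lemma InL2.integrable_quadForm (hg : IsSpectralDensity g) {x : ℝ → Fin T → ℂ} (hx : InL2 g x) :
    Integrable (fun t => quadForm (g t) (x t)) circ := by
  refine ⟨(aemeasurable_quadForm hg.aemeasurable hx.1).aestronglyMeasurable, ?_⟩
  rw [hasFiniteIntegral_iff_ofReal (hg.2.mono fun _ ht => quadForm_nonneg ht _)]
  exact hx.2

lemma sqNorm_eq_ofReal (hg : IsSpectralDensity g) {x : ℝ → Fin T → ℂ} (hx : InL2 g x) :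
    sqNorm g x = ENNReal.ofReal (∫ t, quadForm (g t) (x t) ∂circ) := by
  rw [ofReal_integral_eq_lintegral_ofReal (hx.integrable_quadForm hg)
    (hg.2.mono fun _ ht => quadForm_nonneg ht _)]
  rfl

lemma integral_quadForm_nonneg (hg : IsSpectralDensity g) (x : ℝ → Fin T → ℂ) :
    0 ≤ ∫ t, quadForm (g t) (x t) ∂circ :=
  integral_nonneg_of_ae (hg.2.mono fun _ ht => quadForm_nonneg ht _)

lemma integrable_sesqForm (hg : IsSpectralDensity g) {x y : ℝ → Fin T → ℂ} (hx : InL2 g x)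
    (hy : InL2 g y) : Integrable (fun t => sesqForm (g t) (x t) (y t)) circ := by
  refine Integrable.mono' (((hx.integrable_quadForm hg).add (hy.integrable_quadForm hg)).div_const 2)
    (aemeasurable_sesqForm hg.aemeasurable hx.1 hy.1).aestronglyMeasurable
    (hg.2.mono fun _ ht => norm_sesqForm_le ht _ _)

lemma norm_integral_sesqForm_le (hg : IsSpectralDensity g) {x y : ℝ → Fin T → ℂ} (hx : InL2 g x)
    (hy : InL2 g y) {δ : ℝ} (hδ : 0 < δ) :
    ‖∫ t, sesqForm (g t) (x t) (y t) ∂circ‖ ≤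
      δ * ∫ t, quadForm (g t) (x t) ∂circ + δ⁻¹ * ∫ t, quadForm (g t) (y t) ∂circ := by
  have h1 := (hx.integrable_quadForm hg).const_mul δ
  have h2 := (hy.integrable_quadForm hg).const_mul δ⁻¹
  rw [← integral_const_mul, ← integral_const_mul, ← integral_add h1 h2]
  refine norm_integral_le_of_norm_le (h1.add h2) (hg.2.mono fun t ht => ?_)
  have h := norm_sesqForm_sq_le ht (x t) (y t)
  have hx := quadForm_nonneg ht (x t)
  have hy := quadForm_nonneg ht (y t)
  apply le_of_sq_le_sq _ (by positivity)
  have : δ * δ⁻¹ = 1 := mul_inv_cancel₀ hδ.ne'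
  nlinarith [sq_nonneg (δ * quadForm (g t) (x t) - δ⁻¹ * quadForm (g t) (y t)), mul_nonneg hx hy]

/-- Membership in the closure of `S` in `L₂(g)`. -/
def InClosure (g : ℝ → Mat T) (S : Submodule ℂ (ℝ → Fin T → ℂ)) (h : ℝ → Fin T → ℂ) : Prop :=
  AEMeasurable h circ ∧ ∀ ε : ℝ≥0∞, 0 < ε → ∃ p ∈ S, sqNorm g (h - p) < ε

variable {S : Submodule ℂ (ℝ → Fin T → ℂ)}

lemma inClosure_of_mem {p : ℝ → Fin T → ℂ} (hp : p ∈ S) (hm : AEMeasurable p circ) :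
    InClosure g S p :=
  ⟨hm, fun ε hε => ⟨p, hp, by simpa [sqNorm] using hε⟩⟩

lemma InClosure.inL2 (hg : IsSpectralDensity g) (hS : ∀ p ∈ S, InL2 g p) {h : ℝ → Fin T → ℂ}
    (hh : InClosure g S h) : InL2 g h := by
  obtain ⟨p, hp, hlt⟩ := hh.2 1 one_pos
  have h1 : InL2 g (h - p) := ⟨hh.1.sub (hS p hp).1, hlt.trans ENNReal.one_lt_top⟩
  simpa using h1.add hg (hS p hp)

lemma InClosure.exists_integral_lt (hg : IsSpectralDensity g) (hS : ∀ p ∈ S, InL2 g p)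
    {h : ℝ → Fin T → ℂ} (hh : InClosure g S h) {ε : ℝ} (hε : 0 < ε) :
    ∃ p ∈ S, ∫ t, quadForm (g t) (h t - p t) ∂circ < ε := by
  obtain ⟨p, hp, hlt⟩ := hh.2 (ENNReal.ofReal ε) (by simpa using hε)
  refine ⟨p, hp, ?_⟩
  rw [sqNorm_eq_ofReal hg ((hh.inL2 hg hS).sub hg (hS p hp)), ENNReal.ofReal_lt_ofReal_iff hε] at hlt
  exact hlt

/-- The distance to `S` is not changed by passing to the closure of `S`. -/
lemma InClosure.iInf_sqNorm_le (hg : IsSpectralDensity g) {x h : ℝ → Fin T → ℂ}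
    (hx : AEMeasurable x circ) (hh : InClosure g S h) :
    ⨅ p ∈ S, sqNorm g (x - p) ≤ sqNorm g (x - h) := by
  have h1 : ∀ n : ℕ, ⨅ p ∈ S, sqNorm g (x - p) ≤
      ENNReal.ofReal (1 + 1 / ((n : ℝ) + 1)) * sqNorm g (x - h) := by
    intro n
    set δ : ℝ := 1 / ((n : ℝ) + 1) with hδd
    have hδ : 0 < δ := by positivity
    refine ENNReal.le_of_forall_pos_le_add fun ε hε _ => ?_
    have hC : ENNReal.ofReal (1 + δ⁻¹) ≠ 0 := by
      simp only [ne_eq, ENNReal.ofReal_eq_zero, not_le]; positivity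
    obtain ⟨p, hp, hlt⟩ := hh.2 ((ε : ℝ≥0∞) / ENNReal.ofReal (1 + δ⁻¹))
      (ENNReal.div_pos (by simpa using hε.ne') ENNReal.ofReal_ne_top)
    refine (iInf₂_le p hp).trans ?_
    have := sqNorm_add_le hg (x := x - h) (y := h - p) (hx.sub hh.1) hδ
    rw [sub_add_sub_cancel] at this
    refine this.trans ?_
    gcongr
    calc ENNReal.ofReal (1 + δ⁻¹) * sqNorm g (h - p)
        ≤ ENNReal.ofReal (1 + δ⁻¹) * ((ε : ℝ≥0∞) / ENNReal.ofReal (1 + δ⁻¹)) := by gcongr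
      _ = ε := ENNReal.mul_div_cancel hC ENNReal.ofReal_ne_top
  have h2 : Tendsto (fun n : ℕ => ENNReal.ofReal (1 + 1 / ((n : ℝ) + 1))) atTop (𝓝 1) := by
    have : Tendsto (fun n : ℕ => 1 + 1 / ((n : ℝ) + 1)) atTop (𝓝 (1 + 0)) :=
      tendsto_const_nhds.add tendsto_one_div_add_atTop_nhds_zero_nat
    rw [add_zero] at this
    simpa using ENNReal.tendsto_ofReal this
  rcases eq_or_ne (sqNorm g (x - h)) ∞ with htop | htop
  · rw [htop]; exact le_top
  · have h3 := ENNReal.Tendsto.mul_const h2 (Or.inr htop)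
    rw [one_mul] at h3
    exact ge_of_tendsto' h3 h1

/-- Orthogonality to `S` extends to the closure of `S`. -/
lemma InClosure.integral_sesqForm_eq_zero (hg : IsSpectralDensity g) (hS : ∀ p ∈ S, InL2 g p)
    {y h : ℝ → Fin T → ℂ} (hy : InL2 g y) (hh : InClosure g S h)
    (horth : ∀ p ∈ S, ∫ t, sesqForm (g t) (y t) (p t) ∂circ = 0) :
    ∫ t, sesqForm (g t) (y t) (h t) ∂circ = 0 := by
  rw [← norm_le_zero_iff]
  refine le_of_forall_pos_le_add fun ε hε => ?_
  have hY := integral_quadForm_nonneg hg y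
  set Y := ∫ t, quadForm (g t) (y t) ∂circ
  have hδ : 0 < ε / (2 * (Y + 1)) := by positivity
  obtain ⟨p, hp, hlt⟩ := hh.exists_integral_lt hg hS (ε := ε / (2 * (Y + 1)) * (ε / 2))
    (by positivity)
  have hd := (hh.inL2 hg hS).sub hg (hS p hp)
  have h1 := norm_integral_sesqForm_le hg hy hd hδ
  have h2 : ∫ t, sesqForm (g t) (y t) (h t) ∂circ = ∫ t, sesqForm (g t) (y t) ((h - p) t) ∂circ := by
    simp only [Pi.sub_apply, sesqForm_sub_right]
    rw [integral_sub (integrable_sesqForm hg hy (hh.inL2 hg hS))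
      (integrable_sesqForm hg hy (hS p hp)), horth p hp, sub_zero]
  rw [h2, zero_add]
  refine h1.trans ?_
  have h3 : ε / (2 * (Y + 1)) * Y ≤ ε / 2 := by
    rw [div_mul_eq_mul_div, div_le_div_iff₀ (by positivity) two_pos]; nlinarith
  have h4 : (ε / (2 * (Y + 1)))⁻¹ * ∫ t, quadForm (g t) ((h - p) t) ∂circ ≤ ε / 2 := by
    calc _ ≤ (ε / (2 * (Y + 1)))⁻¹ * (ε / (2 * (Y + 1)) * (ε / 2)) := by
          gcongr; exact hlt.le
      _ = ε / 2 := inv_mul_cancel_left₀ hδ.ne' _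
  linarith

lemma ae_tendsto_zero_of_tsum_lintegral {F : ℕ → ℝ → ℝ≥0∞} (hF : ∀ n, AEMeasurable (F n) circ)
    (h : ∑' n, ∫⁻ t, F n t ∂circ ≠ ∞) : ∀ᵐ t ∂circ, Tendsto (fun n => F n t) atTop (𝓝 0) := by
  rw [← lintegral_tsum hF] at h
  filter_upwards [ae_lt_top' (AEMeasurable.tsum hF) h] with t ht
  exact ENNReal.tendsto_atTop_zero_of_tsum_ne_top ht.ne

lemma continuous_quadForm (A : Mat T) : Continuous (quadForm A) := by
  have : quadForm A = fun x => (∑ i, ∑ j, x i * (A i j * conj (x j))).re := by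
    funext x; rw [quadForm_eq_re, sesqForm_eq_sum]
  rw [this]; fun_prop

/-- Fatou's lemma in `L₂(g)`. -/
lemma sqNorm_le_of_tendsto (hg : IsSpectralDensity g) {y : ℕ → ℝ → Fin T → ℂ}
    {z : ℝ → Fin T → ℂ} (hy : ∀ n, AEMeasurable (y n) circ)
    (hlim : ∀ᵐ t ∂circ, Tendsto (fun n => y n t) atTop (𝓝 (z t))) {c : ℝ≥0∞}
    (hc : ∀ᶠ n in atTop, sqNorm g (y n) ≤ c) : sqNorm g z ≤ c := by
  have h1 : sqNorm g z = ∫⁻ t, liminf (fun n => ENNReal.ofReal (quadForm (g t) (y n t))) atTop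
      ∂circ := by
    refine lintegral_congr_ae (hlim.mono fun t ht => ?_)
    exact ((ENNReal.continuous_ofReal.comp (continuous_quadForm (g t))).continuousAt.tendsto.comp
      ht).liminf_eq.symm
  rw [h1]
  refine (lintegral_liminf_le' fun n =>
    (aemeasurable_quadForm hg.aemeasurable (hy n)).ennreal_ofReal).trans ?_
  refine (liminf_le_liminf (v := fun _ => c) ?_).trans (by simp)
  exact hc

/-- A sequence with summable increments in `L₂(g)` converges almost everywhere. -/
lemma exists_ae_tendsto (hg : IsSpectralDensity g) (hpd : ∀ᵐ t ∂circ, (g t).PosDef)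
    {y : ℕ → ℝ → Fin T → ℂ} (hy : ∀ n, AEMeasurable (y n) circ)
    (h : ∀ n, sqNorm g (y (n + 1) - y n) ≤ 4 * (8 : ℝ≥0∞)⁻¹ ^ n) :
    ∃ z : ℝ → Fin T → ℂ, Measurable z ∧
      ∀ᵐ t ∂circ, Tendsto (fun n => y n t) atTop (𝓝 (z t)) := by
  have hae : ∀ᵐ t ∂circ, Tendsto
      (fun n => (4 : ℝ≥0∞) ^ n * ENNReal.ofReal (quadForm (g t) ((y (n + 1) - y n) t)))
      atTop (𝓝 0) := by
    refine ae_tendsto_zero_of_tsum_lintegral (fun n =>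
      ((aemeasurable_quadForm hg.aemeasurable ((hy _).sub (hy n))).ennreal_ofReal).const_mul _) ?_
    have hb : ∀ n, ∫⁻ t, (4 : ℝ≥0∞) ^ n * ENNReal.ofReal (quadForm (g t) ((y (n + 1) - y n) t)) ∂circ
        ≤ 4 * (2 : ℝ≥0∞)⁻¹ ^ n := by
      intro n
      rw [lintegral_const_mul' _ _ (by simp)]
      calc (4 : ℝ≥0∞) ^ n * _ ≤ 4 ^ n * (4 * (8 : ℝ≥0∞)⁻¹ ^ n) := by gcongr; exact h n
        _ = 4 * (4 * (8 : ℝ≥0∞)⁻¹) ^ n := by rw [mul_pow]; ring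
        _ = 4 * (2 : ℝ≥0∞)⁻¹ ^ n := by
          congr 2
          rw [show (8 : ℝ≥0∞) = 4 * 2 by norm_num, ENNReal.mul_inv (by simp) (by simp), ← mul_assoc,
            ENNReal.mul_inv_cancel (by simp) (by simp), one_mul]
    refine ne_top_of_le_ne_top ?_ (ENNReal.tsum_le_tsum hb)
    rw [ENNReal.tsum_mul_left, ENNReal.tsum_geometric]
    simp [ENNReal.mul_eq_top]
  have hlim : ∀ᵐ t ∂circ, ∃ l, Tendsto (fun n => y n t) atTop (𝓝 l) := by
    filter_upwards [hae, hpd] with t ht hp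
    apply cauchySeq_tendsto_of_complete
    refine cauchySeq_of_summable_dist ?_
    -- the coordinates are controlled by the quadratic form of the positive definite matrix `g t`
    set A := √((g t)⁻¹.trace.re) with hA
    have hs : Summable fun n : ℕ => A * (1 / 2 : ℝ) ^ n :=
      summable_geometric_two.mul_left _
    refine Summable.of_norm_bounded_eventually_nat hs ?_
    have h1 : ∀ᶠ n in atTop, (4 : ℝ≥0∞) ^ n *
        ENNReal.ofReal (quadForm (g t) ((y (n + 1) - y n) t)) < 1 :=
      ht.eventually_lt_const one_pos
    filter_upwards [h1] with n hn
    have hq := quadForm_nonneg hp.posSemidef ((y (n + 1) - y n) t)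
    have h2 : 4 ^ n * quadForm (g t) ((y (n + 1) - y n) t) ≤ 1 := by
      have : ENNReal.ofReal (4 ^ n * quadForm (g t) ((y (n + 1) - y n) t)) < 1 := by
        rwa [ENNReal.ofReal_mul (by positivity), ENNReal.ofReal_pow (by positivity),
          ENNReal.ofReal_ofNat]
      rw [← ENNReal.ofReal_one, ENNReal.ofReal_lt_ofReal_iff one_pos] at this
      exact this.le
    rw [Real.norm_of_nonneg dist_nonneg, dist_comm, dist_eq_norm]
    rw [pi_norm_le_iff_of_nonneg (by positivity)]
    intro p
    have h3 := norm_sq_le_inv_mul_quadForm hp ((y (n + 1) - y n) t) p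
    have h4 := inv_diag_le_trace hp p
    have h5 := PosDef.inv_diag_re_nonneg hp p
    apply le_of_sq_le_sq _ (by positivity)
    rw [mul_pow, hA, Real.sq_sqrt (h5.trans h4), ← pow_mul, mul_comm n 2, pow_mul]
    have h6 : quadForm (g t) ((y (n + 1) - y n) t) ≤ ((1 / 2 : ℝ) ^ 2) ^ n := by
      rw [show ((1 : ℝ) / 2) ^ 2 = 4⁻¹ by norm_num, inv_pow, ← one_div, le_div_iff₀ (by positivity)]
      linarith
    calc _ ≤ _ := h3
      _ ≤ _ := by gcongr; exact h5.trans h4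
  obtain ⟨z, hz, hz'⟩ := measurable_limit_of_tendsto_metrizable_ae hy hlim
  exact ⟨z, hz, hz'⟩

lemma sqNorm_parallelogram (hg : IsSpectralDensity g) {u v : ℝ → Fin T → ℂ}
    (hu : AEMeasurable u circ) (hv : AEMeasurable v circ) :
    sqNorm g (u + v) + sqNorm g (u - v) = 2 * sqNorm g u + 2 * sqNorm g v := by
  have hm : ∀ {x}, AEMeasurable x circ →
      AEMeasurable (fun t => ENNReal.ofReal (quadForm (g t) (x t))) circ := fun hx =>
    (aemeasurable_quadForm hg.aemeasurable hx).ennreal_ofReal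
  simp only [sqNorm_eq]
  rw [← lintegral_add_left' (hm (hu.add hv)), ← lintegral_const_mul' _ _ (by simp),
    ← lintegral_const_mul' _ _ (by simp), ← lintegral_add_left' ((hm hu).const_mul _)]
  refine lintegral_congr_ae (hg.2.mono fun t ht => ?_)
  have h := quadForm_parallelogram (g t) (u t) (v t)
  have n := quadForm_nonneg ht
  simp only [Pi.add_apply, Pi.sub_apply]
  rw [← ENNReal.ofReal_add (n _) (n _), h, ENNReal.ofReal_add (by linarith [n (u t)])
    (by linarith [n (v t)]), ENNReal.ofReal_mul two_pos.le, ENNReal.ofReal_mul two_pos.le,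
    ENNReal.ofReal_ofNat]

/-- Orthogonal projection onto the closure of a subspace of `L₂(g)`, for an almost everywhere
positive definite density `g`. -/
theorem exists_projection (hg : IsSpectralDensity g) (hpd : ∀ᵐ t ∂circ, (g t).PosDef)
    (hS : ∀ p ∈ S, InL2 g p) {x : ℝ → Fin T → ℂ} (hx : InL2 g x) :
    ∃ h, InClosure g S h ∧ ∀ p ∈ S, ∫ t, sesqForm (g t) (x t - h t) (p t) ∂circ = 0 := by
  set m := ⨅ p ∈ S, sqNorm g (x - p) with hm
  have hmtop : m ≠ ∞ := by
    refine ne_top_of_le_ne_top hx.2.ne ((iInf₂_le 0 S.zero_mem).trans_eq ?_)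
    rw [sub_zero]
  have hex : ∀ n : ℕ, ∃ p ∈ S, sqNorm g (x - p) < m + (8 : ℝ≥0∞)⁻¹ ^ n := by
    intro n
    have : m < m + (8 : ℝ≥0∞)⁻¹ ^ n :=
      ENNReal.lt_add_right hmtop (pow_ne_zero _ (by simp))
    nth_rewrite 1 [hm] at this
    simpa only [iInf_lt_iff, exists_prop] using this
  choose y hyS hy using hex
  have hyL : ∀ n, InL2 g (y n) := fun n => hS _ (hyS n)
  -- the parallelogram law makes a minimizing sequence a Cauchy sequence
  have hcauchy : ∀ n k, n ≤ k → sqNorm g (y k - y n) ≤ 4 * (8 : ℝ≥0∞)⁻¹ ^ n := by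
    intro n k hnk
    have hp := sqNorm_parallelogram hg (hx.1.sub (hyL n).1) (hx.1.sub (hyL k).1)
    rw [show x - y n - (x - y k) = y k - y n by abel] at hp
    have hmid : 4 * m ≤ sqNorm g (x - y n + (x - y k)) := by
      have e : x - y n + (x - y k) = (2 : ℂ) • (x - (2 : ℂ)⁻¹ • (y n + y k)) := by
        rw [smul_sub, smul_smul]; norm_num; rw [two_smul]; abel
      rw [e, sqNorm_smul]
      have : ENNReal.ofReal (‖(2 : ℂ)‖ ^ 2) = 4 := by norm_num
      rw [this]
      gcongr
      exact iInf₂_le _ (S.smul_mem _ (S.add_mem (hyS n) (hyS k)))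
    have hle : (8 : ℝ≥0∞)⁻¹ ^ k ≤ (8 : ℝ≥0∞)⁻¹ ^ n :=
      pow_le_pow_of_le_one (by simp) (by simp [ENNReal.inv_le_one]) hnk
    have hfin : (4 : ℝ≥0∞) * m ≠ ∞ := ENNReal.mul_ne_top (by simp) hmtop
    rw [← ENNReal.add_le_add_iff_left hfin]
    calc 4 * m + sqNorm g (y k - y n) ≤ _ := add_le_add_left hmid _
      _ = _ := hp
      _ ≤ 2 * (m + (8 : ℝ≥0∞)⁻¹ ^ n) + 2 * (m + (8 : ℝ≥0∞)⁻¹ ^ n) := by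
        gcongr
        · exact (hy n).le
        · exact (hy k).le.trans (by gcongr)
      _ = _ := by ring
  obtain ⟨h, hhm, hlim⟩ := exists_ae_tendsto hg hpd (fun n => (hyL n).1)
    fun n => hcauchy n (n + 1) (Nat.le_succ n)
  have hconv : ∀ n, sqNorm g (h - y n) ≤ 4 * (8 : ℝ≥0∞)⁻¹ ^ n := fun n =>
    sqNorm_le_of_tendsto hg (y := fun k => y k - y n) (fun k => (hyL k).1.sub (hyL n).1)
      (hlim.mono fun t ht => ht.sub_const _)
      ((eventually_ge_atTop n).mono fun k hk => hcauchy n k hk)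
  have hcl : InClosure g S h := by
    refine ⟨hhm.aemeasurable, fun ε hε => ?_⟩
    have h0 : Tendsto (fun n : ℕ => 4 * (8 : ℝ≥0∞)⁻¹ ^ n) atTop (𝓝 (4 * 0)) :=
      ENNReal.Tendsto.const_mul
        (ENNReal.tendsto_pow_atTop_nhds_zero_of_lt_one (by
          rw [ENNReal.inv_lt_one]; norm_num)) (Or.inr (by simp))
    rw [mul_zero] at h0
    obtain ⟨n, hn⟩ := (h0.eventually_lt_const hε).exists
    exact ⟨y n, hyS n, (hconv n).trans_lt hn⟩
  refine ⟨h, hcl, fun p hp => ?_⟩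
  have hhL := hcl.inL2 hg hS
  have heL := hx.sub hg hhL
  have hpow : Tendsto (fun n : ℕ => (8 : ℝ≥0∞)⁻¹ ^ n) atTop (𝓝 0) :=
    ENNReal.tendsto_pow_atTop_nhds_zero_of_lt_one (by rw [ENNReal.inv_lt_one]; norm_num)
  have hmin : sqNorm g (x - h) ≤ m := by
    refine ENNReal.le_of_forall_pos_le_add fun ε hε _ => ?_
    refine sqNorm_le_of_tendsto hg (y := fun k => x - y k) (fun k => hx.1.sub (hyL k).1)
      (hlim.mono fun t ht => ht.const_sub _) ?_
    filter_upwards [hpow.eventually_lt_const (show (0 : ℝ≥0∞) < ε by simpa using hε)] with n hn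
    exact (hy n).le.trans (by gcongr)
  set I := ∫ t, sesqForm (g t) (x t - h t) (p t) ∂circ with hI
  set a := ∫ t, quadForm (g t) (x t - h t) ∂circ with ha
  set b := ∫ t, quadForm (g t) (p t) ∂circ with hb
  have hpL := hS p hp
  -- first variation of the distance in the direction `σ I p`
  have hvar : ∀ σ : ℝ, 0 ≤ -(2 * σ * ‖I‖ ^ 2) + σ ^ 2 * ‖I‖ ^ 2 * b := by
    intro σ
    set c : ℂ := (σ : ℂ) * I with hc
    have hcl' : InClosure g S (h + c • p) := by
      refine ⟨hcl.1.add (hpL.1.const_smul c), fun ε hε => ?_⟩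
      obtain ⟨u, hu, hlt⟩ := hcl.2 ε hε
      exact ⟨u + c • p, S.add_mem hu (S.smul_mem c hp), by simpa using hlt⟩
    have h1 := hmin.trans (hcl'.iInf_sqNorm_le hg hx.1)
    have hL' : InL2 g (x - (h + c • p)) := hx.sub hg (hcl'.inL2 hg hS)
    rw [sqNorm_eq_ofReal hg heL, sqNorm_eq_ofReal hg hL',
      ENNReal.ofReal_le_ofReal_iff (integral_quadForm_nonneg hg _)] at h1
    have e : ∀ᵐ t ∂circ, quadForm (g t) ((x - (h + c • p)) t) =
        quadForm (g t) (x t - h t) - 2 * (conj c * sesqForm (g t) (x t - h t) (p t)).re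
          + ‖c‖ ^ 2 * quadForm (g t) (p t) := by
      filter_upwards [hg.2] with t ht
      have h2 : sesqForm (g t) (c • p t) (x t - h t) =
          conj (sesqForm (g t) (x t - h t) (c • p t)) := (sesqForm_conj ht.1 _ _).symm
      simp only [Pi.sub_apply, Pi.add_apply, Pi.smul_apply]
      rw [← sub_sub, quadForm_eq_re (g t) (x t - h t - c • p t), sesqForm_sub_left _ (x t - h t),
        sesqForm_sub_right _ _ (x t - h t), sesqForm_sub_right _ _ (x t - h t), h2]
      simp only [Complex.sub_re, Complex.conj_re]
      rw [← quadForm_eq_re, ← quadForm_eq_re, quadForm_smul, sesqForm_smul_right]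
      ring
    have i1 : Integrable (fun t => quadForm (g t) (x t - h t)) circ := heL.integrable_quadForm hg
    have i2 : Integrable (fun t => sesqForm (g t) (x t - h t) (p t)) circ :=
      integrable_sesqForm hg heL hpL
    have i3 : Integrable (fun t => (conj c * sesqForm (g t) (x t - h t) (p t)).re) circ :=
      (i2.const_mul _).re
    have i4 : ∫ t, (conj c * sesqForm (g t) (x t - h t) (p t)).re ∂circ = σ * ‖I‖ ^ 2 := by
      have : ∫ t, (conj c * sesqForm (g t) (x t - h t) (p t)).re ∂circ =
          (∫ t, conj c * sesqForm (g t) (x t - h t) (p t) ∂circ).re :=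
        integral_re (i2.const_mul _)
      rw [this, integral_const_mul, ← hI, hc, map_mul, Complex.conj_ofReal, mul_assoc,
        Complex.conj_mul']
      norm_cast
    have i5 : Integrable (fun t => quadForm (g t) (x t - h t) -
        2 * (conj c * sesqForm (g t) (x t - h t) (p t)).re) circ := i1.sub (i3.const_mul 2)
    rw [integral_congr_ae e, integral_add i5
      ((hpL.integrable_quadForm hg).const_mul _), integral_sub i1 (i3.const_mul 2),
      integral_const_mul, integral_const_mul, i4, ← hb, ← ha] at h1
    have : ‖c‖ ^ 2 = σ ^ 2 * ‖I‖ ^ 2 := by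
      rw [hc, norm_mul, mul_pow, Complex.norm_real, Real.norm_eq_abs, sq_abs]
    rw [this] at h1
    have h2 : ∫ t, quadForm (g t) ((x - h) t) ∂circ = a := rfl
    rw [h2] at h1
    linarith
  -- a small `σ` makes the linear term dominate unless `I = 0`
  have hb0 : 0 ≤ b := integral_quadForm_nonneg hg _
  have h1 := hvar (b + 1)⁻¹
  have h2 : (b + 1)⁻¹ * b ≤ 1 := by
    rw [inv_mul_le_iff₀ (by positivity)]; linarith
  have h3 : 0 < (b + 1)⁻¹ := by positivity
  have h4 : (b + 1)⁻¹ ^ 2 * ‖I‖ ^ 2 * b ≤ (b + 1)⁻¹ * ‖I‖ ^ 2 := by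
    calc (b + 1)⁻¹ ^ 2 * ‖I‖ ^ 2 * b = (b + 1)⁻¹ * ‖I‖ ^ 2 * ((b + 1)⁻¹ * b) := by ring
      _ ≤ (b + 1)⁻¹ * ‖I‖ ^ 2 * 1 := by gcongr
      _ = _ := mul_one _
  have h5 : (b + 1)⁻¹ * ‖I‖ ^ 2 ≤ 0 := by linarith
  have h6 : ‖I‖ ^ 2 ≤ 0 := by
    by_contra hcon
    push Not at hcon
    linarith [mul_pos h3 hcon]
  have h7 : ‖I‖ = 0 := by
    have : ‖I‖ ^ 2 = 0 := le_antisymm h6 (by positivity)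
    simpa using this
  simpa using h7

/-- The Pythagorean identity for a residual orthogonal to `S`. -/
lemma sqNorm_sub_eq_add (hg : IsSpectralDensity g) (hS : ∀ p ∈ S, InL2 g p)
    {e k : ℝ → Fin T → ℂ} (he : InL2 g e) (hk : InClosure g S k)
    (horth : ∀ p ∈ S, ∫ t, sesqForm (g t) (e t) (p t) ∂circ = 0) :
    sqNorm g (e - k) = sqNorm g e + sqNorm g k := by
  have hkL := hk.inL2 hg hS
  rw [sqNorm_eq_ofReal hg (he.sub hg hkL), sqNorm_eq_ofReal hg he, sqNorm_eq_ofReal hg hkL,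
    ← ENNReal.ofReal_add (integral_quadForm_nonneg hg _) (integral_quadForm_nonneg hg _)]
  congr 1
  have hz := hk.integral_sesqForm_eq_zero hg hS he horth
  have i2 := integrable_sesqForm hg he hkL
  have hz' : ∫ t, (sesqForm (g t) (e t) (k t)).re ∂circ = 0 := by
    have : ∫ t, (sesqForm (g t) (e t) (k t)).re ∂circ = (∫ t, sesqForm (g t) (e t) (k t) ∂circ).re :=
      integral_re i2
    rw [this, hz, Complex.zero_re]
  have hexp : ∀ᵐ t ∂circ, quadForm (g t) ((e - k) t) =
      (quadForm (g t) (e t) + quadForm (g t) (k t)) - 2 * (sesqForm (g t) (e t) (k t)).re := by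
    filter_upwards [hg.2] with t ht
    have h2 : sesqForm (g t) (k t) (e t) = conj (sesqForm (g t) (e t) (k t)) :=
      (sesqForm_conj ht.1 _ _).symm
    rw [Pi.sub_apply, quadForm_eq_re, sesqForm_sub_left, sesqForm_sub_right, sesqForm_sub_right, h2]
    simp only [Complex.sub_re, Complex.conj_re]
    rw [← quadForm_eq_re, ← quadForm_eq_re]
    ring
  have i3 : Integrable (fun t => quadForm (g t) (e t) + quadForm (g t) (k t)) circ :=
    (he.integrable_quadForm hg).add (hkL.integrable_quadForm hg)
  have i4 : Integrable (fun t => 2 * (sesqForm (g t) (e t) (k t)).re) circ := i2.re.const_mul 2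
  rw [integral_congr_ae hexp, integral_sub i3 i4,
    integral_add (he.integrable_quadForm hg) (hkL.integrable_quadForm hg), integral_const_mul,
    hz', mul_zero, sub_zero]

/-! ### Polynomials with negative frequencies and damping functions -/


variable {T : ℕ} {g : ℝ → Mat T}

/-- The trigonometric polynomials with vector coefficients and negative frequencies. -/
noncomputable def negSpan (T : ℕ) : Submodule ℂ (ℝ → Fin T → ℂ) :=
  Submodule.span ℂ (Set.range fun (jv : ℕ × (Fin T → ℂ)) (t : ℝ) =>
    expi (-((jv.1 : ℤ) + 1)) t • jv.2)

lemma expi_smul_mem_negSpan (j : ℕ) (v : Fin T → ℂ) :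
    (fun t => expi (-((j : ℤ) + 1)) t • v) ∈ negSpan T :=
  Submodule.subset_span ⟨(j, v), rfl⟩

lemma negSpan_bounded {p : ℝ → Fin T → ℂ} (hp : p ∈ negSpan T) :
    Measurable p ∧ ∃ K : ℝ, ∀ t i, ‖p t i‖ ≤ K := by
  induction hp using Submodule.span_induction with
  | mem x hx =>
    obtain ⟨⟨j, v⟩, rfl⟩ := hx
    refine ⟨((continuous_expi _).smul continuous_const).measurable, ∑ i, ‖v i‖, fun t i => ?_⟩
    simp only [Pi.smul_apply, smul_eq_mul, norm_mul, norm_expi, one_mul]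
    exact Finset.single_le_sum (f := fun i => ‖v i‖) (fun _ _ => norm_nonneg _) (Finset.mem_univ i)
  | zero => exact ⟨measurable_const, 0, fun t i => by simp⟩
  | add x y _ _ hx hy =>
    obtain ⟨hx1, K, hK⟩ := hx
    obtain ⟨hy1, K', hK'⟩ := hy
    exact ⟨hx1.add hy1, K + K', fun t i => (norm_add_le _ _).trans (add_le_add (hK t i) (hK' t i))⟩
  | smul a x _ hx =>
    obtain ⟨hx1, K, hK⟩ := hx
    refine ⟨hx1.const_smul a, ‖a‖ * K, fun t i => ?_⟩
    simp only [Pi.smul_apply, smul_eq_mul, norm_mul]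
    gcongr; exact hK t i

lemma InL2.of_bounded (hg : IsSpectralDensity g) {x : ℝ → Fin T → ℂ} (hx : AEMeasurable x circ)
    {K : ℝ} (hK : ∀ t i, ‖x t i‖ ≤ K) : InL2 g x := by
  refine ⟨hx, ?_⟩
  have hi : Integrable (fun t => (∑ i, ∑ j, ‖g t i j‖) * ∑ _p : Fin T, K ^ 2) circ :=
    (integrable_finsetSum _ fun i _ => integrable_finsetSum _ fun j _ =>
      (hg.1 i j).norm).mul_const _
  refine lt_of_le_of_lt (lintegral_mono fun t => ?_) hi.lintegral_lt_top
  refine ENNReal.ofReal_le_ofReal ((le_abs_self _).trans ((quadForm_le_sum_mul (x t)).trans ?_))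
  gcongr with p
  exact hK t p

lemma negSpan_inL2 (hg : IsSpectralDensity g) : ∀ p ∈ negSpan T, InL2 g p := fun _ hp => by
  obtain ⟨h1, K, hK⟩ := negSpan_bounded hp
  exact InL2.of_bounded hg h1.aemeasurable hK

/-- The minimality condition for a density: almost everywhere positive definite, with integrable
inverse. -/
def InvIntegrable (g : ℝ → Mat T) : Prop :=
  (∀ᵐ t ∂circ, (g t).PosDef) ∧ Integrable (fun t => ((g t)⁻¹).trace.re) circ

/-- The pointwise inequality `|x_p|² ≤ Tr g⁻¹ · xᵀ g x̄`, linearized with a parameter `δ`. -/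
lemma InvIntegrable.norm_le (hi : InvIntegrable g) (x : ℝ → Fin T → ℂ) {δ : ℝ} (hδ : 0 < δ)
    (p : Fin T) : ∀ᵐ t ∂circ, ‖x t p‖ ≤ δ * ((g t)⁻¹).trace.re + δ⁻¹ * quadForm (g t) (x t) := by
  filter_upwards [hi.1] with t ht
  have h1 := norm_sq_le_inv_mul_quadForm ht (x t) p
  have h2 := inv_diag_le_trace ht p
  have h3 := PosDef.inv_diag_re_nonneg ht p
  have h4 := quadForm_nonneg ht.posSemidef (x t)
  have h5 : ‖x t p‖ ^ 2 ≤ ((g t)⁻¹).trace.re * quadForm (g t) (x t) := h1.trans (by gcongr)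
  have h6 : 0 ≤ ((g t)⁻¹).trace.re := h3.trans h2
  apply le_of_sq_le_sq _ (by positivity)
  have : δ * δ⁻¹ = 1 := mul_inv_cancel₀ hδ.ne'
  nlinarith [sq_nonneg (δ * ((g t)⁻¹).trace.re - δ⁻¹ * quadForm (g t) (x t)), mul_nonneg h6 h4]

/-- Under the minimality condition, `L₂(g)` is contained in `L₁`. -/
lemma InvIntegrable.integrable (hi : InvIntegrable g) (hg : IsSpectralDensity g)
    {x : ℝ → Fin T → ℂ} (hx : InL2 g x) (p : Fin T) : Integrable (fun t => x t p) circ := by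
  refine Integrable.mono' ((hi.2.const_mul 1).add ((hx.integrable_quadForm hg).const_mul 1⁻¹))
    (aemeasurable_pi_iff.1 hx.1 p).aestronglyMeasurable (hi.norm_le x one_pos p)

lemma InvIntegrable.integral_norm_le (hi : InvIntegrable g) (hg : IsSpectralDensity g)
    {x : ℝ → Fin T → ℂ} (hx : InL2 g x) (p : Fin T) {δ : ℝ} (hδ : 0 < δ) :
    ∫ t, ‖x t p‖ ∂circ ≤ δ * ∫ t, ((g t)⁻¹).trace.re ∂circ + δ⁻¹ * ∫ t, quadForm (g t) (x t) ∂circ := by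
  have h1 := hi.2.const_mul δ
  have h2 := (hx.integrable_quadForm hg).const_mul δ⁻¹
  rw [← integral_const_mul, ← integral_const_mul, ← integral_add h1 h2]
  exact integral_mono_ae (hi.integrable hg hx p).norm (h1.add h2) (hi.norm_le x hδ p)

lemma negSpan_integrable {p : ℝ → Fin T → ℂ} (hp : p ∈ negSpan T) (i : Fin T) :
    Integrable (fun t => p t i) circ := by
  obtain ⟨h1, K, hK⟩ := negSpan_bounded hp
  exact Integrable.of_bound ((measurable_pi_iff.1 h1 i).aestronglyMeasurable) K
    (ae_of_all _ fun t => hK t i)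

lemma integral_expi_mul_negSpan {p : ℝ → Fin T → ℂ} (hp : p ∈ negSpan T) (i : Fin T) (k : ℕ) :
    ∫ t, expi (-(k : ℤ)) t * p t i ∂circ = 0 := by
  induction hp using Submodule.span_induction with
  | mem x hx =>
    obtain ⟨⟨j, v⟩, rfl⟩ := hx
    simp only [Pi.smul_apply, smul_eq_mul, ← mul_assoc, ← expi_add]
    rw [integral_mul_const, integral_expi, if_neg (by omega), zero_mul]
  | zero => simp
  | add x y hx' hy' hx hy =>
    simp only [Pi.add_apply, mul_add]
    rw [integral_add (integrable_expi_mul (negSpan_integrable hx' i) _)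
      (integrable_expi_mul (negSpan_integrable hy' i) _), hx, hy, add_zero]
  | smul a x _ hx =>
    simp only [Pi.smul_apply, smul_eq_mul, mul_left_comm _ a]
    rw [integral_const_mul, hx, mul_zero]

/-- Under the minimality condition, the closure of the polynomials with negative frequencies has
negative spectrum. -/
lemma InClosure.integral_expi_mul (hi : InvIntegrable g) (hg : IsSpectralDensity g)
    {h : ℝ → Fin T → ℂ} (hh : InClosure g (negSpan T) h) (i : Fin T) (k : ℕ) :
    ∫ t, expi (-(k : ℤ)) t * h t i ∂circ = 0 := by
  rw [← norm_le_zero_iff]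
  refine le_of_forall_pos_le_add fun ε hε => ?_
  set K := ∫ t, ((g t)⁻¹).trace.re ∂circ with hK
  have hK0 : 0 ≤ K := integral_nonneg_of_ae
    (hi.1.mono fun t ht => PosSemidef.trace_re_nonneg ht.inv.posSemidef)
  have hδ : 0 < ε / (2 * (K + 1)) := by positivity
  obtain ⟨p, hp, hlt⟩ := hh.exists_integral_lt hg (negSpan_inL2 hg)
    (ε := ε / (2 * (K + 1)) * (ε / 2)) (by positivity)
  have hd := (hh.inL2 hg (negSpan_inL2 hg)).sub hg (negSpan_inL2 hg p hp)
  have e : ∫ t, expi (-(k : ℤ)) t * h t i ∂circ = ∫ t, expi (-(k : ℤ)) t * (h - p) t i ∂circ := by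
    simp only [Pi.sub_apply, mul_sub]
    rw [integral_sub (integrable_expi_mul (hi.integrable hg (hh.inL2 hg (negSpan_inL2 hg)) i) _)
      (integrable_expi_mul (negSpan_integrable hp i) _), integral_expi_mul_negSpan hp, sub_zero]
  rw [e, zero_add]
  refine (norm_integral_le_integral_norm _).trans ?_
  simp only [norm_mul, norm_expi, one_mul]
  refine (hi.integral_norm_le hg hd i hδ).trans ?_
  have h3 : ε / (2 * (K + 1)) * K ≤ ε / 2 := by
    rw [div_mul_eq_mul_div, div_le_div_iff₀ (by positivity) two_pos]; nlinarith
  have h4 : (ε / (2 * (K + 1)))⁻¹ * ∫ t, quadForm (g t) ((h - p) t) ∂circ ≤ ε / 2 := by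
    calc _ ≤ (ε / (2 * (K + 1)))⁻¹ * (ε / (2 * (K + 1)) * (ε / 2)) := by
          gcongr; exact hlt.le
      _ = ε / 2 := inv_mul_cancel_left₀ hδ.ne' _
  linarith

/-- An integrable scalar function whose Fourier coefficients of positive index vanish. -/
def SpecNonpos (F : ℝ → ℂ) : Prop :=
  Integrable F circ ∧ ∀ k : ℕ, ∫ t, expi (-((k : ℤ) + 1)) t * F t ∂circ = 0

lemma SpecNonpos.sub {F G : ℝ → ℂ} (hF : SpecNonpos F) (hG : SpecNonpos G) :
    SpecNonpos (fun t => F t - G t) := by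
  refine ⟨hF.1.sub hG.1, fun k => ?_⟩
  simp only [mul_sub]
  rw [integral_sub (integrable_expi_mul hF.1 _) (integrable_expi_mul hG.1 _), hF.2, hG.2, sub_zero]

lemma SpecNonpos.negSpan_mul {F : ℝ → ℂ} (hF : SpecNonpos F) {p : ℝ → Fin T → ℂ}
    (hp : p ∈ negSpan T) (i : Fin T) : SpecNonpos (fun t => p t i * F t) := by
  have hint : ∀ {p : ℝ → Fin T → ℂ}, p ∈ negSpan T → Integrable (fun t => p t i * F t) circ := by
    intro p hp
    obtain ⟨h1, K, hK⟩ := negSpan_bounded hp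
    exact hF.1.bdd_mul (c := K) (measurable_pi_iff.1 h1 i).aestronglyMeasurable
      (ae_of_all _ fun t => hK t i)
  refine ⟨hint hp, fun k => ?_⟩
  induction hp using Submodule.span_induction with
  | mem x hx =>
    obtain ⟨⟨j, v⟩, rfl⟩ := hx
    have e : ∀ t, expi (-((k : ℤ) + 1)) t * ((expi (-((j : ℤ) + 1)) t • v) i * F t) =
        v i * (expi (-(((k + j + 1 : ℕ) : ℤ) + 1)) t * F t) := by
      intro t
      rw [show (-(((k + j + 1 : ℕ) : ℤ) + 1)) = -((k : ℤ) + 1) + -((j : ℤ) + 1) by push_cast; ring,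
        expi_add, Pi.smul_apply, smul_eq_mul]
      ring
    simp only [e]
    rw [integral_const_mul, hF.2, mul_zero]
  | zero => simp
  | add x y hx' hy' hx hy =>
    simp only [Pi.add_apply, add_mul, mul_add]
    rw [integral_add (integrable_expi_mul (hint hx') _) (integrable_expi_mul (hint hy') _), hx, hy,
      add_zero]
  | smul a x _ hx =>
    simp only [Pi.smul_apply, smul_eq_mul, mul_assoc, mul_left_comm _ a]
    rw [integral_const_mul, hx, mul_zero]

/-- A scalar weight as a `1 × 1` density. -/
noncomputable def scalarDensity (W : ℝ → ℝ) (t : ℝ) : Mat 1 := (W t : ℂ) • 1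

lemma sesqForm_scalarDensity (W : ℝ → ℝ) (t : ℝ) (x y : Fin 1 → ℂ) :
    sesqForm (scalarDensity W t) x y = W t * (x 0 * conj (y 0)) := by
  simp [sesqForm, scalarDensity, smul_mulVec, dotProduct]
  ring

lemma quadForm_scalarDensity (W : ℝ → ℝ) (t : ℝ) (x : Fin 1 → ℂ) :
    quadForm (scalarDensity W t) x = W t * ‖x 0‖ ^ 2 := by
  rw [quadForm_eq_re, sesqForm_scalarDensity, Complex.mul_conj, Complex.normSq_eq_norm_sq]
  norm_cast

lemma posDef_scalarDensity {W : ℝ → ℝ} {t : ℝ} (h : 0 < W t) : (scalarDensity W t).PosDef :=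
  PosDef.one.smul (by exact_mod_cast h)

lemma isSpectralDensity_scalarDensity {W : ℝ → ℝ} (hW : Integrable W circ) (h1 : ∀ t, 1 ≤ W t) :
    IsSpectralDensity (scalarDensity W) := by
  refine ⟨fun i j => ?_, ae_of_all _ fun t =>
    (posDef_scalarDensity (one_pos.trans_le (h1 t))).posSemidef⟩
  have : (fun t => scalarDensity W t i j) = fun t => (W t : ℂ) := by
    funext t
    rw [Subsingleton.elim i j]
    simp [scalarDensity]
  rw [this]; exact hW.ofReal

lemma invIntegrable_scalarDensity {W : ℝ → ℝ} (hW : Integrable W circ) (h1 : ∀ t, 1 ≤ W t) :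
    InvIntegrable (scalarDensity W) := by
  refine ⟨ae_of_all _ fun t => posDef_scalarDensity (one_pos.trans_le (h1 t)), ?_⟩
  have : (fun t => ((scalarDensity W t)⁻¹).trace.re) = fun t => (W t)⁻¹ := by
    funext t
    have hne : (W t : ℂ) ≠ 0 := by exact_mod_cast (one_pos.trans_le (h1 t)).ne'
    have : (scalarDensity W t)⁻¹ = ((W t)⁻¹ : ℂ) • 1 := by
      refine inv_eq_right_inv ?_
      rw [scalarDensity, smul_mul_smul_comm, mul_inv_cancel₀ hne, one_smul, one_mul]
    rw [this]
    simp [Matrix.trace, ← Complex.ofReal_inv]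
  rw [this]
  refine Integrable.of_bound hW.aemeasurable.inv.aestronglyMeasurable 1 (ae_of_all _ fun t => ?_)
  rw [Real.norm_of_nonneg (inv_nonneg.2 (zero_le_one.trans (h1 t)))]
  exact inv_le_one_of_one_le₀ (h1 t)

/-- Szegő's construction for a scalar weight `W ≥ 1`: the residual `q = 1 - h` of the projection of
`1` on the negative frequencies has `|q|² W` constant. It is close to `1` if `W` is, it is a limit
in `L₂(W)` of polynomials with nonpositive spectrum, and its square damps functions of size `W`. -/
theorem exists_damping {W : ℝ → ℝ} (hW : Integrable W circ) (h1 : ∀ t, 1 ≤ W t) :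
    ∃ (q : ℝ → ℂ) (c : ℝ), AEMeasurable q circ ∧ c ≤ ∫ t, W t ∂circ ∧
      (∀ᵐ t ∂circ, W t * ‖q t‖ ^ 2 = c) ∧
      Integrable (fun t => ‖q t - 1‖ ^ 2) circ ∧
      ∫ t, ‖q t - 1‖ ^ 2 ∂circ ≤ ∫ t, W t ∂circ - 1 ∧
      ∀ ε : ℝ, 0 < ε → ∃ p ∈ negSpan 1, Integrable (fun t => W t * ‖q t - (1 - p t 0)‖ ^ 2) circ ∧
        ∫ t, W t * ‖q t - (1 - p t 0)‖ ^ 2 ∂circ < ε := by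
  set g := scalarDensity W with hgd
  have hg : IsSpectralDensity g := isSpectralDensity_scalarDensity hW h1
  have hi : InvIntegrable g := invIntegrable_scalarDensity hW h1
  have hS := negSpan_inL2 hg
  have hone : InL2 g (fun _ _ => 1) :=
    InL2.of_bounded hg measurable_const.aemeasurable (K := 1) (by simp)
  obtain ⟨h, hcl, horth⟩ := exists_projection hg hi.1 hS hone
  have hhL := hcl.inL2 hg hS
  set e : ℝ → Fin 1 → ℂ := (fun _ _ => 1) - h with he
  have heL : InL2 g e := hone.sub hg hhL
  set q : ℝ → ℂ := fun t => e t 0 with hq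
  have hqe : ∀ t, q t = 1 - h t 0 := fun t => rfl
  have hWq : Integrable (fun t => W t * ‖q t‖ ^ 2) circ := by
    have := heL.integrable_quadForm hg
    simpa only [hgd, quadForm_scalarDensity] using this
  -- all Fourier coefficients of `W |q|²` of nonzero index vanish
  have horth' : ∀ k : ℕ, ∫ t, expi ((k : ℤ) + 1) t * ((W t * ‖q t‖ ^ 2 : ℝ) : ℂ) ∂circ = 0 := by
    intro k
    -- `e^{-i(k+1)t} q` is in the closed span of the negative frequencies
    have hcl2 : InClosure g (negSpan 1) (fun t => expi (-((k : ℤ) + 1)) t • e t) := by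
      refine ⟨((continuous_expi _).measurable.aemeasurable.smul heL.1), fun ε hε => ?_⟩
      obtain ⟨p, hp, hlt⟩ := hcl.2 ε hε
      refine ⟨fun t => expi (-((k : ℤ) + 1)) t • ((fun _ => 1) - p t), ?_, ?_⟩
      · have hmul : ∀ p ∈ negSpan 1, (fun t => expi (-((k : ℤ) + 1)) t • p t) ∈ negSpan 1 := by
          intro p hp
          induction hp using Submodule.span_induction with
          | mem x hx =>
            obtain ⟨⟨j, v⟩, rfl⟩ := hx
            have := expi_smul_mem_negSpan (k + j + 1) v
            convert this using 2 with t
            rw [show (-(((k + j + 1 : ℕ) : ℤ) + 1)) = -((k : ℤ) + 1) + -((j : ℤ) + 1) by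
              push_cast; ring, expi_add, mul_smul]
          | zero => simp only [Pi.zero_apply, smul_zero]; exact Submodule.zero_mem _
          | add x y _ _ hx hy =>
            simp only [Pi.add_apply, smul_add]; exact Submodule.add_mem _ hx hy
          | smul a x _ hx =>
            simp only [Pi.smul_apply, smul_comm _ a]; exact Submodule.smul_mem _ a hx
        simp only [smul_sub]
        exact Submodule.sub_mem _ (expi_smul_mem_negSpan k _) (hmul p hp)
      · refine lt_of_eq_of_lt (sqNorm_congr (ae_of_all _ fun t => ?_)) hlt
        have : expi (-((k : ℤ) + 1)) t • e t - expi (-((k : ℤ) + 1)) t • ((fun _ => 1) - p t) =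
            (-expi (-((k : ℤ) + 1)) t) • (h - p) t := by
          ext i
          simp only [he, Pi.sub_apply, Pi.smul_apply, smul_eq_mul]
          ring
        change quadForm (g t) (expi (-((k : ℤ) + 1)) t • e t -
          expi (-((k : ℤ) + 1)) t • ((fun _ => 1) - p t)) = _
        rw [this, quadForm_smul, norm_neg, norm_expi]
        ring
    have h0 := hcl2.integral_sesqForm_eq_zero hg hS heL horth
    rw [← h0]
    refine integral_congr_ae (ae_of_all _ fun t => ?_)
    simp only [hgd, sesqForm_scalarDensity, Pi.smul_apply, smul_eq_mul, map_mul, conj_expi, neg_neg]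
    rw [mul_left_comm (e t 0), Complex.mul_conj, Complex.normSq_eq_norm_sq]
    push_cast
    simp only [hq]
    ring
  set c := ∫ t, W t * ‖q t‖ ^ 2 ∂circ with hc
  have hconst : ∀ᵐ t ∂circ, W t * ‖q t‖ ^ 2 = c := by
    have hz : (fun t => ((W t * ‖q t‖ ^ 2 - c : ℝ) : ℂ)) =ᵐ[circ] 0 := by
      refine ae_eq_zero_of_fourier (hWq.sub (integrable_const c)).ofReal fun n => ?_
      have hsub : ∀ t, expi n t * ((W t * ‖q t‖ ^ 2 - c : ℝ) : ℂ) =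
          expi n t * ((W t * ‖q t‖ ^ 2 : ℝ) : ℂ) - expi n t * (c : ℂ) := by
        intro t; push_cast; ring
      have i1 : Integrable (fun t => expi n t * ((W t * ‖q t‖ ^ 2 : ℝ) : ℂ)) circ :=
        integrable_expi_mul hWq.ofReal n
      have i2 : Integrable (fun t => expi n t * (c : ℂ)) circ := (integrable_expi n).mul_const _
      simp only [hsub]
      rw [integral_sub i1 i2, integral_mul_const, integral_expi]
      rcases lt_trichotomy n 0 with hn | hn | hn
      · obtain ⟨k, rfl⟩ : ∃ k : ℕ, n = -((k : ℤ) + 1) := ⟨(-n - 1).toNat, by omega⟩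
        have h2 := congrArg conj (horth' k)
        rw [← integral_conj] at h2
        simp only [map_mul, conj_expi, Complex.conj_ofReal, map_zero] at h2
        rw [h2, if_neg (by omega)]; simp
      · subst hn
        simp only [expi_zero, one_mul, if_true]
        rw [show ∫ t, ((W t * ‖q t‖ ^ 2 : ℝ) : ℂ) ∂circ = (c : ℂ) from integral_ofReal, sub_self]
      · obtain ⟨k, rfl⟩ : ∃ k : ℕ, n = (k : ℤ) + 1 := ⟨(n - 1).toNat, by omega⟩
        rw [horth' k, if_neg (by omega)]; simp
    filter_upwards [hz] with t ht
    exact sub_eq_zero.1 (Complex.ofReal_eq_zero.1 ht)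
  have hqm : AEMeasurable q circ := aemeasurable_pi_iff.1 heL.1 0
  have hq2 : Integrable (fun t => ‖q t‖ ^ 2) circ := by
    refine Integrable.mono' hWq (hqm.norm.pow_const 2).aestronglyMeasurable
      (ae_of_all _ fun t => ?_)
    rw [Real.norm_of_nonneg (by positivity)]
    nlinarith [h1 t, sq_nonneg ‖q t‖]
  have hqi : Integrable q circ := hi.integrable hg heL 0
  -- `q` has mean `1`, whence `∫ |q - 1|² = ∫ |q|² - 1 ≤ c - 1`
  have hmean : ∫ t, q t ∂circ = 1 := by
    have h2 := hcl.integral_expi_mul hi hg 0 0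
    simp only [Nat.cast_zero, neg_zero, expi_zero, one_mul] at h2
    simp only [hqe]
    rw [integral_sub (integrable_const 1) (hi.integrable hg hhL 0), h2]
    simp
  have hexp : ∀ t, ‖q t - 1‖ ^ 2 = ‖q t‖ ^ 2 - 2 * (q t).re + 1 := by
    intro t
    rw [← Complex.normSq_eq_norm_sq, ← Complex.normSq_eq_norm_sq, Complex.normSq_sub]
    simp; ring
  have hqre : Integrable (fun t => 2 * (q t).re) circ := hqi.re.const_mul 2
  have hd1 : Integrable (fun t => ‖q t‖ ^ 2 - 2 * (q t).re) circ := hq2.sub hqre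
  have hcle : c ≤ ∫ t, W t ∂circ := by
    have h2 := sqNorm_sub_eq_add hg hS heL (k := -h) ?_ horth
    · have h3 : sqNorm g e ≤ sqNorm g (fun _ _ => 1) := by
        rw [he, sub_neg_eq_add, sub_add_cancel] at h2
        rw [h2]; exact le_self_add
      rw [sqNorm_eq_ofReal hg heL, sqNorm_eq_ofReal hg hone,
        ENNReal.ofReal_le_ofReal_iff (integral_quadForm_nonneg hg _)] at h3
      simpa [hgd, quadForm_scalarDensity] using h3
    · refine ⟨hcl.1.neg, fun ε hε => ?_⟩
      obtain ⟨p, hp, hlt⟩ := hcl.2 ε hε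
      refine ⟨-p, Submodule.neg_mem _ hp, ?_⟩
      rwa [neg_sub_neg, sqNorm_sub_comm]
  refine ⟨q, c, hqm, hcle, hconst, ?_, ?_, ?_⟩
  · simp only [hexp]; exact hd1.add (integrable_const 1)
  · simp only [hexp]
    rw [integral_add hd1 (integrable_const 1), integral_sub hq2 hqre, integral_const_mul]
    have h2 : ∫ t, (q t).re ∂circ = 1 := by
      have : ∫ t, (q t).re ∂circ = (∫ t, q t ∂circ).re := integral_re hqi
      rw [this, hmean, Complex.one_re]
    have h3 : ∫ t, ‖q t‖ ^ 2 ∂circ ≤ c := integral_mono hq2 hWq fun t => by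
      simp only; nlinarith [h1 t, sq_nonneg ‖q t‖]
    rw [h2]
    simp
    linarith
  · intro ε hε
    obtain ⟨p, hp, hlt⟩ := hcl.exists_integral_lt hg hS hε
    have hdL := hhL.sub hg (hS p hp)
    have e1 : ∀ t, quadForm (g t) (h t - p t) = W t * ‖q t - (1 - p t 0)‖ ^ 2 := by
      intro t
      rw [hgd, quadForm_scalarDensity, hqe, Pi.sub_apply, ← norm_neg]
      congr 3; ring
    refine ⟨p, hp, ?_, ?_⟩
    · simp only [← e1]; exact hdL.integrable_quadForm hg
    · simp only [← e1]; exact hlt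

/-- For bounded functions `X`, `Y` with nonpositive spectra the product `e^{-it} X Y` has mean zero:
`e^{-it} X` is a mean square limit of polynomials with negative frequencies. -/
lemma integral_mul_eq_zero_of_bounded {X Y : ℝ → ℂ} (hX : SpecNonpos X) (hY : SpecNonpos Y)
    {K : ℝ} (hXb : ∀ᵐ t ∂circ, ‖X t‖ ≤ K) (hYb : ∀ᵐ t ∂circ, ‖Y t‖ ≤ K) :
    ∫ t, expi (-1) t * (X t * Y t) ∂circ = 0 := by
  have hW : Integrable (fun _ : ℝ => (1 : ℝ)) circ := integrable_const 1
  set g := scalarDensity (fun _ => 1) with hgd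
  have hg : IsSpectralDensity g := isSpectralDensity_scalarDensity hW fun _ => le_rfl
  have hi : InvIntegrable g := invIntegrable_scalarDensity hW fun _ => le_rfl
  have hS := negSpan_inL2 hg
  set x : ℝ → Fin 1 → ℂ := fun t _ => expi (-1) t * X t with hx
  have hxm : AEMeasurable x circ := aemeasurable_pi_iff.2 fun _ =>
    (continuous_expi _).measurable.aemeasurable.mul hX.1.aemeasurable
  have hxL : InL2 g x := by
    refine ⟨hxm, ?_⟩
    refine lt_of_le_of_lt (lintegral_mono_ae (g := fun _ => ENNReal.ofReal (K ^ 2)) ?_) (by simp)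
    filter_upwards [hXb] with t ht
    refine ENNReal.ofReal_le_ofReal ?_
    have := quadForm_scalarDensity (fun _ => 1) t (x t)
    rw [quadForm] at this
    rw [hgd, this]
    simp only [hx, norm_mul, norm_expi, one_mul]
    gcongr
  obtain ⟨h, hcl, horth⟩ := exists_projection hg hi.1 hS hxL
  have hdL := hxL.sub hg (hcl.inL2 hg hS)
  have hdi := hi.integrable hg hdL 0
  -- the residual of the projection has no spectrum
  have hzero : (fun t => (x - h) t 0) =ᵐ[circ] 0 := by
    refine ae_eq_zero_of_fourier hdi fun n => ?_
    rcases le_or_gt n 0 with hn | hn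
    · obtain ⟨k, rfl⟩ : ∃ k : ℕ, n = -(k : ℤ) := ⟨(-n).toNat, by omega⟩
      simp only [Pi.sub_apply, mul_sub]
      rw [integral_sub (integrable_expi_mul (hi.integrable hg hxL 0) _)
        (integrable_expi_mul (hi.integrable hg (hcl.inL2 hg hS) 0) _),
        hcl.integral_expi_mul hi hg, sub_zero, ← hX.2 k]
      refine integral_congr_ae (ae_of_all _ fun t => ?_)
      simp only [hx]
      rw [← mul_assoc, ← expi_add, neg_add]
    · obtain ⟨k, rfl⟩ : ∃ k : ℕ, n = (k : ℤ) + 1 := ⟨(n - 1).toNat, by omega⟩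
      rw [← horth _ (expi_smul_mem_negSpan k fun _ => 1)]
      refine integral_congr_ae (ae_of_all _ fun t => ?_)
      simp only [hgd, sesqForm_scalarDensity, Pi.smul_apply, smul_eq_mul, mul_one, conj_expi,
        neg_neg, Complex.ofReal_one, one_mul, Pi.sub_apply]
      ring
  -- the claim for polynomials in place of `e^{-it} X` is immediate
  have hp0 : ∀ p ∈ negSpan 1, ∫ t, p t 0 * Y t ∂circ = 0 := by
    intro p hp
    induction hp using Submodule.span_induction with
    | mem x hx =>
      obtain ⟨⟨j, v⟩, rfl⟩ := hx
      simp only [Pi.smul_apply, smul_eq_mul, mul_comm _ (v 0), mul_assoc]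
      rw [integral_const_mul, hY.2, mul_zero]
    | zero => simp
    | add x y hx' hy' hx hy =>
      simp only [Pi.add_apply, add_mul]
      rw [integral_add (hY.negSpan_mul hx' 0).1 (hY.negSpan_mul hy' 0).1, hx, hy, add_zero]
    | smul a x _ hx =>
      simp only [Pi.smul_apply, smul_eq_mul, mul_assoc]
      rw [integral_const_mul, hx, mul_zero]
  have hhY : Integrable (fun t => h t 0 * Y t) circ :=
    (hi.integrable hg (hcl.inL2 hg hS) 0).mul_bdd (c := K) hY.1.aestronglyMeasurable hYb
  have e : ∫ t, expi (-1) t * (X t * Y t) ∂circ = ∫ t, h t 0 * Y t ∂circ := by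
    refine integral_congr_ae ?_
    filter_upwards [hzero] with t ht
    have : x t 0 = h t 0 := sub_eq_zero.1 ht
    rw [← this, ← mul_assoc]
  rw [e, ← norm_le_zero_iff]
  obtain ⟨t₀, ht₀⟩ := hYb.exists
  have hK0 : 0 ≤ K := (norm_nonneg _).trans ht₀
  refine le_of_forall_pos_le_add fun ε hε => ?_
  set J := ∫ t, ((g t)⁻¹).trace.re ∂circ with hJ
  have hJ0 : 0 ≤ J := integral_nonneg_of_ae
    (hi.1.mono fun t ht => PosSemidef.trace_re_nonneg ht.inv.posSemidef)
  obtain ⟨η, hη, hηε⟩ : ∃ η : ℝ, 0 < η ∧ η * ((J + 1) * (K + 1)) ≤ ε :=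
    ⟨ε / ((J + 1) * (K + 1)), by positivity, by rw [div_mul_cancel₀]; positivity⟩
  obtain ⟨p, hp, hlt⟩ := hcl.exists_integral_lt hg hS (ε := η * η) (by positivity)
  have hdp := (hcl.inL2 hg hS).sub hg (hS p hp)
  have e2 : ∫ t, h t 0 * Y t ∂circ = ∫ t, (h - p) t 0 * Y t ∂circ := by
    simp only [Pi.sub_apply, sub_mul]
    rw [integral_sub hhY (hY.negSpan_mul hp 0).1, hp0 p hp, sub_zero]
  rw [e2, zero_add]
  have hdpi := hi.integrable hg hdp 0
  calc ‖∫ t, (h - p) t 0 * Y t ∂circ‖ ≤ ∫ t, ‖(h - p) t 0‖ * K ∂circ := by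
        refine norm_integral_le_of_norm_le (hdpi.norm.mul_const K) ?_
        filter_upwards [hYb] with t ht
        rw [norm_mul]; gcongr
    _ = (∫ t, ‖(h - p) t 0‖ ∂circ) * K := integral_mul_const _ _
    _ ≤ (η * J + η⁻¹ * (η * η)) * K := by
        gcongr
        refine (hi.integral_norm_le hg hdp 0 hη).trans ?_
        gcongr
        exact hlt.le
    _ = η * ((J + 1) * K) := by field_simp
    _ ≤ η * ((J + 1) * (K + 1)) := by gcongr; linarith
    _ ≤ ε := hηε

/-! ### Smirnov's maximum principle and the closed span of the negative frequencies -/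


variable {T : ℕ} {g : ℝ → Mat T}

/-- Multiplication by the square of a damping function preserves nonpositive spectra and makes
functions of the size of the weight bounded. -/
lemma SpecNonpos.damping {F : ℝ → ℂ} (hF : SpecNonpos F) {W : ℝ → ℝ} (h1 : ∀ t, 1 ≤ W t)
    {q : ℝ → ℂ} {c : ℝ} (hqm : AEMeasurable q circ) (hconst : ∀ᵐ t ∂circ, W t * ‖q t‖ ^ 2 = c)
    (happ : ∀ ε : ℝ, 0 < ε → ∃ p ∈ negSpan 1,
      Integrable (fun t => W t * ‖q t - (1 - p t 0)‖ ^ 2) circ ∧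
        ∫ t, W t * ‖q t - (1 - p t 0)‖ ^ 2 ∂circ < ε)
    {K : ℝ} (hK : ∀ᵐ t ∂circ, ‖F t‖ ≤ K * W t) :
    SpecNonpos (fun t => q t ^ 2 * F t) ∧ ∀ᵐ t ∂circ, ‖q t ^ 2 * F t‖ ≤ K * c := by
  have hb : ∀ᵐ t ∂circ, ‖q t ^ 2 * F t‖ ≤ K * c := by
    filter_upwards [hK, hconst] with t ht hc
    rw [norm_mul, norm_pow, ← hc]
    calc ‖q t‖ ^ 2 * ‖F t‖ ≤ ‖q t‖ ^ 2 * (K * W t) := by gcongr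
      _ = _ := by ring
  have hint : Integrable (fun t => q t ^ 2 * F t) circ :=
    Integrable.of_bound ((hqm.pow_const 2).mul hF.1.aemeasurable).aestronglyMeasurable _ hb
  refine ⟨⟨hint, fun k => ?_⟩, hb⟩
  obtain ⟨t₀, ht₀⟩ := (hK.and hconst).exists
  have hK0 : 0 ≤ K := by
    by_contra hcon
    have := (norm_nonneg _).trans ht₀.1
    nlinarith [h1 t₀]
  have hc0 : 0 ≤ c := by
    rw [← ht₀.2]; have := h1 t₀; positivity
  rw [← norm_le_zero_iff]
  refine le_of_forall_pos_le_add fun ε hε => ?_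
  obtain ⟨η, hη, hη'⟩ : ∃ η : ℝ, 0 < η ∧ K * (η * c) ≤ ε / 2 := by
    refine ⟨ε / (2 * ((K + 1) * (c + 1))), by positivity, ?_⟩
    rw [div_mul_eq_mul_div, mul_div_assoc', div_le_div_iff₀ (by positivity) two_pos]
    nlinarith [mul_nonneg hK0 hc0, mul_nonneg hε.le hK0, mul_nonneg hε.le hc0]
  obtain ⟨ζ, hζ, hζ'⟩ : ∃ ζ : ℝ, 0 < ζ ∧ K * ((η⁻¹ + 1) * ζ) ≤ ε / 2 := by
    refine ⟨ε / (2 * ((K + 1) * (η⁻¹ + 1))), by positivity, ?_⟩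
    rw [mul_div_assoc', mul_div_assoc', div_le_div_iff₀ (by positivity) two_pos]
    have : 0 < η⁻¹ := by positivity
    nlinarith [mul_pos hε this, mul_nonneg hε.le hK0]
  obtain ⟨p, hp, hpi, hlt⟩ := happ ζ hζ
  -- replace `q` by the polynomial `1 - p`
  have hu1 : SpecNonpos (fun t => F t - p t 0 * F t) := hF.sub (hF.negSpan_mul hp 0)
  have hu2 := hu1.sub (hu1.negSpan_mul hp 0)
  have e : ∫ t, expi (-((k : ℤ) + 1)) t * (q t ^ 2 * F t) ∂circ =
      ∫ t, expi (-((k : ℤ) + 1)) t * (q t ^ 2 * F t) - expi (-((k : ℤ) + 1)) t *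
        ((F t - p t 0 * F t) - p t 0 * (F t - p t 0 * F t)) ∂circ := by
    rw [integral_sub (integrable_expi_mul hint _) (integrable_expi_mul hu2.1 _), hu2.2, sub_zero]
  have hq2 : Integrable (fun t => W t * ‖q t‖ ^ 2) circ :=
    (integrable_const c).congr (hconst.mono fun t ht => ht.symm)
  have hI : ∫ t, W t * ‖q t‖ ^ 2 ∂circ = c := by
    rw [integral_congr_ae hconst]; simp
  have hbd : Integrable (fun t => K * (η * (W t * ‖q t‖ ^ 2) +
      (η⁻¹ + 1) * (W t * ‖q t - (1 - p t 0)‖ ^ 2))) circ :=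
    ((hq2.const_mul η).add (hpi.const_mul (η⁻¹ + 1))).const_mul K
  rw [e, zero_add]
  refine (norm_integral_le_of_norm_le hbd ?_).trans ?_
  · filter_upwards [hK] with t ht
    set d := q t - (1 - p t 0) with hd
    have e2 : expi (-((k : ℤ) + 1)) t * (q t ^ 2 * F t) - expi (-((k : ℤ) + 1)) t *
        ((F t - p t 0 * F t) - p t 0 * (F t - p t 0 * F t)) =
        expi (-((k : ℤ) + 1)) t * ((d * (2 * q t - d)) * F t) := by
      rw [hd]; ring
    rw [e2, norm_mul, norm_expi, one_mul, norm_mul, norm_mul]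
    have h3 : ‖2 * q t - d‖ ≤ 2 * ‖q t‖ + ‖d‖ := by
      refine (norm_sub_le _ _).trans ?_
      rw [norm_mul]; simp
    have h4 : 2 * (‖d‖ * ‖q t‖) ≤ η * ‖q t‖ ^ 2 + η⁻¹ * ‖d‖ ^ 2 := by
      have : η * η⁻¹ = 1 := mul_inv_cancel₀ hη.ne'
      have h5 : η * (‖q t‖ - η⁻¹ * ‖d‖) ^ 2 =
          η * ‖q t‖ ^ 2 - 2 * (η * η⁻¹) * (‖d‖ * ‖q t‖) + (η * η⁻¹) * η⁻¹ * ‖d‖ ^ 2 := by ring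
      rw [this] at h5
      have h6 : 0 ≤ η * (‖q t‖ - η⁻¹ * ‖d‖) ^ 2 := by positivity
      linarith
    have hWt : 0 ≤ W t := zero_le_one.trans (h1 t)
    calc ‖d‖ * ‖2 * q t - d‖ * ‖F t‖ ≤ ‖d‖ * (2 * ‖q t‖ + ‖d‖) * (K * W t) := by gcongr
      _ = K * (W t * (2 * (‖d‖ * ‖q t‖) + ‖d‖ ^ 2)) := by ring
      _ ≤ K * (W t * ((η * ‖q t‖ ^ 2 + η⁻¹ * ‖d‖ ^ 2) + ‖d‖ ^ 2)) := by gcongr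
      _ = _ := by ring
  · rw [integral_const_mul, integral_add (hq2.const_mul η) (hpi.const_mul _), integral_const_mul,
      integral_const_mul, hI]
    calc K * (η * c + (η⁻¹ + 1) * ∫ t, W t * ‖q t - (1 - p t 0)‖ ^ 2 ∂circ)
        ≤ K * (η * c + (η⁻¹ + 1) * ζ) := by gcongr
      _ = K * (η * c) + K * ((η⁻¹ + 1) * ζ) := by ring
      _ ≤ ε := by linarith

/-- The product of an integrable function with negative spectrum and the conjugate of an integrable
function with nonnegative spectrum has mean zero as soon as it is integrable (a form of Smirnov's
maximum principle). Both factors are made bounded by a damping function. -/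
theorem integral_dotProduct_star_eq_zero {e C : ℝ → Fin T → ℂ}
    (he : ∀ p, Integrable (fun t => e t p) circ)
    (heS : ∀ p (k : ℕ), ∫ t, expi (-(k : ℤ)) t * e t p ∂circ = 0)
    (hC : ∀ p, Integrable (fun t => C t p) circ)
    (hCS : ∀ p (k : ℕ), ∫ t, expi ((k : ℤ) + 1) t * C t p ∂circ = 0)
    (hint : Integrable (fun t => e t ⬝ᵥ star (C t)) circ) :
    ∫ t, e t ⬝ᵥ star (C t) ∂circ = 0 := by
  set ω : ℝ → ℝ := fun t => ∑ p, (‖e t p‖ + ‖C t p‖) with hω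
  have hωi : Integrable ω circ := integrable_finsetSum _ fun p _ => (he p).norm.add (hC p).norm
  have hω0 : ∀ t, 0 ≤ ω t := fun t => Finset.sum_nonneg fun p _ => by positivity
  -- the factor `e^{it}` moves the negative spectrum of `e` to the nonpositive indices
  have hFs : ∀ p, SpecNonpos (fun t => expi 1 t * e t p) := fun p => by
    refine ⟨integrable_expi_mul (he p) _, fun k => ?_⟩
    rw [← heS p k]
    refine integral_congr_ae (ae_of_all _ fun t => ?_)
    simp only
    rw [← mul_assoc, ← expi_add]
    congr 2; ring
  have hGs : ∀ p, SpecNonpos (fun t => conj (C t p)) := fun p => by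
    refine ⟨(Complex.conjCLE : ℂ →L[ℝ] ℂ).integrable_comp (hC p), fun k => ?_⟩
    have := congrArg conj (hCS p k)
    rw [← integral_conj] at this
    simpa only [map_mul, conj_expi, map_zero] using this
  have hle : ∀ t p, ‖e t p‖ + ‖C t p‖ ≤ ω t := fun t p =>
    Finset.single_le_sum (f := fun p => ‖e t p‖ + ‖C t p‖) (fun _ _ => by positivity)
      (Finset.mem_univ p)
  -- the weights tend to `1`, and `e`, `C` are bounded by a multiple of each of them
  set W : ℕ → ℝ → ℝ := fun n t => 1 + (1 / 2) ^ n * ω t with hWd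
  have hW1 : ∀ n t, 1 ≤ W n t := fun n t => by
    have := hω0 t
    simp only [hWd, le_add_iff_nonneg_right]; positivity
  have hWi : ∀ n, Integrable (W n) circ := fun n => (integrable_const 1).add (hωi.const_mul _)
  have hWint : ∀ n, ∫ t, W n t ∂circ = 1 + (1 / 2) ^ n * ∫ t, ω t ∂circ := fun n => by
    simp only [hWd]
    rw [integral_add (integrable_const 1) (hωi.const_mul _), integral_const_mul]; simp
  have hΩ : 0 ≤ ∫ t, ω t ∂circ := integral_nonneg hω0
  choose q c hqm hcle hconst hqi hq1 happ using fun n => exists_damping (hWi n) (hW1 n)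
  have hcK : ∀ n, c n ≤ 1 + ∫ t, ω t ∂circ := fun n => by
    refine (hcle n).trans ?_
    rw [hWint n]
    have : ((1 : ℝ) / 2) ^ n ≤ 1 := pow_le_one₀ (by norm_num) (by norm_num)
    nlinarith
  -- `q n ⁴ e · C̄` has mean zero for every `n`
  have hzero : ∀ n, ∫ t, q n t ^ 4 * (e t ⬝ᵥ star (C t)) ∂circ = 0 := by
    intro n
    have hbF : ∀ p, ∀ᵐ t ∂circ, ‖expi 1 t * e t p‖ ≤ 2 ^ n * W n t := fun p =>
      ae_of_all _ fun t => by
        rw [norm_mul, norm_expi, one_mul]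
        have h1 := hle t p
        have h2 : (2 : ℝ) ^ n * W n t = 2 ^ n + ω t := by
          simp only [hWd, mul_add, mul_one, ← mul_assoc, ← mul_pow]; norm_num
        rw [h2]; have := norm_nonneg (C t p); have : (0 : ℝ) < 2 ^ n := by positivity
        linarith
    have hbG : ∀ p, ∀ᵐ t ∂circ, ‖conj (C t p)‖ ≤ 2 ^ n * W n t := fun p =>
      ae_of_all _ fun t => by
        rw [RCLike.norm_conj]
        have h1 := hle t p
        have h2 : (2 : ℝ) ^ n * W n t = 2 ^ n + ω t := by
          simp only [hWd, mul_add, mul_one, ← mul_assoc, ← mul_pow]; norm_num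
        rw [h2]; have := norm_nonneg (e t p); have : (0 : ℝ) < 2 ^ n := by positivity
        linarith
    have hX := fun p => (hFs p).damping (hW1 n) (hqm n) (hconst n) (happ n) (hbF p)
    have hY := fun p => (hGs p).damping (hW1 n) (hqm n) (hconst n) (happ n) (hbG p)
    have h0 := fun p => integral_mul_eq_zero_of_bounded (hX p).1 (hY p).1 (hX p).2 (hY p).2
    have hi : ∀ p, Integrable (fun t => expi (-1) t *
        (q n t ^ 2 * (expi 1 t * e t p) * (q n t ^ 2 * conj (C t p)))) circ := fun p =>
      integrable_expi_mul ((hX p).1.1.mul_bdd (hY p).1.1.aestronglyMeasurable (hY p).2) _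
    rw [← Finset.sum_const_zero (s := (Finset.univ : Finset (Fin T))),
      ← Finset.sum_congr rfl fun p _ => h0 p, ← integral_finsetSum _ fun p _ => hi p]
    refine integral_congr_ae (ae_of_all _ fun t => ?_)
    simp only [dotProduct, Finset.mul_sum, Pi.star_apply, RCLike.star_def]
    refine Finset.sum_congr rfl fun p _ => ?_
    have h1 : expi (-1) t * expi 1 t = 1 := by rw [← expi_add]; simp
    linear_combination (-(q n t ^ 4 * e t p * conj (C t p))) * h1
  -- the damping functions tend to `1`
  have hlim : ∀ᵐ t ∂circ, Tendsto (fun n => q n t) atTop (𝓝 1) := by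
    have h1 : ∀ᵐ t ∂circ, Tendsto (fun n => ENNReal.ofReal (‖q n t - 1‖ ^ 2)) atTop (𝓝 0) := by
      refine ae_tendsto_zero_of_tsum_lintegral
        (fun n => (((hqm n).sub_const 1).norm.pow_const 2).ennreal_ofReal) ?_
      have h2 : ∀ n, ∫⁻ t, ENNReal.ofReal (‖q n t - 1‖ ^ 2) ∂circ ≤
          ENNReal.ofReal ((1 / 2) ^ n * ∫ t, ω t ∂circ) := fun n => by
        rw [← ofReal_integral_eq_lintegral_ofReal (hqi n) (ae_of_all _ fun t => by positivity)]
        refine ENNReal.ofReal_le_ofReal ((hq1 n).trans ?_)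
        rw [hWint n]; linarith
      refine ne_top_of_le_ne_top ?_ (ENNReal.tsum_le_tsum h2)
      rw [← ENNReal.ofReal_tsum_of_nonneg (fun n => by positivity)
        (summable_geometric_two.mul_right _)]
      exact ENNReal.ofReal_ne_top
    filter_upwards [h1] with t ht
    rw [tendsto_iff_norm_sub_tendsto_zero]
    have h2 := (ENNReal.tendsto_toReal ENNReal.zero_ne_top).comp ht
    have h3 : Tendsto (fun n => ‖q n t - 1‖ ^ 2) atTop (𝓝 0) := by
      refine h2.congr fun n => ?_
      simp
    have h4 := (Real.continuous_sqrt.tendsto 0).comp h3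
    rw [Real.sqrt_zero] at h4
    refine h4.congr fun n => ?_
    simp [Real.sqrt_sq (norm_nonneg _)]
  have hbound : ∀ n, ∀ᵐ t ∂circ, ‖q n t ^ 4 * (e t ⬝ᵥ star (C t))‖ ≤
      (1 + ∫ t, ω t ∂circ) ^ 2 * ‖e t ⬝ᵥ star (C t)‖ := by
    intro n
    filter_upwards [hconst n] with t ht
    rw [norm_mul, norm_pow, show ‖q n t‖ ^ 4 = (‖q n t‖ ^ 2) ^ 2 by ring]
    have : ‖q n t‖ ^ 2 ≤ c n := by
      rw [← ht]; nlinarith [hW1 n t, sq_nonneg ‖q n t‖]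
    gcongr
    exact this.trans (hcK n)
  have hconv := tendsto_integral_of_dominated_convergence
    (F := fun n t => q n t ^ 4 * (e t ⬝ᵥ star (C t))) (f := fun t => e t ⬝ᵥ star (C t))
    (fun t => (1 + ∫ t, ω t ∂circ) ^ 2 * ‖e t ⬝ᵥ star (C t)‖)
    (fun n => (((hqm n).pow_const 4).mul hint.aemeasurable).aestronglyMeasurable)
    (hint.norm.const_mul _) hbound
    (hlim.mono fun t ht => by simpa using (ht.pow 4).mul_const (e t ⬝ᵥ star (C t)))
  simp only [hzero] at hconv
  exact tendsto_nhds_unique hconv tendsto_const_nhds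

lemma dotProduct_star_eq_sesqForm {A : Mat T} (hA : A.IsHermitian) (x y : Fin T → ℂ) :
    x ⬝ᵥ star (Aᵀ *ᵥ y) = sesqForm A x y := by
  rw [sesqForm, star_mulVec]
  congr 1
  rw [show (Aᵀ)ᴴ = Aᵀ from hA.transpose.eq, vecMul_transpose]

lemma integral_sesqForm_expi {x : ℝ → Fin T → ℂ} (j : ℕ) (p : Fin T) :
    ∫ t, sesqForm (g t) (x t) (expi (-((j : ℤ) + 1)) t • Pi.single p 1) ∂circ =
      ∫ t, expi ((j : ℤ) + 1) t * ((g t)ᵀ *ᵥ x t) p ∂circ := by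
  refine integral_congr_ae (ae_of_all _ fun t => ?_)
  have : star (Pi.single p (1 : ℂ) : Fin T → ℂ) = Pi.single p 1 := by
    ext k; by_cases hk : k = p <;> simp [hk]
  simp only
  rw [sesqForm_smul_right, conj_expi, neg_neg, sesqForm, this]
  congr 1
  rw [mulVec_single_one, mulVec_transpose]
  rfl

lemma integrable_transpose_mulVec (hg : IsSpectralDensity g) {x : ℝ → Fin T → ℂ} (hx : InL2 g x)
    (p : Fin T) : Integrable (fun t => ((g t)ᵀ *ᵥ x t) p) circ := by
  have hs : InL2 g (fun _ => Pi.single p 1) := by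
    refine InL2.of_bounded hg measurable_const.aemeasurable (K := 1) fun _ i => ?_
    by_cases hi : i = p
    · subst hi; simp
    · simp [hi]
  refine (integrable_sesqForm hg hx hs).congr (ae_of_all _ fun t => ?_)
  have : star (Pi.single p (1 : ℂ) : Fin T → ℂ) = Pi.single p 1 := by
    ext k; by_cases hk : k = p <;> simp [hk]
  simp only
  rw [sesqForm, this, mulVec_single_one, mulVec_transpose]
  rfl

/-- Orthogonality to the negative frequencies in terms of the Fourier coefficients of `gᵀ e`. -/
lemma orthogonal_negSpan_iff (hg : IsSpectralDensity g) {e : ℝ → Fin T → ℂ} (he : InL2 g e) :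
    (∀ p ∈ negSpan T, ∫ t, sesqForm (g t) (e t) (p t) ∂circ = 0) ↔
      ∀ i (k : ℕ), ∫ t, expi ((k : ℤ) + 1) t * ((g t)ᵀ *ᵥ e t) i ∂circ = 0 := by
  constructor
  · intro h i k
    rw [← integral_sesqForm_expi]
    exact h _ (expi_smul_mem_negSpan k _)
  · intro h p hp
    induction hp using Submodule.span_induction with
    | mem x hx =>
      obtain ⟨⟨j, v⟩, rfl⟩ := hx
      have e1 : ∀ t, sesqForm (g t) (e t) (expi (-((j : ℤ) + 1)) t • v) =
          ∑ i, conj (v i) * (expi ((j : ℤ) + 1) t * ((g t)ᵀ *ᵥ e t) i) := by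
        intro t
        rw [sesqForm_smul_right, conj_expi, neg_neg, sesqForm, dotProduct_mulVec, ← mulVec_transpose,
          dotProduct, Finset.mul_sum]
        refine Finset.sum_congr rfl fun i _ => ?_
        simp only [Pi.star_apply, RCLike.star_def]; ring
      simp only [e1]
      rw [integral_finsetSum _ fun i _ =>
        (integrable_expi_mul (integrable_transpose_mulVec hg he i) _).const_mul _]
      refine Finset.sum_eq_zero fun i _ => ?_
      rw [integral_const_mul, h, mul_zero]
    | zero => simp [sesqForm]
    | add x y hx' hy' hx hy =>
      simp only [Pi.add_apply, sesqForm_add_right]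
      rw [integral_add (integrable_sesqForm hg he (negSpan_inL2 hg _ hx'))
        (integrable_sesqForm hg he (negSpan_inL2 hg _ hy')), hx, hy, add_zero]
    | smul a x _ hx =>
      simp only [Pi.smul_apply, sesqForm_smul_right]
      rw [integral_const_mul, hx, mul_zero]

/-- A function of `L₂(g)` with negative spectrum which is orthogonal to the negative frequencies
vanishes. -/
theorem ae_eq_zero_of_orthogonal (hi : InvIntegrable g) (hg : IsSpectralDensity g)
    {e : ℝ → Fin T → ℂ} (he : InL2 g e)
    (heS : ∀ p (k : ℕ), ∫ t, expi (-(k : ℤ)) t * e t p ∂circ = 0)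
    (horth : ∀ p ∈ negSpan T, ∫ t, sesqForm (g t) (e t) (p t) ∂circ = 0) : e =ᵐ[circ] 0 := by
  have e1 : ∀ᵐ t ∂circ, e t ⬝ᵥ star ((g t)ᵀ *ᵥ e t) = (quadForm (g t) (e t) : ℂ) := by
    filter_upwards [hg.2] with t ht
    rw [dotProduct_star_eq_sesqForm ht.1, sesqForm_self ht.1]
  have h0 := integral_dotProduct_star_eq_zero (fun p => hi.integrable hg he p) heS
    (fun p => integrable_transpose_mulVec hg he p) ((orthogonal_negSpan_iff hg he).1 horth)
    ((he.integrable_quadForm hg).ofReal.congr (e1.mono fun t ht => ht.symm))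
  rw [integral_congr_ae e1] at h0
  have h1 : ∫ t, quadForm (g t) (e t) ∂circ = 0 := by
    have : ((∫ t, quadForm (g t) (e t) ∂circ : ℝ) : ℂ) = 0 := by
      rw [← h0]; exact integral_ofReal.symm
    exact_mod_cast this
  rw [integral_eq_zero_iff_of_nonneg_ae (hg.2.mono fun t ht => quadForm_nonneg ht _)
    (he.integrable_quadForm hg)] at h1
  filter_upwards [h1, hi.1] with t ht hp
  by_contra hne
  exact (quadForm_pos hp hne).ne' ht

/-- Under the minimality condition, the closed span of the negative frequencies consists of all
functions of `L₂(g)` with negative spectrum. -/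
theorem inClosure_negSpan (hi : InvIntegrable g) (hg : IsSpectralDensity g) {x : ℝ → Fin T → ℂ}
    (hx : InL2 g x) (hxS : ∀ p (k : ℕ), ∫ t, expi (-(k : ℤ)) t * x t p ∂circ = 0) :
    InClosure g (negSpan T) x := by
  obtain ⟨h, hcl, horth⟩ := exists_projection hg hi.1 (negSpan_inL2 hg) hx
  have hhL := hcl.inL2 hg (negSpan_inL2 hg)
  have h0 := ae_eq_zero_of_orthogonal hi hg (hx.sub hg hhL) (fun p k => by
    simp only [Pi.sub_apply, mul_sub]
    rw [integral_sub (integrable_expi_mul (hi.integrable hg hx p) _)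
      (integrable_expi_mul (hi.integrable hg hhL p) _), hxS, hcl.integral_expi_mul hi hg, sub_zero])
    horth
  refine ⟨hx.1, fun ε hε => ?_⟩
  obtain ⟨p, hp, hlt⟩ := hcl.2 ε hε
  refine ⟨p, hp, lt_of_eq_of_lt (sqNorm_congr_ae ?_) hlt⟩
  filter_upwards [h0] with t ht
  have : x t = h t := sub_eq_zero.1 ht
  simp [this]

/-! ### Residuals and the Toeplitz system -/


variable {T : ℕ} {g : ℝ → Mat T}

lemma InClosure.sub {S : Submodule ℂ (ℝ → Fin T → ℂ)} (hg : IsSpectralDensity g)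
    {h k : ℝ → Fin T → ℂ}
    (hS : ∀ p ∈ S, InL2 g p) (hh : InClosure g S h) (hk : InClosure g S k) :
    InClosure g S (h - k) := by
  refine ⟨hh.1.sub hk.1, fun ε hε => ?_⟩
  have hε4 : 0 < ε / 4 := ENNReal.div_pos hε.ne' (by simp)
  obtain ⟨p, hp, h1⟩ := hh.2 _ hε4
  obtain ⟨q, hq, h2⟩ := hk.2 _ hε4
  refine ⟨p - q, S.sub_mem hp hq, ?_⟩
  have h3 := sqNorm_add_le hg (x := h - p) (y := q - k) (hh.1.sub (hS p hp).1) one_pos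
  rw [show h - p + (q - k) = h - k - (p - q) by abel, sqNorm_sub_comm q k] at h3
  refine h3.trans_lt ?_
  norm_num
  calc 2 * sqNorm g (h - p) + 2 * sqNorm g (k - q) < 2 * (ε / 4) + 2 * (ε / 4) :=
        ENNReal.add_lt_add (by gcongr; simp) (by gcongr; simp)
    _ = ε := by
        rw [← two_mul, ← mul_assoc, show (2 : ℝ≥0∞) * 2 = 4 by norm_num]
        exact ENNReal.mul_div_cancel (by simp) (by simp)

lemma aemeasurable_inv_entry (hg : ∀ i j, AEMeasurable (fun t => g t i j) circ) (i j : Fin T) :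
    AEMeasurable (fun t => (g t)⁻¹ i j) circ := by
  have hG : AEMeasurable (fun t => (fun i j => g t i j : Fin T → Fin T → ℂ)) circ :=
    aemeasurable_pi_iff.2 fun i => aemeasurable_pi_iff.2 fun j => hg i j
  have hd : Continuous fun A : Fin T → Fin T → ℂ => (of A : Mat T).det :=
    Continuous.matrix_det continuous_id
  have ha : Continuous fun A : Fin T → Fin T → ℂ => (of A : Mat T).adjugate i j :=
    (Continuous.matrix_adjugate (A := fun A : Fin T → Fin T → ℂ => (of A : Mat T))
      continuous_id).matrix_elem i j
  have h1 := (hd.measurable.comp_aemeasurable hG).inv.mul (ha.measurable.comp_aemeasurable hG)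
  refine h1.congr (ae_of_all _ fun t => ?_)
  simp only [Matrix.inv_def, Matrix.smul_apply, smul_eq_mul, Ring.inverse_eq_inv']
  rfl

lemma aemeasurable_mulVec {A : ℝ → Mat T} (hA : ∀ i j, AEMeasurable (fun t => A t i j) circ)
    {x : ℝ → Fin T → ℂ} (hx : AEMeasurable x circ) : AEMeasurable (fun t => A t *ᵥ x t) circ := by
  refine aemeasurable_pi_iff.2 fun i => ?_
  simp only [mulVec, dotProduct]
  exact Finset.aemeasurable_fun_sum _ fun j _ => (hA i j).mul (aemeasurable_pi_iff.1 hx j)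

section Target

variable {b : ℕ → Fin T → ℂ}

lemma summable_target (hb : Summable fun k => ‖b k‖) (p : Fin T) : Summable fun k => ‖b k p‖ :=
  hb.of_nonneg_of_le (fun _ => norm_nonneg _) fun k => norm_le_pi_norm (b k) p

lemma targetFun_apply (t : ℝ) (p : Fin T) :
    targetFun b t p = ∑' k : ℕ, b k p * expi k t := by
  simp only [targetFun, expi_nat_eq]

lemma continuous_targetFun (hb : Summable fun k => ‖b k‖) : Continuous (targetFun b) := by
  refine continuous_pi fun p => ?_
  simp only [targetFun_apply]
  refine continuous_tsum (fun k => continuous_const.mul (continuous_expi _)) (summable_target hb p)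
    fun k t => by rw [norm_mul, norm_expi, mul_one]

lemma norm_targetFun_le (hb : Summable fun k => ‖b k‖) (t : ℝ) (p : Fin T) :
    ‖targetFun b t p‖ ≤ ∑' k, ‖b k‖ := by
  rw [targetFun_apply]
  refine (norm_tsum_le_tsum_norm ?_).trans ?_
  · simpa only [norm_mul, norm_expi, mul_one] using summable_target hb p
  · simp only [norm_mul, norm_expi, mul_one]
    exact (summable_target hb p).tsum_le_tsum (fun k => norm_le_pi_norm (b k) p) hb

lemma inL2_targetFun (hb : Summable fun k => ‖b k‖) (hg : IsSpectralDensity g) : InL2 g (targetFun b) :=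
  InL2.of_bounded hg (continuous_targetFun hb).measurable.aemeasurable (norm_targetFun_le hb)

lemma hasSum_integral_targetFun (hb : Summable fun k => ‖b k‖) {φ : ℝ → ℂ}
    (hφ : Integrable φ circ) (p : Fin T) :
    HasSum (fun k : ℕ => b k p * ∫ t, expi k t * φ t ∂circ) (∫ t, targetFun b t p * φ t ∂circ) := by
  have h1 : ∀ k : ℕ, Integrable (fun t => b k p * (expi k t * φ t)) circ := fun k =>
    (integrable_expi_mul hφ _).const_mul _
  have h2 : Summable fun k : ℕ => ∫ t, ‖b k p * (expi k t * φ t)‖ ∂circ := by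
    simp only [norm_mul, norm_expi, one_mul, integral_const_mul]
    exact (summable_target hb p).mul_right _
  have h3 := hasSum_integral_of_summable_integral_norm h1 h2
  simp only [integral_const_mul] at h3
  have e : ∀ t, targetFun b t p * φ t = ∑' k : ℕ, b k p * (expi k t * φ t) := fun t => by
    rw [targetFun_apply, ← tsum_mul_right]
    exact tsum_congr fun k => by ring
  simp only [e]
  exact h3

lemma integral_expi_mul_targetFun (hb : Summable fun k => ‖b k‖) (p : Fin T)
    (n : ℕ) :
    ∫ t, expi (-(n : ℤ)) t * targetFun b t p ∂circ = b n p := by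
  have h := hasSum_integral_targetFun hb (integrable_expi (-(n : ℤ))) p
  have h2 : ∀ k : ℕ, b k p * ∫ t, expi k t * expi (-(n : ℤ)) t ∂circ = if k = n then b n p else 0 := by
    intro k
    simp only [← expi_add, integral_expi]
    by_cases hk : k = n
    · subst hk; simp
    · rw [if_neg (by omega), if_neg hk, mul_zero]
  simp only [h2] at h
  have h4 := h.unique (hasSum_ite_eq n (b n p))
  rw [← h4]
  exact integral_congr_ae (ae_of_all _ fun t => mul_comm _ _)

end Target

/-- `e` is the residual of the projection of `∑ b(k) e^{ikt}` on the closed span of the negative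
frequencies in `L₂(g)`. -/
structure IsResidual (g : ℝ → Mat T) (b : ℕ → Fin T → ℂ) (e : ℝ → Fin T → ℂ) : Prop where
  inL2 : InL2 g e
  closure : InClosure g (negSpan T) (targetFun b - e)
  orthogonal : ∀ p ∈ negSpan T, ∫ t, sesqForm (g t) (e t) (p t) ∂circ = 0

section Residual

variable {b : ℕ → Fin T → ℂ} {e : ℝ → Fin T → ℂ}

lemma IsResidual.sqNorm_sub (hg : IsSpectralDensity g) (he : IsResidual g b e)
    {k : ℝ → Fin T → ℂ} (hk : InClosure g (negSpan T) k) :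
    sqNorm g (targetFun b - k) = sqNorm g e + sqNorm g (k - (targetFun b - e)) := by
  rw [← sqNorm_sub_eq_add hg (negSpan_inL2 hg) he.inL2 (hk.sub hg (negSpan_inL2 hg) he.closure)
    he.orthogonal]
  congr 1; abel

lemma exists_isResidual (hi : InvIntegrable g) (hg : IsSpectralDensity g)
    (hb : Summable fun k => ‖b k‖) : ∃ e, IsResidual g b e := by
  obtain ⟨h, hcl, horth⟩ := exists_projection hg hi.1 (negSpan_inL2 hg) (inL2_targetFun hb hg)
  refine ⟨targetFun b - h, (inL2_targetFun hb hg).sub hg (hcl.inL2 hg (negSpan_inL2 hg)), ?_,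
    horth⟩
  rwa [sub_sub_cancel]

lemma IsResidual.integral_expi_mul (hi : InvIntegrable g) (hg : IsSpectralDensity g)
    (hb : Summable fun k => ‖b k‖) (he : IsResidual g b e) (p : Fin T) (k : ℕ) :
    ∫ t, expi (-(k : ℤ)) t * e t p ∂circ = b k p := by
  have h1 := he.closure.integral_expi_mul hi hg p k
  simp only [Pi.sub_apply, mul_sub] at h1
  rw [integral_sub (integrable_expi_mul (hi.integrable hg (inL2_targetFun hb hg) p) _)
    (integrable_expi_mul (hi.integrable hg he.inL2 p) _), integral_expi_mul_targetFun hb] at h1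
  exact (sub_eq_zero.1 h1).symm

/-- A function with the Fourier coefficients `b(k)`, `k ≥ 0`, which is orthogonal to the negative
frequencies is the residual. -/
lemma isResidual_of_integral (hi : InvIntegrable g) (hg : IsSpectralDensity g)
    (hb : Summable fun k => ‖b k‖) (he : InL2 g e)
    (hcoef : ∀ (k : ℕ) p, ∫ t, expi (-(k : ℤ)) t * e t p ∂circ = b k p)
    (horth : ∀ p ∈ negSpan T, ∫ t, sesqForm (g t) (e t) (p t) ∂circ = 0) : IsResidual g b e := by
  refine ⟨he, inClosure_negSpan hi hg ((inL2_targetFun hb hg).sub hg he) fun p k => ?_, horth⟩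
  simp only [Pi.sub_apply, mul_sub]
  rw [integral_sub (integrable_expi_mul (hi.integrable hg (inL2_targetFun hb hg) p) _)
    (integrable_expi_mul (hi.integrable hg he p) _), integral_expi_mul_targetFun hb, hcoef, sub_self]

lemma IsResidual.ae_eq (hi : InvIntegrable g) (hg : IsSpectralDensity g)
    (hb : Summable fun k => ‖b k‖) {e' : ℝ → Fin T → ℂ} (he : IsResidual g b e)
    (he' : IsResidual g b e') : e =ᵐ[circ] e' := by
  have h0 := ae_eq_zero_of_orthogonal hi hg (he.inL2.sub hg he'.inL2) (fun p k => by
    simp only [Pi.sub_apply, mul_sub]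
    rw [integral_sub (integrable_expi_mul (hi.integrable hg he.inL2 p) _)
      (integrable_expi_mul (hi.integrable hg he'.inL2 p) _), he.integral_expi_mul hi hg hb,
      he'.integral_expi_mul hi hg hb, sub_self]) (fun p hp => by
    simp only [Pi.sub_apply, sesqForm_sub_left]
    rw [integral_sub (integrable_sesqForm hg he.inL2 (negSpan_inL2 hg p hp))
      (integrable_sesqForm hg he'.inL2 (negSpan_inL2 hg p hp)), he.orthogonal p hp,
      he'.orthogonal p hp, sub_zero])
  filter_upwards [h0] with t ht
  exact sub_eq_zero.1 ht

/-- The residual is orthogonal to the projection, so that its square norm is its inner product with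
`∑ b(k) e^{ikt}`. -/
lemma IsResidual.integral_targetFun (hg : IsSpectralDensity g) (hb : Summable fun k => ‖b k‖)
    (he : IsResidual g b e) :
    ∫ t, sesqForm (g t) (targetFun b t) (e t) ∂circ = (∫ t, quadForm (g t) (e t) ∂circ : ℝ) := by
  have hhL := he.closure.inL2 hg (negSpan_inL2 hg)
  have h1 := he.closure.integral_sesqForm_eq_zero hg (negSpan_inL2 hg) he.inL2 he.orthogonal
  have h2 : ∫ t, sesqForm (g t) ((targetFun b - e) t) (e t) ∂circ = 0 := by
    have := congrArg conj h1
    rw [← integral_conj, map_zero] at this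
    rw [← this]
    exact integral_congr_ae (hg.2.mono fun t ht => (sesqForm_conj ht.1 _ _).symm)
  simp only [Pi.sub_apply, sesqForm_sub_left] at h2
  rw [integral_sub (integrable_sesqForm hg (inL2_targetFun hb hg) he.inL2)
    (integrable_sesqForm hg he.inL2 he.inL2), sub_eq_zero] at h2
  rw [h2, ← integral_complex_ofReal]
  exact integral_congr_ae (hg.2.mono fun t ht => sesqForm_self ht.1 _)

end Residual

section Weighted

variable {r : ℕ} (μ s d : Fin r → ℕ)

/-- The spectral density `|χ_μ(e^{-iλ})|² |β(iλ)|⁻² f(λ)` of the increments. -/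
noncomputable def weighted (f : ℝ → Mat T) (t : ℝ) : Mat T := (weight μ s d t : ℂ) • f t

lemma sqNorm_kappa_smul (f : ℝ → Mat T) (x : ℝ → Fin T → ℂ) :
    sqNorm f (fun t => kappa μ s d t • x t) = sqNorm (weighted μ s d f) x :=
  sqNorm_congr (ae_of_all _ fun t => by
    rw [quadForm_smul, weighted, quadForm_smul_mat, weight_eq])

variable {μ s}

lemma IsSpectralDensity.weighted (hs : ∀ j, 0 < s j) {f : ℝ → Mat T} (hf : IsSpectralDensity f) :
    IsSpectralDensity (weighted μ s d f) := by
  obtain ⟨K, _, hK⟩ := exists_weight_le (μ := μ) d hs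
  refine ⟨fun i j => ?_, hf.2.mono fun t ht => ht.smul (by exact_mod_cast weight_nonneg μ s d t)⟩
  simp only [GMForecast.weighted, Matrix.smul_apply, smul_eq_mul]
  refine (hf.1 i j).bdd_mul (c := K)
    (Complex.measurable_ofReal.comp (measurable_weight μ s d)).aestronglyMeasurable
    (ae_of_all _ fun t => ?_)
  rw [Complex.norm_real, Real.norm_of_nonneg (weight_nonneg μ s d t)]
  exact hK t

lemma inv_weighted {f : ℝ → Mat T} {t : ℝ} (hw : 0 < weight μ s d t) (hf : (f t).PosDef) :
    (weighted μ s d f t)⁻¹ = (((weight μ s d t)⁻¹ : ℝ) : ℂ) • (f t)⁻¹ := by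
  have hu : IsUnit (f t).det := (isUnit_iff_isUnit_det _).1 hf.isUnit
  refine inv_eq_right_inv ?_
  rw [weighted, smul_mul_smul_comm, mul_nonsing_inv _ hu, ← Complex.ofReal_mul,
    mul_inv_cancel₀ hw.ne', Complex.ofReal_one, one_smul]

lemma posDef_weighted {f : ℝ → Mat T} {t : ℝ} (hw : 0 < weight μ s d t) (hf : (f t).PosDef) :
    (weighted μ s d f t).PosDef := hf.smul (by exact_mod_cast hw)

lemma Minimality.invIntegrable (hμ : ∀ j, 0 < μ j) (hs : ∀ j, 0 < s j) {f : ℝ → Mat T}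
    (hm : Minimality μ s d f) : InvIntegrable (weighted μ s d f) := by
  refine ⟨?_, ?_⟩
  · filter_upwards [weight_pos_ae d hμ hs, hm.1] with t hw hf using posDef_weighted d hw hf
  · refine hm.2.re.congr ?_
    filter_upwards [weight_pos_ae d hμ hs, hm.1] with t hw hf
    rw [inv_weighted d hw hf, trace_smul]
    rfl

lemma expi_neg_succ_eq (j : ℕ) (t : ℝ) :
    Complex.exp (-(Complex.I * ((j : ℂ) + 1) * t)) = expi (-((j : ℤ) + 1)) t := by
  rw [expi]; push_cast; ring_nf

/-- The linear predictors are the polynomials with negative frequencies, multiplied by `χ/β`. -/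
lemma exists_pastPoly_eq {p : ℝ → Fin T → ℂ} (hp : p ∈ negSpan T) :
    ∃ (N : ℕ) (x : ℕ → Fin T → ℂ), ∀ t, pastPoly μ s d N x t = kappa μ s d t • p t := by
  suffices h : ∃ (N : ℕ) (x : ℕ → Fin T → ℂ), (∀ j, N ≤ j → x j = 0) ∧
      ∀ t : ℝ, ∑ j ∈ Finset.range N, Complex.exp (-(Complex.I * ((j : ℂ) + 1) * t)) • x j = p t by
    obtain ⟨N, x, _, hx⟩ := h
    exact ⟨N, x, fun t => by rw [pastPoly, hx]⟩
  induction hp using Submodule.span_induction with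
  | mem x hx =>
    obtain ⟨⟨j, v⟩, rfl⟩ := hx
    refine ⟨j + 1, Pi.single j v, fun k hk => Pi.single_eq_of_ne (by omega) _, fun t => ?_⟩
    rw [Finset.sum_eq_single j]
    · rw [Pi.single_eq_same, expi_neg_succ_eq]
    · intro k _ hk; rw [Pi.single_eq_of_ne hk, smul_zero]
    · intro hj; simp at hj
  | zero => exact ⟨0, 0, fun _ _ => rfl, fun t => by simp⟩
  | add x y _ _ hx hy =>
    obtain ⟨N, u, hu0, hu⟩ := hx
    obtain ⟨M, v, hv0, hv⟩ := hy
    refine ⟨max N M, u + v, fun j hj => ?_, fun t => ?_⟩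
    · rw [Pi.add_apply, hu0 j (le_of_max_le_left hj), hv0 j (le_of_max_le_right hj), add_zero]
    · simp only [Pi.add_apply, smul_add, Finset.sum_add_distrib, ← hu, ← hv]
      congr 1 <;> symm <;> refine Finset.sum_subset (Finset.range_mono (by simp)) ?_
      · intro j _ hj; rw [hu0 j (not_lt.1 (Finset.mem_range.not.1 hj)), smul_zero]
      · intro j _ hj; rw [hv0 j (not_lt.1 (Finset.mem_range.not.1 hj)), smul_zero]
  | smul a x _ hx =>
    obtain ⟨N, u, hu0, hu⟩ := hx
    refine ⟨N, a • u, fun j hj => by simp [hu0 j hj], fun t => ?_⟩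
    rw [Pi.smul_apply, ← hu, Finset.smul_sum]
    exact Finset.sum_congr rfl fun j _ => by rw [Pi.smul_apply, smul_comm]

lemma exists_negSpan_eq (N : ℕ) (x : ℕ → Fin T → ℂ) :
    ∃ p ∈ negSpan T, ∀ t, pastPoly μ s d N x t = kappa μ s d t • p t := by
  refine ⟨∑ j ∈ Finset.range N, fun t => expi (-((j : ℤ) + 1)) t • x j,
    Submodule.sum_mem _ fun j _ => expi_smul_mem_negSpan j _, fun t => ?_⟩
  rw [pastPoly, Finset.sum_apply]
  congr 1
  exact Finset.sum_congr rfl fun j _ => by rw [expi_neg_succ_eq]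

lemma sqNorm_sub_kappa_smul (hμ : ∀ j, 0 < μ j) (hs : ∀ j, 0 < s j) (f : ℝ → Mat T)
    (h x : ℝ → Fin T → ℂ) :
    sqNorm f (fun t => kappa μ s d t • x t - h t) =
      sqNorm (weighted μ s d f) (x - fun t => (kappa μ s d t)⁻¹ • h t) := by
  rw [← sqNorm_kappa_smul]
  refine sqNorm_congr_ae ?_
  filter_upwards [kappa_ne_zero_ae d hμ hs] with t ht
  rw [Pi.sub_apply, smul_sub, smul_inv_smul₀ ht]

/-- Division by `χ/β` identifies the past in `L₂(f)` with the closed span of the negative frequencies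
in the space of the weighted density. -/
lemma inPast_iff (hμ : ∀ j, 0 < μ j) (hs : ∀ j, 0 < s j) (f : ℝ → Mat T) (h : ℝ → Fin T → ℂ) :
    InPast μ s d f h ↔
      InClosure (weighted μ s d f) (negSpan T) (fun t => (kappa μ s d t)⁻¹ • h t) := by
  have hk := measurable_kappa μ s d
  have key : ∀ {N : ℕ} {x : ℕ → Fin T → ℂ} {p : ℝ → Fin T → ℂ},
      (∀ t, pastPoly μ s d N x t = kappa μ s d t • p t) →
      sqNorm f (fun t => h t - pastPoly μ s d N x t) =
        sqNorm (weighted μ s d f) ((fun t => (kappa μ s d t)⁻¹ • h t) - p) := by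
    intro N x p hp
    rw [sqNorm_sub_comm, ← sqNorm_sub_kappa_smul d hμ hs f h p]
    refine sqNorm_congr (ae_of_all _ fun t => ?_)
    rw [hp, quadForm_sub_comm]
  refine and_congr ?_ (forall_congr' fun ε => imp_congr_right fun _ => ?_)
  · constructor
    · intro hm
      exact hk.inv.aemeasurable.smul (aemeasurable_pi_iff.2 hm)
    · intro hm p
      have h1 := aemeasurable_pi_iff.1 (hk.aemeasurable.smul hm) p
      refine h1.congr ?_
      filter_upwards [kappa_ne_zero_ae d hμ hs] with t ht
      simp only [Pi.smul_apply']
      rw [smul_inv_smul₀ ht]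
  · constructor
    · rintro ⟨N, x, hlt⟩
      obtain ⟨p, hp, he⟩ := exists_negSpan_eq d N x
      exact ⟨p, hp, by rwa [← key he]⟩
    · rintro ⟨p, hp, hlt⟩
      obtain ⟨N, x, he⟩ := exists_pastPoly_eq (μ := μ) (s := s) d hp
      exact ⟨N, x, by rwa [key he]⟩

lemma err_eq (hμ : ∀ j, 0 < μ j) (hs : ∀ j, 0 < s j) (b : ℕ → Fin T → ℂ) (f : ℝ → Mat T)
    (h : ℝ → Fin T → ℂ) :
    err μ s d b h f =
      sqNorm (weighted μ s d f) (targetFun b - fun t => (kappa μ s d t)⁻¹ • h t) :=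
  sqNorm_sub_kappa_smul d hμ hs f h (targetFun b)

lemma pastPoly_inPast (f : ℝ → Mat T) (N : ℕ)
    (x : ℕ → Fin T → ℂ) : InPast μ s d f (pastPoly μ s d N x) := by
  refine ⟨fun p => ?_, fun ε hε => ⟨N, x, by simpa [sqNorm] using hε⟩⟩
  obtain ⟨p', hp', he⟩ := exists_negSpan_eq (μ := μ) (s := s) d N x
  have h1 := aemeasurable_pi_iff.1 ((measurable_kappa μ s d).aemeasurable.smul
    (negSpan_bounded hp').1.aemeasurable (μ := circ)) p
  refine h1.congr (ae_of_all _ fun t => ?_)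
  simp only [he, Pi.smul_apply']

/-- The minimal error is the infimum over the finite linear predictors. -/
lemma optErr_eq (hμ : ∀ j, 0 < μ j) (hs : ∀ j, 0 < s j) {b : ℕ → Fin T → ℂ}
    (hb : Summable fun k => ‖b k‖) {f : ℝ → Mat T} (hf : IsSpectralDensity f) :
    optErr μ s d b f = ⨅ p ∈ negSpan T, sqNorm (weighted μ s d f) (targetFun b - p) := by
  have hg := hf.weighted (μ := μ) d hs
  refine le_antisymm (le_iInf₂ fun p hp => ?_) (le_iInf₂ fun h hh => ?_)
  · obtain ⟨N, x, he⟩ := exists_pastPoly_eq (μ := μ) (s := s) d hp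
    refine (iInf₂_le _ (pastPoly_inPast d f N x)).trans_eq ?_
    rw [err_eq d hμ hs]
    refine sqNorm_congr_ae ?_
    filter_upwards [kappa_ne_zero_ae d hμ hs] with t ht
    rw [Pi.sub_apply, Pi.sub_apply, he, inv_smul_smul₀ ht]
  · rw [err_eq d hμ hs]
    exact ((inPast_iff d hμ hs f h).1 hh).iInf_sqNorm_le hg (inL2_targetFun hb hg).1

lemma optErr_lt_top (hμ : ∀ j, 0 < μ j) (hs : ∀ j, 0 < s j) {b : ℕ → Fin T → ℂ}
    (hb : Summable fun k => ‖b k‖) {f : ℝ → Mat T} (hf : IsSpectralDensity f) :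
    optErr μ s d b f < ∞ := by
  rw [optErr_eq d hμ hs hb hf]
  refine lt_of_le_of_lt (iInf₂_le 0 (Submodule.zero_mem _)) ?_
  rw [sub_zero]
  exact (inL2_targetFun hb (hf.weighted d hs)).2

lemma IsResidual.optErr_eq (hμ : ∀ j, 0 < μ j) (hs : ∀ j, 0 < s j) {b : ℕ → Fin T → ℂ}
    (hb : Summable fun k => ‖b k‖) {f : ℝ → Mat T} (hf : IsSpectralDensity f)
    {e : ℝ → Fin T → ℂ} (he : IsResidual (weighted μ s d f) b e) :
    optErr μ s d b f = sqNorm (weighted μ s d f) e := by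
  have hg := hf.weighted (μ := μ) d hs
  rw [GMForecast.optErr_eq d hμ hs hb hf]
  refine le_antisymm ?_ (le_iInf₂ fun p hp => ?_)
  · refine (he.closure.iInf_sqNorm_le hg (inL2_targetFun hb hg).1).trans_eq ?_
    rw [sub_sub_cancel]
  · rw [he.sqNorm_sub hg (inClosure_of_mem hp (negSpan_inL2 hg p hp).1)]
    exact le_self_add

/-- The residual `|β|² |χ_μ|⁻² (f⁻¹)ᵀ C` belonging to a solution `C` of the Toeplitz system. -/
noncomputable def residual (f : ℝ → Mat T) (C : ℝ → Fin T → ℂ) (t : ℝ) : Fin T → ℂ :=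
  (((weight μ s d t)⁻¹ : ℝ) : ℂ) • (((f t)⁻¹)ᵀ *ᵥ C t)

lemma weighted_transpose_mulVec_residual {f : ℝ → Mat T} {C : ℝ → Fin T → ℂ} {t : ℝ}
    (hw : 0 < weight μ s d t) (hf : (f t).PosDef) :
    (weighted μ s d f t)ᵀ *ᵥ residual (μ := μ) (s := s) d f C t = C t := by
  have hu : IsUnit (f t).det := (isUnit_iff_isUnit_det _).1 hf.isUnit
  rw [weighted, residual, transpose_smul, smul_mulVec, mulVec_smul, smul_smul, mulVec_mulVec,
    ← transpose_mul, nonsing_inv_mul _ hu, transpose_one, one_mulVec, ← Complex.ofReal_mul,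
    mul_inv_cancel₀ hw.ne', Complex.ofReal_one, one_smul]

/-- A solution `C` of the Toeplitz system of a density `f` yields the residual `e` with `C = gᵀ e` for
the weighted density `g`: the equations prescribe the Fourier coefficients of `e` of nonnegative
index, and the vanishing coefficients of `C` express the orthogonality of `e` to the past. -/
lemma IsSolution.isResidual (hμ : ∀ j, 0 < μ j) (hs : ∀ j, 0 < s j) {b : ℕ → Fin T → ℂ}
    (hb : Summable fun k => ‖b k‖) {f : ℝ → Mat T} (hf : IsSpectralDensity f)
    (hm : Minimality μ s d f) {c : ℕ → Fin T → ℂ} {C : ℝ → Fin T → ℂ}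
    (hsol : IsSolution μ s d b f c C) :
    IsResidual (weighted μ s d f) b (residual (μ := μ) (s := s) d f C) := by
  have hg := hf.weighted (μ := μ) d hs
  have hi := hm.invIntegrable d hμ hs
  have hCm : AEMeasurable C circ := aemeasurable_pi_iff.2 fun p => (hsol.series p).1.aemeasurable
  have hem : AEMeasurable (residual (μ := μ) (s := s) d f C) circ :=
    (Complex.measurable_ofReal.comp (measurable_weight μ s d).inv).aemeasurable.smul
      (aemeasurable_mulVec (fun i j => aemeasurable_inv_entry hf.aemeasurable j i) hCm)
  have hmv : ∀ᵐ t ∂circ, (weighted μ s d f t)ᵀ *ᵥ residual (μ := μ) (s := s) d f C t = C t := by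
    filter_upwards [weight_pos_ae d hμ hs, hm.1] with t hw hp
      using weighted_transpose_mulVec_residual d hw hp
  have hen : ∀ᵐ t ∂circ, ((((weight μ s d t)⁻¹ : ℝ) : ℂ) * (C t ⬝ᵥ ((f t)⁻¹ *ᵥ star (C t)))).re =
      quadForm (weighted μ s d f t) (residual (μ := μ) (s := s) d f C t) := by
    filter_upwards [hmv, hg.2, hm.1] with t h1 h2 h3
    rw [quadForm_eq_re, ← dotProduct_star_eq_sesqForm h2.1, h1, residual, smul_dotProduct,
      smul_eq_mul, mulVec_transpose, dotProduct_mulVec]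
  have heL : InL2 (weighted μ s d f) (residual (μ := μ) (s := s) d f C) := by
    refine ⟨hem, ?_⟩
    exact ((hasFiniteIntegral_iff_ofReal (hg.2.mono fun t ht => quadForm_nonneg ht _)).1
      (hsol.energy.re.congr hen).2)
  refine isResidual_of_integral hi hg hb heL (fun k p => ?_) ?_
  · rw [← hsol.system k p]
    refine integral_congr_ae (ae_of_all _ fun t => ?_)
    simp only [expi_neg_nat_eq, residual, Pi.smul_apply, smul_eq_mul]
  · rw [orthogonal_negSpan_iff hg heL]
    intro i k
    have h1 := (hsol.series i).2 (-((k : ℤ) + 1))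
    rw [if_neg (by omega)] at h1
    rw [← h1]
    refine integral_congr_ae (hmv.mono fun t ht => ?_)
    simp only
    rw [ht, expi_neg_eq, neg_neg]

/-- The residual `e` yields the solution `C = gᵀ e` of the Toeplitz system. -/
lemma IsResidual.exists_isSolution (hμ : ∀ j, 0 < μ j) (hs : ∀ j, 0 < s j) {b : ℕ → Fin T → ℂ}
    (hb : Summable fun k => ‖b k‖) {f : ℝ → Mat T} (hf : IsSpectralDensity f)
    (hm : Minimality μ s d f) {e : ℝ → Fin T → ℂ} (he : IsResidual (weighted μ s d f) b e) :
    ∃ c C, IsSolution μ s d b f c C := by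
  have hg := hf.weighted (μ := μ) d hs
  have hi := hm.invIntegrable d hμ hs
  set C : ℝ → Fin T → ℂ := fun t => (weighted μ s d f t)ᵀ *ᵥ e t with hC
  have hCi := fun p => integrable_transpose_mulVec hg he.inL2 p
  have hinv : ∀ᵐ t ∂circ,
      (((weight μ s d t)⁻¹ : ℝ) : ℂ) • (((f t)⁻¹)ᵀ *ᵥ C t) = e t := by
    filter_upwards [weight_pos_ae d hμ hs, hm.1] with t hw hp
    have hu : IsUnit (f t).det := (isUnit_iff_isUnit_det _).1 hp.isUnit
    simp only [hC]
    rw [weighted, transpose_smul, smul_mulVec, mulVec_smul, smul_smul, mulVec_mulVec,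
      ← transpose_mul, mul_nonsing_inv _ hu, transpose_one, one_mulVec, ← Complex.ofReal_mul,
      inv_mul_cancel₀ hw.ne', Complex.ofReal_one, one_smul]
  refine ⟨fun k p => ∫ t, Complex.exp (-(Complex.I * k * t)) * C t p ∂circ, C, ⟨?_, ?_, ?_⟩⟩
  · intro p
    refine ⟨hCi p, fun k => ?_⟩
    split_ifs with hk
    · obtain ⟨n, rfl⟩ := Int.eq_ofNat_of_zero_le hk
      simp
    · obtain ⟨n, rfl⟩ : ∃ n : ℕ, k = -((n : ℤ) + 1) := ⟨(-k - 1).toNat, by omega⟩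
      have := (orthogonal_negSpan_iff hg he.inL2).1 he.orthogonal p n
      rw [← this]
      simp only [expi_neg_eq, neg_neg, hC]
  · refine (he.inL2.integrable_quadForm hg).ofReal.congr ?_
    filter_upwards [hinv, hg.2] with t h1 h2
    change ((quadForm (weighted μ s d f t) (e t) : ℝ) : ℂ) = _
    rw [← sesqForm_self h2.1, ← dotProduct_star_eq_sesqForm h2.1]
    nth_rewrite 1 [← h1]
    rw [smul_dotProduct, smul_eq_mul, mulVec_transpose, dotProduct_mulVec]
  · intro j p
    rw [← he.integral_expi_mul hi hg hb p j]
    refine integral_congr_ae (hinv.mono fun t ht => ?_)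
    simp only
    rw [expi_neg_nat_eq, ← ht, Pi.smul_apply, smul_eq_mul]

/-- The minimal error as a pairing: by Parseval's identity `⟨b, c⟩` is the integral of `Bᵀ C̄`, the
inner product of `∑ b(k) e^{ikt}` with the residual. -/
lemma IsSolution.pairing_eq (hμ : ∀ j, 0 < μ j) (hs : ∀ j, 0 < s j) {b : ℕ → Fin T → ℂ}
    (hb : Summable fun k => ‖b k‖) {f : ℝ → Mat T} (hf : IsSpectralDensity f)
    (hm : Minimality μ s d f) {c : ℕ → Fin T → ℂ} {C : ℝ → Fin T → ℂ}
    (hsol : IsSolution μ s d b f c C) :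
    optErr μ s d b f = ENNReal.ofReal (pairing b c).re ∧ 0 ≤ (pairing b c).re := by
  have hg := hf.weighted (μ := μ) d hs
  have hres := hsol.isResidual d hμ hs hb hf hm
  have hmv : ∀ᵐ t ∂circ, (weighted μ s d f t)ᵀ *ᵥ residual (μ := μ) (s := s) d f C t = C t := by
    filter_upwards [weight_pos_ae d hμ hs, hm.1] with t hw hp
      using weighted_transpose_mulVec_residual d hw hp
  have hsum : ∀ p, HasSum (fun k : ℕ => b k p * conj (c k p))
      (∫ t, targetFun b t p * conj (C t p) ∂circ) := by
    intro p
    have hci := (Complex.conjCLE : ℂ →L[ℝ] ℂ).integrable_comp (hsol.series p).1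
    have h1 := hasSum_integral_targetFun hb hci p
    have h2 : ∀ k : ℕ, ∫ t, expi k t * conj (C t p) ∂circ = conj (c k p) := fun k => by
      have h3 := (hsol.series p).2 k
      rw [if_pos (by omega)] at h3
      rw [show c k p = c (k : ℤ).toNat p by simp, ← h3, ← integral_conj]
      simp only [expi_neg_eq, map_mul, conj_expi, neg_neg]
    have h4 : (fun k : ℕ => b k p * conj (c k p)) =
        fun k : ℕ => b k p * ∫ t, expi k t * conj (C t p) ∂circ := by
      funext k; rw [h2]
    rw [h4]
    exact h1
  have h1 : pairing b c = ∫ t, targetFun b t ⬝ᵥ star (C t) ∂circ := by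
    have hint : ∀ p, Integrable (fun t => targetFun b t p * conj (C t p)) circ := fun p =>
      ((Complex.conjCLE : ℂ →L[ℝ] ℂ).integrable_comp (hsol.series p).1).bdd_mul
        (c := ∑' k, ‖b k‖)
        ((continuous_apply p).comp (continuous_targetFun hb)).aestronglyMeasurable
        (ae_of_all _ fun t => norm_targetFun_le hb t p)
    simp only [dotProduct, Pi.star_apply, RCLike.star_def, pairing]
    rw [integral_finsetSum _ fun p _ => hint p]
    exact (hasSum_sum fun p _ => hsum p).tsum_eq
  have h2 : pairing b c = (∫ t, quadForm (weighted μ s d f t)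
      (residual (μ := μ) (s := s) d f C t) ∂circ : ℝ) := by
    rw [h1, ← hres.integral_targetFun hg hb]
    refine integral_congr_ae ?_
    filter_upwards [hmv, hg.2] with t h3 h4
    rw [← dotProduct_star_eq_sesqForm h4.1, h3]
  rw [h2, Complex.ofReal_re, hres.optErr_eq d hμ hs hb hf, sqNorm_eq_ofReal hg hres.inL2]
  exact ⟨rfl, integral_quadForm_nonneg hg _⟩

end Weighted

/-! ### Saddle points and minimax characteristics -/


variable {T : ℕ} {g : ℝ → Mat T}

lemma InClosure.congr_ae {S : Submodule ℂ (ℝ → Fin T → ℂ)} {h k : ℝ → Fin T → ℂ}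
    (hh : InClosure g S h) (e : h =ᵐ[circ] k) : InClosure g S k := by
  refine ⟨hh.1.congr e, fun ε hε => ?_⟩
  obtain ⟨p, hp, hlt⟩ := hh.2 ε hε
  refine ⟨p, hp, lt_of_eq_of_lt (sqNorm_congr_ae ?_) hlt⟩
  filter_upwards [e] with t ht
  simp only [Pi.sub_apply, ht]

lemma ae_tendsto_of_tsum_sqNorm (hg : IsSpectralDensity g) (hpd : ∀ᵐ t ∂circ, (g t).PosDef)
    {y : ℕ → ℝ → Fin T → ℂ} (hy : ∀ n, AEMeasurable (y n) circ)
    (h : ∑' n, sqNorm g (y n) ≠ ∞) : ∀ᵐ t ∂circ, Tendsto (fun n => y n t) atTop (𝓝 0) := by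
  have h1 := ae_tendsto_zero_of_tsum_lintegral
    (fun n => (aemeasurable_quadForm hg.aemeasurable (hy n)).ennreal_ofReal) h
  filter_upwards [h1, hpd] with t ht hp
  rw [tendsto_pi_nhds]
  intro p
  rw [Pi.zero_apply, tendsto_zero_iff_norm_tendsto_zero]
  have h2 : Tendsto (fun n => quadForm (g t) (y n t)) atTop (𝓝 0) := by
    refine ((ENNReal.tendsto_toReal ENNReal.zero_ne_top).comp ht).congr fun n => ?_
    exact ENNReal.toReal_ofReal (quadForm_nonneg hp.posSemidef _)
  have h3 := (Real.continuous_sqrt.tendsto 0).comp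
    (by simpa using h2.const_mul ((g t)⁻¹ p p).re)
  rw [Real.sqrt_zero] at h3
  refine squeeze_zero (fun _ => norm_nonneg _) (fun n => ?_) h3
  exact Real.le_sqrt_of_sq_le (norm_sq_le_inv_mul_quadForm hp (y n t) p)

section Mix

variable {f₀ f : ℝ → Mat T} {τ : ℝ}

/-- The convex combination `(1 - τ) f₀ + τ f`. -/
noncomputable def mix (τ : ℝ) (f₀ f : ℝ → Mat T) (t : ℝ) : Mat T :=
  ((1 - τ : ℝ) : ℂ) • f₀ t + (τ : ℂ) • f t

lemma quadForm_mix (t : ℝ) (x : Fin T → ℂ) :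
    quadForm (mix τ f₀ f t) x = (1 - τ) * quadForm (f₀ t) x + τ * quadForm (f t) x := by
  rw [mix, quadForm_add_mat, quadForm_smul_mat, quadForm_smul_mat]

lemma IsSpectralDensity.mix (h0 : IsSpectralDensity f₀) (h : IsSpectralDensity f) (hτ : 0 ≤ τ)
    (hτ1 : τ ≤ 1) : IsSpectralDensity (mix τ f₀ f) := by
  refine ⟨fun i j => ?_, ?_⟩
  · simp only [GMForecast.mix, Matrix.add_apply, Matrix.smul_apply, smul_eq_mul]
    exact ((h0.1 i j).const_mul _).add ((h.1 i j).const_mul _)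
  · filter_upwards [h0.2, h.2] with t ht0 ht
    exact (ht0.smul (by exact_mod_cast sub_nonneg.2 hτ1)).add (ht.smul (by exact_mod_cast hτ))

variable {r : ℕ} {μ s : Fin r → ℕ} (d : Fin r → ℕ)

/-- The minimality condition at one end point is inherited by the segment, since
`(1 - τ) f₀ ≤ (1 - τ) f₀ + τ f`. -/
lemma Minimality.mix (h0 : IsSpectralDensity f₀) (h : IsSpectralDensity f)
    (hm : Minimality μ s d f₀) (hτ : 0 ≤ τ) (hτ1 : τ < 1) : Minimality μ s d (mix τ f₀ f) := by
  have hpos : 0 < 1 - τ := sub_pos.2 hτ1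
  have hpd : ∀ᵐ t ∂circ, (GMForecast.mix τ f₀ f t).PosDef := by
    filter_upwards [hm.1, h.2] with t ht0 ht
    exact (ht0.smul (by exact_mod_cast hpos)).add_posSemidef (ht.smul (by exact_mod_cast hτ))
  refine ⟨hpd, ?_⟩
  have hmeas : AEMeasurable (fun t => (((weight μ s d t)⁻¹ : ℝ) : ℂ) *
      ((GMForecast.mix τ f₀ f t)⁻¹).trace) circ := by
    refine (Complex.measurable_ofReal.comp (measurable_weight μ s d).inv).aemeasurable.mul ?_
    simp only [Matrix.trace, Matrix.diag]
    exact Finset.aemeasurable_fun_sum _ fun i _ =>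
      aemeasurable_inv_entry (h0.mix h hτ hτ1.le).aemeasurable i i
  refine Integrable.mono' (hm.2.norm.const_mul (1 - τ)⁻¹) hmeas.aestronglyMeasurable ?_
  filter_upwards [hpd, hm.1, h.2] with t h1 h2 h3
  have hn : ∀ {A : Mat T}, A.PosDef → ‖(A⁻¹).trace‖ = (A⁻¹).trace.re := fun hA => by
    have := Complex.norm_of_nonneg' hA.inv.posSemidef.trace_nonneg
    have h := congrArg Complex.re this
    rwa [Complex.ofReal_re] at h
  rw [norm_mul, norm_mul, hn h1, hn h2]
  have h4 : ((GMForecast.mix τ f₀ f t)⁻¹).trace.re ≤ (1 - τ)⁻¹ * ((f₀ t)⁻¹).trace.re := by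
    rw [trace_re_eq_sum, trace_re_eq_sum, Finset.mul_sum]
    refine Finset.sum_le_sum fun p _ => inv_diag_le_of_le h2 h1 hpos (fun x => ?_) p
    rw [quadForm_mix]
    have := quadForm_nonneg h3 x
    nlinarith
  calc _ ≤ ‖(((weight μ s d t)⁻¹ : ℝ) : ℂ)‖ * ((1 - τ)⁻¹ * ((f₀ t)⁻¹).trace.re) := by gcongr
    _ = _ := by ring

lemma sqNorm_mix (hs : ∀ j, 0 < s j) (h0 : IsSpectralDensity f₀) (h : IsSpectralDensity f)
    (hτ : 0 ≤ τ) (hτ1 : τ ≤ 1) {x : ℝ → Fin T → ℂ} (hx : AEMeasurable x circ) :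
    sqNorm (weighted μ s d (mix τ f₀ f)) x =
      ENNReal.ofReal (1 - τ) * sqNorm (weighted μ s d f₀) x +
        ENNReal.ofReal τ * sqNorm (weighted μ s d f) x := by
  have hg0 := h0.weighted (μ := μ) d hs
  have hg := h.weighted (μ := μ) d hs
  simp only [sqNorm_eq]
  rw [← lintegral_const_mul' _ _ ENNReal.ofReal_ne_top,
    ← lintegral_const_mul' _ _ ENNReal.ofReal_ne_top, ← lintegral_add_left'
      ((aemeasurable_quadForm hg0.aemeasurable hx).ennreal_ofReal.const_mul _)]
  refine lintegral_congr_ae ?_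
  filter_upwards [hg0.2, hg.2] with t h1 h2
  have h3 := sub_nonneg.2 hτ1
  rw [← ENNReal.ofReal_mul h3, ← ENNReal.ofReal_mul hτ,
    ← ENNReal.ofReal_add (mul_nonneg h3 (quadForm_nonneg h1 _))
      (mul_nonneg hτ (quadForm_nonneg h2 _))]
  congr 1
  simp only [weighted, quadForm_smul_mat, quadForm_mix]
  ring

/-- The minimal error is a concave function of the density. -/
lemma le_optErr_mix (hμ : ∀ j, 0 < μ j) (hs : ∀ j, 0 < s j) {b : ℕ → Fin T → ℂ}
    (hb : Summable fun k => ‖b k‖) (h0 : IsSpectralDensity f₀) (h : IsSpectralDensity f)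
    (hτ : 0 ≤ τ) (hτ1 : τ ≤ 1) :
    ENNReal.ofReal (1 - τ) * optErr μ s d b f₀ + ENNReal.ofReal τ * optErr μ s d b f ≤
      optErr μ s d b (mix τ f₀ f) := by
  have hg0 := h0.weighted (μ := μ) d hs
  rw [optErr_eq d hμ hs hb (h0.mix h hτ hτ1), optErr_eq d hμ hs hb h0, optErr_eq d hμ hs hb h]
  refine le_iInf₂ fun p hp => ?_
  rw [sqNorm_mix d hs h0 h hτ hτ1
    ((inL2_targetFun hb hg0).1.sub (negSpan_bounded hp).1.aemeasurable)]
  gcongr <;> exact iInf₂_le p hp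

lemma optErr_le_of_mix_half (hμ : ∀ j, 0 < μ j) (hs : ∀ j, 0 < s j) {b : ℕ → Fin T → ℂ}
    (hb : Summable fun k => ‖b k‖) (h0 : IsSpectralDensity f₀) (h : IsSpectralDensity f)
    (hle : optErr μ s d b (mix (1 / 2) f₀ f) ≤ optErr μ s d b f₀) :
    optErr μ s d b f ≤ optErr μ s d b f₀ := by
  have h1 := (le_optErr_mix (τ := 1 / 2) d hμ hs hb h0 h (by norm_num) (by norm_num)).trans hle
  have h2 := optErr_lt_top d hμ hs hb h0
  have h3 := optErr_lt_top d hμ hs hb h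
  rw [← ENNReal.ofReal_toReal h2.ne, ← ENNReal.ofReal_toReal h3.ne] at h1 ⊢
  rw [← ENNReal.ofReal_mul (by norm_num), ← ENNReal.ofReal_mul (by norm_num),
    ← ENNReal.ofReal_add (by positivity) (by positivity),
    ENNReal.ofReal_le_ofReal_iff ENNReal.toReal_nonneg] at h1
  exact ENNReal.ofReal_le_ofReal (by linarith)

end Mix

section Minimax

variable {r : ℕ} {μ s d : Fin r → ℕ} {b : ℕ → Fin T → ℂ} {D : Set (ℝ → Mat T)}
  {f₀ : ℝ → Mat T} {e : ℝ → Fin T → ℂ}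

/-- If the minimal error has a maximum at `f₀`, the error of the characteristic optimal for `f₀` has
a maximum there as well. The near-minimizers for `(1 - τ) f₀ + τ f` converge to the optimal
characteristic of `f₀` as `τ → 0`, and their errors under `f` do not exceed `Δ(f₀) + τ`. -/
theorem IsLeastFavourable.sqNorm_residual_le (hμ : ∀ j, 0 < μ j) (hs : ∀ j, 0 < s j)
    (hb : Summable fun k => ‖b k‖) (hD : ∀ f ∈ D, IsSpectralDensity f)
    (hconv : ∀ f ∈ D, ∀ f' ∈ D, ∀ τ : ℝ, 0 ≤ τ → τ ≤ 1 → mix τ f f' ∈ D)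
    (hm : Minimality μ s d f₀) (he : IsResidual (weighted μ s d f₀) b e)
    (hlf : IsLeastFavourable μ s d b D f₀) {f : ℝ → Mat T} (hf : f ∈ D) :
    sqNorm (weighted μ s d f) e ≤ sqNorm (weighted μ s d f₀) e := by
  have h0 := hD f₀ hlf.1
  have h := hD f hf
  have hg0 := h0.weighted (μ := μ) d hs
  have hg := h.weighted (μ := μ) d hs
  have hi := hm.invIntegrable d hμ hs
  have hΔ := he.optErr_eq d hμ hs hb h0
  set Δ : ℝ := ∫ t, quadForm (weighted μ s d f₀ t) (e t) ∂circ with hΔd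
  have hΔ0 : 0 ≤ Δ := integral_quadForm_nonneg hg0 e
  have hΔe : sqNorm (weighted μ s d f₀) e = ENNReal.ofReal Δ := sqNorm_eq_ofReal hg0 he.inL2
  set τ : ℕ → ℝ := fun n => (1 / 2) ^ (n + 1) with hτ
  have hτ0 : ∀ n, 0 < τ n := fun n => by positivity
  have hτ1 : ∀ n, τ n ≤ 1 / 2 := fun n => by
    simp only [hτ, pow_succ]
    have : ((1 : ℝ) / 2) ^ n ≤ 1 := pow_le_one₀ (by norm_num) (by norm_num)
    linarith
  have hex : ∀ n, ∃ p ∈ negSpan T,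
      sqNorm (weighted μ s d (mix (τ n) f₀ f)) (targetFun b - p) <
        ENNReal.ofReal (Δ + τ n ^ 2) := by
    intro n
    have h1 := hlf.2 _ (hconv f₀ hlf.1 f hf (τ n) (hτ0 n).le (by linarith [hτ1 n]))
    rw [hΔ, hΔe] at h1
    have h2 : optErr μ s d b (mix (τ n) f₀ f) < ENNReal.ofReal (Δ + τ n ^ 2) := by
      refine h1.trans_lt ((ENNReal.ofReal_lt_ofReal_iff ?_).2 ?_) <;> nlinarith [hτ0 n]
    rw [optErr_eq d hμ hs hb (h0.mix h (hτ0 n).le (by linarith [hτ1 n]))] at h2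
    simpa only [iInf_lt_iff, exists_prop] using h2
  choose p hp hlt using hex
  have hpL := fun n => negSpan_inL2 hg0 (p n) (hp n)
  have hBp := fun n => (inL2_targetFun hb hg0).sub hg0 (hpL n)
  have hBp' := fun n => (inL2_targetFun hb hg).sub hg (negSpan_inL2 hg (p n) (hp n))
  set E : ℕ → ℝ := fun n => ∫ t, quadForm (weighted μ s d f t) ((targetFun b - p n) t) ∂circ
  set X : ℕ → ℝ := fun n =>
    ∫ t, quadForm (weighted μ s d f₀ t) ((p n - (targetFun b - e)) t) ∂circ with hX
  have hpcl := fun n => inClosure_of_mem (g := weighted μ s d f₀) (hp n) (hpL n).1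
  have hXL := fun n => (hpL n).sub hg0 (he.closure.inL2 hg0 (negSpan_inL2 hg0))
  have hE0 : ∀ n, 0 ≤ E n := fun n => integral_quadForm_nonneg hg _
  have hX0 : ∀ n, 0 ≤ X n := fun n => integral_quadForm_nonneg hg0 _
  -- Pythagoras for `f₀` in the error of the near-minimizer; `X n` is its squared distance to the
  -- optimal characteristic of `f₀`, and `E n` its error under `f`
  have hmain : ∀ n, (1 - τ n) * (Δ + X n) + τ n * E n < Δ + τ n ^ 2 := by
    intro n
    have h1 := hlt n
    have h2 : 0 ≤ 1 - τ n := by linarith [hτ1 n]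
    rw [sqNorm_mix d hs h0 h (hτ0 n).le (by linarith [hτ1 n]) (hBp n).1,
      he.sqNorm_sub hg0 (hpcl n), hΔe, sqNorm_eq_ofReal hg0 (hXL n),
      sqNorm_eq_ofReal hg (hBp' n), ← ENNReal.ofReal_add hΔ0 (hX0 n), ← ENNReal.ofReal_mul h2,
      ← ENNReal.ofReal_mul (hτ0 n).le, ← ENNReal.ofReal_add
        (mul_nonneg h2 (add_nonneg hΔ0 (hX0 n))) (mul_nonneg (hτ0 n).le (hE0 n)),
      ENNReal.ofReal_lt_ofReal_iff (by have := hτ0 n; positivity)] at h1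
    exact h1
  have hXle : ∀ n, X n ≤ 2 * (Δ + 1) * τ n := fun n => by
    have h1 := hmain n
    have h2 := mul_nonneg (hτ0 n).le (hE0 n)
    nlinarith [hX0 n, hτ0 n, hτ1 n, mul_nonneg (hτ0 n).le (hX0 n)]
  have hEle : ∀ n, E n ≤ Δ + τ n := fun n => by
    have h1 := hmain n
    have h2 : 0 ≤ (1 - τ n) * X n := mul_nonneg (by linarith [hτ1 n]) (hX0 n)
    have h3 : τ n * E n ≤ τ n * (Δ + τ n) := by nlinarith
    exact le_of_mul_le_mul_left h3 (hτ0 n)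
  -- `∑ X n < ∞`, so that the near-minimizers converge almost everywhere
  have hlim : ∀ᵐ t ∂circ, Tendsto (fun n => (p n - (targetFun b - e)) t) atTop (𝓝 0) := by
    refine ae_tendsto_of_tsum_sqNorm hg0 hi.1 (fun n => (hXL n).1) ?_
    have h1 : ∀ n, sqNorm (weighted μ s d f₀) (p n - (targetFun b - e)) ≤
        ENNReal.ofReal (2 * (Δ + 1) * τ n) := fun n => by
      rw [sqNorm_eq_ofReal hg0 (hXL n)]
      exact ENNReal.ofReal_le_ofReal (hXle n)
    refine ne_top_of_le_ne_top ?_ (ENNReal.tsum_le_tsum h1)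
    rw [← ENNReal.ofReal_tsum_of_nonneg (fun n => by have := hτ0 n; positivity)]
    · exact ENNReal.ofReal_ne_top
    · refine Summable.mul_left _ ?_
      simp only [hτ, pow_succ]
      exact summable_geometric_two.mul_right _
  have hτlim : Tendsto τ atTop (𝓝 0) :=
    (tendsto_pow_atTop_nhds_zero_of_lt_one (by norm_num) (by norm_num)).comp (tendsto_add_atTop_nat 1)
  rw [hΔe]
  refine ENNReal.le_of_forall_pos_le_add fun ε hε _ => ?_
  refine sqNorm_le_of_tendsto hg (y := fun n => targetFun b - p n) (fun n => (hBp n).1) ?_ ?_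
  · filter_upwards [hlim] with t ht
    have h1 := ht.const_sub (e t)
    rw [sub_zero] at h1
    refine h1.congr fun n => ?_
    simp only [Pi.sub_apply]; abel
  · filter_upwards [hτlim.eventually_lt_const (show (0 : ℝ) < ε by exact_mod_cast hε)] with n hn
    rw [sqNorm_eq_ofReal hg (hBp' n)]
    refine (ENNReal.ofReal_le_ofReal (hEle n)).trans ?_
    rw [ENNReal.ofReal_add hΔ0 (hτ0 n).le]
    gcongr
    rw [← ENNReal.ofReal_coe_nnreal]
    exact ENNReal.ofReal_le_ofReal hn.le

/-- A characteristic optimal for `f₀` whose error under `f` is finite is admissible for `(f₀ + f)/2`,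
where the past consists of all functions with negative spectrum. -/
lemma IsResidual.inClosure_mix_half (hμ : ∀ j, 0 < μ j) (hs : ∀ j, 0 < s j)
    (hb : Summable fun k => ‖b k‖) (h0 : IsSpectralDensity f₀) (hm : Minimality μ s d f₀)
    (he : IsResidual (weighted μ s d f₀) b e) {f : ℝ → Mat T} (h : IsSpectralDensity f)
    (hfin : sqNorm (weighted μ s d f) e < ∞) :
    InClosure (weighted μ s d (mix (1 / 2) f₀ f)) (negSpan T) (targetFun b - e) := by
  have hg0 := h0.weighted (μ := μ) d hs
  have hmix := h0.mix h (τ := 1 / 2) (by norm_num) (by norm_num)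
  have hgm := hmix.weighted (μ := μ) d hs
  have hmm := Minimality.mix (f := f) (τ := 1 / 2) d h0 h hm (by norm_num) (by norm_num)
  refine inClosure_negSpan (hmm.invIntegrable d hμ hs) hgm
    ((inL2_targetFun hb hgm).sub hgm ⟨he.inL2.1, ?_⟩)
    fun p k => he.closure.integral_expi_mul (hm.invIntegrable d hμ hs) hg0 p k
  rw [sqNorm_mix d hs h0 h (by norm_num) (by norm_num) he.inL2.1]
  exact ENNReal.add_lt_top.2 ⟨ENNReal.mul_lt_top ENNReal.ofReal_lt_top he.inL2.2,
    ENNReal.mul_lt_top ENNReal.ofReal_lt_top hfin⟩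

/-- A characteristic optimal for `f₀` whose error under `f` is finite is admissible for `f`: the norm of
`L₂(f)` is dominated by that of `L₂((f₀ + f)/2)`. The density `f` itself need not satisfy the
minimality condition. -/
lemma IsResidual.inClosure_of_sqNorm_lt_top (hμ : ∀ j, 0 < μ j) (hs : ∀ j, 0 < s j)
    (hb : Summable fun k => ‖b k‖) (h0 : IsSpectralDensity f₀) (hm : Minimality μ s d f₀)
    (he : IsResidual (weighted μ s d f₀) b e) {f : ℝ → Mat T} (h : IsSpectralDensity f)
    (hfin : sqNorm (weighted μ s d f) e < ∞) :
    InClosure (weighted μ s d f) (negSpan T) (targetFun b - e) := by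
  have h1 := he.inClosure_mix_half hμ hs hb h0 hm h hfin
  refine ⟨h1.1, fun ε hε => ?_⟩
  obtain ⟨p, hp, hlt⟩ := h1.2 (ε / 2) (ENNReal.half_pos hε.ne')
  refine ⟨p, hp, ?_⟩
  rw [sqNorm_mix d hs h0 h (by norm_num) (by norm_num)
    (h1.1.sub (negSpan_bounded hp).1.aemeasurable)] at hlt
  have h2 : ENNReal.ofReal (1 / 2) * sqNorm (weighted μ s d f) (targetFun b - e - p) < ε / 2 :=
    le_add_self.trans_lt hlt
  rw [show ENNReal.ofReal (1 / 2) = 2⁻¹ by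
    rw [one_div, ENNReal.ofReal_inv_of_pos two_pos]; simp, mul_comm, ← div_eq_mul_inv] at h2
  exact (ENNReal.div_lt_div_iff_left (by simp) (by simp)).1 h2

/-- Saddle points: if the error of the characteristic optimal for `f₀` has a maximum at `f₀`, then
`f₀` is least favourable. -/
theorem isLeastFavourable_of_sqNorm_residual_le (hμ : ∀ j, 0 < μ j) (hs : ∀ j, 0 < s j)
    (hb : Summable fun k => ‖b k‖) (hD : ∀ f ∈ D, IsSpectralDensity f)
    (hm : Minimality μ s d f₀) (he : IsResidual (weighted μ s d f₀) b e) (hf₀ : f₀ ∈ D)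
    (hle : ∀ f ∈ D, sqNorm (weighted μ s d f) e ≤ sqNorm (weighted μ s d f₀) e) :
    IsLeastFavourable μ s d b D f₀ := by
  refine ⟨hf₀, fun f hf => ?_⟩
  have h0 := hD f₀ hf₀
  have h := hD f hf
  have hmix := h0.mix h (τ := 1 / 2) (by norm_num) (by norm_num)
  have hgm := hmix.weighted (μ := μ) d hs
  have hcl := he.inClosure_mix_half hμ hs hb h0 hm h ((hle f hf).trans_lt he.inL2.2)
  refine optErr_le_of_mix_half d hμ hs hb h0 h ?_
  rw [optErr_eq d hμ hs hb hmix, he.optErr_eq d hμ hs hb h0]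
  refine (hcl.iInf_sqNorm_le hgm (inL2_targetFun hb hgm).1).trans ?_
  rw [sub_sub_cancel, sqNorm_mix d hs h0 h (by norm_num) (by norm_num) he.inL2.1]
  calc _ ≤ ENNReal.ofReal (1 - 1 / 2) * sqNorm (weighted μ s d f₀) e +
        ENNReal.ofReal (1 / 2) * sqNorm (weighted μ s d f₀) e := by gcongr; exact hle f hf
    _ = sqNorm (weighted μ s d f₀) e := by
        rw [← add_mul, ← ENNReal.ofReal_add (by norm_num) (by norm_num)]; norm_num

/-- The minimal error at the densities satisfying the minimality condition determines the least
favourable densities, because `(f₀ + f)/2` satisfies it along with `f₀`. -/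
theorem isLeastFavourable_iff_solvesOptimization (hμ : ∀ j, 0 < μ j) (hs : ∀ j, 0 < s j)
    (hb : Summable fun k => ‖b k‖) (hD : ∀ f ∈ D, IsSpectralDensity f)
    (hconv : ∀ f ∈ D, ∀ f' ∈ D, ∀ τ : ℝ, 0 ≤ τ → τ ≤ 1 → mix τ f f' ∈ D)
    (h0 : IsSpectralDensity f₀) (hm : Minimality μ s d f₀)
    {c₀ : ℕ → Fin T → ℂ} {C₀ : ℝ → Fin T → ℂ} (hsol : IsSolution μ s d b f₀ c₀ C₀) :
    IsLeastFavourable μ s d b D f₀ ↔ f₀ ∈ D ∧ SolvesOptimization μ s d b D f₀ := by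
  constructor
  · refine fun hlf => ⟨hlf.1, fun f hf hmf c C c₁ C₁ h1 h2 => ?_⟩
    have h3 := hlf.2 f hf
    rw [(h1.pairing_eq d hμ hs hb (hD f hf) hmf).1, (h2.pairing_eq d hμ hs hb h0 hm).1,
      ENNReal.ofReal_le_ofReal_iff (h2.pairing_eq d hμ hs hb h0 hm).2] at h3
    exact h3
  · rintro ⟨hf₀, hopt⟩
    refine ⟨hf₀, fun f hf => ?_⟩
    have h := hD f hf
    have hmix := h0.mix h (τ := 1 / 2) (by norm_num) (by norm_num)
    have hmm := Minimality.mix (f := f) (τ := 1 / 2) d h0 h hm (by norm_num) (by norm_num)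
    obtain ⟨e, he⟩ := exists_isResidual (hmm.invIntegrable d hμ hs) (hmix.weighted (μ := μ) d hs) hb
    obtain ⟨c, C, hC⟩ := he.exists_isSolution d hμ hs hb hmix hmm
    refine optErr_le_of_mix_half d hμ hs hb h0 h ?_
    rw [(hC.pairing_eq d hμ hs hb hmix hmm).1, (hsol.pairing_eq d hμ hs hb h0 hm).1]
    exact ENNReal.ofReal_le_ofReal (hopt _
      (hconv f₀ hf₀ f hf _ (by norm_num) (by norm_num)) hmm _ _ _ _ hC hsol)

/-- Divided by `χ/β`, the explicit characteristic is `∑ b(k) e^{ikt}` minus the residual. -/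
lemma inv_kappa_smul_spectralCharacteristic {f : ℝ → Mat T} {C : ℝ → Fin T → ℂ} {t : ℝ}
    (hk : kappa μ s d t ≠ 0) :
    (kappa μ s d t)⁻¹ • spectralCharacteristic μ s d b f C t =
      targetFun b t - residual (μ := μ) (s := s) d f C t := by
  have h1 : (kappa μ s d t)⁻¹ * (conj (beta s d t) / chi μ s d (-t)) =
      (((weight μ s d t)⁻¹ : ℝ) : ℂ) := by
    have : conj (beta s d t) / chi μ s d (-t) = (conj (kappa μ s d t))⁻¹ := by
      rw [kappa, chi_neg, map_div₀, inv_div]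
    rw [this, ← mul_inv, Complex.mul_conj, Complex.normSq_eq_norm_sq, weight_eq]
    push_cast; ring
  rw [spectralCharacteristic, smul_sub, inv_smul_smul₀ hk, smul_smul, h1, residual, mulVec_transpose]

lemma err_spectralCharacteristic (hμ : ∀ j, 0 < μ j) (hs : ∀ j, 0 < s j) {f f' : ℝ → Mat T}
    {C : ℝ → Fin T → ℂ} :
    err μ s d b (spectralCharacteristic μ s d b f C) f' =
      sqNorm (weighted μ s d f') (residual (μ := μ) (s := s) d f C) := by
  rw [err_eq d hμ hs]
  refine sqNorm_congr_ae ?_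
  filter_upwards [kappa_ne_zero_ae d hμ hs] with t ht
  rw [Pi.sub_apply, inv_kappa_smul_spectralCharacteristic ht, sub_sub_cancel]

/-- The characteristic optimal for a least favourable density is the unique minimax-robust one. -/
theorem IsLeastFavourable.minimax (hμ : ∀ j, 0 < μ j) (hs : ∀ j, 0 < s j)
    (hb : Summable fun k => ‖b k‖) (hD : ∀ f ∈ D, IsSpectralDensity f)
    (hconv : ∀ f ∈ D, ∀ f' ∈ D, ∀ τ : ℝ, 0 ≤ τ → τ ≤ 1 → mix τ f f' ∈ D)
    (h0 : IsSpectralDensity f₀) (hm : Minimality μ s d f₀)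
    {c₀ : ℕ → Fin T → ℂ} {C₀ : ℝ → Fin T → ℂ} (hsol : IsSolution μ s d b f₀ c₀ C₀)
    (hlf : IsLeastFavourable μ s d b D f₀) :
    IsMinimaxRobust μ s d b D (spectralCharacteristic μ s d b f₀ C₀) ∧
    (∀ h, IsMinimaxRobust μ s d b D h →
      ∀ᵐ t ∂circ, h t = spectralCharacteristic μ s d b f₀ C₀ t) ∧
    IsOptimal μ s d b f₀ (spectralCharacteristic μ s d b f₀ C₀) ∧
    ∀ f ∈ D, err μ s d b (spectralCharacteristic μ s d b f₀ C₀) f ≤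
      err μ s d b (spectralCharacteristic μ s d b f₀ C₀) f₀ := by
  have hg0 := h0.weighted (μ := μ) d hs
  have he := hsol.isResidual d hμ hs hb h0 hm
  set e := residual (μ := μ) (s := s) d f₀ C₀
  set h₀ := spectralCharacteristic μ s d b f₀ C₀
  have hae : (fun t => (kappa μ s d t)⁻¹ • h₀ t) =ᵐ[circ] targetFun b - e := by
    filter_upwards [kappa_ne_zero_ae d hμ hs] with t ht
    exact inv_kappa_smul_spectralCharacteristic ht
  have herr : ∀ f', err μ s d b h₀ f' = sqNorm (weighted μ s d f') e := fun f' =>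
    err_spectralCharacteristic hμ hs
  have hsat : ∀ f ∈ D, sqNorm (weighted μ s d f) e ≤ sqNorm (weighted μ s d f₀) e := fun f hf =>
    hlf.sqNorm_residual_le hμ hs hb hD hconv hm he hf
  have hsat' : ∀ f ∈ D, err μ s d b h₀ f ≤ err μ s d b h₀ f₀ := fun f hf => by
    rw [herr, herr]; exact hsat f hf
  -- the saddle point inequality makes the errors finite, hence `h₀` admissible for the whole class
  have hcommon : h₀ ∈ commonPast μ s d D := fun f hf => by
    rw [inPast_iff d hμ hs]
    exact (he.inClosure_of_sqNorm_lt_top hμ hs hb h0 hm (hD f hf)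
      ((hsat f hf).trans_lt he.inL2.2)).congr_ae hae.symm
  -- by Pythagoras under `f₀` a minimax-robust characteristic cannot differ from `h₀`
  have hpyth : ∀ h, InPast μ s d f₀ h → err μ s d b h f₀ = err μ s d b h₀ f₀ +
      sqNorm (weighted μ s d f₀) ((fun t => (kappa μ s d t)⁻¹ • h t) - (targetFun b - e)) := by
    intro h hh
    rw [err_eq d hμ hs, he.sqNorm_sub hg0 ((inPast_iff d hμ hs _ _).1 hh), herr]
  have hopt : IsOptimal μ s d b f₀ h₀ := ⟨hcommon f₀ hlf.1, fun h hh => by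
    rw [hpyth h hh]; exact le_self_add⟩
  have hsup : (⨆ f ∈ D, err μ s d b h₀ f) ≤ err μ s d b h₀ f₀ := iSup₂_le hsat'
  refine ⟨⟨hcommon, fun h hh => ?_⟩, fun h hh => ?_, hopt, hsat'⟩
  · exact hsup.trans ((hopt.2 h (hh f₀ hlf.1)).trans (le_iSup₂ (f := fun f _ => err μ s d b h f)
      f₀ hlf.1))
  · have h1 : err μ s d b h f₀ ≤ err μ s d b h₀ f₀ :=
      (le_iSup₂ (f := fun f _ => err μ s d b h f) f₀ hlf.1).trans ((hh.2 h₀ hcommon).trans hsup)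
    have hin := hh.1 f₀ hlf.1
    rw [hpyth h hin] at h1
    have hfin : err μ s d b h₀ f₀ ≠ ∞ := by rw [herr]; exact he.inL2.2.ne
    have h2 : sqNorm (weighted μ s d f₀)
        ((fun t => (kappa μ s d t)⁻¹ • h t) - (targetFun b - e)) = 0 := by
      have : err μ s d b h₀ f₀ + sqNorm (weighted μ s d f₀)
          ((fun t => (kappa μ s d t)⁻¹ • h t) - (targetFun b - e)) ≤ err μ s d b h₀ f₀ + 0 := by
        rwa [add_zero]
      exact le_antisymm ((ENNReal.add_le_add_iff_left hfin).1 this) zero_le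
    have hm1 : AEMeasurable ((fun t => (kappa μ s d t)⁻¹ • h t) - (targetFun b - e)) circ :=
      ((inPast_iff d hμ hs _ _).1 hin).1.sub he.closure.1
    rw [sqNorm_eq, lintegral_eq_zero_iff'
      (aemeasurable_quadForm hg0.aemeasurable hm1).ennreal_ofReal] at h2
    filter_upwards [h2, hm.1, weight_pos_ae d hμ hs, kappa_ne_zero_ae d hμ hs, hae]
      with t h3 h4 h5 h6 h7
    have h8 : ((fun t => (kappa μ s d t)⁻¹ • h t) - (targetFun b - e)) t = 0 := by
      by_contra hne
      have := quadForm_pos (posDef_weighted d h5 h4) hne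
      have h9 := ENNReal.ofReal_eq_zero.1 h3
      linarith
    rw [Pi.sub_apply, sub_eq_zero, ← h7] at h8
    simpa [smul_right_inj (inv_ne_zero h6)] using h8

end Minimax

/-! ### Canonical factorizations -/


section Factorization

variable {T q : ℕ} {g : ℝ → Mat T} {b : ℕ → Fin T → ℂ} {e : ℝ → Fin T → ℂ}
  {φ : ℕ → Matrix (Fin T) (Fin q) ℂ} {Φ : ℝ → Matrix (Fin T) (Fin q) ℂ}

lemma sesqForm_mul_conjTranspose (A : Matrix (Fin T) (Fin q) ℂ) (x y : Fin T → ℂ) :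
    sesqForm (A * Aᴴ) x y = (Aᵀ *ᵥ x) ⬝ᵥ star (Aᵀ *ᵥ y) := by
  have h : Aᵀᴴᵀ = Aᴴ := by ext i j; simp
  rw [sesqForm, ← mulVec_mulVec, dotProduct_mulVec, star_mulVec, ← mulVec_transpose,
    ← mulVec_transpose Aᵀᴴ, h]

lemma quadForm_mul_conjTranspose (A : Matrix (Fin T) (Fin q) ℂ) (x : Fin T → ℂ) :
    quadForm (A * Aᴴ) x = ∑ i, ‖(Aᵀ *ᵥ x) i‖ ^ 2 := by
  rw [quadForm_eq_re, sesqForm_mul_conjTranspose, dotProduct, Complex.re_sum]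
  refine Finset.sum_congr rfl fun i _ => ?_
  rw [Pi.star_apply, Complex.star_def, Complex.mul_conj, Complex.normSq_eq_norm_sq,
    Complex.ofReal_re]

lemma aemeasurable_transpose_mulVec (hΦ : ∀ i j, AEMeasurable (fun t => Φ t i j) circ)
    {x : ℝ → Fin T → ℂ} (hx : AEMeasurable x circ) :
    AEMeasurable (fun t => (Φ t)ᵀ *ᵥ x t) circ := by
  refine aemeasurable_pi_lambda _ fun i => ?_
  simp only [mulVec, dotProduct, transpose_apply]
  exact Finset.aemeasurable_fun_sum _ fun j _ => (hΦ j i).mul (aemeasurable_pi_iff.1 hx j)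

lemma norm_transpose_mulVec_le {A : Matrix (Fin T) (Fin q) ℂ} {G : Mat T} (hG : G = A * Aᴴ)
    (x : Fin T → ℂ) {δ : ℝ} (hδ : 0 < δ) (i : Fin q) :
    ‖(Aᵀ *ᵥ x) i‖ ≤ δ + δ⁻¹ * quadForm G x := by
  have h1 : ‖(Aᵀ *ᵥ x) i‖ ^ 2 ≤ quadForm G x := by
    rw [hG, quadForm_mul_conjTranspose]
    exact Finset.single_le_sum (f := fun i => ‖(Aᵀ *ᵥ x) i‖ ^ 2) (fun _ _ => by positivity)
      (Finset.mem_univ i)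
  have h2 : δ⁻¹ * ‖(Aᵀ *ᵥ x) i‖ ^ 2 ≤ δ⁻¹ * quadForm G x := by gcongr
  refine le_trans ?_ (add_le_add_right h2 δ)
  have h3 : 0 ≤ δ⁻¹ * (‖(Aᵀ *ᵥ x) i‖ - δ) ^ 2 := by positivity
  have h4 : δ⁻¹ * (‖(Aᵀ *ᵥ x) i‖ - δ) ^ 2 =
      δ⁻¹ * ‖(Aᵀ *ᵥ x) i‖ ^ 2 - 2 * ‖(Aᵀ *ᵥ x) i‖ + δ := by field_simp; ring
  have h5 := norm_nonneg ((Aᵀ *ᵥ x) i)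
  linarith

lemma integrable_transpose_mulVec_factor (hΦm : ∀ i j, AEMeasurable (fun t => Φ t i j) circ)
    (hfac : ∀ᵐ t ∂circ, g t = Φ t * (Φ t)ᴴ) (hg : IsSpectralDensity g) {x : ℝ → Fin T → ℂ}
    (hx : InL2 g x) (i : Fin q) : Integrable (fun t => ((Φ t)ᵀ *ᵥ x t) i) circ := by
  refine Integrable.mono' ((integrable_const (1 : ℝ)).add (hx.integrable_quadForm hg))
    (aemeasurable_pi_iff.1 (aemeasurable_transpose_mulVec hΦm hx.1) i).aestronglyMeasurable ?_
  filter_upwards [hfac] with t ht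
  simpa using norm_transpose_mulVec_le ht (x t) one_pos i

/-- The Cauchy–Schwarz inequality, linearized with a parameter `δ`; the norm of `z` is the supremum
norm. -/
lemma norm_dotProduct_star_le (x z : Fin q → ℂ) {δ : ℝ} (hδ : 0 < δ) :
    ‖x ⬝ᵥ star z‖ ≤ δ * ∑ i, ‖x i‖ ^ 2 + δ⁻¹ * (q * ‖z‖ ^ 2) := by
  have h1 : ‖x ⬝ᵥ star z‖ ≤ ∑ i, ‖x i‖ * ‖z‖ := by
    refine (norm_sum_le _ _).trans (Finset.sum_le_sum fun i _ => ?_)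
    rw [norm_mul, Pi.star_apply, norm_star]
    gcongr
    exact norm_le_pi_norm z i
  have h2 : ∀ i, ‖x i‖ * ‖z‖ ≤ δ * ‖x i‖ ^ 2 + δ⁻¹ * ‖z‖ ^ 2 := fun i => by
    have h3 : 0 ≤ δ⁻¹ * (δ * ‖x i‖ - ‖z‖) ^ 2 := by positivity
    have h4 : δ⁻¹ * (δ * ‖x i‖ - ‖z‖) ^ 2 =
        δ * ‖x i‖ ^ 2 + δ⁻¹ * ‖z‖ ^ 2 - 2 * (‖x i‖ * ‖z‖) := by field_simp; ring
    have h5 : 0 ≤ ‖x i‖ * ‖z‖ := by positivity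
    linarith
  refine h1.trans ((Finset.sum_le_sum fun i _ => h2 i).trans_eq ?_)
  rw [Finset.sum_add_distrib, ← Finset.mul_sum, Finset.sum_const, Finset.card_univ,
    Fintype.card_fin, nsmul_eq_mul]
  ring

/-- The negative Fourier coefficients of `Φᵀ e` vanish: the residual is orthogonal to the past,
whose image under `Φᵀ` is dense in the past of `ℂ^q`-valued functions because the factorization is
canonical. -/
lemma integral_expi_mul_factor_neg (hΦm : ∀ i j, AEMeasurable (fun t => Φ t i j) circ)
    (hfac : ∀ᵐ t ∂circ, g t = Φ t * (Φ t)ᴴ)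
    (hcan : ∀ (v : Fin q → ℂ) (ε : ℝ≥0∞), 0 < ε → ∃ (N : ℕ) (x : ℕ → Fin T → ℂ),
      ∫⁻ t, ‖v - ∑ k ∈ Finset.range N,
        Complex.exp (-(Complex.I * k * t)) • ((Φ t)ᵀ *ᵥ x k)‖ₑ ^ 2 ∂circ < ε)
    (hg : IsSpectralDensity g) (he : InL2 g e)
    (horth : ∀ p ∈ negSpan T, ∫ t, sesqForm (g t) (e t) (p t) ∂circ = 0) (j : ℕ) (i : Fin q) :
    ∫ t, expi ((j : ℤ) + 1) t * ((Φ t)ᵀ *ᵥ e t) i ∂circ = 0 := by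
  set v : Fin q → ℂ := Pi.single i 1 with hv
  have hstar : star v = v := by
    rw [hv]; ext k
    by_cases h : k = i
    · subst h; simp
    · simp [h]
  set A : ℝ := ∫ t, quadForm (g t) (e t) ∂circ with hA
  have hA0 : 0 ≤ A := integral_quadForm_nonneg hg e
  have hRi := integrable_transpose_mulVec_factor hΦm hfac hg he
  have key : ∀ δ : ℝ, 0 < δ →
      ‖∫ t, expi ((j : ℤ) + 1) t * ((Φ t)ᵀ *ᵥ e t) i ∂circ‖ ≤ δ * A + δ := by
    intro δ hδ
    obtain ⟨N, x, hx⟩ := hcan v (ENNReal.ofReal (δ * δ / (q + 1))) (by positivity)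
    set y : ℝ → Fin q → ℂ := fun t => ∑ k ∈ Finset.range N,
        Complex.exp (-(Complex.I * k * t)) • ((Φ t)ᵀ *ᵥ x k) with hy
    set p : ℝ → Fin T → ℂ := ∑ k ∈ Finset.range N,
      fun t => expi (-(((k + j : ℕ) : ℤ) + 1)) t • x k with hp
    have hpm : p ∈ negSpan T :=
      Submodule.sum_mem _ fun k _ => expi_smul_mem_negSpan (k + j) (x k)
    have hpy : ∀ t, (Φ t)ᵀ *ᵥ p t = expi (-((j : ℤ) + 1)) t • y t := fun t => by
      rw [hp, hy, Finset.sum_apply, Matrix.mulVec_sum, Finset.smul_sum]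
      refine Finset.sum_congr rfl fun k _ => ?_
      rw [mulVec_smul, expi_neg_nat_eq, smul_smul, ← expi_add]
      congr 2; push_cast; ring
    have hyL : AEMeasurable y circ := by
      have h1 : AEMeasurable (fun t => expi ((j : ℤ) + 1) t • ((Φ t)ᵀ *ᵥ p t)) circ :=
        (continuous_expi _).measurable.aemeasurable.smul
          (aemeasurable_transpose_mulVec hΦm (negSpan_inL2 hg p hpm).1)
      refine h1.congr (ae_of_all _ fun t => ?_)
      simp only [hpy, smul_smul, ← expi_add]
      simp
    have hzm : AEMeasurable (fun t => v - y t) circ := hyL.const_sub v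
    have hzi : Integrable (fun t => ‖v - y t‖ ^ 2) circ := by
      refine ⟨(hzm.norm.pow_const 2).aestronglyMeasurable, ?_⟩
      refine lt_of_le_of_lt (lintegral_mono fun t => le_of_eq ?_) (hx.trans ENNReal.ofReal_lt_top)
      rw [enorm_pow, enorm_norm]
    have hzs : ∫ t, ‖v - y t‖ ^ 2 ∂circ < δ * δ / (q + 1) := by
      rw [← ENNReal.ofReal_lt_ofReal_iff (by positivity),
        ofReal_integral_eq_lintegral_ofReal hzi (ae_of_all _ fun t => by positivity)]
      refine lt_of_le_of_lt (lintegral_mono fun t => le_of_eq ?_) hx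
      rw [ENNReal.ofReal_pow (norm_nonneg _), ofReal_norm]
    have hs0 : ∀ᵐ t ∂circ, sesqForm (g t) (e t) (p t) =
        expi ((j : ℤ) + 1) t * ((Φ t)ᵀ *ᵥ e t) ⬝ᵥ star (y t) := by
      filter_upwards [hfac] with t ht
      rw [ht, sesqForm_mul_conjTranspose, hpy, star_smul, dotProduct_smul, Complex.star_def,
        conj_expi, neg_neg, smul_eq_mul]
    have hsi : Integrable (fun t => expi ((j : ℤ) + 1) t * ((Φ t)ᵀ *ᵥ e t) ⬝ᵥ star (y t)) circ :=
      (integrable_sesqForm hg he (negSpan_inL2 hg p hpm)).congr hs0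
    have hs1 : ∫ t, expi ((j : ℤ) + 1) t * ((Φ t)ᵀ *ᵥ e t) ⬝ᵥ star (y t) ∂circ = 0 := by
      rw [← integral_congr_ae hs0, horth p hpm]
    have hsplit : ∀ t, expi ((j : ℤ) + 1) t * ((Φ t)ᵀ *ᵥ e t) i -
        expi ((j : ℤ) + 1) t * ((Φ t)ᵀ *ᵥ e t) ⬝ᵥ star (y t) =
        expi ((j : ℤ) + 1) t * ((Φ t)ᵀ *ᵥ e t) ⬝ᵥ star (v - y t) := fun t => by
      rw [star_sub, dotProduct_sub, hstar, hv, dotProduct_single_one, mul_sub]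
    have h1 : ∫ t, expi ((j : ℤ) + 1) t * ((Φ t)ᵀ *ᵥ e t) i ∂circ =
        ∫ t, expi ((j : ℤ) + 1) t * ((Φ t)ᵀ *ᵥ e t) ⬝ᵥ star (v - y t) ∂circ := by
      simp_rw [← hsplit]
      rw [integral_sub (integrable_expi_mul (hRi i) _) hsi, hs1, sub_zero]
    rw [h1]
    calc _ ≤ ∫ t, (δ * quadForm (g t) (e t) + δ⁻¹ * (q * ‖v - y t‖ ^ 2)) ∂circ := by
          refine norm_integral_le_of_norm_le (((he.integrable_quadForm hg).const_mul _).add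
            ((hzi.const_mul _).const_mul _)) ?_
          filter_upwards [hfac] with t ht
          rw [norm_mul, norm_expi, one_mul, ht, quadForm_mul_conjTranspose]
          exact norm_dotProduct_star_le _ _ hδ
      _ = δ * A + δ⁻¹ * (q * ∫ t, ‖v - y t‖ ^ 2 ∂circ) := by
          rw [integral_add ((he.integrable_quadForm hg).const_mul _)
            ((hzi.const_mul _).const_mul _), integral_const_mul, integral_const_mul,
            integral_const_mul]
      _ ≤ δ * A + δ⁻¹ * ((q + 1) * (δ * δ / (q + 1))) := by
          have : (0 : ℝ) ≤ ∫ t, ‖v - y t‖ ^ 2 ∂circ := integral_nonneg fun t => by positivity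
          gcongr
          linarith
      _ = δ * A + δ := by field_simp
  refine norm_le_zero_iff.1 (le_of_forall_pos_le_add fun ε hε => ?_)
  have := key (ε / (A + 1)) (by positivity)
  refine this.trans (le_of_eq ?_)
  field_simp; ring

lemma integral_expi_mul_factor_negSpan (hΦi : ∀ i j, Integrable (fun t => Φ t i j) circ)
    (hser : ∀ i j, ∀ k : ℤ, k < 0 → ∫ t, expi k t * Φ t i j ∂circ = 0)
    {p : ℝ → Fin T → ℂ} (hp : p ∈ negSpan T) (k : ℕ) (i : Fin q) :
    Integrable (fun t => expi (-(k : ℤ)) t * ((Φ t)ᵀ *ᵥ p t) i) circ ∧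
      ∫ t, expi (-(k : ℤ)) t * ((Φ t)ᵀ *ᵥ p t) i ∂circ = 0 := by
  induction hp using Submodule.span_induction with
  | mem x hx =>
    obtain ⟨⟨j, v⟩, rfl⟩ := hx
    have h1 : ∀ t, expi (-(k : ℤ)) t * ((Φ t)ᵀ *ᵥ (expi (-((j : ℤ) + 1)) t • v)) i =
        ∑ l, expi (-(k : ℤ) + -((j : ℤ) + 1)) t * Φ t l i * v l := fun t => by
      rw [mulVec_smul, expi_add, Pi.smul_apply, smul_eq_mul, mulVec, dotProduct, Finset.mul_sum,
        Finset.mul_sum]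
      exact Finset.sum_congr rfl fun l _ => by rw [transpose_apply]; ring
    have h2 : ∀ l, Integrable
        (fun t => expi (-(k : ℤ) + -((j : ℤ) + 1)) t * Φ t l i * v l) circ := fun l =>
      (integrable_expi_mul (hΦi l i) _).mul_const _
    simp only [h1]
    refine ⟨integrable_finsetSum _ fun l _ => h2 l, ?_⟩
    rw [integral_finsetSum _ fun l _ => h2 l]
    refine Finset.sum_eq_zero fun l _ => ?_
    rw [integral_mul_const, hser l i _ (by omega), zero_mul]
  | zero => simp
  | add x y _ _ hx hy =>
    simp only [Pi.add_apply, mulVec_add, mul_add]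
    exact ⟨hx.1.add hy.1, by rw [integral_add hx.1 hy.1, hx.2, hy.2, add_zero]⟩
  | smul a x _ hx =>
    simp only [Pi.smul_apply, mulVec_smul, smul_eq_mul, mul_left_comm _ a]
    exact ⟨hx.1.const_mul a, by rw [integral_const_mul, hx.2, mul_zero]⟩

/-- The image under `Φᵀ` of the past has negative spectrum, as `Φ` has nonpositive spectrum. -/
lemma InClosure.integral_expi_mul_factor (hΦi : ∀ i j, Integrable (fun t => Φ t i j) circ)
    (hfac : ∀ᵐ t ∂circ, g t = Φ t * (Φ t)ᴴ)
    (hser : ∀ i j, ∀ k : ℤ, k < 0 → ∫ t, expi k t * Φ t i j ∂circ = 0)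
    (hg : IsSpectralDensity g) {h : ℝ → Fin T → ℂ} (hh : InClosure g (negSpan T) h) (k : ℕ)
    (i : Fin q) : ∫ t, expi (-(k : ℤ)) t * ((Φ t)ᵀ *ᵥ h t) i ∂circ = 0 := by
  have hhL := hh.inL2 hg (negSpan_inL2 hg)
  have hΦm := fun i j => (hΦi i j).aemeasurable
  have hi := integrable_expi_mul (integrable_transpose_mulVec_factor hΦm hfac hg hhL i) (-(k : ℤ))
  refine norm_le_zero_iff.1 (le_of_forall_pos_le_add fun ε hε => ?_)
  have hδ : 0 < ε / 2 := half_pos hε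
  obtain ⟨p, hp, hlt⟩ := hh.exists_integral_lt hg (negSpan_inL2 hg) (mul_pos hδ hδ)
  have hpL := hhL.sub hg (negSpan_inL2 hg p hp)
  obtain ⟨h1, h2⟩ := integral_expi_mul_factor_negSpan hΦi hser hp k i
  have h3 : ∫ t, expi (-(k : ℤ)) t * ((Φ t)ᵀ *ᵥ h t) i ∂circ =
      ∫ t, expi (-(k : ℤ)) t * ((Φ t)ᵀ *ᵥ (h t - p t)) i ∂circ := by
    simp only [mulVec_sub, Pi.sub_apply, mul_sub]
    rw [integral_sub hi h1, h2, sub_zero]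
  rw [h3, zero_add]
  calc _ ≤ ∫ t, (ε / 2 + (ε / 2)⁻¹ * quadForm (g t) (h t - p t)) ∂circ := by
        refine norm_integral_le_of_norm_le ((integrable_const _).add
          ((hpL.integrable_quadForm hg).const_mul _)) ?_
        filter_upwards [hfac] with t ht
        rw [norm_mul, norm_expi, one_mul]
        exact norm_transpose_mulVec_le ht _ hδ i
    _ = ε / 2 + (ε / 2)⁻¹ * ∫ t, quadForm (g t) (h t - p t) ∂circ := by
        have h4 : Integrable (fun t => quadForm (g t) (h t - p t)) circ :=
          hpL.integrable_quadForm hg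
        rw [integral_add (integrable_const _) (h4.const_mul _), integral_const_mul]
        simp
    _ ≤ ε / 2 + (ε / 2)⁻¹ * (ε / 2 * (ε / 2)) := by gcongr
    _ = ε := by field_simp; ring

/-- The Fourier coefficients of nonnegative index of `Φᵀ ∑ b(k) e^{ikt}` are the transformed
coefficients. -/
lemma integral_expi_mul_factor_targetFun (hΦi : ∀ i j, Integrable (fun t => Φ t i j) circ)
    (hser : ∀ i j, ∀ k : ℤ, ∫ t, expi k t * Φ t i j ∂circ = if 0 ≤ k then φ k.toNat i j else 0)
    (hb : Summable fun k => ‖b k‖) (k : ℕ) (i : Fin q) :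
    ∫ t, expi (-(k : ℤ)) t * ((Φ t)ᵀ *ᵥ targetFun b t) i ∂circ = transformedCoeff b φ k i := by
  have h1 : ∀ p, HasSum (fun m : ℕ => φ m p i * b (m + k) p)
      (∫ t, targetFun b t p * (expi (-(k : ℤ)) t * Φ t p i) ∂circ) := fun p => by
    have h2 := hasSum_integral_targetFun hb (integrable_expi_mul (hΦi p i) (-(k : ℤ))) p
    have h3 : ∀ n : ℕ, b n p * ∫ t, expi n t * (expi (-(k : ℤ)) t * Φ t p i) ∂circ =
        b n p * if k ≤ n then φ (n - k) p i else 0 := fun n => by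
      simp only [← mul_assoc, ← expi_add, hser]
      by_cases hkn : k ≤ n
      · rw [if_pos (by omega), if_pos hkn]
        congr 2; omega
      · rw [if_neg (by omega), if_neg hkn]
    simp only [h3] at h2
    rw [← hasSum_nat_add_iff' k, Finset.sum_eq_zero, sub_zero] at h2
    · refine h2.congr_fun fun m => ?_
      rw [if_pos (by omega), Nat.add_sub_cancel, mul_comm]
    · intro n hn
      rw [if_neg (by have := Finset.mem_range.1 hn; omega), mul_zero]
  have h4 : ∫ t, expi (-(k : ℤ)) t * ((Φ t)ᵀ *ᵥ targetFun b t) i ∂circ =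
      ∑ p, ∫ t, targetFun b t p * (expi (-(k : ℤ)) t * Φ t p i) ∂circ := by
    rw [← integral_finsetSum]
    · refine integral_congr_ae (ae_of_all _ fun t => ?_)
      simp only [mulVec, dotProduct, transpose_apply, Finset.mul_sum]
      exact Finset.sum_congr rfl fun p _ => by ring
    · intro p _
      refine (integrable_expi_mul (hΦi p i) _).bdd_mul (c := ∑' k, ‖b k‖)
        ((continuous_apply p).comp (continuous_targetFun hb)).aestronglyMeasurable
        (ae_of_all _ fun t => norm_targetFun_le hb t p)
  rw [h4, transformedCoeff]
  have h5 := (hasSum_sum fun p (_ : p ∈ Finset.univ) => h1 p).tsum_eq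
  rw [← h5]
  rfl

end Factorization

section Equations

variable {r T q : ℕ} {μ s : Fin r → ℕ} (d : Fin r → ℕ) {f₀ : ℝ → Mat T} {b : ℕ → Fin T → ℂ}
  {e : ℝ → Fin T → ℂ}
  {φ : ℕ → Matrix (Fin T) (Fin q) ℂ} {Φ : ℝ → Matrix (Fin T) (Fin q) ℂ}

/-- The Fourier series of `Φᵀ e`, where `e` is the residual. -/
theorem IsResidual.hasFourierSeries_factor (hs : ∀ j, 0 < s j) (hb : Summable fun k => ‖b k‖)
    (h0 : IsSpectralDensity f₀) (he : IsResidual (weighted μ s d f₀) b e)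
    (hΦ : IsCanonicalFactorization μ s d f₀ φ Φ) :
    HasFourierSeries (fun t => (Φ t)ᵀ *ᵥ e t) (transformedCoeff b φ) := by
  have hg := h0.weighted (μ := μ) d hs
  have hΦi : ∀ i j, Integrable (fun t => Φ t i j) circ := fun i j =>
    (hΦ.memLp i j).integrable one_le_two
  have hΦm := fun i j => (hΦi i j).aemeasurable
  have hser : ∀ i j, ∀ k : ℤ,
      ∫ t, expi k t * Φ t i j ∂circ = if 0 ≤ k then φ k.toNat i j else 0 := hΦ.series
  have hser' : ∀ i j, ∀ k : ℤ, k < 0 → ∫ t, expi k t * Φ t i j ∂circ = 0 := fun i j k hk => by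
    rw [hser, if_neg (not_le.2 hk)]
  have hfac : ∀ᵐ t ∂circ, weighted μ s d f₀ t = Φ t * (Φ t)ᴴ := hΦ.factorization
  have hRi := fun {x : ℝ → Fin T → ℂ} (hx : InL2 (weighted μ s d f₀) x) =>
    integrable_transpose_mulVec_factor hΦm hfac hg hx
  refine fun i => ⟨hRi he.inL2 i, fun k => ?_⟩
  simp only [expi_neg_eq]
  split_ifs with hk
  · lift k to ℕ using hk
    rw [Int.toNat_natCast, ← integral_expi_mul_factor_targetFun hΦi hser hb k i]
    have h1 := he.closure.integral_expi_mul_factor hΦi hfac hser' hg k i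
    simp only [Pi.sub_apply, mulVec_sub, mul_sub] at h1
    rw [integral_sub (integrable_expi_mul (hRi (inL2_targetFun hb hg) i) _)
      (integrable_expi_mul (hRi he.inL2 i) _), sub_eq_zero] at h1
    exact h1.symm
  · obtain ⟨j, rfl⟩ : ∃ j : ℕ, k = -((j : ℤ) + 1) := ⟨(-k - 1).toNat, by omega⟩
    rw [neg_neg]
    exact integral_expi_mul_factor_neg hΦm hfac hΦ.canonical hg he.inL2 he.orthogonal j i

/-- With `R = Φᵀ e` the factorized equation holds for `L = e e*`. -/
lemma factorizedEquation_residual :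
    FactorizedEquation Φ (fun t => (Φ t)ᵀ *ᵥ e t) fun t => vecMulVec (e t) (star (e t)) := by
  refine ae_of_all _ fun t => ?_
  rw [mul_vecMulVec, vecMulVec_mul, star_mulVec]
  congr 2

/-- Multiplication of the factorized equation by `Φ̄` from the left and by `Φᵀ` from the right gives the
main equation, since `C₀ = Φ̄ Φᵀ e`. -/
lemma FactorizedEquation.mainEquation {C₀ : ℝ → Fin T → ℂ} {L : ℝ → Mat T}
    (hfac : ∀ᵐ t ∂circ, (weight μ s d t : ℂ) • f₀ t = Φ t * (Φ t)ᴴ)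
    (hC : ∀ᵐ t ∂circ, (weighted μ s d f₀ t)ᵀ *ᵥ e t = C₀ t)
    (h : FactorizedEquation Φ (fun t => (Φ t)ᵀ *ᵥ e t) L) : MainEquation μ s d f₀ C₀ L := by
  filter_upwards [h, hfac, hC] with t h1 h2 h3
  have h4 : (weight μ s d t : ℂ) • (f₀ t)ᵀ = (Φ t).map conj * (Φ t)ᵀ := by
    rw [← transpose_smul, h2, transpose_mul, conjTranspose, transpose_map, transpose_transpose]
    rfl
  have h5 : C₀ t = (Φ t).map conj *ᵥ ((Φ t)ᵀ *ᵥ e t) := by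
    rw [← h3, weighted, transpose_smul, h4, mulVec_mulVec]
  have h6 : ((Φ t).map conj)ᴴ = (Φ t)ᵀ := by
    ext i j; simp
  rw [h4, h5, star_mulVec, ← mul_vecMulVec, h6, ← vecMulVec_mul, h1]
  simp only [Matrix.mul_assoc]

/-- The main equation holds for `L = e e*`, since `C₀` is the product of the weighted `f₀ᵀ` and `e`. -/
lemma mainEquation_residual {C₀ : ℝ → Fin T → ℂ} (h0 : IsSpectralDensity f₀)
    (hC : ∀ᵐ t ∂circ, (weighted μ s d f₀ t)ᵀ *ᵥ e t = C₀ t) :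
    MainEquation μ s d f₀ C₀ fun t => vecMulVec (e t) (star (e t)) := by
  filter_upwards [hC, h0.2] with t h1 h2
  have h3 : ((weight μ s d t : ℂ) • (f₀ t)ᵀ)ᴴ = (weight μ s d t : ℂ) • (f₀ t)ᵀ := by
    rw [conjTranspose_smul, h2.1.transpose.eq]
    simp
  rw [← h1, weighted, transpose_smul, star_mulVec, h3, ← mul_vecMulVec, ← vecMulVec_mul,
    Matrix.mul_assoc]

/-- The equation determines the multiplier matrix, as `f₀` is invertible. -/
lemma MainEquation.eq_residual {C₀ : ℝ → Fin T → ℂ} {L : ℝ → Mat T} (hμ : ∀ j, 0 < μ j)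
    (hs : ∀ j, 0 < s j) (h0 : IsSpectralDensity f₀) (hm : Minimality μ s d f₀)
    (hC : ∀ᵐ t ∂circ, (weighted μ s d f₀ t)ᵀ *ᵥ e t = C₀ t) (h : MainEquation μ s d f₀ C₀ L) :
    ∀ᵐ t ∂circ, L t = vecMulVec (e t) (star (e t)) := by
  filter_upwards [h, mainEquation_residual d h0 hC, hm.1, weight_pos_ae d hμ hs] with t h1 h2 h3 h4
  have h5 : IsUnit ((weight μ s d t : ℂ) • (f₀ t)ᵀ) :=
    (h3.transpose.smul (by exact_mod_cast h4 : (0 : ℂ) < (weight μ s d t : ℂ))).isUnit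
  rw [h1] at h2
  exact h5.mul_left_cancel (h5.mul_right_cancel h2)

end Equations

/-! ### The spectral isometry and the error of the forecast -/


section Isometry

variable {T : ℕ} {g : ℝ → Mat T} {Ω : Type*} [MeasurableSpace Ω] {P : Measure Ω}
  {η : ℤ → Fin T → Ω → ℂ} {ι : Type*}

/-- The spectral isometry on finite linear combinations. -/
lemma lintegral_sum_sq_eq_sqNorm (hg : IsSpectralDensity g) (hL : ∀ n p, MemLp (η n p) 2 P)
    (hcov : ∀ m n p q,
      ∫ ω, η m p ω * conj (η n q ω) ∂P = ∫ t, expi (m - n) t * g t p q ∂circ)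
    (F : Finset ι) (c : ι → ℂ) (n : ι → ℤ) (p : ι → Fin T) :
    ∫⁻ ω, ‖∑ i ∈ F, c i * η (n i) (p i) ω‖ₑ ^ 2 ∂P =
      sqNorm g fun t => ∑ i ∈ F, (c i * expi (n i) t) • Pi.single (p i) (1 : ℂ) := by
  set X : Ω → ℂ := fun ω => ∑ i ∈ F, c i * η (n i) (p i) ω with hX
  set x : ℝ → Fin T → ℂ := fun t => ∑ i ∈ F, (c i * expi (n i) t) • Pi.single (p i) (1 : ℂ) with hx
  have hXL : MemLp X 2 P := memLp_finsetSum _ fun i _ => (hL (n i) (p i)).const_mul (c i)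
  have hxL : InL2 g x := by
    have h1 : Continuous x := by
      exact continuous_finsetSum _ fun i _ =>
        (continuous_const.mul (continuous_expi _)).smul continuous_const
    refine InL2.of_bounded hg h1.measurable.aemeasurable (K := ∑ i ∈ F, ‖c i‖) fun t k => ?_
    simp only [hx, Finset.sum_apply]
    refine (norm_sum_le _ _).trans (Finset.sum_le_sum fun i _ => ?_)
    rw [Pi.smul_apply, smul_eq_mul, norm_mul, norm_mul, norm_expi, mul_one]
    refine mul_le_of_le_one_right (norm_nonneg _) ?_
    by_cases h : k = p i
    · subst h; simp
    · simp [h]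
  have hsq : ∫⁻ ω, ‖X ω‖ₑ ^ 2 ∂P = ENNReal.ofReal (∫ ω, ‖X ω‖ ^ 2 ∂P) := by
    rw [ofReal_integral_eq_lintegral_ofReal (hXL.integrable_norm_pow two_ne_zero)
      (ae_of_all _ fun ω => by positivity)]
    refine lintegral_congr fun ω => ?_
    rw [ENNReal.ofReal_pow (norm_nonneg _), ofReal_norm]
  rw [hsq, sqNorm_eq_ofReal hg hxL]
  congr 1
  have hci : ∀ i ∈ F, ∀ j ∈ F, Integrable (fun ω =>
      c i * conj (c j) * (η (n i) (p i) ω * conj (η (n j) (p j) ω))) P := fun i _ j _ =>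
    (MemLp.integrable_mul (hL (n i) (p i)) (hL (n j) (p j)).star).const_mul _
  have hgi : ∀ i ∈ F, ∀ j ∈ F, Integrable (fun t =>
      c i * conj (c j) * (expi (n i - n j) t * g t (p i) (p j))) circ := fun i _ j _ =>
    (integrable_expi_mul (hg.1 _ _) _).const_mul _
  have h1 : ((∫ ω, ‖X ω‖ ^ 2 ∂P : ℝ) : ℂ) = ∑ i ∈ F, ∑ j ∈ F,
      c i * conj (c j) * ∫ ω, η (n i) (p i) ω * conj (η (n j) (p j) ω) ∂P := by
    rw [← integral_complex_ofReal]
    have h2 : ∀ ω, ((‖X ω‖ ^ 2 : ℝ) : ℂ) = ∑ i ∈ F, ∑ j ∈ F,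
        c i * conj (c j) * (η (n i) (p i) ω * conj (η (n j) (p j) ω)) := fun ω => by
      rw [← Complex.normSq_eq_norm_sq, ← Complex.mul_conj, hX, map_sum, Finset.sum_mul_sum]
      refine Finset.sum_congr rfl fun i _ => Finset.sum_congr rfl fun j _ => ?_
      rw [map_mul]; ring
    simp only [h2]
    rw [integral_finsetSum _ fun i hi => integrable_finsetSum _ fun j hj => hci i hi j hj]
    refine Finset.sum_congr rfl fun i hi => ?_
    rw [integral_finsetSum _ fun j hj => hci i hi j hj]
    exact Finset.sum_congr rfl fun j _ => integral_const_mul _ _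
  have h3 : ((∫ t, quadForm (g t) (x t) ∂circ : ℝ) : ℂ) = ∑ i ∈ F, ∑ j ∈ F,
      c i * conj (c j) * ∫ t, expi (n i - n j) t * g t (p i) (p j) ∂circ := by
    rw [← integral_complex_ofReal]
    have h2 : ∀ᵐ t ∂circ, ((quadForm (g t) (x t) : ℝ) : ℂ) = ∑ i ∈ F, ∑ j ∈ F,
        c i * conj (c j) * (expi (n i - n j) t * g t (p i) (p j)) := by
      filter_upwards [hg.2] with t ht
      rw [← sesqForm_self ht.1, sesqForm, hx, star_sum, mulVec_sum, sum_dotProduct]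
      refine Finset.sum_congr rfl fun i _ => ?_
      rw [dotProduct_sum]
      refine Finset.sum_congr rfl fun j _ => ?_
      rw [star_smul, Pi.star_single, star_one, mulVec_smul, smul_dotProduct, dotProduct_smul,
        mulVec_single_one, single_one_dotProduct, Complex.star_def, map_mul, conj_expi,
        sub_eq_add_neg, expi_add, col_apply, smul_eq_mul, smul_eq_mul]
      ring
    rw [integral_congr_ae h2,
      integral_finsetSum _ fun i hi => integrable_finsetSum _ fun j hj => hgi i hi j hj]
    refine Finset.sum_congr rfl fun i hi => ?_
    rw [integral_finsetSum _ fun j hj => hgi i hi j hj]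
    exact Finset.sum_congr rfl fun j _ => integral_const_mul _ _
  have h4 : ((∫ ω, ‖X ω‖ ^ 2 ∂P : ℝ) : ℂ) = ((∫ t, quadForm (g t) (x t) ∂circ : ℝ) : ℂ) := by
    rw [h1, h3]; simp only [hcov]
  exact_mod_cast h4

lemma lintegral_sum_dotProduct_sq_eq_sqNorm (hg : IsSpectralDensity g)
    (hL : ∀ n p, MemLp (η n p) 2 P)
    (hcov : ∀ m n p q,
      ∫ ω, η m p ω * conj (η n q ω) ∂P = ∫ t, expi (m - n) t * g t p q ∂circ)
    (F : Finset ι) (v : ι → Fin T → ℂ) (n : ι → ℤ) :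
    ∫⁻ ω, ‖∑ i ∈ F, v i ⬝ᵥ fun p => η (n i) p ω‖ₑ ^ 2 ∂P =
      sqNorm g fun t => ∑ i ∈ F, expi (n i) t • v i := by
  have h := lintegral_sum_sq_eq_sqNorm hg hL hcov (F ×ˢ Finset.univ) (fun i => v i.1 i.2)
    (fun i => n i.1) fun i => i.2
  simp only [Finset.sum_product] at h
  simp only [dotProduct]
  rw [h]
  congr 1
  ext t k
  simp only [Finset.sum_apply, Pi.smul_apply, smul_eq_mul]
  refine Finset.sum_congr rfl fun i _ => ?_
  rw [Finset.sum_eq_single k]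
  · simp [mul_comm]
  · intro j _ hj
    simp [hj.symm]
  · simp

lemma ennreal_mul_le_sq_add_sq (x y : ℝ≥0∞) : x * y ≤ x ^ 2 + y ^ 2 := by
  rcases le_total x y with hxy | hxy
  · exact (mul_le_mul_left hxy y).trans (by rw [sq y]; exact le_add_self)
  · exact (mul_le_mul_right hxy x).trans (by rw [sq x]; exact le_self_add)

/-- The Cauchy–Schwarz inequality for series of random variables, up to a constant. -/
lemma lintegral_tsum_mul_sq_le [Countable ι] {a : ι → ℝ≥0∞} {h : ι → Ω → ℝ≥0∞}
    (hh : ∀ i, AEMeasurable (h i) P) {A : ℝ≥0∞} (hA : ∀ i, ∫⁻ ω, h i ω ^ 2 ∂P ≤ A) :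
    ∫⁻ ω, (∑' i, a i * h i ω) ^ 2 ∂P ≤ 2 * (∑' i, a i) ^ 2 * A := by
  have h1 : ∀ ω, (∑' i, a i * h i ω) ^ 2 ≤ 2 * ((∑' i, a i) * ∑' i, a i * h i ω ^ 2) := fun ω => by
    calc (∑' i, a i * h i ω) ^ 2 = ∑' i, ∑' j, a i * h i ω * (a j * h j ω) := by
          rw [sq, ← ENNReal.tsum_mul_right]
          exact tsum_congr fun i => by rw [ENNReal.tsum_mul_left]
      _ ≤ ∑' i, ∑' j, (a i * h i ω ^ 2 * a j + a i * (a j * h j ω ^ 2)) := by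
          refine ENNReal.tsum_le_tsum fun i => ENNReal.tsum_le_tsum fun j => ?_
          calc a i * h i ω * (a j * h j ω) = a i * a j * (h i ω * h j ω) := by ring
            _ ≤ a i * a j * (h i ω ^ 2 + h j ω ^ 2) := by gcongr; exact ennreal_mul_le_sq_add_sq _ _
            _ = _ := by ring
      _ = _ := by
          simp only [ENNReal.tsum_add, ENNReal.tsum_mul_left, ENNReal.tsum_mul_right]
          ring
  calc _ ≤ ∫⁻ ω, 2 * ((∑' i, a i) * ∑' i, a i * h i ω ^ 2) ∂P := lintegral_mono h1
    _ = 2 * ((∑' i, a i) * ∑' i, a i * ∫⁻ ω, h i ω ^ 2 ∂P) := by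
        have hm : AEMeasurable (fun ω => ∑' i, a i * h i ω ^ 2) P :=
          AEMeasurable.tsum fun i => ((hh i).pow_const 2).const_mul _
        rw [lintegral_const_mul'' _ (hm.const_mul _), lintegral_const_mul'' _ hm,
          lintegral_tsum fun i => ((hh i).pow_const 2).const_mul _]
        simp only [lintegral_const_mul'' _ ((hh _).pow_const 2)]
    _ ≤ 2 * ((∑' i, a i) * ∑' i, a i * A) := by
        gcongr with i; exact hA i
    _ = _ := by rw [ENNReal.tsum_mul_right]; ring

/-- The spectral isometry between the sums `∑_{k ≥ 0} b(k)ᵀ η(k)` minus combinations of observed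
values and their spectral characteristics. -/
lemma lintegral_target_sub_eq_sqNorm {b : ℕ → Fin T → ℂ} (hb : Summable fun k => ‖b k‖)
    (hg : IsSpectralDensity g) (hL : ∀ n p, MemLp (η n p) 2 P)
    (hcov : ∀ m n p q,
      ∫ ω, η m p ω * conj (η n q ω) ∂P = ∫ t, expi (m - n) t * g t p q ∂circ)
    (N : ℕ) (x : ℕ → Fin T → ℂ) :
    ∫⁻ ω, ‖(∑' k : ℕ, b k ⬝ᵥ fun p => η k p ω) -
      ∑ j ∈ Finset.range N, x j ⬝ᵥ fun p => η (-((j : ℤ) + 1)) p ω‖ₑ ^ 2 ∂P =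
    sqNorm g fun t => targetFun b t - ∑ j ∈ Finset.range N, expi (-((j : ℤ) + 1)) t • x j := by
  set Z : Ω → ℂ := fun ω => ∑ j ∈ Finset.range N, x j ⬝ᵥ fun p => η (-((j : ℤ) + 1)) p ω with hZ
  set z : ℝ → Fin T → ℂ := fun t => ∑ j ∈ Finset.range N, expi (-((j : ℤ) + 1)) t • x j with hz
  have hdot : ∀ (v : Fin T → ℂ) n, MemLp (fun ω => v ⬝ᵥ fun p => η n p ω) 2 P := fun v n =>
    memLp_finsetSum _ fun p _ => (hL n p).const_mul _
  have hZL : MemLp Z 2 P := memLp_finsetSum _ fun j _ => hdot _ _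
  have hpart : ∀ K : ℕ, ∫⁻ ω, ‖(∑ k ∈ Finset.range K, b k ⬝ᵥ fun p => η k p ω) - Z ω‖ₑ ^ 2 ∂P =
      sqNorm g fun t => (∑ k ∈ Finset.range K, expi k t • b k) - z t := fun K => by
    have h := lintegral_sum_dotProduct_sq_eq_sqNorm hg hL hcov
      ((Finset.range K).disjSum (Finset.range N)) (Sum.elim b fun j => -x j)
      (Sum.elim (fun k => (k : ℤ)) fun j => -((j : ℤ) + 1))
    simpa only [Finset.sum_disjSum, Sum.elim_inl, Sum.elim_inr, neg_dotProduct, smul_neg,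
      Finset.sum_neg_distrib, ← sub_eq_add_neg] using h
  -- the random side
  set a : ℕ × Fin T → ℝ≥0∞ := fun i => ‖b i.1 i.2‖ₑ with ha
  set Y : Ω → ℝ≥0∞ := fun ω => ∑' i, a i * ‖η (i : ℕ × Fin T).1 i.2 ω‖ₑ with hY
  have hηm : ∀ i : ℕ × Fin T, AEMeasurable (fun ω => ‖η i.1 i.2 ω‖ₑ) P := fun i =>
    (hL _ _).1.enorm
  have hYm : AEMeasurable Y P := AEMeasurable.tsum fun i => (hηm i).const_mul _
  have hasum : ∑' i, a i ≠ ∞ := by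
    rw [tsum_enorm_ne_top_iff_summable_norm, summable_prod_of_nonneg fun i => norm_nonneg _]
    refine ⟨fun k => Summable.of_finite, ?_⟩
    refine Summable.of_nonneg_of_le (fun k => tsum_nonneg fun _ => norm_nonneg _) (fun k => ?_)
      (hb.mul_left (T : ℝ))
    rw [tsum_fintype]
    refine (Finset.sum_le_sum fun p _ => norm_le_pi_norm (b k) p).trans_eq ?_
    simp
  have hsec : ∀ i : ℕ × Fin T, ∫⁻ ω, ‖η i.1 i.2 ω‖ₑ ^ 2 ∂P ≤
      ∑ p : Fin T, ENNReal.ofReal (∫ t, ‖g t p p‖ ∂circ) := fun i => by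
    have h1 := lintegral_sum_sq_eq_sqNorm hg hL hcov {()} (fun _ => 1) (fun _ => (i.1 : ℤ))
      fun _ => i.2
    simp only [Finset.sum_singleton, one_mul] at h1
    rw [h1]
    refine le_trans ?_ (Finset.single_le_sum (f := fun p => ENNReal.ofReal (∫ t, ‖g t p p‖ ∂circ))
      (fun _ _ => zero_le) (Finset.mem_univ i.2))
    rw [ofReal_integral_eq_lintegral_ofReal (hg.1 _ _).norm (ae_of_all _ fun t => norm_nonneg _),
      sqNorm_eq]
    refine lintegral_mono fun t => ENNReal.ofReal_le_ofReal ?_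
    rw [quadForm_smul, norm_expi, one_pow, one_mul, quadForm, Pi.star_single, star_one,
      mulVec_single_one, single_one_dotProduct]
    exact Complex.re_le_norm _
  have hYfin : ∫⁻ ω, Y ω ^ 2 ∂P ≠ ∞ := by
    refine ne_top_of_le_ne_top ?_ (lintegral_tsum_mul_sq_le hηm hsec)
    exact ENNReal.mul_ne_top (ENNReal.mul_ne_top (by simp) (ENNReal.pow_ne_top hasum))
      (ENNReal.sum_ne_top.2 fun _ _ => ENNReal.ofReal_ne_top)
  have hYle : ∀ ω, ∑' k : ℕ, ‖b k ⬝ᵥ fun p => η k p ω‖ₑ ≤ Y ω := fun ω => by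
    rw [hY]
    simp only
    rw [ENNReal.tsum_prod']
    refine ENNReal.tsum_le_tsum fun k => ?_
    rw [tsum_fintype]
    refine (enorm_sum_le _ _).trans (Finset.sum_le_sum fun p _ => ?_)
    rw [enorm_mul]
  have hYae : ∀ᵐ ω ∂P, Y ω < ∞ := by
    filter_upwards [ae_lt_top' (hYm.pow_const 2) hYfin] with ω hω
    by_contra h
    rw [not_lt_top_iff] at h
    simp [h] at hω
  have hlim1 : Tendsto (fun K : ℕ =>
      ∫⁻ ω, ‖(∑ k ∈ Finset.range K, b k ⬝ᵥ fun p => η k p ω) - Z ω‖ₑ ^ 2 ∂P) atTop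
      (𝓝 (∫⁻ ω, ‖(∑' k : ℕ, b k ⬝ᵥ fun p => η k p ω) - Z ω‖ₑ ^ 2 ∂P)) := by
    refine tendsto_lintegral_of_dominated_convergence' (fun ω => 3 * (Y ω ^ 2 + ‖Z ω‖ₑ ^ 2))
      (fun K => ?_) (fun K => ae_of_all _ fun ω => ?_) ?_ ?_
    · exact ((memLp_finsetSum _ fun k _ => hdot (b k) k).sub hZL).1.enorm.pow_const 2
    · have h1 : ‖(∑ k ∈ Finset.range K, b k ⬝ᵥ fun p => η k p ω) - Z ω‖ₑ ≤ Y ω + ‖Z ω‖ₑ := by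
        refine (enorm_sub_le).trans (add_le_add_left ?_ _)
        exact (enorm_sum_le _ _).trans ((ENNReal.sum_le_tsum _).trans (hYle ω))
      refine (pow_le_pow_left' h1 2).trans ?_
      calc (Y ω + ‖Z ω‖ₑ) ^ 2 = Y ω ^ 2 + ‖Z ω‖ₑ ^ 2 + 2 * (Y ω * ‖Z ω‖ₑ) := by ring
        _ ≤ Y ω ^ 2 + ‖Z ω‖ₑ ^ 2 + 2 * (Y ω ^ 2 + ‖Z ω‖ₑ ^ 2) := by
            gcongr; exact ennreal_mul_le_sq_add_sq _ _
        _ = _ := by ring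
    · have hZ2 : ∫⁻ ω, ‖Z ω‖ₑ ^ 2 ∂P ≠ ∞ := by
        have := (hZL.integrable_norm_pow two_ne_zero).2
        refine ne_of_lt (lt_of_le_of_lt (lintegral_mono fun ω => le_of_eq ?_) this)
        rw [enorm_pow, enorm_norm]
      rw [lintegral_const_mul' _ _ (by simp), lintegral_add_left' (hYm.pow_const 2)]
      exact ENNReal.mul_ne_top (by simp) (ENNReal.add_ne_top.2 ⟨hYfin, hZ2⟩)
    · filter_upwards [hYae] with ω hω
      have h1 : Summable fun k : ℕ => b k ⬝ᵥ fun p => η k p ω :=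
        (tsum_enorm_ne_top_iff_summable_norm.1 ((hYle ω).trans_lt hω).ne).of_norm
      exact ENNReal.Tendsto.pow ((h1.hasSum.tendsto_sum_nat.sub_const _).enorm)
  -- the spectral side
  have hzc : Continuous z := by
    exact continuous_finsetSum _ fun j _ => (continuous_expi _).smul continuous_const
  set M : ℝ := (∑' k, ‖b k‖) + ∑ j ∈ Finset.range N, ‖x j‖ with hM
  have hM0 : 0 ≤ M := add_nonneg (tsum_nonneg fun _ => norm_nonneg _)
    (Finset.sum_nonneg fun _ _ => norm_nonneg _)
  have hzM : ∀ K t i, ‖((∑ k ∈ Finset.range K, expi k t • b k) - z t) i‖ ≤ M := fun K t i => by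
    refine (norm_le_pi_norm _ i).trans ((norm_sub_le _ _).trans (add_le_add ?_ ?_))
    · refine (norm_sum_le _ _).trans (le_trans (Finset.sum_le_sum fun k _ => ?_)
        (hb.sum_le_tsum (Finset.range K) fun _ _ => norm_nonneg _))
      rw [norm_smul, norm_expi, one_mul]
    · refine (norm_sum_le _ _).trans (Finset.sum_le_sum fun k _ => ?_)
      rw [norm_smul, norm_expi, one_mul]
  have hgn : Integrable (fun t => (∑ i, ∑ j, ‖g t i j‖) * ∑ _p : Fin T, M ^ 2) circ :=
    (integrable_finsetSum _ fun i _ => integrable_finsetSum _ fun j _ => (hg.1 i j).norm).mul_const _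
  have hlim2 : Tendsto (fun K : ℕ => sqNorm g fun t => (∑ k ∈ Finset.range K, expi k t • b k) - z t)
      atTop (𝓝 (sqNorm g fun t => targetFun b t - z t)) := by
    simp only [sqNorm_eq]
    refine tendsto_lintegral_of_dominated_convergence'
      (fun t => ENNReal.ofReal ((∑ i, ∑ j, ‖g t i j‖) * ∑ _p : Fin T, M ^ 2))
      (fun K => ?_) (fun K => ae_of_all _ fun t => ?_) ?_ (ae_of_all _ fun t => ?_)
    · refine (aemeasurable_quadForm hg.aemeasurable (Continuous.aemeasurable ?_)).ennreal_ofReal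
      exact (continuous_finsetSum _ fun j _ => (continuous_expi _).smul continuous_const).sub hzc
    · refine ENNReal.ofReal_le_ofReal (((le_abs_self _).trans (quadForm_le_sum_mul _)).trans ?_)
      gcongr with p
      exact hzM K t p
    · rw [← ofReal_integral_eq_lintegral_ofReal hgn (ae_of_all _ fun t => by positivity)]
      exact ENNReal.ofReal_ne_top
    · refine ENNReal.tendsto_ofReal (((continuous_quadForm (g t)).tendsto _).comp ?_)
      refine Tendsto.sub_const (tendsto_pi_nhds.2 fun p => ?_) _
      rw [targetFun_apply]
      have h1 : Summable fun k : ℕ => b k p * expi k t := by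
        refine Summable.of_norm ?_
        simpa using summable_target hb p
      refine h1.hasSum.tendsto_sum_nat.congr fun K => ?_
      rw [Finset.sum_apply]
      exact Finset.sum_congr rfl fun k _ => by rw [Pi.smul_apply, smul_eq_mul, mul_comm]
  simp only [hpart] at hlim1
  exact tendsto_nhds_unique hlim1 hlim2

end Isometry

section ForecastError

variable {r T : ℕ} {μ s : Fin r → ℕ} (d : Fin r → ℕ) {Ω : Type*} [MeasurableSpace Ω]
  {P : Measure Ω} {ξ : ℤ → Fin T → Ω → ℂ} {f : ℝ → Mat T}

lemma HasSpectralDensity.integral_increment_mul (hμ : ∀ j, 0 < μ j)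
    (h : HasSpectralDensity s d f P ξ) (m n : ℤ) (p q : Fin T) :
    ∫ ω, increment μ s d ξ m p ω * conj (increment μ s d ξ n q ω) ∂P =
      ∫ t, expi (m - n) t * weighted μ s d f t p q ∂circ := by
  have h1 := h.structural μ μ hμ hμ n (m - n) p q
  rw [add_sub_cancel] at h1
  rw [h1]
  refine integral_congr_ae (ae_of_all _ fun t => ?_)
  simp only [expi, weighted, weight, Matrix.smul_apply, smul_eq_mul, Complex.mul_conj,
    Complex.normSq_eq_norm_sq]
  push_cast
  ring

/-- The error of the optimal forecast is computed in the spectral domain. -/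
theorem HasSpectralDensity.forecastError_eq (hμ : ∀ j, 0 < μ j) (hs : ∀ j, 0 < s j)
    {b : ℕ → Fin T → ℂ} (hb : Summable fun k => ‖b k‖) (hf : IsSpectralDensity f)
    (h : HasSpectralDensity s d f P ξ) : forecastError μ s d b P ξ = optErr μ s d b f := by
  have hg := hf.weighted (μ := μ) d hs
  have h1 := lintegral_target_sub_eq_sqNorm hb hg (h.memLp μ hμ) (h.integral_increment_mul d hμ)
  have hp : ∀ (N : ℕ) (x : ℕ → Fin T → ℂ),
      (fun t => ∑ j ∈ Finset.range N, expi (-((j : ℤ) + 1)) t • x j) ∈ negSpan T := fun N x => by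
    have : (fun t => ∑ j ∈ Finset.range N, expi (-((j : ℤ) + 1)) t • x j) =
        ∑ j ∈ Finset.range N, fun t => expi (-((j : ℤ) + 1)) t • x j := by
      ext t; simp
    rw [this]
    exact Submodule.sum_mem _ fun j _ => expi_smul_mem_negSpan j (x j)
  rw [optErr_eq d hμ hs hb hf, forecastError]
  refine le_antisymm (le_iInf₂ fun p hpm => ?_) (le_iInf₂ fun N x => ?_)
  · obtain ⟨N, x, hx⟩ := exists_pastPoly_eq (μ := μ) (s := s) d hpm
    refine (iInf₂_le N x).trans_eq ?_
    rw [h1]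
    refine sqNorm_congr_ae ?_
    filter_upwards [kappa_ne_zero_ae d hμ hs] with t ht
    have h2 := hx t
    rw [pastPoly] at h2
    have h3 := smul_right_injective _ ht h2
    simp only [expi_neg_succ_eq] at h3
    rw [Pi.sub_apply, ← h3]
  · rw [h1]
    exact iInf₂_le (f := fun p (_ : p ∈ negSpan T) =>
      sqNorm (weighted μ s d f) (targetFun b - p)) _ (hp N x)

end ForecastError

/-! ### The exchange argument and perturbations of a density -/


section Exchange

variable {w ρ p ν : ℝ → ℝ}

lemma integral_pos_of_frequently {F : ℝ → ℝ} (hi : Integrable F circ) (h0 : ∀ᵐ t ∂circ, 0 ≤ F t)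
    (h : ∃ᵐ t ∂circ, 0 < F t) : 0 < ∫ t, F t ∂circ := by
  refine lt_of_le_of_ne (integral_nonneg_of_ae h0) fun h1 => h ?_
  filter_upwards [(integral_eq_zero_iff_of_nonneg_ae h0 hi).1 h1.symm] with t ht
  rw [ht]; exact lt_irrefl _

lemma integrable_mul_of_abs_le_one (hwi : Integrable w circ) {θ : ℝ → ℝ} (hθ : AEMeasurable θ circ)
    (h1 : ∀ᵐ t ∂circ, |θ t| ≤ 1) : Integrable (fun t => w t * θ t) circ :=
  hwi.mul_bdd (c := 1) hθ.aestronglyMeasurable h1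

/-- The exchange argument: if no perturbation `θ` with `-p ≤ θ ≤ ν` and `∫ w θ = 0` increases
`∫ w θ ρ`, then a constant separates the values of `ρ` on `{p > 0}` from those on `{ν > 0}`. -/
theorem exists_threshold (hw : ∀ᵐ t ∂circ, 0 < w t) (hwi : Integrable w circ)
    (hρm : AEMeasurable ρ circ) (hpm : AEMeasurable p circ) (hνm : AEMeasurable ν circ)
    (hρ : ∀ᵐ t ∂circ, 0 ≤ ρ t) (hp : ∀ᵐ t ∂circ, 0 ≤ p t) (hν : ∀ᵐ t ∂circ, 0 ≤ ν t)
    (hpos : ∃ᵐ t ∂circ, 0 < p t)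
    (h : ∀ θ : ℝ → ℝ, AEMeasurable θ circ →
      (∀ᵐ t ∂circ, -p t ≤ θ t ∧ θ t ≤ ν t ∧ |θ t| ≤ 1) → ∫ t, w t * θ t ∂circ = 0 →
      Integrable (fun t => w t * (θ t * ρ t)) circ ∧ ∫ t, w t * (θ t * ρ t) ∂circ ≤ 0) :
    ∃ c : ℝ, 0 ≤ c ∧ (∀ᵐ t ∂circ, 0 < p t → c ≤ ρ t) ∧ ∀ᵐ t ∂circ, 0 < ν t → ρ t ≤ c := by
  -- the constant is the essential infimum of `ρ` on `{p > 0}`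
  set S : Set ℝ := {c | ∀ᵐ t ∂circ, 0 < p t → c ≤ ρ t} with hS
  have h0S : (0 : ℝ) ∈ S := hρ.mono fun t ht _ => ht
  have hbdd : BddAbove S := by
    by_contra hb
    have h1 : ∀ n : ℕ, ∀ᵐ t ∂circ, 0 < p t → (n : ℝ) ≤ ρ t := fun n => by
      obtain ⟨c, hc, hnc⟩ := not_bddAbove_iff.1 hb n
      filter_upwards [hc] with t ht htp using hnc.le.trans (ht htp)
    obtain ⟨t, ht, htn⟩ := (hpos.and_eventually (ae_all_iff.2 h1)).exists
    obtain ⟨n, hn⟩ := exists_nat_gt (ρ t)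
    exact (htn n ht).not_gt hn
  have hinv : ∀ ε : ℝ, 0 < ε → ∃ n : ℕ, 1 / ((n : ℝ) + 1) < ε := fun ε hε =>
    exists_nat_one_div_lt hε
  refine ⟨sSup S, le_csSup hbdd h0S, ?_, ?_⟩
  · have h1 : ∀ n : ℕ, ∀ᵐ t ∂circ, 0 < p t → sSup S - 1 / ((n : ℝ) + 1) ≤ ρ t := fun n => by
      obtain ⟨c, hc, hnc⟩ := exists_lt_of_lt_csSup ⟨0, h0S⟩
        (sub_lt_self (sSup S) (show (0 : ℝ) < 1 / ((n : ℝ) + 1) by positivity))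
      filter_upwards [hc] with t ht htp using hnc.le.trans (ht htp)
    filter_upwards [ae_all_iff.2 h1] with t ht htp
    refine le_of_forall_pos_le_add fun ε hε => ?_
    obtain ⟨n, hn⟩ := hinv ε hε
    linarith [ht n htp]
  · by_contra hne
    obtain ⟨n, hn⟩ : ∃ n : ℕ, ∃ᵐ t ∂circ, 0 < ν t ∧ sSup S + 1 / ((n : ℝ) + 1) < ρ t := by
      by_contra hcon
      refine hne ?_
      have h1 : ∀ n : ℕ, ∀ᵐ t ∂circ, ¬(0 < ν t ∧ sSup S + 1 / ((n : ℝ) + 1) < ρ t) := fun n =>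
        not_frequently.1 fun hf => hcon ⟨n, hf⟩
      filter_upwards [ae_all_iff.2 h1] with t ht htν
      refine le_of_forall_pos_le_add fun ε hε => ?_
      obtain ⟨n, hn⟩ := hinv ε hε
      have := not_lt.1 fun h2 => ht n ⟨htν, h2⟩
      linarith
    set c := sSup S + 1 / ((n : ℝ) + 1) with hc
    have hcS : c ∉ S := notMem_of_csSup_lt (lt_add_of_pos_right _ (by positivity)) hbdd
    -- otherwise mass can be moved from `M = {p > 0, ρ < c}` to `N = {ν > 0, ρ > c}`
    have hP : ∃ᵐ t ∂circ, 0 < p t ∧ ρ t < c := by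
      refine fun hcon => hcS (hcon.mono fun t ht htp => ?_)
      exact not_lt.1 fun h2 => ht ⟨htp, h2⟩
    set N : Set ℝ := {t | 0 < ν t ∧ c < ρ t} with hNd
    set M : Set ℝ := {t | 0 < p t ∧ ρ t < c} with hMd
    have hNm : NullMeasurableSet N circ := (nullMeasurableSet_lt aemeasurable_const hνm).inter
      (nullMeasurableSet_lt aemeasurable_const hρm)
    have hMm : NullMeasurableSet M circ := (nullMeasurableSet_lt aemeasurable_const hpm).inter
      (nullMeasurableSet_lt hρm aemeasurable_const)
    set α : ℝ → ℝ := N.indicator fun t => min (ν t) 1 with hα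
    set π : ℝ → ℝ := M.indicator fun t => min (p t) 1 with hπ
    have hαm : AEMeasurable α circ := (hνm.min aemeasurable_const).indicator₀ hNm
    have hπm : AEMeasurable π circ := (hpm.min aemeasurable_const).indicator₀ hMm
    have hα0 : ∀ t, 0 ≤ α t ∧ α t ≤ 1 := fun t => by
      by_cases ht : t ∈ N
      · rw [hα, Set.indicator_of_mem ht]
        exact ⟨le_min ht.1.le zero_le_one, min_le_right _ _⟩
      · rw [hα, Set.indicator_of_notMem ht]; norm_num
    have hπ0 : ∀ t, 0 ≤ π t ∧ π t ≤ 1 := fun t => by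
      by_cases ht : t ∈ M
      · rw [hπ, Set.indicator_of_mem ht]
        exact ⟨le_min ht.1.le zero_le_one, min_le_right _ _⟩
      · rw [hπ, Set.indicator_of_notMem ht]; norm_num
    have hαi := integrable_mul_of_abs_le_one hwi hαm
      (ae_of_all _ fun t => abs_le.2 ⟨by linarith [(hα0 t).1], (hα0 t).2⟩)
    have hπi := integrable_mul_of_abs_le_one hwi hπm
      (ae_of_all _ fun t => abs_le.2 ⟨by linarith [(hπ0 t).1], (hπ0 t).2⟩)
    set A := ∫ t, w t * α t ∂circ with hA
    set B := ∫ t, w t * π t ∂circ with hB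
    have hαpos : ∀ t ∈ N, 0 < α t := fun t ht => by
      rw [hα, Set.indicator_of_mem ht]; exact lt_min ht.1 one_pos
    have hπpos : ∀ t ∈ M, 0 < π t := fun t ht => by
      rw [hπ, Set.indicator_of_mem ht]; exact lt_min ht.1 one_pos
    have hApos : 0 < A := integral_pos_of_frequently hαi
      (hw.mono fun t ht => mul_nonneg ht.le (hα0 t).1)
      ((hn.and_eventually hw).mono fun t ht => mul_pos ht.2 (hαpos t ht.1))
    have hBpos : 0 < B := integral_pos_of_frequently hπi
      (hw.mono fun t ht => mul_nonneg ht.le (hπ0 t).1)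
      ((hP.and_eventually hw).mono fun t ht => mul_pos ht.2 (hπpos t ht.1))
    have hAB : 0 < A + B := add_pos hApos hBpos
    -- the proportions `b`, `a` balance the mass taken and the mass given
    set a := A / (A + B) with ha
    set b := B / (A + B) with hb
    have ha0 : 0 < a := div_pos hApos hAB
    have hb0 : 0 < b := div_pos hBpos hAB
    have hab : a + b = 1 := by rw [ha, hb, ← add_div, div_self hAB.ne']
    set θ : ℝ → ℝ := fun t => b * α t - a * π t with hθ
    have hθm : AEMeasurable θ circ := (hαm.const_mul b).sub (hπm.const_mul a)
    have hθb : ∀ᵐ t ∂circ, -p t ≤ θ t ∧ θ t ≤ ν t ∧ |θ t| ≤ 1 := by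
      filter_upwards [hp, hν] with t htp htν
      have h1 := hα0 t
      have h2 := hπ0 t
      have h3 : α t ≤ ν t := by
        by_cases ht : t ∈ N
        · rw [hα, Set.indicator_of_mem ht]; exact min_le_left _ _
        · rw [hα, Set.indicator_of_notMem ht]; exact htν
      have h4 : π t ≤ p t := by
        by_cases ht : t ∈ M
        · rw [hπ, Set.indicator_of_mem ht]; exact min_le_left _ _
        · rw [hπ, Set.indicator_of_notMem ht]; exact htp
      have h5 : b * α t ≤ α t := mul_le_of_le_one_left h1.1 (by linarith)
      have h6 : a * π t ≤ π t := mul_le_of_le_one_left h2.1 (by linarith)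
      have h7 := mul_nonneg hb0.le h1.1
      have h8 := mul_nonneg ha0.le h2.1
      simp only [hθ]
      refine ⟨by linarith, by linarith, abs_le.2 ⟨by linarith, by linarith⟩⟩
    have hθ0 : ∫ t, w t * θ t ∂circ = 0 := by
      have h1 : ∀ t, w t * θ t = b * (w t * α t) - a * (w t * π t) := fun t => by
        simp only [hθ]; ring
      simp only [h1]
      rw [integral_sub (hαi.const_mul b) (hπi.const_mul a), integral_const_mul, integral_const_mul,
        ← hA, ← hB, ha, hb]
      ring
    obtain ⟨hi, hle⟩ := h θ hθm hθb hθ0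
    have hθi := integrable_mul_of_abs_le_one hwi hθm (hθb.mono fun t ht => ht.2.2)
    have h1 : ∀ t, w t * (θ t * ρ t) - c * (w t * θ t) = w t * (θ t * (ρ t - c)) := fun t => by ring
    have h2 : ∫ t, w t * (θ t * (ρ t - c)) ∂circ ≤ 0 := by
      simp only [← h1]
      rw [integral_sub hi (hθi.const_mul c), integral_const_mul, hθ0]
      linarith
    refine h2.not_gt (integral_pos_of_frequently ?_ ?_ ?_)
    · exact (hi.sub (hθi.const_mul c)).congr (ae_of_all _ h1)
    · filter_upwards [hw] with t htw
      refine mul_nonneg htw.le ?_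
      by_cases htN : t ∈ N
      · have : π t = 0 := Set.indicator_of_notMem (fun htM => htN.2.not_gt htM.2) _
        simp only [hθ, this]
        exact mul_nonneg (by nlinarith [(hα0 t).1]) (sub_nonneg.2 htN.2.le)
      · have h3 : α t = 0 := Set.indicator_of_notMem htN _
        by_cases htM : t ∈ M
        · simp only [hθ, h3]
          exact mul_nonneg_of_nonpos_of_nonpos (by nlinarith [(hπ0 t).1]) (sub_nonpos.2 htM.2.le)
        · have h4 : π t = 0 := Set.indicator_of_notMem htM _
          simp [hθ, h3, h4]
    · refine (hn.and_eventually hw).mono fun t ht => mul_pos ht.2 ?_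
      have : π t = 0 := Set.indicator_of_notMem (fun htM => ht.1.2.not_gt htM.2) _
      simp only [hθ, this]
      exact mul_pos (by nlinarith [hαpos t ht.1]) (sub_pos.2 ht.1.2)

/-- If no small perturbation `θ` increases `∫ w θ ρ`, then `ρ` vanishes. -/
theorem ae_eq_zero_of_integral_nonpos (hw : ∀ᵐ t ∂circ, 0 < w t)
    (hρm : AEMeasurable ρ circ) (hpm : AEMeasurable p circ) (hp : ∀ᵐ t ∂circ, 0 < p t)
    (h : ∀ θ : ℝ → ℝ, AEMeasurable θ circ → (∀ᵐ t ∂circ, |θ t| ≤ p t ∧ |θ t| ≤ 1) →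
      Integrable (fun t => w t * (θ t * ρ t)) circ ∧ ∫ t, w t * (θ t * ρ t) ∂circ ≤ 0) :
    ∀ᵐ t ∂circ, ρ t = 0 := by
  -- a bounded perturbation with the sign of `ρ`
  set θ : ℝ → ℝ := fun t => ρ t / (|ρ t| + 1) * min (p t) 1 with hθ
  have hθm : AEMeasurable θ circ := by
    refine (hρm.div ?_).mul (hpm.min aemeasurable_const)
    exact (continuous_abs.measurable.comp_aemeasurable hρm).add_const 1
  have h1 : ∀ t, |ρ t / (|ρ t| + 1)| ≤ 1 := fun t => by
    rw [abs_div, abs_of_pos (by positivity : 0 < |ρ t| + 1), div_le_one (by positivity)]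
    linarith
  obtain ⟨hi, hle⟩ := h θ hθm (by
    filter_upwards [hp] with t ht
    have h2 : |θ t| ≤ min (p t) 1 := by
      simp only [hθ]
      rw [abs_mul, abs_of_pos (lt_min ht one_pos)]
      exact mul_le_of_le_one_left (le_min ht.le zero_le_one) (h1 t)
    exact ⟨h2.trans (min_le_left _ _), h2.trans (min_le_right _ _)⟩)
  have hpos : ∀ t, 0 < w t → 0 < p t → ρ t ≠ 0 → 0 < w t * (θ t * ρ t) := fun t h2 h3 h4 => by
    have h5 : θ t * ρ t = ρ t ^ 2 / (|ρ t| + 1) * min (p t) 1 := by simp only [hθ]; ring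
    rw [h5]
    have := lt_min h3 one_pos
    positivity
  by_contra hne
  refine hle.not_gt (integral_pos_of_frequently hi ?_ ?_)
  · filter_upwards [hw, hp] with t h2 h3
    by_cases h4 : ρ t = 0
    · simp [h4]
    · exact (hpos t h2 h3 h4).le
  · exact ((not_eventually.1 hne).and_eventually (hw.and hp)).mono fun t ht =>
      hpos t ht.2.1 ht.2.2 ht.1

end Exchange

section Perturbation

variable {r T : ℕ} {μ s : Fin r → ℕ} (d : Fin r → ℕ) {b : ℕ → Fin T → ℂ} {D : Set (ℝ → Mat T)}
  {f₀ : ℝ → Mat T} {e : ℝ → Fin T → ℂ}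

/-- The perturbation `f₀ + θ H` in a constant direction `H`. -/
noncomputable def perturb (f₀ : ℝ → Mat T) (θ : ℝ → ℝ) (H : Mat T) (t : ℝ) : Mat T :=
  f₀ t + (θ t : ℂ) • H

lemma isSpectralDensity_perturb (h0 : IsSpectralDensity f₀) {θ : ℝ → ℝ} {H : Mat T}
    (hθ : AEMeasurable θ circ) (h1 : ∀ᵐ t ∂circ, |θ t| ≤ 1)
    (hpsd : ∀ᵐ t ∂circ, (perturb f₀ θ H t).PosSemidef) : IsSpectralDensity (perturb f₀ θ H) := by
  refine ⟨fun i j => (h0.1 i j).add ?_, hpsd⟩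
  have h2 : Integrable θ circ := Integrable.of_bound hθ.aestronglyMeasurable 1 h1
  exact h2.ofReal.mul_const (H i j)

/-- The first variation: if the error of a fixed characteristic does not increase under the perturbation
`θ H`, then the integral of `w θ eᵀ H ē` is not positive. -/
lemma integral_perturb_nonpos (hs : ∀ j, 0 < s j) (h0 : IsSpectralDensity f₀)
    (he : InL2 (weighted μ s d f₀) e) {θ : ℝ → ℝ} {H : Mat T}
    (hf : IsSpectralDensity (perturb f₀ θ H))
    (hsat : sqNorm (weighted μ s d (perturb f₀ θ H)) e ≤ sqNorm (weighted μ s d f₀) e) :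
    Integrable (fun t => weight μ s d t * (θ t * quadForm H (e t))) circ ∧
      ∫ t, weight μ s d t * (θ t * quadForm H (e t)) ∂circ ≤ 0 := by
  have hg0 := h0.weighted (μ := μ) d hs
  have hg := hf.weighted (μ := μ) d hs
  have hL : InL2 (weighted μ s d (perturb f₀ θ H)) e := ⟨he.1, hsat.trans_lt he.2⟩
  have h1 : ∀ t, quadForm (weighted μ s d (perturb f₀ θ H) t) (e t) -
      quadForm (weighted μ s d f₀ t) (e t) = weight μ s d t * (θ t * quadForm H (e t)) := fun t => by
    simp only [weighted, perturb, quadForm_smul_mat, quadForm_add_mat]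
    ring
  refine ⟨((hL.integrable_quadForm hg).sub (he.integrable_quadForm hg0)).congr (ae_of_all _ h1), ?_⟩
  simp only [← h1]
  rw [integral_sub (hL.integrable_quadForm hg) (he.integrable_quadForm hg0), sub_nonpos]
  rw [sqNorm_eq_ofReal hg hL, sqNorm_eq_ofReal hg0 he,
    ENNReal.ofReal_le_ofReal_iff (integral_quadForm_nonneg hg0 e)] at hsat
  exact hsat

/-- A pointwise bound of the gain by a function of mean zero bounds the error. -/
lemma sqNorm_le_of_quadForm_le (hμ : ∀ j, 0 < μ j) (hs : ∀ j, 0 < s j) (h0 : IsSpectralDensity f₀)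
    (he : InL2 (weighted μ s d f₀) e) {f : ℝ → Mat T} (hf : IsSpectralDensity f) {ζ : ℝ → ℝ}
    (hζ : Integrable (fun t => weight μ s d t * ζ t) circ)
    (hζ0 : ∫ t, weight μ s d t * ζ t ∂circ = 0)
    (hle : ∀ᵐ t ∂circ, quadForm (f t - f₀ t) (e t) ≤ ζ t) :
    sqNorm (weighted μ s d f) e ≤ sqNorm (weighted μ s d f₀) e := by
  have hg0 := h0.weighted (μ := μ) d hs
  have h1 : ∀ᵐ t ∂circ, quadForm (weighted μ s d f t) (e t) ≤
      quadForm (weighted μ s d f₀ t) (e t) + weight μ s d t * ζ t := by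
    filter_upwards [hle, weight_pos_ae d hμ hs] with t h1 h2
    rw [quadForm_sub_mat] at h1
    simp only [weighted, quadForm_smul_mat]
    nlinarith
  have h2 : ∀ᵐ t ∂circ, 0 ≤ quadForm (weighted μ s d f₀ t) (e t) + weight μ s d t * ζ t := by
    filter_upwards [h1, (hf.weighted (μ := μ) d hs).2] with t h3 h4
    exact (quadForm_nonneg h4 _).trans h3
  have hi := (he.integrable_quadForm hg0).add hζ
  calc sqNorm (weighted μ s d f) e
      ≤ ∫⁻ t, ENNReal.ofReal (quadForm (weighted μ s d f₀ t) (e t) + weight μ s d t * ζ t) ∂circ :=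
        lintegral_mono_ae (h1.mono fun t ht => ENNReal.ofReal_le_ofReal ht)
    _ = ENNReal.ofReal (∫ t, (quadForm (weighted μ s d f₀ t) (e t) + weight μ s d t * ζ t) ∂circ) :=
        (ofReal_integral_eq_lintegral_ofReal hi h2).symm
    _ = sqNorm (weighted μ s d f₀) e := by
        rw [integral_add (he.integrable_quadForm hg0) hζ, hζ0, add_zero, sqNorm_eq_ofReal hg0 he]

/-- The description of the least favourable densities of a convex class follows from conditions on
the residual `e`: necessary ones for the multiplier matrix `e e*`, and sufficient ones for every
matrix function equal to it. -/
theorem determinedBy_of_residual (hμ : ∀ j, 0 < μ j) (hs : ∀ j, 0 < s j)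
    (hb : Summable fun k => ‖b k‖) (hD : ∀ f ∈ D, IsSpectralDensity f)
    (hconv : ∀ f ∈ D, ∀ f' ∈ D, ∀ τ : ℝ, 0 ≤ τ → τ ≤ 1 → mix τ f f' ∈ D)
    (h0 : IsSpectralDensity f₀) (hm : Minimality μ s d f₀)
    {c₀ : ℕ → Fin T → ℂ} {C₀ : ℝ → Fin T → ℂ} (hsol : IsSolution μ s d b f₀ c₀ C₀)
    {Nd : Prop} {M Ms : (ℝ → Mat T) → Prop}
    (hnec : ∀ e, InL2 (weighted μ s d f₀) e → f₀ ∈ D →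
      (∀ f ∈ D, sqNorm (weighted μ s d f) e ≤ sqNorm (weighted μ s d f₀) e) → Nd →
        M fun t => vecMulVec (e t) (star (e t)))
    (hsuf : ∀ e L, InL2 (weighted μ s d f₀) e → f₀ ∈ D → Ms L →
      (∀ᵐ t ∂circ, L t = vecMulVec (e t) (star (e t))) → ∀ f ∈ D,
        sqNorm (weighted μ s d f) e ≤ sqNorm (weighted μ s d f₀) e) :
    DeterminedBy μ s d b D f₀ C₀ Nd M Ms := by
  have he := hsol.isResidual d hμ hs hb h0 hm
  set e := residual (μ := μ) (s := s) d f₀ C₀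
  have hC : ∀ᵐ t ∂circ, (weighted μ s d f₀ t)ᵀ *ᵥ e t = C₀ t := by
    filter_upwards [hm.1, weight_pos_ae d hμ hs] with t h1 h2
    exact weighted_transpose_mulVec_residual d h2 h1
  have hN : IsLeastFavourable μ s d b D f₀ → Nd → M fun t => vecMulVec (e t) (star (e t)) :=
    fun hlf => hnec e he.inL2 hlf.1 fun f hf => hlf.sqNorm_residual_le hμ hs hb hD hconv hm he hf
  have hS : f₀ ∈ D → ∀ L, Ms L → MainEquation μ s d f₀ C₀ L → IsLeastFavourable μ s d b D f₀ :=
    fun hf₀ L hL heq => isLeastFavourable_of_sqNorm_residual_le hμ hs hb hD hm he hf₀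
      (hsuf e L he.inL2 hf₀ hL (heq.eq_residual d hμ hs h0 hm hC))
  refine ⟨isLeastFavourable_iff_solvesOptimization hμ hs hb hD hconv h0 hm hsol,
    fun hlf hNd => ⟨_, hN hlf hNd, mainEquation_residual d h0 hC⟩,
    fun hf₀ ⟨L, hL, heq⟩ => hS hf₀ L hL heq, fun q φ Φ hΦ => ⟨fun t => (Φ t)ᵀ *ᵥ e t,
      he.hasFourierSeries_factor d hs hb h0 hΦ,
      fun hlf hNd => ⟨_, hN hlf hNd, factorizedEquation_residual⟩,
      fun hf₀ ⟨L, hL, heq⟩ => hS hf₀ L hL (heq.mainEquation d hΦ.factorization hC)⟩,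
    fun hlf => hlf.minimax hμ hs hb hD hconv h0 hm hsol⟩

end Perturbation

/-! ### Classes given by linear functionals -/


section Frob

variable {T : ℕ}

lemma frob_eq_sum (A B : Mat T) : frob A B = ∑ i, ∑ j, (A i j * conj (B i j)).re := by
  simp [frob, Matrix.trace, Matrix.mul_apply]

lemma frob_add_right (A B C : Mat T) : frob A (B + C) = frob A B + frob A C := by
  simp [frob, conjTranspose_add, Matrix.mul_add]

lemma frob_sub_right (A B C : Mat T) : frob A (B - C) = frob A B - frob A C := by
  simp [frob, conjTranspose_sub, Matrix.mul_sub]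

lemma frob_smul_right (A B : Mat T) (c : ℝ) : frob A ((c : ℂ) • B) = c * frob A B := by
  simp [frob, conjTranspose_smul]

lemma frob_sub_left (A B C : Mat T) : frob (A - B) C = frob A C - frob B C := by
  simp [frob, Matrix.sub_mul]

lemma frob_sum_right {ι : Type*} (F : Finset ι) (A : Mat T) (B : ι → Mat T) :
    frob A (∑ i ∈ F, B i) = ∑ i ∈ F, frob A (B i) := by
  simp [frob, conjTranspose_sum, Finset.mul_sum, trace_sum]

lemma frob_sum_smul_left {ι : Type*} (F : Finset ι) (c : ι → ℝ) (A : ι → Mat T) (B : Mat T) :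
    frob (∑ i ∈ F, (c i : ℂ) • A i) B = ∑ i ∈ F, c i * frob (A i) B := by
  simp [frob, Finset.sum_mul, trace_sum]

/-- The quadratic form as the functional defined by the transpose of `x x*`. -/
lemma quadForm_eq_frob {A : Mat T} (hA : A.IsHermitian) (x : Fin T → ℂ) :
    quadForm A x = frob (vecMulVec x (star x))ᵀ A := by
  have h : quadForm A x = ((vecMulVec x (star x))ᵀ * A).trace.re := by
    rw [quadForm_eq_re, sesqForm_eq_sum, Finset.sum_comm]
    simp only [Matrix.trace, diag, Matrix.mul_apply, transpose_apply, vecMulVec_apply, Pi.star_apply,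
      Complex.star_def]
    congr 1
    refine Finset.sum_congr rfl fun i _ => Finset.sum_congr rfl fun j _ => ?_
    ring
  rw [h, frob, hA.eq]

/-- The Hermitian matrices with at most two nonzero entries. -/
noncomputable def hermSingle (k l : Fin T) (z : ℂ) : Mat T := single k l z + single l k (conj z)

lemma isHermitian_hermSingle (k l : Fin T) (z : ℂ) : (hermSingle k l z).IsHermitian := by
  rw [IsHermitian, hermSingle, conjTranspose_add, conjTranspose_single, conjTranspose_single,
    add_comm]
  simp

lemma frob_single (A : Mat T) (k l : Fin T) (z : ℂ) : frob A (single k l z) = (A k l * conj z).re := by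
  simp [frob, conjTranspose_single, trace_mul_single]

/-- The functionals of the matrices `hermSingle` separate the Hermitian matrices. -/
lemma eq_of_frob_hermSingle {A B : Mat T} (hA : A.IsHermitian) (hB : B.IsHermitian)
    (h1 : ∀ k l, frob A (hermSingle k l 1) = frob B (hermSingle k l 1))
    (h2 : ∀ k l, frob A (hermSingle k l Complex.I) = frob B (hermSingle k l Complex.I)) :
    A = B := by
  have hX : (A - B).IsHermitian := hA.sub hB
  have h3 : ∀ k l z, frob (A - B) (hermSingle k l z) = 2 * ((A - B) k l * conj z).re :=
    fun k l z => by
      have h4 : (A - B) l k = conj ((A - B) k l) := (hX.apply l k).symm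
      rw [hermSingle, frob_add_right, frob_single, frob_single, h4, Complex.conj_conj]
      simp only [Complex.mul_re, Complex.conj_re, Complex.conj_im]
      ring
  rw [← sub_eq_zero]
  ext k l
  have h4 := h3 k l 1
  have h5 := h3 k l Complex.I
  rw [frob_sub_left, h1, sub_self] at h4
  rw [frob_sub_left, h2, sub_self] at h5
  refine Complex.ext ?_ ?_
  · simpa using h4.symm
  · simpa using h5.symm

lemma aemeasurable_quadForm_const (A : Mat T) {x : ℝ → Fin T → ℂ} (hx : AEMeasurable x circ) :
    AEMeasurable (fun t => quadForm A (x t)) circ :=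
  aemeasurable_quadForm (g := fun _ => A) (fun i j => aemeasurable_const (b := A i j)) hx

lemma aemeasurable_frob (K : Mat T) {f : ℝ → Mat T}
    (hf : ∀ i j, AEMeasurable (fun t => f t i j) circ) : AEMeasurable (fun t => frob K (f t)) circ := by
  simp only [frob_eq_sum]
  exact Finset.aemeasurable_fun_sum _ fun i _ => Finset.aemeasurable_fun_sum _ fun j _ =>
    Complex.measurable_re.comp_aemeasurable
      ((Complex.continuous_conj.measurable.comp_aemeasurable (hf i j)).const_mul _)

lemma integrable_frob (K : Mat T) {f : ℝ → Mat T} (hf : IsSpectralDensity f) :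
    Integrable (fun t => frob K (f t)) circ := by
  simp only [frob_eq_sum]
  refine integrable_finsetSum _ fun i _ => integrable_finsetSum _ fun j _ => ?_
  have h : Integrable (fun t => conj (f t i j)) circ :=
    Complex.conjCLE.toContinuousLinearMap.integrable_comp (hf.1 i j)
  exact (h.const_mul _).re

lemma aemeasurable_room {f : ℝ → Mat T} (hf : ∀ i j, AEMeasurable (fun t => f t i j) circ) :
    AEMeasurable (fun t => room (f t)) circ := by
  simp only [room, Matrix.trace, diag]
  exact (Complex.measurable_re.comp_aemeasurable
    (Finset.aemeasurable_fun_sum _ fun i _ => aemeasurable_inv_entry hf i i)).inv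

end Frob

section TraceClass

variable {r T : ℕ} {μ s : Fin r → ℕ} (d : Fin r → ℕ) {κ : Type*}

lemma integrable_weight_mul (hs : ∀ j, 0 < s j) {F : ℝ → ℝ} (hF : Integrable F circ) :
    Integrable (fun t => weight μ s d t * F t) circ := by
  obtain ⟨K, _, hK⟩ := exists_weight_le (μ := μ) d hs
  refine hF.bdd_mul (c := K) (measurable_weight μ s d).aestronglyMeasurable (ae_of_all _ fun t => ?_)
  rw [Real.norm_of_nonneg (weight_nonneg μ s d t)]
  exact hK t

/-- The densities `f` for which finitely many functionals `⟨Kᵢ, f⟩` are bounded by those of `V` and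
`U`, with given means. -/
def traceClass (μ s d : Fin r → ℕ) (V U : ℝ → Mat T) (K : κ → Mat T) (q : κ → ℝ) :
    Set (ℝ → Mat T) :=
  {f | IsSpectralDensity f ∧
    (∀ᵐ t ∂circ, ∀ i, frob (K i) (V t) ≤ frob (K i) (f t) ∧ frob (K i) (f t) ≤ frob (K i) (U t)) ∧
    ∀ i, ∫ t, weight μ s d t * frob (K i) (f t) ∂circ = q i}

/-- `L = ∑ᵢ (βᵢ² + γ_{1i} + γ_{2i}) Kᵢᵀ` with the signs and the slackness of the bounds of
`traceClass`. -/
def TraceMultipliers (V U f₀ : ℝ → Mat T) [Fintype κ] (K : κ → Mat T) (L : ℝ → Mat T) : Prop :=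
  ∃ (β : κ → ℝ) (γ₁ γ₂ : κ → ℝ → ℝ),
    (∀ i, AEMeasurable (γ₁ i) circ) ∧ (∀ i, AEMeasurable (γ₂ i) circ) ∧
    ∀ᵐ t ∂circ, L t = ∑ i, ((β i ^ 2 + γ₁ i t + γ₂ i t : ℝ) : ℂ) • (K i)ᵀ ∧
      ∀ i, γ₁ i t ≤ 0 ∧ (frob (K i) (V t) < frob (K i) (f₀ t) → γ₁ i t = 0) ∧
        0 ≤ γ₂ i t ∧ (frob (K i) (f₀ t) < frob (K i) (U t) → γ₂ i t = 0)

variable {V U f₀ : ℝ → Mat T} {K H : κ → Mat T} {q : κ → ℝ} {e : ℝ → Fin T → ℂ}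

lemma mix_mem_traceClass (hs : ∀ j, 0 < s j) {f f' : ℝ → Mat T} (hf : f ∈ traceClass μ s d V U K q)
    (hf' : f' ∈ traceClass μ s d V U K q) {τ : ℝ} (h0 : 0 ≤ τ) (h1 : τ ≤ 1) :
    mix τ f f' ∈ traceClass μ s d V U K q := by
  have h2 := sub_nonneg.2 h1
  have h3 : ∀ i t, frob (K i) (mix τ f f' t) = (1 - τ) * frob (K i) (f t) + τ * frob (K i) (f' t) :=
    fun i t => by rw [mix, frob_add_right, frob_smul_right, frob_smul_right]
  refine ⟨hf.1.mix hf'.1 h0 h1, ?_, fun i => ?_⟩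
  · filter_upwards [hf.2.1, hf'.2.1] with t h4 h5 i
    rw [h3]
    have h6 := h4 i
    have h7 := h5 i
    constructor <;> nlinarith
  · have h4 : ∀ t, weight μ s d t * frob (K i) (mix τ f f' t) =
        (1 - τ) * (weight μ s d t * frob (K i) (f t)) +
          τ * (weight μ s d t * frob (K i) (f' t)) := fun t => by rw [h3]; ring
    simp only [h4]
    rw [integral_add ((integrable_weight_mul d hs (integrable_frob _ hf.1)).const_mul _)
      ((integrable_weight_mul d hs (integrable_frob _ hf'.1)).const_mul _), integral_const_mul,
      integral_const_mul, hf.2.2, hf'.2.2]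
    ring

lemma perturb_mem_traceClass (hs : ∀ j, 0 < s j) (hf : f₀ ∈ traceClass μ s d V U K q)
    {G : Mat T} (hG : G.IsHermitian) {θ : ℝ → ℝ} (hθ : AEMeasurable θ circ)
    (h1 : ∀ᵐ t ∂circ, |θ t| ≤ 1)
    (hroom : ∀ᵐ t ∂circ, |θ t| * ∑ i, ∑ j, ‖G i j‖ ≤ room (f₀ t))
    (hVU : ∀ᵐ t ∂circ, ∀ i, frob (K i) (V t) ≤ frob (K i) (f₀ t) + θ t * frob (K i) G ∧
      frob (K i) (f₀ t) + θ t * frob (K i) G ≤ frob (K i) (U t))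
    (hint : ∀ i, frob (K i) G * ∫ t, weight μ s d t * θ t ∂circ = 0) :
    perturb f₀ θ G ∈ traceClass μ s d V U K q := by
  have h3 : ∀ i t, frob (K i) (perturb f₀ θ G t) = frob (K i) (f₀ t) + θ t * frob (K i) G :=
    fun i t => by rw [perturb, frob_add_right, frob_smul_right]
  refine ⟨isSpectralDensity_perturb hf.1 hθ h1 ?_, ?_, fun i => ?_⟩
  · filter_upwards [hf.1.2, hroom] with t h4 h5
    exact posSemidef_add_smul h4 hG h5
  · simpa only [h3] using hVU
  · have h4 : ∀ t, weight μ s d t * frob (K i) (perturb f₀ θ G t) =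
        weight μ s d t * frob (K i) (f₀ t) + frob (K i) G * (weight μ s d t * θ t) := fun t => by
      rw [h3]; ring
    simp only [h4]
    rw [integral_add (integrable_weight_mul d hs (integrable_frob _ hf.1))
      ((integrable_mul_of_abs_le_one (integrable_weight d hs) hθ h1).const_mul _),
      integral_const_mul, hint, add_zero, hf.2.2]

section Necessity

variable [NeZero T]

/-- The quadratic form of the residual vanishes in the directions on which no functional of the
class depends. -/
lemma quadForm_residual_eq_zero (hμ : ∀ j, 0 < μ j) (hs : ∀ j, 0 < s j)
    (hf : f₀ ∈ traceClass μ s d V U K q) (hpd : ∀ᵐ t ∂circ, (f₀ t).PosDef)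
    (he : InL2 (weighted μ s d f₀) e)
    (hsat : ∀ f ∈ traceClass μ s d V U K q,
      sqNorm (weighted μ s d f) e ≤ sqNorm (weighted μ s d f₀) e)
    {G : Mat T} (hG : G.IsHermitian) (hK : ∀ i, frob (K i) G = 0) :
    ∀ᵐ t ∂circ, quadForm G (e t) = 0 := by
  set c : ℝ := (∑ i, ∑ j, ‖G i j‖) + 1 with hc
  have hc0 : 0 < c := by positivity
  refine ae_eq_zero_of_integral_nonpos (p := fun t => room (f₀ t) / c) (weight_pos_ae d hμ hs)
    (aemeasurable_quadForm_const G he.1)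
    ((aemeasurable_room hf.1.aemeasurable).div_const c)
    (hpd.mono fun t ht => div_pos (room_pos ht) hc0) fun θ hθ hb => ?_
  have hmem : perturb f₀ θ G ∈ traceClass μ s d V U K q := by
    refine perturb_mem_traceClass d hs hf hG hθ (hb.mono fun t ht => ht.2) ?_ ?_ fun i => ?_
    · filter_upwards [hb] with t ht
      have := (le_div_iff₀ hc0).1 ht.1
      refine le_trans ?_ this
      gcongr
      rw [hc]; linarith
    · simpa only [hK, mul_zero, add_zero] using hf.2.1
    · rw [hK, zero_mul]
  exact integral_perturb_nonpos d hs hf.1 he hmem.1 (hsat _ hmem)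

/-- The direction `G` changes only the functional with the index `i`, so that a separating constant is
obtained for `eᵀ G ē`. The perturbation has to keep `f₀` nonnegative definite, which is possible
because `f₀` is positive definite. -/
lemma exists_threshold_traceClass [Countable κ] [DecidableEq κ] (hμ : ∀ j, 0 < μ j)
    (hs : ∀ j, 0 < s j)
    (hf : f₀ ∈ traceClass μ s d V U K q) (hpd : ∀ᵐ t ∂circ, (f₀ t).PosDef)
    (hV : IsSpectralDensity V) (hU : IsSpectralDensity U)
    (he : InL2 (weighted μ s d f₀) e)
    (hsat : ∀ f ∈ traceClass μ s d V U K q,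
      sqNorm (weighted μ s d f) e ≤ sqNorm (weighted μ s d f₀) e)
    {G : Mat T} (hG : G.PosSemidef) {i : κ} (hK : ∀ j, frob (K j) G = if j = i then 1 else 0)
    (hNd : ∃ᵐ t ∂circ, frob (K i) (V t) < frob (K i) (f₀ t)) :
    ∃ c : ℝ, 0 ≤ c ∧
      (∀ᵐ t ∂circ, frob (K i) (V t) < frob (K i) (f₀ t) → c ≤ quadForm G (e t)) ∧
      ∀ᵐ t ∂circ, frob (K i) (f₀ t) < frob (K i) (U t) → quadForm G (e t) ≤ c := by
  set c : ℝ := (∑ i, ∑ j, ‖G i j‖) + 1 with hc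
  have hc0 : 0 < c := by positivity
  have hrm := (aemeasurable_room hf.1.aemeasurable).div_const c
  have hF := aemeasurable_frob (K i) hf.1.aemeasurable
  have hroom : ∀ᵐ t ∂circ, 0 < room (f₀ t) / c := hpd.mono fun t ht => div_pos (room_pos ht) hc0
  have hvar : ∀ θ : ℝ → ℝ, AEMeasurable θ circ →
      (∀ᵐ t ∂circ, -min (room (f₀ t) / c) (frob (K i) (f₀ t) - frob (K i) (V t)) ≤ θ t ∧
        θ t ≤ min (room (f₀ t) / c) (frob (K i) (U t) - frob (K i) (f₀ t)) ∧ |θ t| ≤ 1) →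
      ∫ t, weight μ s d t * θ t ∂circ = 0 →
      Integrable (fun t => weight μ s d t * (θ t * quadForm G (e t))) circ ∧
        ∫ t, weight μ s d t * (θ t * quadForm G (e t)) ∂circ ≤ 0 := by
    intro θ hθ hb hint
    have hmem : perturb f₀ θ G ∈ traceClass μ s d V U K q := by
      refine perturb_mem_traceClass d hs hf hG.1 hθ (hb.mono fun t ht => ht.2.2) ?_ ?_ fun j => ?_
      · filter_upwards [hb] with t ht
        have h3 : |θ t| ≤ room (f₀ t) / c := abs_le.2
          ⟨by linarith [ht.1, min_le_left (room (f₀ t) / c) (frob (K i) (f₀ t) - frob (K i) (V t))],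
            ht.2.1.trans (min_le_left _ _)⟩
        have := (le_div_iff₀ hc0).1 h3
        refine le_trans ?_ this
        gcongr
        rw [hc]; linarith
      · filter_upwards [hb, hf.2.1] with t ht h3 j
        rw [hK]
        split_ifs with hj
        · subst hj
          have h4 := ht.2.1.trans (min_le_right _ _)
          have h5 := min_le_right (room (f₀ t) / c) (frob (K j) (f₀ t) - frob (K j) (V t))
          constructor <;> linarith [ht.1]
        · simpa using h3 j
      · rw [hint, mul_zero]
    exact integral_perturb_nonpos d hs hf.1 he hmem.1 (hsat _ hmem)
  obtain ⟨a, ha0, h1, h2⟩ := exists_threshold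
    (p := fun t => min (room (f₀ t) / c) (frob (K i) (f₀ t) - frob (K i) (V t)))
    (ν := fun t => min (room (f₀ t) / c) (frob (K i) (U t) - frob (K i) (f₀ t)))
    (ρ := fun t => quadForm G (e t))
    (weight_pos_ae d hμ hs) (integrable_weight d hs)
    (aemeasurable_quadForm_const G he.1)
    (hrm.min (hF.sub (aemeasurable_frob (K i) hV.aemeasurable)))
    (hrm.min ((aemeasurable_frob (K i) hU.aemeasurable).sub hF))
    (ae_of_all _ fun t => quadForm_nonneg hG _)
    (by filter_upwards [hroom, hf.2.1] with t h1 h2 using le_min h1.le (sub_nonneg.2 (h2 i).1))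
    (by filter_upwards [hroom, hf.2.1] with t h1 h2 using le_min h1.le (sub_nonneg.2 (h2 i).2))
    ((hNd.and_eventually hroom).mono fun t ht => lt_min ht.2 (sub_pos.2 ht.1))
    hvar
  refine ⟨a, ha0, ?_, ?_⟩
  · filter_upwards [h1, hroom] with t h3 h4 h5 using h3 (lt_min h4 (sub_pos.2 h5))
  · filter_upwards [h2, hroom] with t h3 h4 h5 using h3 (lt_min h4 (sub_pos.2 h5))

/-- Necessity of the multiplier form. With the dual family `Hᵢ`, `e e*` is the sum of the matrices
`(eᵀ Hᵢ ē) Kᵢᵀ`, and the coefficient splits as `cᵢ + min(eᵀ Hᵢ ē - cᵢ, 0) + max(eᵀ Hᵢ ē - cᵢ, 0)` with the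
separating constants `cᵢ = βᵢ²`. -/
lemma traceMultipliers_residual [Fintype κ] [DecidableEq κ] (hμ : ∀ j, 0 < μ j)
    (hs : ∀ j, 0 < s j)
    (hf : f₀ ∈ traceClass μ s d V U K q) (hpd : ∀ᵐ t ∂circ, (f₀ t).PosDef)
    (hV : IsSpectralDensity V) (hU : IsSpectralDensity U)
    (he : InL2 (weighted μ s d f₀) e)
    (hsat : ∀ f ∈ traceClass μ s d V U K q,
      sqNorm (weighted μ s d f) e ≤ sqNorm (weighted μ s d f₀) e)
    (hKH : ∀ i, (K i).IsHermitian) (hH : ∀ i, (H i).PosSemidef)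
    (hdual : ∀ j i, frob (K j) (H i) = if j = i then 1 else 0)
    (hNd : ∀ i, ∃ᵐ t ∂circ, frob (K i) (V t) < frob (K i) (f₀ t)) :
    TraceMultipliers V U f₀ K fun t => vecMulVec (e t) (star (e t)) := by
  choose c hc0 hc1 hc2 using fun i =>
    exists_threshold_traceClass d hμ hs hf hpd hV hU he hsat (hH i) (fun j => hdual j i) (hNd i)
  have hm : ∀ i, AEMeasurable (fun t => quadForm (H i) (e t)) circ := fun i =>
    aemeasurable_quadForm_const (H i) he.1
  -- every Hermitian matrix is a combination of the `H i` and of a matrix orthogonal to the `K i`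
  have hG : ∀ G : Mat T, G.IsHermitian → ∀ᵐ t ∂circ,
      frob (vecMulVec (e t) (star (e t)))ᵀ G =
        frob (∑ i, ((quadForm (H i) (e t) : ℝ) : ℂ) • K i) G := fun G hG => by
    have hsum : (∑ i, (frob (K i) G : ℂ) • H i).IsHermitian := by
      rw [IsHermitian, conjTranspose_sum]
      refine Finset.sum_congr rfl fun i _ => ?_
      rw [conjTranspose_smul, (hH i).1.eq]
      simp
    have h1 := quadForm_residual_eq_zero d hμ hs hf hpd he hsat
      (hG.sub hsum) fun j => by
        rw [frob_sub_right, frob_sum_right]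
        simp only [frob_smul_right, hdual, mul_ite, mul_one, mul_zero, Finset.sum_ite_eq,
          Finset.mem_univ, if_true, sub_self]
    filter_upwards [h1] with t h2
    rw [quadForm_eq_frob (hG.sub hsum), frob_sub_right, sub_eq_zero, frob_sum_right] at h2
    rw [h2, frob_sum_smul_left]
    refine Finset.sum_congr rfl fun i _ => ?_
    rw [frob_smul_right, quadForm_eq_frob (hH i).1, mul_comm]
  refine ⟨fun i => √(c i), fun i t => min (quadForm (H i) (e t) - c i) 0,
    fun i t => max (quadForm (H i) (e t) - c i) 0,
    fun i => ((hm i).sub_const _).min aemeasurable_const,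
    fun i => ((hm i).sub_const _).max aemeasurable_const, ?_⟩
  filter_upwards [ae_all_iff.2 hc1, ae_all_iff.2 hc2,
    ae_all_iff.2 fun k => ae_all_iff.2 fun l => hG _ (isHermitian_hermSingle k l 1),
    ae_all_iff.2 fun k => ae_all_iff.2 fun l => hG _ (isHermitian_hermSingle k l Complex.I)]
    with t h1 h2 h3 h4
  refine ⟨?_, fun i => ⟨min_le_right _ _, fun h5 => min_eq_right (sub_nonneg.2 (h1 i h5)),
    le_max_right _ _, fun h5 => max_eq_right (sub_nonpos.2 (h2 i h5))⟩⟩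
  have h5 : ∀ i, √(c i) ^ 2 + min (quadForm (H i) (e t) - c i) 0 +
      max (quadForm (H i) (e t) - c i) 0 = quadForm (H i) (e t) := fun i => by
    rw [Real.sq_sqrt (hc0 i), add_assoc, min_add_max]; ring
  simp only [h5]
  have h6 : (vecMulVec (e t) (star (e t)))ᵀ = ∑ i, ((quadForm (H i) (e t) : ℝ) : ℂ) • K i := by
    refine eq_of_frob_hermSingle (posSemidef_vecMulVec_self_star (e t)).1.transpose ?_ h3 h4
    rw [IsHermitian, conjTranspose_sum]
    refine Finset.sum_congr rfl fun i _ => ?_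
    rw [conjTranspose_smul, (hKH i).eq]
    simp
  rw [← transpose_transpose (vecMulVec (e t) (star (e t))), h6, transpose_sum]
  exact Finset.sum_congr rfl fun i _ => transpose_smul _ _

end Necessity

/-- Sufficiency of the multiplier form: the terms with the multipliers of the bounds are not positive,
and the term with the constants has mean zero. -/
lemma sqNorm_le_of_traceMultipliers [Fintype κ] (hμ : ∀ j, 0 < μ j) (hs : ∀ j, 0 < s j)
    (hf₀ : f₀ ∈ traceClass μ s d V U K q) (he : InL2 (weighted μ s d f₀) e) {L : ℝ → Mat T}
    (hL : TraceMultipliers V U f₀ K L)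
    (heq : ∀ᵐ t ∂circ, L t = vecMulVec (e t) (star (e t))) {f : ℝ → Mat T}
    (hf : f ∈ traceClass μ s d V U K q) :
    sqNorm (weighted μ s d f) e ≤ sqNorm (weighted μ s d f₀) e := by
  obtain ⟨β, γ₁, γ₂, -, -, hβ⟩ := hL
  have hi : ∀ i, Integrable (fun t => weight μ s d t * frob (K i) (f t)) circ := fun i =>
    integrable_weight_mul d hs (integrable_frob _ hf.1)
  have hi₀ : ∀ i, Integrable (fun t => weight μ s d t * frob (K i) (f₀ t)) circ := fun i =>
    integrable_weight_mul d hs (integrable_frob _ hf₀.1)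
  have h1 : ∀ t, weight μ s d t * ∑ i, β i ^ 2 * (frob (K i) (f t) - frob (K i) (f₀ t)) =
      ∑ i, β i ^ 2 * (weight μ s d t * frob (K i) (f t) - weight μ s d t * frob (K i) (f₀ t)) :=
    fun t => by
      rw [Finset.mul_sum]
      exact Finset.sum_congr rfl fun i _ => by ring
  have h2 : ∀ i, Integrable (fun t => β i ^ 2 * (weight μ s d t * frob (K i) (f t) -
      weight μ s d t * frob (K i) (f₀ t))) circ := fun i => ((hi i).sub (hi₀ i)).const_mul _
  refine sqNorm_le_of_quadForm_le d hμ hs hf₀.1 he hf.1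
    (ζ := fun t => ∑ i, β i ^ 2 * (frob (K i) (f t) - frob (K i) (f₀ t))) ?_ ?_ ?_
  · simp only [h1]
    exact integrable_finsetSum _ fun i _ => h2 i
  · simp only [h1]
    rw [integral_finsetSum _ fun i _ => h2 i]
    refine Finset.sum_eq_zero fun i _ => ?_
    rw [integral_const_mul, integral_sub (hi i) (hi₀ i), hf.2.2, hf₀.2.2, sub_self, mul_zero]
  · filter_upwards [hβ, heq, hf.1.2, hf₀.1.2, hf.2.1, hf₀.2.1] with t h2 h3 h4 h5 h6 h7
    have h8 : (vecMulVec (e t) (star (e t)))ᵀ =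
        ∑ i, ((β i ^ 2 + γ₁ i t + γ₂ i t : ℝ) : ℂ) • K i := by
      rw [← h3, h2.1, transpose_sum]
      exact Finset.sum_congr rfl fun i _ => by rw [transpose_smul, transpose_transpose]
    rw [quadForm_eq_frob (h4.1.sub h5.1), h8, frob_sum_smul_left]
    refine Finset.sum_le_sum fun i _ => ?_
    obtain ⟨g1, g2, g3, g4⟩ := h2.2 i
    rw [frob_sub_right]
    have h9 : γ₁ i t * (frob (K i) (f t) - frob (K i) (f₀ t)) ≤ 0 := by
      rcases (h7 i).1.eq_or_lt with h | h
      · exact mul_nonpos_of_nonpos_of_nonneg g1 (by linarith [(h6 i).1])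
      · rw [g2 h, zero_mul]
    have h10 : γ₂ i t * (frob (K i) (f t) - frob (K i) (f₀ t)) ≤ 0 := by
      rcases (h7 i).2.eq_or_lt with h | h
      · exact mul_nonpos_of_nonneg_of_nonpos g3 (by linarith [(h6 i).2])
      · rw [g4 h, zero_mul]
    linarith

/-- The least favourable densities of a class given by finitely many functionals `⟨Kᵢ, f⟩`, where
the matrices `Kᵢ` have a dual family of nonnegative definite matrices. -/
theorem determinedBy_traceClass [NeZero T] [Fintype κ] [DecidableEq κ] {b : ℕ → Fin T → ℂ}
    (hμ : ∀ j, 0 < μ j) (hs : ∀ j, 0 < s j) (hb : Summable fun k => ‖b k‖)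
    (hV : IsSpectralDensity V) (hU : IsSpectralDensity U)
    (hKH : ∀ i, (K i).IsHermitian) (hH : ∀ i, (H i).PosSemidef)
    (hdual : ∀ j i, frob (K j) (H i) = if j = i then 1 else 0)
    (h0 : IsSpectralDensity f₀) (hm : Minimality μ s d f₀)
    {c₀ : ℕ → Fin T → ℂ} {C₀ : ℝ → Fin T → ℂ} (hsol : IsSolution μ s d b f₀ c₀ C₀) :
    DeterminedBy μ s d b (traceClass μ s d V U K q) f₀ C₀
      (∀ i, ∃ᵐ t ∂circ, frob (K i) (V t) < frob (K i) (f₀ t))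
      (TraceMultipliers V U f₀ K) (TraceMultipliers V U f₀ K) :=
  determinedBy_of_residual d hμ hs hb (fun _ hf => hf.1)
    (fun _ hf _ hf' _ h1 h2 => mix_mem_traceClass d hs hf hf' h1 h2) h0 hm hsol
    (fun _ he hf₀ hsat hNd =>
      traceMultipliers_residual d hμ hs hf₀ hm.1 hV hU he hsat hKH hH hdual hNd)
    fun _ _ he hf₀ hL heq _ hf => sqNorm_le_of_traceMultipliers d hμ hs hf₀ he hL heq hf

end TraceClass

/-! ### The four classes -/


section TraceClasses

variable {r T : ℕ} {μ s : Fin r → ℕ} (d : Fin r → ℕ) {V U f₀ : ℝ → Mat T} {b : ℕ → Fin T → ℂ}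
  {c₀ : ℕ → Fin T → ℂ} {C₀ : ℝ → Fin T → ℂ}

lemma frob_one (A : Mat T) : frob 1 A = A.trace.re := by
  simp [frob, trace_conjTranspose]

lemma frob_one_right (A : Mat T) : frob A 1 = A.trace.re := by simp [frob]

lemma frob_single_left (k : Fin T) (A : Mat T) : frob (single k k 1) A = (A k k).re := by
  simp [frob, trace_single_mul]

lemma class4_eq_traceClass {B₂ : Mat T} {q : ℝ} :
    class4 μ s d V U B₂ q = traceClass μ s d V U (fun _ : Unit => B₂) fun _ => q := by
  ext f
  simp [class4, traceClass]

lemma multipliers4_eq_traceMultipliers {B₂ : Mat T} :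
    Multipliers4 V U f₀ B₂ = TraceMultipliers V U f₀ fun _ : Unit => B₂ := by
  ext L
  constructor
  · rintro ⟨β, γ₁, γ₂, h1, h2, h3⟩
    refine ⟨fun _ => β, fun _ => γ₁, fun _ => γ₂, fun _ => h1, fun _ => h2, ?_⟩
    filter_upwards [h3] with t h4
    exact ⟨by rw [Fintype.sum_unique]; exact h4.1, fun _ => h4.2⟩
  · rintro ⟨β, γ₁, γ₂, h1, h2, h3⟩
    refine ⟨β (), γ₁ (), γ₂ (), h1 (), h2 (), ?_⟩
    filter_upwards [h3] with t h4
    exact ⟨by rw [h4.1, Fintype.sum_unique], h4.2 ()⟩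

/-- The dual matrix is `I / Tr B₂`. -/
theorem determinedBy_class4 [NeZero T] {B₂ : Mat T} {q : ℝ} (hB₂ : B₂.PosDef)
    (hμ : ∀ j, 0 < μ j) (hs : ∀ j, 0 < s j) (hb : Summable fun k => ‖b k‖)
    (hV : IsSpectralDensity V) (hU : IsSpectralDensity U) (h0 : IsSpectralDensity f₀)
    (hm : Minimality μ s d f₀) (hsol : IsSolution μ s d b f₀ c₀ C₀) :
    DeterminedBy μ s d b (class4 μ s d V U B₂ q) f₀ C₀
      (∃ᵐ t ∂circ, frob B₂ (V t) < frob B₂ (f₀ t))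
      (Multipliers4 V U f₀ B₂) (Multipliers4 V U f₀ B₂) := by
  have htr : 0 < B₂.trace.re := (Complex.lt_def.1 hB₂.trace_pos).1
  have h := determinedBy_traceClass d (K := fun _ : Unit => B₂) (q := fun _ => q)
    (H := fun _ => (((B₂.trace.re)⁻¹ : ℝ) : ℂ) • 1) hμ hs hb hV hU (fun _ => hB₂.1)
    (fun _ => PosSemidef.one.smul (by exact_mod_cast (inv_pos.2 htr).le))
    (fun _ _ => by
      rw [frob_smul_right, frob_one_right, inv_mul_cancel₀ htr.ne', if_pos (Subsingleton.elim _ _)])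
    h0 hm hsol
  rw [class4_eq_traceClass, multipliers4_eq_traceMultipliers]
  simpa only [forall_const] using h

/-- The trace is the functional of the identity matrix. -/
theorem determinedBy_class2 [NeZero T] {q : ℝ}
    (hμ : ∀ j, 0 < μ j) (hs : ∀ j, 0 < s j) (hb : Summable fun k => ‖b k‖)
    (hV : IsSpectralDensity V) (hU : IsSpectralDensity U) (h0 : IsSpectralDensity f₀)
    (hm : Minimality μ s d f₀) (hsol : IsSolution μ s d b f₀ c₀ C₀) :
    DeterminedBy μ s d b (class2 μ s d V U q) f₀ C₀
      (∃ᵐ t ∂circ, (V t).trace.re < (f₀ t).trace.re)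
      (Multipliers2 V U f₀) (Multipliers2 V U f₀) := by
  have h := determinedBy_class4 d (q := q) PosDef.one hμ hs hb hV hU h0 hm hsol
  have h1 : class4 μ s d V U 1 q = class2 μ s d V U q := by
    simp only [class4, class2, frob_one]
  have h2 : Multipliers4 V U f₀ 1 = Multipliers2 V U f₀ := by
    ext L
    simp only [Multipliers4, Multipliers2, frob_one, transpose_one]
  simpa only [h1, h2, frob_one] using h

/-- The diagonal matrix units are self-dual. -/
theorem determinedBy_class3 [NeZero T] {q : Fin T → ℝ}
    (hμ : ∀ j, 0 < μ j) (hs : ∀ j, 0 < s j) (hb : Summable fun k => ‖b k‖)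
    (hV : IsSpectralDensity V) (hU : IsSpectralDensity U) (h0 : IsSpectralDensity f₀)
    (hm : Minimality μ s d f₀) (hsol : IsSolution μ s d b f₀ c₀ C₀) :
    DeterminedBy μ s d b (class3 μ s d V U q) f₀ C₀
      (∀ k, ∃ᵐ t ∂circ, (V t k k).re < (f₀ t k k).re)
      (Multipliers3 V U f₀) (Multipliers3 V U f₀) := by
  have hpsd : ∀ k : Fin T, (single k k 1 : Mat T).PosSemidef := fun k => by
    have h : (single k k 1 : Mat T) = vecMulVec (Pi.single k 1) (star (Pi.single k 1)) := by
      rw [Pi.star_single, star_one, single_eq_single_vecMulVec_single]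
    rw [h]; exact posSemidef_vecMulVec_self_star _
  have h := determinedBy_traceClass d (K := fun k : Fin T => single k k 1) (q := q)
    (H := fun k => single k k 1) hμ hs hb hV hU (fun k => (hpsd k).1) hpsd
    (fun j i => by
      rw [frob_single_left, single_apply]
      by_cases hij : j = i
      · subst hij; simp
      · simp [hij, Ne.symm hij]) h0 hm hsol
  have h1 : traceClass μ s d V U (fun k : Fin T => single k k 1) q = class3 μ s d V U q := by
    simp only [traceClass, class3, frob_single_left]
  have h2 : TraceMultipliers V U f₀ (fun k : Fin T => single k k 1) = Multipliers3 V U f₀ := by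
    ext L
    simp only [TraceMultipliers, Multipliers3, frob_single_left, transpose_single]
    have h3 : ∀ v : Fin T → ℂ, ∑ i, v i • (single i i 1 : Mat T) = diagonal v := fun v => by
      simp only [smul_single, smul_eq_mul, mul_one, sum_single_eq_diagonal]
    simp only [h3]
  simpa only [h1, h2, frob_single_left] using h

end TraceClasses

section LoewnerClass

variable {T : ℕ}

lemma frob_add_left (A B C : Mat T) : frob (A + B) C = frob A C + frob B C := by
  simp [frob, Matrix.add_mul]

lemma frob_neg_left (A B : Mat T) : frob (-A) B = -frob A B := by simp [frob]

/-- The cone of nonnegative definite matrices is contained in its dual cone. -/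
lemma frob_nonneg {A B : Mat T} (hA : A.PosSemidef) (hB : B.PosSemidef) : 0 ≤ frob A B := by
  obtain ⟨C, rfl⟩ : ∃ C : Mat T, A = Cᴴ * C := by
    open scoped MatrixOrder in
    exact CStarAlgebra.nonneg_iff_eq_star_mul_self.1 hA.nonneg
  rw [frob, hB.1.eq, Matrix.mul_assoc, trace_mul_comm, Matrix.mul_assoc, ← Matrix.mul_assoc]
  exact PosSemidef.trace_re_nonneg (hB.mul_mul_conjTranspose_same C)

lemma frob_eq_zero_of_mul_eq_zero {A B : Mat T} (hB : B.IsHermitian) (h : A * B = 0) :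
    frob A B = 0 := by
  rw [frob, hB.eq, h, trace_zero, Complex.zero_re]

lemma quadForm_vecMulVec (v x : Fin T → ℂ) :
    quadForm (vecMulVec v (star v)) x = ‖x ⬝ᵥ v‖ ^ 2 := by
  rw [quadForm, vecMulVec_mulVec, dotProduct_smul]
  have h : star v ⬝ᵥ star x = conj (x ⬝ᵥ v) := by
    rw [star_dotProduct_star]; rfl
  rw [h, MulOpposite.smul_eq_mul_unop, MulOpposite.unop_op, Complex.mul_conj,
    Complex.normSq_eq_norm_sq, Complex.ofReal_re]

lemma vecMulVec_smul_star (k : ℂ) (x : Fin T → ℂ) :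
    vecMulVec (k • x) (star (k • x)) = ((‖k‖ ^ 2 : ℝ) : ℂ) • vecMulVec x (star x) := by
  ext i j
  rw [← Complex.normSq_eq_norm_sq, ← Complex.mul_conj]
  simp only [vecMulVec_apply, Pi.star_apply, Pi.smul_apply, Matrix.smul_apply, smul_eq_mul, star_mul',
    Complex.star_def]
  ring

/-- If every linear functional is smaller at `x` than at `y`, then `x` is a multiple of `y`. -/
lemma exists_eq_smul_of_norm_dotProduct_le {x y : Fin T → ℂ}
    (h : ∀ v, ‖x ⬝ᵥ v‖ ^ 2 ≤ ‖y ⬝ᵥ v‖ ^ 2) : ∃ c : ℂ, x = c • y := by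
  by_cases hy : y = 0
  · subst hy
    have h1 := h (star x)
    rw [zero_dotProduct, norm_zero] at h1
    have h2 : x ⬝ᵥ star x = 0 := by
      rw [← norm_le_zero_iff]
      nlinarith [norm_nonneg (x ⬝ᵥ star x)]
    exact ⟨0, by rw [dotProduct_self_star_eq_zero.1 h2, smul_zero]⟩
  have hyy : y ⬝ᵥ star y ≠ 0 := fun h1 => hy (dotProduct_self_star_eq_zero.1 h1)
  set c := (x ⬝ᵥ star y) / (y ⬝ᵥ star y) with hc
  refine ⟨c, ?_⟩
  set z := x - c • y with hz
  have h1 : z ⬝ᵥ star y = 0 := by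
    rw [hz, sub_dotProduct, smul_dotProduct, smul_eq_mul, hc, div_mul_cancel₀ _ hyy, sub_self]
  have h2 : y ⬝ᵥ star z = 0 := by
    have : y ⬝ᵥ star z = star (z ⬝ᵥ star y) := by
      rw [← star_dotProduct_star, star_star]
    rw [this, h1, star_zero]
  have h3 : x ⬝ᵥ star z = 0 := by
    have := h (star z)
    rw [h2, norm_zero] at this
    rw [← norm_le_zero_iff]
    nlinarith [norm_nonneg (x ⬝ᵥ star z)]
  have h4 : z ⬝ᵥ star z = 0 := by
    conv_lhs => rw [hz]
    rw [sub_dotProduct, smul_dotProduct, h3, h2, smul_zero, sub_zero]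
  exact sub_eq_zero.1 (dotProduct_self_star_eq_zero.1 h4)

lemma posSemidef_add_smul_of_neg_le {A G : Mat T} (hA : A.PosSemidef) (hG : G.PosSemidef) {θ : ℝ}
    (hθ : -θ * ∑ i, ∑ j, ‖G i j‖ ≤ room A) : (A + (θ : ℂ) • G).PosSemidef := by
  rcases le_total 0 θ with h | h
  · exact hA.add (hG.smul (by exact_mod_cast h))
  · exact posSemidef_add_smul hA hG.1 (by rwa [abs_of_nonpos h])

variable {r : ℕ} {μ s : Fin r → ℕ} (d : Fin r → ℕ) {V U f₀ : ℝ → Mat T} {Q : Mat T}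
  {e : ℝ → Fin T → ℂ}

lemma integrable_weight_mul_complex (hs : ∀ j, 0 < s j) {F : ℝ → ℂ} (hF : Integrable F circ) :
    Integrable (fun t => (weight μ s d t : ℂ) * F t) circ := by
  obtain ⟨K, _, hK⟩ := exists_weight_le (μ := μ) d hs
  refine hF.bdd_mul (c := K)
    (Complex.measurable_ofReal.comp (measurable_weight μ s d)).aestronglyMeasurable
    (ae_of_all _ fun t => ?_)
  rw [Complex.norm_of_nonneg (weight_nonneg μ s d t)]
  exact hK t

lemma mix_mem_class1 (hs : ∀ j, 0 < s j) {f f' : ℝ → Mat T} (hf : f ∈ class1 μ s d V U Q)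
    (hf' : f' ∈ class1 μ s d V U Q) {τ : ℝ} (h0 : 0 ≤ τ) (h1 : τ ≤ 1) :
    mix τ f f' ∈ class1 μ s d V U Q := by
  have h2 := sub_nonneg.2 h1
  have h3 : ∀ {A B : Mat T}, A.PosSemidef → B.PosSemidef →
      (((1 - τ : ℝ) : ℂ) • A + (τ : ℂ) • B).PosSemidef := fun hA hB =>
    (hA.smul (by exact_mod_cast h2)).add (hB.smul (by exact_mod_cast h0))
  refine ⟨hf.1.mix hf'.1 h0 h1, ?_, fun i j => ?_⟩
  · filter_upwards [hf.2.1, hf'.2.1] with t h4 h5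
    have e1 : mix τ f f' t - V t =
        ((1 - τ : ℝ) : ℂ) • (f t - V t) + (τ : ℂ) • (f' t - V t) := by
      rw [mix]; push_cast; module
    have e2 : U t - mix τ f f' t =
        ((1 - τ : ℝ) : ℂ) • (U t - f t) + (τ : ℂ) • (U t - f' t) := by
      rw [mix]; push_cast; module
    rw [e1, e2]
    exact ⟨h3 h4.1 h5.1, h3 h4.2 h5.2⟩
  · have h4 : ∀ t, (weight μ s d t : ℂ) * mix τ f f' t i j =
        ((1 - τ : ℝ) : ℂ) * (weight μ s d t * f t i j) + (τ : ℂ) * (weight μ s d t * f' t i j) :=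
      fun t => by
        simp only [mix, Matrix.add_apply, Matrix.smul_apply, smul_eq_mul]; ring
    simp only [h4]
    rw [integral_add ((integrable_weight_mul_complex d hs (hf.1.1 i j)).const_mul _)
      ((integrable_weight_mul_complex d hs (hf'.1.1 i j)).const_mul _), integral_const_mul,
      integral_const_mul, hf.2.2, hf'.2.2]
    push_cast; ring

/-- Only nonnegative definite directions `G` are used: where `θ > 0` the lower bound is not affected, and
where `θ < 0` the upper bound is not. -/
lemma perturb_mem_class1 (hs : ∀ j, 0 < s j) (hV : IsSpectralDensity V)
    (hf : f₀ ∈ class1 μ s d V U Q) {G : Mat T} (hG : G.PosSemidef) {θ : ℝ → ℝ}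
    (hθ : AEMeasurable θ circ) (h1 : ∀ᵐ t ∂circ, |θ t| ≤ 1)
    (hlow : ∀ᵐ t ∂circ, -θ t * ∑ i, ∑ j, ‖G i j‖ ≤ room (f₀ t - V t))
    (hupp : ∀ᵐ t ∂circ, θ t * ∑ i, ∑ j, ‖G i j‖ ≤ room (U t - f₀ t))
    (hint : ∫ t, weight μ s d t * θ t ∂circ = 0) :
    perturb f₀ θ G ∈ class1 μ s d V U Q := by
  have hVU : ∀ᵐ t ∂circ, (perturb f₀ θ G t - V t).PosSemidef ∧
      (U t - perturb f₀ θ G t).PosSemidef := by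
    filter_upwards [hf.2.1, hlow, hupp] with t h2 h3 h4
    have e1 : perturb f₀ θ G t - V t = (f₀ t - V t) + (θ t : ℂ) • G := by rw [perturb]; abel
    have e2 : U t - perturb f₀ θ G t = (U t - f₀ t) + ((-θ t : ℝ) : ℂ) • G := by
      rw [perturb]; push_cast; module
    rw [e1, e2]
    exact ⟨posSemidef_add_smul_of_neg_le h2.1 hG h3,
      posSemidef_add_smul_of_neg_le h2.2 hG (by rwa [neg_neg])⟩
  refine ⟨isSpectralDensity_perturb hf.1 hθ h1 ?_, hVU, fun i j => ?_⟩
  · filter_upwards [hVU, hV.2] with t h2 h3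
    simpa using h2.1.add h3
  · have hi := integrable_mul_of_abs_le_one (integrable_weight (μ := μ) d hs) hθ h1
    have h4 : ∀ t, (weight μ s d t : ℂ) * perturb f₀ θ G t i j =
        weight μ s d t * f₀ t i j + ((weight μ s d t * θ t : ℝ) : ℂ) * G i j := fun t => by
      simp only [perturb, Matrix.add_apply, Matrix.smul_apply, smul_eq_mul]; push_cast; ring
    have h5 : Integrable (fun t => ((weight μ s d t * θ t : ℝ) : ℂ) * G i j) circ :=
      hi.ofReal.mul_const _
    simp only [h4]
    rw [integral_add (integrable_weight_mul_complex d hs (hf.1.1 i j)) h5,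
      integral_mul_const, integral_complex_ofReal, hint, hf.2.2]
    simp

lemma aemeasurable_room_sub {f g : ℝ → Mat T} (hf : IsSpectralDensity f)
    (hg : IsSpectralDensity g) : AEMeasurable (fun t => room (f t - g t)) circ :=
  aemeasurable_room (f := fun t => f t - g t) fun i j =>
    (hf.aemeasurable i j).sub (hg.aemeasurable i j)

/-- The separating constant for the functional `|e · v|²`, from perturbations in the direction `v v*`. -/
lemma exists_threshold_class1 (hμ : ∀ j, 0 < μ j) (hs : ∀ j, 0 < s j)
    (hV : IsSpectralDensity V) (hU : IsSpectralDensity U) (hf : f₀ ∈ class1 μ s d V U Q)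
    (he : InL2 (weighted μ s d f₀) e)
    (hsat : ∀ f ∈ class1 μ s d V U Q,
      sqNorm (weighted μ s d f) e ≤ sqNorm (weighted μ s d f₀) e)
    (hNd : ∃ᵐ t ∂circ, 0 < room (f₀ t - V t)) (v : Fin T → ℂ) :
    ∃ c : ℝ, 0 ≤ c ∧ (∀ᵐ t ∂circ, 0 < room (f₀ t - V t) → c ≤ ‖e t ⬝ᵥ v‖ ^ 2) ∧
      ∀ᵐ t ∂circ, 0 < room (U t - f₀ t) → ‖e t ⬝ᵥ v‖ ^ 2 ≤ c := by
  set G : Mat T := vecMulVec v (star v) with hGd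
  have hG : G.PosSemidef := posSemidef_vecMulVec_self_star v
  set c : ℝ := (∑ i, ∑ j, ‖G i j‖) + 1 with hc
  have hC0 : 0 ≤ ∑ i, ∑ j, ‖G i j‖ := by positivity
  have hc0 : 0 < c := by positivity
  have hle : ∀ {x y : ℝ}, x ≤ y / c → 0 ≤ y → x * ∑ i, ∑ j, ‖G i j‖ ≤ y := fun {x y} h hy => by
    calc x * ∑ i, ∑ j, ‖G i j‖ ≤ y / c * ∑ i, ∑ j, ‖G i j‖ := by gcongr
      _ ≤ y / c * c := by
          have : 0 ≤ y / c := by positivity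
          gcongr
          rw [hc]; linarith
      _ = y := div_mul_cancel₀ _ hc0.ne'
  have hvar : ∀ θ : ℝ → ℝ, AEMeasurable θ circ →
      (∀ᵐ t ∂circ, -(room (f₀ t - V t) / c) ≤ θ t ∧ θ t ≤ room (U t - f₀ t) / c ∧ |θ t| ≤ 1) →
      ∫ t, weight μ s d t * θ t ∂circ = 0 →
      Integrable (fun t => weight μ s d t * (θ t * quadForm G (e t))) circ ∧
        ∫ t, weight μ s d t * (θ t * quadForm G (e t)) ∂circ ≤ 0 := by
    intro θ hθ hb hint
    have hmem : perturb f₀ θ G ∈ class1 μ s d V U Q := by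
      refine perturb_mem_class1 d hs hV hf hG hθ (hb.mono fun t ht => ht.2.2) ?_ ?_ hint
      · filter_upwards [hb, hf.2.1] with t h1 h2
        exact hle (by linarith [h1.1]) (room_nonneg h2.1)
      · filter_upwards [hb, hf.2.1] with t h1 h2
        exact hle h1.2.1 (room_nonneg h2.2)
    exact integral_perturb_nonpos d hs hf.1 he hmem.1 (hsat _ hmem)
  obtain ⟨a, ha0, h1, h2⟩ := exists_threshold (p := fun t => room (f₀ t - V t) / c)
    (ν := fun t => room (U t - f₀ t) / c) (ρ := fun t => quadForm G (e t))
    (weight_pos_ae d hμ hs) (integrable_weight d hs) (aemeasurable_quadForm_const G he.1)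
    ((aemeasurable_room_sub hf.1 hV).div_const c) ((aemeasurable_room_sub hU hf.1).div_const c)
    (ae_of_all _ fun t => quadForm_nonneg hG _)
    (hf.2.1.mono fun t ht => div_nonneg (room_nonneg ht.1) hc0.le)
    (hf.2.1.mono fun t ht => div_nonneg (room_nonneg ht.2) hc0.le)
    (hNd.mono fun t ht => div_pos ht hc0) hvar
  simp only [hGd, quadForm_vecMulVec] at h1 h2
  exact ⟨a, ha0, h1.mono fun t ht hp => ht (div_pos hp hc0),
    h2.mono fun t ht hp => ht (div_pos hp hc0)⟩

/-- For the Loewner order the separating constants for the functionals `|e · v|²` make the residual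
proportional to one vector `x` wherever one of the bounds is slack. -/
lemma exists_vector_class1 (hμ : ∀ j, 0 < μ j) (hs : ∀ j, 0 < s j)
    (hV : IsSpectralDensity V) (hU : IsSpectralDensity U) (hf : f₀ ∈ class1 μ s d V U Q)
    (he : InL2 (weighted μ s d f₀) e)
    (hsat : ∀ f ∈ class1 μ s d V U Q,
      sqNorm (weighted μ s d f) e ≤ sqNorm (weighted μ s d f₀) e)
    (hNd : ∃ᵐ t ∂circ, 0 < room (f₀ t - V t))
    (hne : ∃ᵐ t ∂circ, 0 < room (U t - f₀ t) ∧ e t ≠ 0) :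
    ∃ x : Fin T → ℂ, x ≠ 0 ∧ ∀ᵐ t ∂circ,
      0 < room (f₀ t - V t) ∨ 0 < room (U t - f₀ t) → ∃ k : ℂ, e t = k • x := by
  -- a countable dense set of `v` avoids an uncountable union of null sets
  set D := TopologicalSpace.denseSeq (Fin T → ℂ) with hD
  choose c hc0 hc1 hc2 using fun v =>
    exists_threshold_class1 d hμ hs hV hU hf he hsat hNd v
  have h1 := ae_all_iff.2 fun n => hc1 (D n)
  have h2 := ae_all_iff.2 fun n => hc2 (D n)
  have hcmp : ∀ {t u : ℝ}, (∀ n, ‖e t ⬝ᵥ D n‖ ^ 2 ≤ c (D n)) → (∀ n, c (D n) ≤ ‖e u ⬝ᵥ D n‖ ^ 2) →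
      ∃ k : ℂ, e t = k • e u := fun {t u} ht hu => by
    refine exists_eq_smul_of_norm_dotProduct_le fun v => ?_
    refine (TopologicalSpace.denseRange_denseSeq (Fin T → ℂ)).induction_on
      (p := fun v => ‖e t ⬝ᵥ v‖ ^ 2 ≤ ‖e u ⬝ᵥ v‖ ^ 2) v ?_ fun n => (ht n).trans (hu n)
    have hcont : ∀ y : Fin T → ℂ, Continuous fun v : Fin T → ℂ => ‖y ⬝ᵥ v‖ ^ 2 := fun y =>
      (continuous_const.dotProduct continuous_id).norm.pow 2
    exact isClosed_le (hcont _) (hcont _)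
  -- `e t` and `e u` represent the two sides of the separation; both are nonzero
  obtain ⟨t, ⟨htN, htx⟩, ht⟩ := (hne.and_eventually h2).exists
  obtain ⟨u, huP, hu⟩ := (hNd.and_eventually h1).exists
  obtain ⟨k, hk⟩ := hcmp (fun n => ht n htN) fun n => hu n huP
  have hk0 : k ≠ 0 := fun h => htx (by rw [hk, h, zero_smul])
  refine ⟨e t, htx, ?_⟩
  filter_upwards [h1, h2] with τ h3 h4 h5
  rcases h5 with h5 | h5
  · obtain ⟨l, hl⟩ := hcmp (fun n => ht n htN) fun n => h3 n h5
    have hl0 : l ≠ 0 := fun h => htx (by rw [hl, h, zero_smul])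
    exact ⟨l⁻¹, by rw [hl, inv_smul_smul₀ hl0]⟩
  · obtain ⟨l, hl⟩ := hcmp (fun n => h4 n h5) fun n => hu n huP
    exact ⟨l * k⁻¹, by rw [hl, hk, smul_smul, mul_assoc, inv_mul_cancel₀ hk0, mul_one]⟩

/-- Necessity of the multiplier form for the Loewner order. With `β β* = c x x*`, where `x` spans the
residual off the set on which both bounds are active and `c` is the separating constant in the
direction dual to `x`, the difference `e e* - β β*` is attributed to `Γ₂` where `f₀ > V` and to `Γ₁`
where `f₀ < U` but not `f₀ > V`. Where neither bound is slack, `Γ₁ = -β β*` and `Γ₂ = e e*`. -/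
lemma multipliers1_residual [NeZero T] (hμ : ∀ j, 0 < μ j) (hs : ∀ j, 0 < s j)
    (hV : IsSpectralDensity V) (hU : IsSpectralDensity U) (hf : f₀ ∈ class1 μ s d V U Q)
    (he : InL2 (weighted μ s d f₀) e)
    (hsat : ∀ f ∈ class1 μ s d V U Q,
      sqNorm (weighted μ s d f) e ≤ sqNorm (weighted μ s d f₀) e)
    (hNd : ∃ᵐ t ∂circ, (f₀ t - V t).PosDef) :
    Multipliers1 V U f₀ fun t => vecMulVec (e t) (star (e t)) := by
  have hNd' : ∃ᵐ t ∂circ, 0 < room (f₀ t - V t) := hNd.mono fun t ht => room_pos ht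
  have hEm : ∀ i j, AEMeasurable (fun t => vecMulVec (e t) (star (e t)) i j) circ := fun i j => by
    simp only [vecMulVec_apply, Pi.star_apply]
    exact (aemeasurable_pi_iff.1 he.1 i).mul
      (Complex.continuous_conj.measurable.comp_aemeasurable (aemeasurable_pi_iff.1 he.1 j))
  have hE : ∀ t, (vecMulVec (e t) (star (e t))).PosSemidef := fun t =>
    posSemidef_vecMulVec_self_star _
  -- if `e` vanishes wherever `f₀ < U`, the choice `β = 0`, `Γ₂ = e e*` is possible
  by_cases hne : ∃ᵐ t ∂circ, 0 < room (U t - f₀ t) ∧ e t ≠ 0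
  swap
  · refine ⟨0, 0, fun t => vecMulVec (e t) (star (e t)), fun _ _ => aemeasurable_const, hEm, ?_⟩
    filter_upwards [not_frequently.1 hne] with t ht
    refine ⟨by simp, by simpa using PosSemidef.zero, fun _ => rfl, hE t, fun h => ?_⟩
    have : e t = 0 := by
      by_contra h2
      exact ht ⟨room_pos h, h2⟩
    rw [this, zero_vecMulVec]
  obtain ⟨x, hx, hpar⟩ := exists_vector_class1 d hμ hs hV hU hf he hsat hNd' hne
  have hxx : x ⬝ᵥ star x ≠ 0 := fun h => hx (dotProduct_self_star_eq_zero.1 h)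
  obtain ⟨c, hc0, hc1, hc2⟩ := exists_threshold_class1 d hμ hs hV hU hf he hsat hNd'
    ((x ⬝ᵥ star x)⁻¹ • star x)
  set X : Mat T := vecMulVec x (star x) with hX
  have hXp : X.PosSemidef := posSemidef_vecMulVec_self_star x
  have hEk : ∀ {t : ℝ} {k : ℂ}, e t = k • x →
      vecMulVec (e t) (star (e t)) = ((‖k‖ ^ 2 : ℝ) : ℂ) • X := fun {t k} h => by
    rw [h, vecMulVec_smul_star]
  have hkv : ∀ {t : ℝ} {k : ℂ}, e t = k • x →
      ‖e t ⬝ᵥ ((x ⬝ᵥ star x)⁻¹ • star x)‖ ^ 2 = ‖k‖ ^ 2 := fun {t k} h => by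
    rw [h, smul_dotProduct, dotProduct_smul, smul_eq_mul, smul_eq_mul, inv_mul_cancel₀ hxx, mul_one]
  set A : Mat T := (c : ℂ) • X with hA
  have hAp : A.PosSemidef := hXp.smul (by exact_mod_cast hc0)
  -- the indicators of `{f₀ > V}ᶜ` and of `{f₀ < U}`, which make `Γ₁` measurable
  set p : ℝ → ℂ := {t | 0 < room (f₀ t - V t)}ᶜ.indicator fun _ => 1 with hp
  set n : ℝ → ℂ := {t | 0 < room (U t - f₀ t)}.indicator fun _ => 1 with hn
  have hpm : AEMeasurable p circ := aemeasurable_const.indicator₀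
    (nullMeasurableSet_lt aemeasurable_const (aemeasurable_room_sub hf.1 hV)).compl
  have hnm : AEMeasurable n circ := aemeasurable_const.indicator₀
    (nullMeasurableSet_lt aemeasurable_const (aemeasurable_room_sub hU hf.1))
  set Γ : ℝ → Mat T := fun t => p t • (n t • vecMulVec (e t) (star (e t)) - A) with hΓ
  have hΓm : ∀ i j, AEMeasurable (fun t => Γ t i j) circ := fun i j => by
    simp only [hΓ, Matrix.smul_apply, Matrix.sub_apply, smul_eq_mul]
    exact hpm.mul ((hnm.mul (hEm i j)).sub_const _)
  refine ⟨(√c : ℂ) • x, Γ, fun t => vecMulVec (e t) (star (e t)) - A - Γ t, hΓm,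
    fun i j => ((hEm i j).sub_const _).sub (hΓm i j), ?_⟩
  have hβ : vecMulVec ((√c : ℂ) • x) (star ((√c : ℂ) • x)) = A := by
    rw [vecMulVec_smul_star, Complex.norm_of_nonneg (Real.sqrt_nonneg c), Real.sq_sqrt hc0]
  filter_upwards [hpar, hc1, hc2, hf.2.1] with t h1 h2 h3 h4
  refine ⟨by rw [hβ]; abel, ?_⟩
  by_cases hP : 0 < room (f₀ t - V t)
  · have hpt : p t = 0 := Set.indicator_of_notMem (by simpa using hP) _
    have hΓt : Γ t = 0 := by simp only [hΓ, hpt, zero_smul]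
    obtain ⟨k, hk⟩ := h1 (Or.inl hP)
    have h5 := h2 hP
    rw [hkv hk] at h5
    rw [hΓt, sub_zero, hEk hk, hA, ← sub_smul, ← Complex.ofReal_sub]
    refine ⟨by simpa using PosSemidef.zero, fun _ => rfl,
      hXp.smul (by exact_mod_cast sub_nonneg.2 h5), fun h => ?_⟩
    have h6 := h3 (room_pos h)
    rw [hkv hk] at h6
    rw [le_antisymm h6 h5, sub_self, Complex.ofReal_zero, zero_smul]
  · have hpt : p t = 1 := Set.indicator_of_mem (by simpa using hP) _
    by_cases hN : 0 < room (U t - f₀ t)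
    · have hnt : n t = 1 := Set.indicator_of_mem (by simpa using hN) _
      have hΓt : Γ t = vecMulVec (e t) (star (e t)) - A := by
        simp only [hΓ, hpt, hnt, one_smul]
      obtain ⟨k, hk⟩ := h1 (Or.inr hN)
      have h5 := h3 hN
      rw [hkv hk] at h5
      rw [hΓt, sub_self]
      refine ⟨?_, fun h => absurd (room_pos h) hP, PosSemidef.zero, fun _ => rfl⟩
      rw [neg_sub, hEk hk, hA, ← sub_smul, ← Complex.ofReal_sub]
      exact hXp.smul (by exact_mod_cast sub_nonneg.2 h5)
    · have hnt : n t = 0 := Set.indicator_of_notMem (by simpa using hN) _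
      have hΓt : Γ t = -A := by simp only [hΓ, hpt, hnt, one_smul, zero_smul, zero_sub]
      rw [hΓt, neg_neg, sub_neg_eq_add, sub_add_cancel]
      exact ⟨hAp, fun h => absurd (room_pos h) hP, hE t, fun h => absurd (room_pos h) hN⟩

/-- Sufficiency of the multiplier form: by complementary slackness `⟨Γ₁ᵀ, f - f₀⟩ = ⟨Γ₁ᵀ, f - V⟩ ≤ 0` and
`⟨Γ₂ᵀ, f - f₀⟩ = -⟨Γ₂ᵀ, U - f⟩ ≤ 0`, and the quadratic form of `f - f₀` at `β` has weighted mean zero. -/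
lemma sqNorm_le_of_strictMultipliers1 (hμ : ∀ j, 0 < μ j) (hs : ∀ j, 0 < s j)
    (hf₀ : f₀ ∈ class1 μ s d V U Q) (he : InL2 (weighted μ s d f₀) e) {L : ℝ → Mat T}
    (hL : StrictMultipliers1 V U f₀ L)
    (heq : ∀ᵐ t ∂circ, L t = vecMulVec (e t) (star (e t))) {f : ℝ → Mat T}
    (hf : f ∈ class1 μ s d V U Q) :
    sqNorm (weighted μ s d f) e ≤ sqNorm (weighted μ s d f₀) e := by
  obtain ⟨β, Γ₁, Γ₂, -, -, hβ⟩ := hL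
  set ψ : ℝ → ℂ := fun t => ∑ i, ∑ j, β i *
    ((weight μ s d t * f t i j - weight μ s d t * f₀ t i j) * conj (β j)) with hψ
  have hi : ∀ i j, Integrable (fun t => β i *
      ((weight μ s d t * f t i j - weight μ s d t * f₀ t i j) * conj (β j))) circ := fun i j =>
    (((integrable_weight_mul_complex d hs (hf.1.1 i j)).sub
      (integrable_weight_mul_complex d hs (hf₀.1.1 i j))).mul_const _).const_mul _
  have hψi : Integrable ψ circ := integrable_finsetSum _ fun i _ => integrable_finsetSum _ fun j _ =>
    hi i j
  have hψ0 : ∫ t, ψ t ∂circ = 0 := by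
    simp only [hψ]
    rw [integral_finsetSum _ fun i _ => integrable_finsetSum _ fun j _ => hi i j]
    refine Finset.sum_eq_zero fun i _ => ?_
    rw [integral_finsetSum _ fun j _ => hi i j]
    refine Finset.sum_eq_zero fun j _ => ?_
    rw [integral_const_mul, integral_mul_const,
      integral_sub (integrable_weight_mul_complex d hs (hf.1.1 i j))
        (integrable_weight_mul_complex d hs (hf₀.1.1 i j)), hf.2.2, hf₀.2.2, sub_self, zero_mul,
      mul_zero]
  have hre : ∀ t, weight μ s d t * quadForm (f t - f₀ t) β = (ψ t).re := fun t => by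
    rw [quadForm_eq_re, ← Complex.re_ofReal_mul, sesqForm_eq_sum, Finset.mul_sum]
    simp only [hψ, Finset.mul_sum, Matrix.sub_apply]
    congr 1
    refine Finset.sum_congr rfl fun i _ => Finset.sum_congr rfl fun j _ => ?_
    ring
  refine sqNorm_le_of_quadForm_le d hμ hs hf₀.1 he hf.1 (ζ := fun t => quadForm (f t - f₀ t) β)
    ?_ ?_ ?_
  · simp only [hre]
    exact hψi.re
  · simp only [hre]
    have h1 : ∫ t, (ψ t).re ∂circ = (∫ t, ψ t ∂circ).re := integral_re hψi
    rw [h1, hψ0, Complex.zero_re]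
  · filter_upwards [hβ, heq, hf.1.2, hf₀.1.2, hf.2.1, hf₀.2.1] with t h2 h3 h4 h5 h6 h7
    obtain ⟨g1, g2, g3, g4, g5⟩ := h2
    have hH := h4.1.sub h5.1
    rw [quadForm_eq_frob hH, ← h3, g1, transpose_add, transpose_add, frob_add_left, frob_add_left,
      ← quadForm_eq_frob hH]
    have h8 : frob (Γ₁ t)ᵀ (f t - f₀ t) ≤ 0 := by
      have h9 := frob_nonneg g2.transpose h6.1
      have h10 := frob_eq_zero_of_mul_eq_zero h7.1.1 g3
      rw [transpose_neg, frob_neg_left] at h9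
      rw [← sub_sub_sub_cancel_right (f t) (f₀ t) (V t), frob_sub_right, h10]
      linarith
    have h11 : frob (Γ₂ t)ᵀ (f t - f₀ t) ≤ 0 := by
      have h9 := frob_nonneg g4.transpose h6.2
      have h10 := frob_eq_zero_of_mul_eq_zero h7.2.1 g5
      rw [← sub_sub_sub_cancel_left (f₀ t) (f t) (U t), frob_sub_right, h10]
      linarith
    linarith

theorem determinedBy_class1 [NeZero T] {b : ℕ → Fin T → ℂ} {c₀ : ℕ → Fin T → ℂ}
    {C₀ : ℝ → Fin T → ℂ}
    (hμ : ∀ j, 0 < μ j) (hs : ∀ j, 0 < s j) (hb : Summable fun k => ‖b k‖)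
    (hV : IsSpectralDensity V) (hU : IsSpectralDensity U) (h0 : IsSpectralDensity f₀)
    (hm : Minimality μ s d f₀) (hsol : IsSolution μ s d b f₀ c₀ C₀) :
    DeterminedBy μ s d b (class1 μ s d V U Q) f₀ C₀ (∃ᵐ t ∂circ, (f₀ t - V t).PosDef)
      (Multipliers1 V U f₀) (StrictMultipliers1 V U f₀) :=
  determinedBy_of_residual d hμ hs hb (fun _ hf => hf.1)
    (fun _ hf _ hf' _ h1 h2 => mix_mem_class1 d hs hf hf' h1 h2) h0 hm hsol
    (fun _ he hf₀ hsat hNd => multipliers1_residual d hμ hs hV hU hf₀ he hsat hNd)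
    fun _ _ he hf₀ hL heq _ hf => sqNorm_le_of_strictMultipliers1 d hμ hs hf₀ he hL heq hf

end LoewnerClass

section Solution

variable {r T : ℕ} {μ s : Fin r → ℕ} (d : Fin r → ℕ) {b : ℕ → Fin T → ℂ} {f : ℝ → Mat T}

/-- The system `𝐅 c = b` has a unique solution of finite energy. -/
theorem exists_unique_isSolution (hμ : ∀ j, 0 < μ j) (hs : ∀ j, 0 < s j)
    (hb : Summable fun k => ‖b k‖) (hf : IsSpectralDensity f) (hm : Minimality μ s d f) :
    ∃ c C, IsSolution μ s d b f c C ∧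
      ∀ c' C', IsSolution μ s d b f c' C' → c' = c ∧ C' =ᵐ[circ] C := by
  have hg := hf.weighted (μ := μ) d hs
  have hi := hm.invIntegrable d hμ hs
  obtain ⟨e, he⟩ := exists_isResidual hi hg hb
  obtain ⟨c, C, hC⟩ := he.exists_isSolution d hμ hs hb hf hm
  refine ⟨c, C, hC, fun c' C' hC' => ?_⟩
  have hae : C' =ᵐ[circ] C := by
    filter_upwards [(hC'.isResidual d hμ hs hb hf hm).ae_eq hi hg hb
      (hC.isResidual d hμ hs hb hf hm), hm.1, weight_pos_ae d hμ hs] with t h1 h2 h3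
    rw [← weighted_transpose_mulVec_residual d h3 h2 (C := C'), h1,
      weighted_transpose_mulVec_residual d h3 h2]
  refine ⟨?_, hae⟩
  ext k p
  have h1 := (hC.series p).2 k
  have h2 := (hC'.series p).2 k
  simp only [Nat.cast_nonneg, if_true, Int.toNat_natCast] at h1 h2
  rw [← h1, ← h2]
  refine integral_congr_ae ?_
  filter_upwards [hae] with t ht
  rw [ht]

end Solution

end GMForecast

theorem mainTheorem10 {r T : ℕ} [NeZero T] (μ s d : Fin r → ℕ)
    (hμ : ∀ j, 0 < μ j) (hs : ∀ j, 0 < s j) (hd : ∀ j, 0 < d j)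
    (a b : ℕ → Fin T → ℂ) (hab : GMForecast.IsDTransform μ s d a b)
    (ha : GMForecast.IsAdmissible a) (hb : GMForecast.IsAdmissible b)
    (V U : ℝ → GMForecast.Mat T)
    (hV : GMForecast.IsSpectralDensity V) (hU : GMForecast.IsSpectralDensity U)
    (Q B₂ : GMForecast.Mat T) (hQ : Q.PosDef) (hB₂ : B₂.PosDef) (q : ℝ) (qk : Fin T → ℝ) :
    -- the meaning of the error functional
    (∀ f, GMForecast.IsSpectralDensity f →
      ∀ (Ω : Type*) [MeasurableSpace Ω] (P : MeasureTheory.Measure Ω)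
        [MeasureTheory.IsProbabilityMeasure P] (ξ : ℤ → Fin T → Ω → ℂ),
        GMForecast.HasSpectralDensity s d f P ξ →
          GMForecast.forecastError μ s d b P ξ = GMForecast.optErr μ s d b f) ∧
    -- invertibility of the operator `𝐅_μ`
    (∀ f, GMForecast.IsSpectralDensity f → GMForecast.Minimality μ s d f →
      ∃ c C, GMForecast.IsSolution μ s d b f c C ∧
        ∀ c' C', GMForecast.IsSolution μ s d b f c' C' → c' = c ∧ C' =ᵐ[GMForecast.circ] C) ∧
    -- the least favourable densities and the minimax-robust spectral characteristics
    (∀ f₀, GMForecast.IsSpectralDensity f₀ → GMForecast.Minimality μ s d f₀ →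
      ∀ c₀ C₀, GMForecast.IsSolution μ s d b f₀ c₀ C₀ →
        GMForecast.DeterminedBy μ s d b (GMForecast.class1 μ s d V U Q) f₀ C₀
          (∃ᵐ t ∂GMForecast.circ, (f₀ t - V t).PosDef)
          (GMForecast.Multipliers1 V U f₀) (GMForecast.StrictMultipliers1 V U f₀) ∧
        GMForecast.DeterminedBy μ s d b (GMForecast.class2 μ s d V U q) f₀ C₀
          (∃ᵐ t ∂GMForecast.circ, (V t).trace.re < (f₀ t).trace.re)
          (GMForecast.Multipliers2 V U f₀) (GMForecast.Multipliers2 V U f₀) ∧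
        GMForecast.DeterminedBy μ s d b (GMForecast.class3 μ s d V U qk) f₀ C₀
          (∀ k, ∃ᵐ t ∂GMForecast.circ, (V t k k).re < (f₀ t k k).re)
          (GMForecast.Multipliers3 V U f₀) (GMForecast.Multipliers3 V U f₀) ∧
        GMForecast.DeterminedBy μ s d b (GMForecast.class4 μ s d V U B₂ q) f₀ C₀
          (∃ᵐ t ∂GMForecast.circ, GMForecast.frob B₂ (V t) < GMForecast.frob B₂ (f₀ t))
          (GMForecast.Multipliers4 V U f₀ B₂) (GMForecast.Multipliers4 V U f₀ B₂)) := by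
  refine ⟨fun f hf Ω _ P _ ξ hξ => hξ.forecastError_eq d hμ hs hb.1 hf,
    fun f hf hm => GMForecast.exists_unique_isSolution d hμ hs hb.1 hf hm,
    fun f₀ h0 hm c₀ C₀ hsol => ⟨?_, ?_, ?_, ?_⟩⟩
  · exact GMForecast.determinedBy_class1 d hμ hs hb.1 hV hU h0 hm hsol
  · exact GMForecast.determinedBy_class2 d hμ hs hb.1 hV hU h0 hm hsol
  · exact GMForecast.determinedBy_class3 d hμ hs hb.1 hV hU h0 hm hsol
  · exact GMForecast.determinedBy_class4 d hB₂ hμ hs hb.1 hV hU h0 hm hsol
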